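/- Let $K$ be an algebraically closed field, let $B=\operatorname{Spec} K[[t]]$, and let $\pi\colon\mathcal C\to B$ be a smoothing of a nodal curve with two smooth components: $\pi$ is proper and flat, $\mathcal C$ is regular, and the special fibre $C$ of $\pi$ is a connected, reduced, projective curve over $K$ whose only singularities are nodes and which has exactly two irreducible components $C_1$ and $C_2$, both smooth over $K$. Let $\mathcal C^d$ be the fibre product of $d$ copies of $\mathcal C$ over $B$. Define schemes $\widetilde{\mathcal C}^d$ over $\mathcal C^d$ for $d\ge 1$ recursively as follows. Put $\widetilde{\mathcal C}^1=\mathcal C^1=\mathcal C$. Given $\widetilde{\mathcal C}^d\to\mathcal C^d$, let $\delta_i\colon\widetilde{\mathcal C}^d\to\mathcal C$ be its composition with the $i$-th projection, for $1\le i\le d$, and let $\Delta_{i,d+1}\subset\widetilde{\mathcal C}^d\times_B\mathcal C$ be the image of the section $(\mathrm{id},\delta_i)$. Then $\widetilde{\mathcal C}^{d+1}\to\widetilde{\mathcal C}^d\times_B\mathcal C$ is the composition of the successive blowups along the strict transforms of $$\Delta_{d,d+1},\ \Delta_{d-1,d+1},\ \dots,\ \Delta_{1,d+1},$$ in this order,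 followed by the successive blowups along the strict transforms of the $2^{d+1}$ products $$C_{\epsilon_1}\times C_{\epsilon_2}\times\dots\times C_{\epsilon_{d+1}}\subset\mathcal C^{d+1},\qquad \epsilon\in\{1,2\}^{d+1},$$ in the lexicographic order $C_1^{d+1},\ C_1^{d}\times C_2,\ \dots,\ C_2^{d+1}$. All centers are taken with their reduced scheme structure. Then, for every $d\ge 1$, the scheme $\widetilde{\mathcal C}^d$ is smooth, that is, regular: it is locally Noetherian and all its local rings are regular local rings. -/

import Mathlib

universe u

open CategoryTheory CategoryTheory.Limits AlgebraicGeometry TopologicalSpace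

/-! ## Blowups of affine schemes: `Proj` of the Rees algebra -/

namespace AlgebraicGeometry.Blowup

section Rees

variable {R : Type u} [CommRing R] (I : Ideal R)

/-- The degree `n` part `I ^ n T ^ n` of the Rees algebra `⨁ I ^ n T ^ n`. -/
noncomputable def reesGrading (n : ℕ) : Submodule R (reesAlgebra I) :=
  (LinearMap.range (Polynomial.monomial (R := R) n)).comap (reesAlgebra I).val.toLinearMap

variable {I} in
theorem mem_reesGrading {n : ℕ} {f : reesAlgebra I} :
    f ∈ reesGrading I n ↔ ∃ r, Polynomial.monomial n r = (f : Polynomial R) := Iff.rfl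

theorem coeff_coeAddMonoidHom_rees (x : DirectSum ℕ fun n => reesGrading I n) (i : ℕ) :
    (DirectSum.coeAddMonoidHom (reesGrading I) x : Polynomial R).coeff i =
      ((x i : reesAlgebra I) : Polynomial R).coeff i := by
  classical
  induction x using DirectSum.induction_on with
  | zero => simp
  | of j y =>
    obtain ⟨r, hr⟩ := mem_reesGrading.mp y.2
    rw [DirectSum.coeAddMonoidHom_of]
    by_cases h : j = i
    · subst h; rw [DirectSum.of_eq_same]
    · rw [DirectSum.of_eq_of_ne _ _ _ (Ne.symm h), ← hr, Polynomial.coeff_monomial, if_neg h]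
      simp
  | add x y hx hy => simp [hx, hy]

theorem isInternal_reesGrading : DirectSum.IsInternal (reesGrading I) := by
  classical
  constructor
  · intro x y hxy
    ext i : 2
    apply Subtype.ext
    obtain ⟨r, hr⟩ := mem_reesGrading.mp (x i).2
    obtain ⟨s, hs⟩ := mem_reesGrading.mp (y i).2
    have h := coeff_coeAddMonoidHom_rees I x i
    rw [hxy, coeff_coeAddMonoidHom_rees I y i, ← hr, ← hs, Polynomial.coeff_monomial,
      Polynomial.coeff_monomial, if_pos rfl, if_pos rfl] at h
    rw [← hr, ← hs, h]
  · intro f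
    refine ⟨∑ i ∈ f.1.support, DirectSum.of (fun n => reesGrading I n) i
      ⟨⟨Polynomial.monomial i (f.1.coeff i), reesAlgebra.monomial_mem.mpr (f.2 i)⟩, ⟨_, rfl⟩⟩, ?_⟩
    apply Subtype.ext
    conv_rhs => rw [f.1.as_sum_support]
    simp

noncomputable instance reesGradedAlgebra : GradedAlgebra (reesGrading I) where
  __ := (isInternal_reesGrading I).chooseDecomposition
  one_mem := ⟨1, by simp⟩
  mul_mem := by
    rintro i j f g ⟨a, ha⟩ ⟨b, hb⟩
    refine ⟨a * b, ?_⟩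
    rw [← Polynomial.monomial_mul_monomial, ha, hb]
    rfl

end Rees

section ReesMap

variable {R S : Type u} [CommRing R] [CommRing S] {I : Ideal R} {J : Ideal S} (φ : R →+* S)
  (h : J = I.map φ)

/-- The graded ring homomorphism between Rees algebras induced by `φ : R →+* S`, if the image of
`I` generates `J`. -/
noncomputable def reesMap : reesGrading I →+*ᵍ reesGrading J where
  toRingHom := ((Polynomial.mapRingHom φ).comp (reesAlgebra I).val.toRingHom).codRestrict
    (reesAlgebra J).toSubring fun f i => by
      simpa [h, Ideal.map_pow] using Ideal.mem_map_of_mem φ (f.2 i)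
  map_mem := by
    rintro n f ⟨r, hr⟩
    exact ⟨φ r, ((congrArg (Polynomial.map φ) hr).symm.trans (Polynomial.map_monomial φ)).symm⟩

theorem coe_reesMap (f : reesAlgebra I) :
    (reesMap φ h f : Polynomial S) = (f : Polynomial R).map φ := rfl

theorem irrelevant_le_map_reesMap :
    HomogeneousIdeal.irrelevant (reesGrading J) ≤
      (HomogeneousIdeal.irrelevant (reesGrading I)).map (reesMap φ h) := by
  refine (HomogeneousIdeal.toIdeal_irrelevant_le _).mpr ?_
  rintro n hn ⟨f, hf⟩ ⟨s, hs⟩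
  obtain rfl : Polynomial.monomial n s = f := hs
  have hs : s ∈ (I ^ n).map φ := by
    rw [Ideal.map_pow, ← h]; exact reesAlgebra.monomial_mem.mp hf
  change (⟨_, hf⟩ : reesAlgebra J) ∈
    (HomogeneousIdeal.irrelevant (reesGrading I)).toIdeal.map (reesMap φ h)
  have key : ∀ s ∈ (I ^ n).map φ, ∃ f ∈ (HomogeneousIdeal.irrelevant (reesGrading I)).toIdeal.map
      (reesMap φ h), (f : Polynomial S) = Polynomial.monomial n s := by
    intro s hs
    induction hs using Submodule.span_induction with
    | zero => exact ⟨0, zero_mem _, by simp⟩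
    | mem x hx =>
      obtain ⟨a, ha, rfl⟩ := hx
      refine ⟨reesMap φ h ⟨Polynomial.monomial n a, reesAlgebra.monomial_mem.mpr ha⟩,
        Ideal.mem_map_of_mem _ ?_, ?_⟩
      · exact (HomogeneousIdeal.toIdeal_irrelevant_le _).mp le_rfl n hn ⟨a, rfl⟩
      · rw [coe_reesMap, Polynomial.map_monomial]
    | add x y _ _ hx hy =>
      obtain ⟨f, hf, hf'⟩ := hx
      obtain ⟨g, hg, hg'⟩ := hy
      exact ⟨f + g, add_mem hf hg, by simp [hf', hg']⟩
    | smul c x _ hx =>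
      obtain ⟨f, hf, hf'⟩ := hx
      refine ⟨algebraMap S (reesAlgebra J) c * f, Ideal.mul_mem_left _ _ hf, ?_⟩
      change Polynomial.C c * (f : Polynomial S) = _
      rw [hf', Polynomial.C_mul_monomial, smul_eq_mul]
  obtain ⟨f, hf', hf''⟩ := key s hs
  convert hf'
  exact hf''.symm

/-- The morphism of blowups of affine schemes induced by `φ`. -/
noncomputable def projMap : Proj (reesGrading J) ⟶ Proj (reesGrading I) :=
  Proj.map (reesMap φ h) (irrelevant_le_map_reesMap φ h)

end ReesMap


variable {R : Type u} [CommRing R] (I : Ideal R)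

/-- The ring homomorphism from `R` to the degree zero part of the Rees algebra localized at `f`. -/
noncomputable def toAway (f : reesAlgebra I) :
    R →+* HomogeneousLocalization.Away (reesGrading I) f :=
  (HomogeneousLocalization.fromZeroRingHom (reesGrading I) (Submonoid.powers f)).comp
    (algebraMap R (reesGrading I 0))

theorem val_toAway (f : reesAlgebra I) (r : R) : (toAway I f r).val =
    algebraMap _ (Localization (Submonoid.powers f)) (algebraMap R (reesAlgebra I) r) := rfl

/-- The structure morphism of the blowup of the affine scheme `Spec R` along `I`. -/
noncomputable def projToSpec : Proj (reesGrading I) ⟶ Spec (.of R) :=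
  Proj.toSpecZero (reesGrading I) ≫ Spec.map (CommRingCat.ofHom (algebraMap R (reesGrading I 0)))

theorem awayι_projToSpec (f : reesAlgebra I) {m : ℕ} (hf : f ∈ reesGrading I m) (hm : 0 < m) :
    Proj.awayι (reesGrading I) f hf hm ≫ projToSpec I =
      Spec.map (CommRingCat.ofHom (toAway I f)) := by
  rw [projToSpec, Proj.awayι_toSpecZero_assoc, ← Spec.map_comp]
  rfl

section
variable {R S : Type u} [CommRing R] [CommRing S] {I : Ideal R} {J : Ideal S} (φ : R →+* S)
  (h : J = I.map φ)

theorem awayMap_comp_toAway (f : reesAlgebra I) :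
    (HomogeneousLocalization.Away.map (reesMap φ h) f).comp (toAway I f) =
      (toAway J (reesMap φ h f)).comp φ := by
  ext r
  change Localization.mk (reesMap φ h (algebraMap R (reesAlgebra I) r)) ⟨reesMap φ h 1, _⟩ =
    Localization.mk (algebraMap S (reesAlgebra J) (φ r)) 1
  have e1 : reesMap φ h 1 = 1 := map_one _
  have e2 : reesMap φ h (algebraMap R (reesAlgebra I) r) = algebraMap S (reesAlgebra J) (φ r) :=
    Subtype.ext (Polynomial.map_C φ)
  rw [e2]
  congr 1
  exact Subtype.ext e1


/-- The fraction `(a T ^ (n d)) / f ^ n`, where `f` is homogeneous of degree `d`. -/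
noncomputable def awayMk {f : reesAlgebra I} {d : ℕ} (hf : f ∈ reesGrading I d) (n : ℕ) (a : R)
    (ha : a ∈ I ^ (n • d)) : HomogeneousLocalization.Away (reesGrading I) f :=
  .mk (reesGrading I) hf n ⟨Polynomial.monomial (n • d) a, reesAlgebra.monomial_mem.mpr ha⟩
    (mem_reesGrading.mpr ⟨a, rfl⟩)

theorem exists_awayMk {f : reesAlgebra I} {d : ℕ} (hf : f ∈ reesGrading I d)
    (z : HomogeneousLocalization.Away (reesGrading I) f) :
    ∃ n a ha, awayMk hf n a ha = z := by
  obtain ⟨n, g, hg, rfl⟩ := HomogeneousLocalization.Away.mk_surjective _ hf z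
  obtain ⟨a, ha⟩ := mem_reesGrading.mp hg
  refine ⟨n, a, ?_, ?_⟩
  · rw [← reesAlgebra.monomial_mem, ha]
    exact g.2
  · rw [awayMk]
    congr 1
    exact Subtype.ext ha

theorem toAway_mul_awayMk (r : R) {f : reesAlgebra I} {d : ℕ} (hf : f ∈ reesGrading I d) (n : ℕ)
    (a : R) (ha : a ∈ I ^ (n • d)) :
    toAway I f r * awayMk hf n a ha = awayMk hf n (r * a) (Ideal.mul_mem_left _ r ha) := by
  apply HomogeneousLocalization.val_injective
  rw [HomogeneousLocalization.val_mul, val_toAway, awayMk, awayMk,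
    HomogeneousLocalization.Away.val_mk, HomogeneousLocalization.Away.val_mk,
    ← Localization.mk_one_eq_algebraMap, Localization.mk_mul, one_mul]
  congr 1
  exact Subtype.ext (Polynomial.C_mul_monomial)

theorem awayMk_eq_zero_iff {f : reesAlgebra I} {d : ℕ} (hf : f ∈ reesGrading I d) (b : R)
    (hb : Polynomial.monomial d b = (f : Polynomial R)) (n : ℕ)
    (a : R) (ha : a ∈ I ^ (n • d)) :
    awayMk hf n a ha = 0 ↔ ∃ k : ℕ, b ^ k * a = 0 := by
  rw [HomogeneousLocalization.ext_iff_val, HomogeneousLocalization.val_zero, awayMk,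
    HomogeneousLocalization.Away.val_mk, Localization.mk_eq_mk', IsLocalization.mk'_eq_zero_iff]
  have (k : ℕ) : f ^ k * ⟨Polynomial.monomial (n • d) a, reesAlgebra.monomial_mem.mpr ha⟩ = 0 ↔
      b ^ k * a = 0 := by
    rw [Subtype.ext_iff]
    change (f : Polynomial R) ^ k * Polynomial.monomial (n • d) a = 0 ↔ _
    rw [← hb, Polynomial.monomial_pow, Polynomial.monomial_mul_monomial,
      Polynomial.monomial_eq_zero_iff]
  constructor
  · rintro ⟨⟨_, k, rfl⟩, hk⟩
    exact ⟨k, (this k).mp hk⟩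
  · rintro ⟨k, hk⟩
    exact ⟨⟨_, k, rfl⟩, (this k).mpr hk⟩

theorem map_pow_mem {R S : Type u} [CommRing R] [CommRing S] {I : Ideal R} {J : Ideal S}
    (φ : R →+* S) (h : J = I.map φ) {a : R} {n : ℕ} (ha : a ∈ I ^ n) : φ a ∈ J ^ n := by
  rw [h, ← Ideal.map_pow]
  exact Ideal.mem_map_of_mem φ ha

theorem map_awayMk {f : reesAlgebra I} {d : ℕ} (hf : f ∈ reesGrading I d) (n : ℕ)
    (a : R) (ha : a ∈ I ^ (n • d)) :
    HomogeneousLocalization.Away.map (reesMap φ h) f (awayMk hf n a ha) =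
      awayMk (GradedRingHom.map_mem (reesMap φ h) hf) n (φ a) (map_pow_mem φ h ha) := by
  rw [awayMk, awayMk, HomogeneousLocalization.Away.map_mk]
  congr 1
  exact Subtype.ext (Polynomial.map_monomial φ)

theorem isLocalization_away_of {A B : Type u} [CommRing A] [CommRing B] (g : A →+* B) (a : A)
    (h₁ : IsUnit (g a)) (h₂ : ∀ z, ∃ x, ∃ m : ℕ, g (a ^ m) * z = g x)
    (h₃ : ∀ x, g x = 0 → ∃ m : ℕ, a ^ m * x = 0) :
    letI := g.toAlgebra
    IsLocalization.Away a B := by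
  let := g.toAlgebra
  refine ⟨?_, ?_, ?_⟩
  · rintro ⟨_, n, rfl⟩
    exact (map_pow g a n).symm ▸ h₁.pow n
  · intro z
    obtain ⟨x, m, hx⟩ := h₂ z
    exact ⟨⟨x, ⟨_, m, rfl⟩⟩, (mul_comm _ _).trans hx⟩
  · intro x y hxy
    obtain ⟨m, hm⟩ := h₃ (x - y) (by rw [map_sub, sub_eq_zero]; exact hxy)
    exact ⟨⟨_, m, rfl⟩, by rwa [mul_sub, sub_eq_zero] at hm⟩

open HomogeneousLocalization in
theorem isLocalization_awayMap (r : R) (hr : letI := φ.toAlgebra; IsLocalization.Away r S)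
    (f : reesAlgebra I) {d : ℕ} (hf : f ∈ reesGrading I d) :
    letI := (Away.map (reesMap φ h) f).toAlgebra
    IsLocalization.Away (toAway I f r) (Away (reesGrading J) (reesMap φ h f)) := by
  have comm (r : R) : Away.map (reesMap φ h) f (toAway I f r) = toAway J (reesMap φ h f) (φ r) :=
    congr($(awayMap_comp_toAway φ h f) r)
  apply isLocalization_away_of
  · rw [comm]
    let := φ.toAlgebra
    have hr' : IsLocalization.Away r S := hr
    exact (IsLocalization.Away.algebraMap_isUnit (S := S) r).map _
  · intro z
    obtain ⟨n, s, hs, rfl⟩ := exists_awayMk (GradedRingHom.map_mem (reesMap φ h) hf) z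
    obtain ⟨a, ha, m, hm⟩ : ∃ a ∈ I ^ (n • d), ∃ m : ℕ, φ (r ^ m) * s = φ a := by
      let := φ.toAlgebra
      have hr' : IsLocalization.Away r S := hr
      have hs' : s ∈ (I ^ (n • d)).map (algebraMap R S) := by
        rw [Ideal.map_pow]
        change s ∈ (I.map φ) ^ _
        rwa [← h]
      obtain ⟨⟨⟨a, ha⟩, ⟨_, m, rfl⟩⟩, hm⟩ :=
        (IsLocalization.mem_map_algebraMap_iff (Submonoid.powers r) S).mp hs'
      exact ⟨a, ha, m, (mul_comm _ _).trans hm⟩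
    refine ⟨awayMk hf n a ha, m, ?_⟩
    rw [← map_pow (toAway I f), comm, map_awayMk]
    refine (toAway_mul_awayMk ..).trans ?_
    congr 1
  · intro x hx
    obtain ⟨n, a, ha, rfl⟩ := exists_awayMk hf x
    obtain ⟨b, hb⟩ := mem_reesGrading.mp hf
    have hb' : Polynomial.monomial d (φ b) = (reesMap φ h f : Polynomial S) := by
      rw [coe_reesMap, ← hb, Polynomial.map_monomial]
    rw [map_awayMk, awayMk_eq_zero_iff _ _ hb'] at hx
    obtain ⟨k, hk⟩ := hx
    obtain ⟨m, hm⟩ : ∃ m : ℕ, r ^ m * (b ^ k * a) = 0 := by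
      let := φ.toAlgebra
      have hr' : IsLocalization.Away r S := hr
      rw [← map_pow, ← map_mul] at hk
      obtain ⟨⟨_, m, rfl⟩, hm⟩ :=
        (IsLocalization.map_eq_zero_iff (Submonoid.powers r) S _).mp hk
      exact ⟨m, hm⟩
    refine ⟨m, ?_⟩
    rw [← map_pow (toAway I f)]
    refine (toAway_mul_awayMk ..).trans ?_
    rw [awayMk_eq_zero_iff _ _ hb]
    exact ⟨k, by rw [← hm]; ring⟩

theorem isPushout_of_isLocalization_away {R S A B : Type u} [CommRing R] [CommRing S] [CommRing A]
    [CommRing B] (φ : R →+* S) (α : R →+* A) (g : A →+* B) (β : S →+* B)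
    (comm : g.comp α = β.comp φ) (r : R) (hr : letI := φ.toAlgebra; IsLocalization.Away r S)
    (hr' : letI := g.toAlgebra; IsLocalization.Away (α r) B) :
    IsPushout (CommRingCat.ofHom α) (CommRingCat.ofHom φ) (CommRingCat.ofHom g)
      (CommRingCat.ofHom β) := by
  algebraize [φ, α, g, β, β.comp φ]
  have : IsScalarTower R A B := .of_algebraMap_eq' comm.symm
  have hr₁ : IsLocalization.Away r S := hr
  have hr₂ : IsLocalization.Away (α r) B := hr'
  refine ((CommRingCat.isPushout_iff_isPushout (R := R) (S := S) (R' := A) (S' := B)).mpr ?_)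
  refine (Algebra.isLocalization_iff_isPushout (.powers r) S).mp ?_
  simpa [RingHom.algebraMap_toAlgebra, Algebra.algebraMapSubmonoid] using hr₂

theorem isPullback_awayMap (r : R) (hr : letI := φ.toAlgebra; IsLocalization.Away r S)
    (f : reesAlgebra I) {d : ℕ} (hf : f ∈ reesGrading I d) :
    IsPullback (Spec.map (CommRingCat.ofHom (HomogeneousLocalization.Away.map (reesMap φ h) f)))
      (Spec.map (CommRingCat.ofHom (toAway J (reesMap φ h f))))
      (Spec.map (CommRingCat.ofHom (toAway I f))) (Spec.map (CommRingCat.ofHom φ)) :=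
  isPullback_SpecMap_of_isPushout _ _ _ _ (isPushout_of_isLocalization_away _ _ _ _
    (awayMap_comp_toAway φ h f) r hr (isLocalization_awayMap φ h r hr f hf))

theorem awayι_projMap (f : reesAlgebra I) {d : ℕ} (hd : 0 < d) (hf : f ∈ reesGrading I d) :
    Proj.awayι (reesGrading J) (reesMap φ h f) (GradedRingHom.map_mem (reesMap φ h) hf) hd ≫
      projMap φ h = Spec.map (CommRingCat.ofHom
        (HomogeneousLocalization.Away.map (reesMap φ h) f)) ≫ Proj.awayι (reesGrading I) f hf hd :=
  Proj.awayι_comp_map _ _ hd f hf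

theorem isPullback_awayι_projMap (f : reesAlgebra I) {d : ℕ} (hd : 0 < d)
    (hf : f ∈ reesGrading I d) :
    IsPullback (Spec.map (CommRingCat.ofHom (HomogeneousLocalization.Away.map (reesMap φ h) f)))
      (Proj.awayι (reesGrading J) (reesMap φ h f) (GradedRingHom.map_mem (reesMap φ h) hf) hd)
      (Proj.awayι (reesGrading I) f hf hd) (projMap φ h) := by
  refine IsOpenImmersion.isPullback _ _ _ _ (awayι_projMap φ h f hd hf) ?_
  rw [Proj.opensRange_awayι, Proj.opensRange_awayι]
  rfl

theorem projMap_projToSpec : projMap φ h ≫ projToSpec I =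
    projToSpec J ≫ Spec.map (CommRingCat.ofHom φ) := by
  refine (Proj.mapAffineOpenCover _ (irrelevant_le_map_reesMap φ h)).openCover.hom_ext _ _ ?_
  rintro ⟨⟨d, hd⟩, ⟨f, hf⟩⟩
  replace hf : f ∈ reesGrading I d := hf
  change Proj.awayι (reesGrading J) (reesMap φ h f)
      (GradedRingHom.map_mem (reesMap φ h) hf) hd ≫ _ =
    Proj.awayι (reesGrading J) (reesMap φ h f)
      (GradedRingHom.map_mem (reesMap φ h) hf) hd ≫ _
  rw [← Category.assoc, awayι_projMap φ h f hd hf, Category.assoc, awayι_projToSpec, ← Category.assoc,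
    awayι_projToSpec, ← Spec.map_comp, ← Spec.map_comp, ← CommRingCat.ofHom_comp,
    ← CommRingCat.ofHom_comp, awayMap_comp_toAway]

theorem isPullback_projMap (r : R) (hr : letI := φ.toAlgebra; IsLocalization.Away r S) :
    IsPullback (projMap φ h) (projToSpec J) (projToSpec I) (Spec.map (CommRingCat.ofHom φ)) := by
  refine Scheme.isPullback_of_openCover _ _ _ _ (Proj.affineOpenCover (reesGrading I)).openCover ?_
  rintro ⟨⟨d, hd⟩, ⟨f, hf⟩⟩
  replace hf : f ∈ reesGrading I d := hf
  have h₁ := isPullback_awayι_projMap φ h f hd hf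
  have h₂ := isPullback_awayMap φ h r hr f hf
  rw [← awayι_projToSpec _ _ hf hd, ← awayι_projToSpec _ _
    (GradedRingHom.map_mem (reesMap φ h) hf) hd] at h₂
  change IsPullback (pullback.snd (projMap φ h) (Proj.awayι (reesGrading I) f hf hd))
    (pullback.fst (projMap φ h) (Proj.awayι (reesGrading I) f hf hd) ≫ _)
    (Proj.awayι (reesGrading I) f hf hd ≫ _) _
  refine h₂.of_iso h₁.flip.isoPullback (Iso.refl _) (Iso.refl _) (Iso.refl _) ?_ ?_ ?_ ?_ <;> simp

theorem projMap_eq_id (φ : R →+* R) (h : I = I.map φ) (hφ : φ = .id R) :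
    projMap φ h = 𝟙 _ := by
  have : reesMap φ h = GradedRingHom.id _ := by
    subst hφ
    exact GradedRingHom.ext fun x => Subtype.ext Polynomial.map_id
  rw [projMap, ← Proj.map_id]
  congr 1

theorem projMap_comp {T : Type u} [CommRing T] {L : Ideal T} (ψ : S →+* T) (h' : L = J.map ψ)
    (χ : R →+* T) (h'' : L = I.map χ) (hχ : χ = ψ.comp φ) :
    projMap χ h'' = projMap ψ h' ≫ projMap φ h := by
  have : reesMap χ h'' = (reesMap ψ h').comp (reesMap φ h) := by
    subst hχ
    exact GradedRingHom.ext fun x => Subtype.ext (Polynomial.map_map ..).symm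
  rw [projMap, projMap, projMap, ← Proj.map_comp]
  congr 1

end

end AlgebraicGeometry.Blowup

/-! ## Blowups of schemes -/

namespace AlgebraicGeometry.Scheme

open Blowup

variable {X : Scheme.{u}} (I : X.IdealSheafData)

/-- The blowups of the affine open subschemes of `X`. -/
noncomputable def blowupFunctor : X.AffineZariskiSite ⥤ Scheme.{u} where
  obj U := Proj (reesGrading (I.ideal U))
  map {U V} f := projMap (X.presheaf.map (homOfLE (AffineZariskiSite.toOpens_mono f.le)).op).hom
    (I.map_ideal (U := U) (V := V) (AffineZariskiSite.toOpens_mono f.le)).symm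
  map_id U := projMap_eq_id _ _ (by
    rw [show (homOfLE _).op = 𝟙 _ from rfl, X.presheaf.map_id]; rfl)
  map_comp {U V W} f g := projMap_comp _ _ _ _ _ _ (by
    rw [← CommRingCat.hom_comp, ← Functor.map_comp]; rfl)

theorem specMap_isoSpec_inv {U V : X.AffineZariskiSite} (h : U.1 ≤ V.1) :
    Spec.map (X.presheaf.map (homOfLE h).op) ≫ V.2.isoSpec.inv =
      U.2.isoSpec.inv ≫ X.homOfLE h := by
  rw [← cancel_mono V.1.ι, Category.assoc, Category.assoc, X.homOfLE_ι,
    IsAffineOpen.isoSpec_inv_ι, IsAffineOpen.isoSpec_inv_ι, IsAffineOpen.map_fromSpec V.2 U.2]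

/-- The structure morphisms of the blowups of the affine open subschemes of `X`. -/
noncomputable def blowupNatTrans :
    blowupFunctor I ⟶ (AffineZariskiSite.directedCover X).functorOfLocallyDirected where
  app U := projToSpec (I.ideal U) ≫ U.2.isoSpec.inv
  naturality {U V} f := by
    change projMap _ _ ≫ projToSpec (I.ideal V) ≫ V.2.isoSpec.inv =
      (projToSpec (I.ideal U) ≫ U.2.isoSpec.inv) ≫ X.homOfLE (AffineZariskiSite.toOpens_mono f.le)
    refine (Category.assoc _ _ _).symm.trans
      ((congrArg (· ≫ V.2.isoSpec.inv) (projMap_projToSpec _ _)).trans ?_)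
    exact (Category.assoc _ _ _).trans
      ((congrArg (projToSpec (I.ideal U) ≫ ·) (specMap_isoSpec_inv _)).trans
        (Category.assoc _ _ _).symm)

theorem blowupNatTrans_equifibered : (blowupNatTrans I).Equifibered := by
  rintro U V f
  have hUV := AffineZariskiSite.toOpens_mono f.le
  obtain ⟨r, hr⟩ := f.le
  have h₁ := isPullback_projMap (X.presheaf.map (homOfLE hUV).op).hom
    (I.map_ideal (U := U) (V := V) hUV).symm r
    (V.2.isLocalization_of_eq_basicOpen r (homOfLE hUV) hr.symm)
  have h₂ : IsPullback (Spec.map (X.presheaf.map (homOfLE hUV).op)) U.2.isoSpec.inv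
      V.2.isoSpec.inv (X.homOfLE hUV) :=
    IsPullback.of_vert_isIso ⟨specMap_isoSpec_inv hUV⟩
  exact h₁.paste_vert h₂

/-- The gluing datum for the blowup of `X` along `I`. -/
noncomputable def blowupGlueData : (AffineZariskiSite.directedCover X).RelativeGluingData where
  functor := blowupFunctor I
  natTrans := blowupNatTrans I
  equifibered := blowupNatTrans_equifibered I

instance : (blowupFunctor I ⋙ Scheme.forget).IsLocallyDirected :=
  Cover.RelativeGluingData.instIsLocallyDirectedI₀CompFunctorForgetOfIsThin (blowupGlueData I)

instance {U V : X.AffineZariskiSite} (f : U ⟶ V) : IsOpenImmersion ((blowupFunctor I).map f) :=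
  Cover.RelativeGluingData.instIsOpenImmersionMapI₀Functor (blowupGlueData I) f

/-- The blowup of the scheme `X` along the quasi-coherent ideal sheaf `I`: the relative
homogeneous spectrum of the Rees algebra `⨁ I ^ n`, glued from
`Proj (⨁ I(U) ^ n)` for `U` an affine open of `X`. -/
noncomputable def blowup : Scheme.{u} := (blowupGlueData I).glued

/-- The structure morphism of the blowup. -/
noncomputable def blowupπ : blowup I ⟶ X := (blowupGlueData I).toBase

theorem isPullback_blowupπ (U : X.AffineZariskiSite) :
    IsPullback (projToSpec (I.ideal U) ≫ U.2.isoSpec.inv)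
      (colimit.ι (blowupFunctor I) U) U.1.ι (blowupπ I) :=
  (blowupGlueData I).isPullback_natTrans_ι_toBase U

end AlgebraicGeometry.Scheme

/-! ## Strict transforms and iterated blowups -/

namespace AlgebraicGeometry

/-- A scheme is regular if it is locally Noetherian and all its local rings are regular. -/
structure IsRegularScheme (X : Scheme.{u}) : Prop where
  isLocallyNoetherian : IsLocallyNoetherian X
  isRegularLocalRing_stalk : ∀ x : X, IsRegularLocalRing (X.presheaf.stalk x)

/-- The largest open subset of `Z` over which `f : Y ⟶ Z` is an isomorphism. -/
def isoLocus {Y Z : Scheme.{u}} (f : Y ⟶ Z) : Z.Opens :=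
  sSup {V : Z.Opens | IsIso (f ∣_ V)}

/-- The strict transform of `D ⊆ Z` via a birational morphism `f : Y ⟶ Z`: the closure in `Y` of
the part of `D` that lies in the locus over which `f` is an isomorphism. -/
def strictTransform {Y Z : Scheme.{u}} (f : Y ⟶ Z) (D : Set Z) : Closeds Y :=
  Closeds.closure (f ⁻¹' (D ∩ isoLocus f))

/-- The sequence of blowups of `Z` along the strict transforms of the members of the list
`[D₁, …, Dₘ]`, in this order. At each step the center is the strict transform of `Dᵢ` via the
composition of the previous blowups, with its reduced scheme structure. -/
noncomputable def iteratedBlowup {Z : Scheme.{u}} (L : List (Set Z)) : Over Z :=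
  L.foldl (fun W D => Over.mk (Scheme.blowupπ
    (Scheme.IdealSheafData.vanishingIdeal (strictTransform (W.hom : W.left ⟶ Z) D)) ≫ W.hom))
    (Over.mk (𝟙 Z))

/-! ## Smoothings of nodal curves with two smooth components -/

section Curves

variable {k : Type u} [Field k]

/-- A point `x` of a scheme is a node (over `k`) if the completion of its local ring is isomorphic
to `k[[x, y]] / (x y)`. -/
def IsNode (k : Type u) [Field k] {C : Scheme.{u}} (x : C) : Prop :=
  Nonempty (AdicCompletion (IsLocalRing.maximalIdeal (C.presheaf.stalk x)) (C.presheaf.stalk x) ≃+*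
    MvPowerSeries (Fin 2) k ⧸
      Ideal.span {(MvPowerSeries.X 0 * MvPowerSeries.X 1 : MvPowerSeries (Fin 2) k)})

/-- A nodal curve over an algebraically closed field `k`: a connected, proper (equivalently, in
dimension one, projective) and reduced `k`-scheme of dimension one, all of whose closed points are
smooth points or nodes. -/
structure IsNodalCurve {C : Scheme.{u}} (p : C ⟶ Spec (.of k)) : Prop where
  isProper : IsProper p
  connectedSpace : ConnectedSpace C
  isReduced : IsReduced C
  dim_eq_one : topologicalKrullDim C = 1
  smooth_or_node : ∀ x : C, IsClosed {x} → (∃ U : C.Opens, x ∈ U ∧ Smooth (U.ι ≫ p)) ∨ IsNode k x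

/-- The irreducible components of the curve `C` are `Z 0` and `Z 1`, which are distinct, and both
are smooth over `k` (with their reduced structure). -/
structure HasTwoSmoothComponents {C : Scheme.{u}} (p : C ⟶ Spec (.of k))
    (Z : Fin 2 → Closeds C) : Prop where
  ne : Z 0 ≠ Z 1
  irreducibleComponents_eq : irreducibleComponents C = {(Z 0 : Set C), (Z 1 : Set C)}
  smooth : ∀ i, Smooth ((Scheme.IdealSheafData.vanishingIdeal (Z i)).subschemeι ≫ p)

/-- The special fiber of a scheme over `Spec k[[t]]`. -/
noncomputable def specialFiber {X : Scheme.{u}} (π : X ⟶ Spec (.of (PowerSeries k))) :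
    Scheme.{u} :=
  pullback π (Spec.map (CommRingCat.ofHom (PowerSeries.constantCoeff (R := k))))

/-- The inclusion of the special fiber. -/
noncomputable def specialFiberι {X : Scheme.{u}} (π : X ⟶ Spec (.of (PowerSeries k))) :
    specialFiber π ⟶ X :=
  pullback.fst _ _

/-- The structure morphism of the special fiber. -/
noncomputable def specialFiberToSpec {X : Scheme.{u}} (π : X ⟶ Spec (.of (PowerSeries k))) :
    specialFiber π ⟶ Spec (.of k) :=
  pullback.snd _ _

/-- A smoothing of a nodal curve: a proper and flat morphism to `Spec k[[t]]` with regular total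
space, whose special fiber is a nodal curve. -/
structure IsSmoothing {X : Scheme.{u}} (π : X ⟶ Spec (.of (PowerSeries k))) : Prop where
  isProper : IsProper π
  flat : Flat π
  isRegular : IsRegularScheme X
  isNodalCurve : IsNodalCurve (specialFiberToSpec π)

end Curves

/-! ## The iterated desingularization of the fiber powers -/

section FiberPower

variable {X B : Scheme.{u}} (π : X ⟶ B)

/-- The fiber product `X ^ d` of `d` copies of `X` over `B`. -/
noncomputable abbrev fiberPower (d : ℕ) : Scheme.{u} :=
  widePullback B (fun _ : Fin d => X) (fun _ => π)

/-- The projection of `X ^ d` onto the `i`-th factor. -/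
noncomputable abbrev fiberPowerProj {d : ℕ} (i : Fin d) : fiberPower π d ⟶ X :=
  WidePullback.π (fun _ => π) i

/-- The structure morphism `X ^ d ⟶ B`. -/
noncomputable abbrev fiberPowerBase (d : ℕ) : fiberPower π d ⟶ B :=
  WidePullback.base (fun _ => π)

variable {d : ℕ} {Y : Scheme.{u}} (f : Y ⟶ fiberPower π d)

/-- The product `Y ×_B X`, for a scheme `Y` over `X ^ d`. -/
noncomputable abbrev prodTotal : Scheme.{u} :=
  pullback (f ≫ fiberPowerBase π d) π

/-- The morphism `f × id : Y ×_B X ⟶ X ^ (d + 1)` for `f : Y ⟶ X ^ d`. -/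
noncomputable def prodTotalToPower : prodTotal π f ⟶ fiberPower π (d + 1) :=
  WidePullback.lift (pullback.snd _ _ ≫ π)
    (Fin.snoc (α := fun _ => (prodTotal π f ⟶ X))
      (fun i => pullback.fst _ _ ≫ f ≫ fiberPowerProj π i) (pullback.snd _ _))
    (fun j => by
      refine Fin.lastCases ?_ (fun i => ?_) j
      · rw [Fin.snoc_last]
      · rw [Fin.snoc_castSucc, Category.assoc, Category.assoc, WidePullback.π_arrow,
          pullback.condition])

/-- The section of `Y ×_B X ⟶ Y` induced by `δ_i : Y ⟶ X ^ d ⟶ X`, the composition of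
`f : Y ⟶ X ^ d` with the projection onto the `i`-th factor. -/
noncomputable def diagonalSection (i : Fin d) : Y ⟶ prodTotal π f :=
  pullback.lift (𝟙 Y) (f ≫ fiberPowerProj π i) (by
    rw [Category.id_comp, Category.assoc, WidePullback.π_arrow])

/-- The product `C_{ε 1} × ⋯ × C_{ε d}` as a subset of `X ^ d`. -/
def productDivisor (C : Fin 2 → Set X) (ε : Fin d → Fin 2) : Set (fiberPower π d) :=
  {x | ∀ i, fiberPowerProj π i x ∈ C (ε i)}

/-- All words of length `n` in the letters `0, 1`, in lexicographic order. -/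
def lexWords : (n : ℕ) → List (Fin n → Fin 2)
  | 0 => [Fin.elim0]
  | n + 1 => (lexWords n).flatMap fun w =>
      [Fin.snoc (α := fun _ => Fin 2) w 0, Fin.snoc (α := fun _ => Fin 2) w 1]

/-- The centers of the sequence of blowups of `Y ×_B X`, in order: the diagonals
`Δ_{d, d + 1}, …, Δ_{1, d + 1}`, i.e. the images of the sections induced by `δ_d, …, δ_1`, and then
the (strict transforms in `Y ×_B X` of the) products `C_{ε 1} × ⋯ × C_{ε (d + 1)}`, in
lexicographic order. -/
noncomputable def blowupCenters (C : Fin 2 → Set X) : List (Set ↥(prodTotal π f)) :=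
  ((List.finRange d).reverse.map fun i => Set.range (diagonalSection π f i)) ++
    (lexWords (d + 1)).map fun ε =>
      (strictTransform (prodTotalToPower π f) (productDivisor π C ε) : Set ↥(prodTotal π f))

/-- The schemes `X̃ ^ d`, with their morphisms to `X ^ d`: one has `X̃ ^ 1 = X ^ 1`, and
`X̃ ^ (d + 1)` is obtained from `X̃ ^ d ×_B X` by blowing up successively the strict transforms of
the diagonals and of the products of the `C i`. For `d = 0` we put `X̃ ^ 0 = X ^ 0`. -/
noncomputable def desingularization (C : Fin 2 → Set X) : (d : ℕ) → Over (fiberPower π d)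
  | 0 => Over.mk (𝟙 _)
  | 1 => Over.mk (𝟙 _)
  | d + 2 =>
      let f : (desingularization C (d + 1)).left ⟶ fiberPower π (d + 1) :=
        (desingularization C (d + 1)).hom
      Over.mk ((iteratedBlowup (blowupCenters π f C)).hom ≫ prodTotalToPower π f)

end FiberPower

end AlgebraicGeometry

/-! The induction on `d` carries more than regularity. At every point of `X̃ ^ d` there are
functions `z_ε`, one for each word `ε` of length `d`, whose nonunits are part of a regular system of
parameters, whose product is `t`, and such that the local equation of the `k`-th component, pulled
back by the `j`-th projection, is a unit times the product of the `z_ε` with `ε j = k`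
(`IsResolved`). Regularity of the total space and the shape of the special fibre give étale
coordinates on `X`, with `x y = t` near a node and `x y = 1` elsewhere (`exists_isNodeChart`). Hence
`X̃ ^ d ×_B X` is locally étale over a hypersurface `x y = ∏ z_ε` (or `x y = 1`) over a regular
ring, and it is singular only because of the many factors on the right.

Every blowup splits this product. A chart always has the form `x y = ∏_S z`, where the original
coordinates are `x ∏_M z` and `y ∏_N z`, and `S`, `M`, `N` partition the set of words (`State`).
Each center, diagonal or product of components, is locally generated by two elements of ratio `x /
∏_T z` with `T ⊆ S` (`IsCenter`), so its blowup has charts of the same form with `S \ T` or `T` in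
place of `S` (`IsCenter.exists_state_chart`). For a product whose word has initial part `i ∈ S`,
either `T` or `S \ T` is `{i}`; afterwards `i ∈ S` forces `S = {i}`, and this survives later
blowups. Once all words have been used, the charts are `x y = 1` or `x y = z_i`. These are regular,
and the functions `x`, `y`, `z_l` and `1` form the family for words of length `d + 1`
(`State.isParameterFamily`, `IsStage.isResolved`).

Two points need care. The centers are closures with their reduced structure, so their ideals are
only known through generic points. But an essentially étale map extends a prime to a radical ideal
without components inside `τ = 0`, for any `τ` outside the prime, so equations that are prime in the
model may be tested generically (`EssEtale.mem_map_of_forall_prime`). The model primes are `(x, z)`,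
`(z)` and the ideal of the closure of the graph of a section (`Node.isPrime_graphIdeal`). Secondly,
strict transforms are taken through a locus of isomorphism that is not known explicitly. It contains
the open set where at most one `z_ε` is a nonunit: there every center is principal. This open set is
dense in every center, and that determines the strict transforms (`strictTransform_eq`). -/

namespace NodalResolution

open scoped TensorProduct

/-! ## Flat, formally unramified ring homomorphisms essentially of finite type -/

/-- A ring homomorphism is essentially étale if it is flat, formally unramified and essentially of
finite type. -/
structure EssEtale {A B : Type u} [CommRing A] [CommRing B] (φ : A →+* B) : Prop where
  flat : φ.Flat
  unramified : φ.FormallyUnramified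
  essFiniteType : φ.EssFiniteType

section EssEtale

variable {A B C : Type u} [CommRing A] [CommRing B] [CommRing C]

theorem essEtale_algebraMap [Algebra A B] : EssEtale (algebraMap A B) ↔
    Module.Flat A B ∧ Algebra.FormallyUnramified A B ∧ Algebra.EssFiniteType A B := by
  constructor
  · rintro ⟨h₁, h₂, h₃⟩
    exact ⟨RingHom.flat_algebraMap_iff.mp h₁, RingHom.formallyUnramified_algebraMap.mp h₂,
      RingHom.essFiniteType_algebraMap.mp h₃⟩
  · rintro ⟨h₁, h₂, h₃⟩
    exact ⟨RingHom.flat_algebraMap_iff.mpr h₁, RingHom.formallyUnramified_algebraMap.mpr h₂,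
      RingHom.essFiniteType_algebraMap.mpr h₃⟩

theorem EssEtale.comp {φ : A →+* B} {ψ : B →+* C} (hφ : EssEtale φ) (hψ : EssEtale ψ) :
    EssEtale (ψ.comp φ) := by
  algebraize [φ, ψ, ψ.comp φ]
  obtain ⟨_, _, _⟩ := essEtale_algebraMap.mp hφ
  obtain ⟨_, _, _⟩ := essEtale_algebraMap.mp hψ
  exact essEtale_algebraMap.mpr ⟨.trans A B C, .comp A B C, .comp A B C⟩

theorem EssEtale.of_isLocalization [Algebra A B] (M : Submonoid A) [IsLocalization M B] :
    EssEtale (algebraMap A B) :=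
  essEtale_algebraMap.mpr ⟨IsLocalization.flat _ M, .of_isLocalization M, .of_isLocalization _ M⟩

theorem EssEtale.of_bijective {φ : A →+* B} (h : Function.Bijective φ) : EssEtale φ := by
  algebraize [φ]
  have : IsLocalization (⊥ : Submonoid A) A := IsLocalization.self (by
    rintro x rfl; exact isUnit_one)
  have : IsLocalization (⊥ : Submonoid A) B := IsLocalization.isLocalization_of_algEquiv _
    (AlgEquiv.ofBijective (Algebra.ofId A B) h)
  exact EssEtale.of_isLocalization (⊥ : Submonoid A)

theorem EssEtale.of_comp_isLocalization [Algebra A B] [Algebra A C] [Algebra B C]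
    [IsScalarTower A B C] (M : Submonoid A) [IsLocalization M B]
    (h : EssEtale (algebraMap A C)) : EssEtale (algebraMap B C) := by
  obtain ⟨_, _, _⟩ := essEtale_algebraMap.mp h
  exact essEtale_algebraMap.mpr ⟨(Module.flat_iff_of_isLocalization B M C).mpr inferInstance,
    .of_restrictScalars A B C, .of_comp A B C⟩

theorem EssEtale.baseChange [Algebra A B] [Algebra A C] (h : EssEtale (algebraMap A B)) :
    EssEtale (algebraMap C (C ⊗[A] B)) := by
  obtain ⟨_, _, _⟩ := essEtale_algebraMap.mp h
  exact essEtale_algebraMap.mpr ⟨inferInstance, inferInstance, inferInstance⟩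

theorem EssEtale.quotient [Algebra A B] (h : EssEtale (algebraMap A B)) (J : Ideal A) :
    EssEtale (algebraMap (A ⧸ J) (B ⧸ J.map (algebraMap A B))) := by
  obtain ⟨_, _, _⟩ := essEtale_algebraMap.mp h
  refine essEtale_algebraMap.mpr ⟨?_, ?_, inferInstance⟩
  · exact .of_linearEquiv (Algebra.TensorProduct.quotIdealMapEquivQuotTensor B J).toLinearEquiv
  · exact .of_equiv (Algebra.TensorProduct.quotIdealMapEquivQuotTensor B J).symm

/-- An unramified algebra over the field of fractions is reduced, and by flatness `B` embeds in its
base change to that field. -/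
theorem EssEtale.isReduced [Algebra A B] [IsDomain A] (h : EssEtale (algebraMap A B)) :
    IsReduced B := by
  obtain ⟨_, _, _⟩ := essEtale_algebraMap.mp h
  have := Algebra.FormallyUnramified.isReduced_of_field (FractionRing A) (FractionRing A ⊗[A] B)
  refine isReduced_of_injective (Algebra.TensorProduct.includeRight : B →ₐ[A] FractionRing A ⊗[A] B) ?_
  exact Algebra.TensorProduct.includeRight_injective (IsFractionRing.injective A (FractionRing A))

/-- Modulo `J` the map is still essentially étale, now over a domain, so `B / J B` is reduced and
`τ` is a nonzerodivisor on it. This is the tool that identifies the ideal of a closure from its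
generic points. -/
theorem EssEtale.mem_map_of_forall_prime [Algebra A B] (h : EssEtale (algebraMap A B))
    {J : Ideal A} [J.IsPrime] {τ : A} (hτ : τ ∉ J) {b : B}
    (hb : ∀ P : Ideal B, P.IsPrime → J ≤ P.comap (algebraMap A B) → algebraMap A B τ ∉ P → b ∈ P) :
    b ∈ J.map (algebraMap A B) := by
  have h' := h.quotient J
  have := h'.isReduced
  obtain ⟨_, _, _⟩ := essEtale_algebraMap.mp h'
  rw [← Ideal.Quotient.eq_zero_iff_mem]
  have h₀ : Ideal.Quotient.mk J τ ∈ nonZeroDivisors (A ⧸ J) :=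
    mem_nonZeroDivisors_of_ne_zero (by rwa [Ne, Ideal.Quotient.eq_zero_iff_mem])
  have h₁ := Module.Flat.isSMulRegular_of_nonZeroDivisors (M := B ⧸ J.map (algebraMap A B)) h₀
  apply h₁
  simp only [smul_zero]
  rw [Algebra.smul_def]
  change Ideal.Quotient.mk _ (algebraMap A B τ) * Ideal.Quotient.mk _ b = 0
  rw [← map_mul]
  -- It suffices that `τ b` be nilpotent: primes containing `τ` contain the product, and the others
  -- contain `b` by hypothesis.
  apply IsReduced.eq_zero
  rw [nilpotent_iff_mem_prime]
  intro P hP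
  by_cases hτP : algebraMap A B τ ∈ P.comap (Ideal.Quotient.mk (J.map (algebraMap A B)))
  · rw [map_mul]; exact Ideal.mul_mem_right _ _ hτP
  · rw [map_mul]
    refine Ideal.mul_mem_left _ _ (hb _ inferInstance ?_ hτP)
    intro a ha
    change Ideal.Quotient.mk _ (algebraMap A B a) ∈ P
    rw [Ideal.Quotient.eq_zero_iff_mem.mpr (Ideal.mem_map_of_mem _ ha)]
    exact zero_mem _

theorem EssEtale.isRegular [Algebra A B] (h : EssEtale (algebraMap A B)) [IsDomain A] {a : A}
    (ha : a ≠ 0) : IsSMulRegular B (algebraMap A B a) := by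
  obtain ⟨_, _, _⟩ := essEtale_algebraMap.mp h
  have h₁ := Module.Flat.isSMulRegular_of_nonZeroDivisors (M := B)
    (mem_nonZeroDivisors_of_ne_zero ha)
  intro x y hxy
  apply h₁
  simpa [Algebra.smul_def] using hxy

end EssEtale

/-! ## The family of plane curves `x y = s` -/

/-- The ring `R[x, y] / (x y - s)`. -/
def Node (R : Type u) [CommRing R] (s : R) : Type u :=
  MvPolynomial (Fin 2) R ⧸ Ideal.span {(.X 0 * .X 1 - .C s : MvPolynomial (Fin 2) R)}

namespace Node

variable (R : Type u) [CommRing R] (s : R)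

noncomputable instance : CommRing (Node R s) :=
  inferInstanceAs (CommRing (MvPolynomial (Fin 2) R ⧸ _))

/-- The quotient map from the polynomial ring. -/
noncomputable def mkHom : MvPolynomial (Fin 2) R →+* Node R s := Ideal.Quotient.mk _

noncomputable instance : Algebra R (Node R s) := ((mkHom R s).comp MvPolynomial.C).toAlgebra

/-- The quotient map from the polynomial ring, as a homomorphism of algebras. -/
noncomputable def mk : MvPolynomial (Fin 2) R →ₐ[R] Node R s where
  __ := mkHom R s
  commutes' _ := rfl

theorem mk_surjective : Function.Surjective (mk R s) := Ideal.Quotient.mk_surjective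

instance : Algebra.FiniteType R (Node R s) := .of_surjective (mk R s) (mk_surjective R s)

instance [IsNoetherianRing R] : IsNoetherianRing (Node R s) :=
  Algebra.FiniteType.isNoetherianRing R _

/-- The coordinate `x`. -/
noncomputable def x : Node R s := mk R s (.X 0)

/-- The coordinate `y`. -/
noncomputable def y : Node R s := mk R s (.X 1)

variable {R s}

theorem x_mul_y : x R s * y R s = algebraMap R _ s := by
  rw [x, y, ← map_mul, ← sub_eq_zero, ← AlgHom.commutes (mk R s), ← map_sub]
  exact Ideal.Quotient.eq_zero_iff_mem.mpr (Ideal.subset_span rfl)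

section Lift

variable {A : Type u} [CommRing A] (ρ : R →+* A) (a b : A) (h : a * b = ρ s)

/-- The homomorphism from `R[x, y] / (x y - s)` determined by the images of `R`, `x` and `y`. -/
noncomputable def lift : Node R s →+* A :=
  Ideal.Quotient.lift _ (MvPolynomial.eval₂Hom ρ ![a, b]) (by
    intro f hf
    have : Ideal.span {(.X 0 * .X 1 - .C s : MvPolynomial (Fin 2) R)} ≤
        RingHom.ker (MvPolynomial.eval₂Hom ρ ![a, b]) := by
      rw [Ideal.span_singleton_le_iff_mem, RingHom.mem_ker]
      simp [h]
    exact this hf)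

@[simp] theorem lift_algebraMap (r : R) : lift ρ a b h (algebraMap R _ r) = ρ r :=
  MvPolynomial.eval₂_C ρ _ r

@[simp] theorem lift_x : lift ρ a b h (x R s) = a := MvPolynomial.eval₂_X ρ _ 0

@[simp] theorem lift_y : lift ρ a b h (y R s) = b := MvPolynomial.eval₂_X ρ _ 1

theorem lift_comp_algebraMap : (lift ρ a b h).comp (algebraMap R _) = ρ :=
  RingHom.ext fun r => lift_algebraMap ρ a b h r

end Lift

theorem induction {p : Node R s → Prop} (hC : ∀ r, p (algebraMap R _ r)) (hx : p (x R s))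
    (hy : p (y R s)) (hadd : ∀ f g, p f → p g → p (f + g)) (hmul : ∀ f g, p f → p g → p (f * g))
    (f : Node R s) : p f := by
  obtain ⟨f, rfl⟩ := mk_surjective R s f
  induction f using MvPolynomial.induction_on with
  | C r => exact (AlgHom.commutes (mk R s) r).symm ▸ hC r
  | add f g hf hg => rw [map_add]; exact hadd _ _ hf hg
  | mul_X f i hf =>
    rw [map_mul]
    refine hmul _ _ hf ?_
    fin_cases i
    · exact hx
    · exact hy

theorem ringHom_ext {A : Type u} [CommRing A] {f g : Node R s →+* A}
    (h : f.comp (algebraMap R _) = g.comp (algebraMap R _)) (hx : f (x R s) = g (x R s))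
    (hy : f (y R s) = g (y R s)) : f = g := by
  ext z
  induction z using induction with
  | hC r => exact congr($h r)
  | hx => exact hx
  | hy => exact hy
  | hadd a b ha hb => rw [map_add, map_add, ha, hb]
  | hmul a b ha hb => rw [map_mul, map_mul, ha, hb]

open Polynomial in
-- Since `x y` is a constant, mixed monomials can be eliminated. The factor `y` in front of the
-- second summand keeps the constant term from being counted twice, so that the normal form is
-- unique when `s` is regular.
theorem exists_eq (f : Node R s) :
    ∃ G H : R[X], f = aeval (x R s) G + y R s * aeval (y R s) H := by
  have hxy := x_mul_y (R := R) (s := s)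
  have key₁ : ∀ G : R[X], ∃ G' : R[X], ∃ r : R,
      y R s * aeval (x R s) G = aeval (x R s) G' + r • y R s := by
    intro G
    refine ⟨C s * G.divX, G.coeff 0, ?_⟩
    conv_lhs => rw [← G.divX_mul_X_add]
    simp only [map_add, map_mul, aeval_X, aeval_C, Algebra.smul_def, ← hxy]
    ring
  have key₂ : ∀ H : R[X], ∃ H' : R[X], x R s * (y R s * aeval (y R s) H) = aeval (y R s) H' :=
    fun H => ⟨C s * H, by simp only [map_mul, aeval_C, ← hxy]; ring⟩
  have key₃ : ∀ H : R[X], ∃ r : R, ∃ H' : R[X], aeval (y R s) H =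
      algebraMap R _ r + y R s * aeval (y R s) H' := by
    intro H
    refine ⟨H.coeff 0, H.divX, ?_⟩
    conv_lhs => rw [← H.divX_mul_X_add]
    simp only [map_add, map_mul, aeval_X, aeval_C]
    ring
  obtain ⟨f, rfl⟩ := mk_surjective R s f
  induction f using MvPolynomial.induction_on with
  | C r => exact ⟨C r, 0, by
      rw [← MvPolynomial.algebraMap_eq, AlgHom.commutes]; simp⟩
  | add f g hf hg =>
    obtain ⟨G, H, hf⟩ := hf
    obtain ⟨G', H', hg⟩ := hg
    exact ⟨G + G', H + H', by rw [map_add, hf, hg, map_add, map_add]; ring⟩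
  | mul_X f i hf =>
    obtain ⟨G, H, hf⟩ := hf
    fin_cases i
    · obtain ⟨H', hH'⟩ := key₂ H
      obtain ⟨r, H'', hH''⟩ := key₃ H'
      refine ⟨X * G + C r, H'', ?_⟩
      rw [map_mul, hf]
      change _ * x R s = _
      simp only [map_add, map_mul, aeval_X, aeval_C]
      rw [add_mul, mul_comm _ (x R s), mul_comm _ (x R s), hH', hH'', add_assoc]
    · obtain ⟨G', r, hG'⟩ := key₁ G
      refine ⟨G', C r + X * H, ?_⟩
      rw [map_mul, hf]
      change _ * y R s = _
      simp only [map_add, map_mul, aeval_X, aeval_C]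
      rw [add_mul, mul_comm _ (y R s), hG', Algebra.smul_def]
      ring

end Node

end NodalResolution

/-! ### Injectivity, flatness and prime ideals of the rings `R[x, y] / (x y - s)`. -/

namespace NodalResolution

namespace Node

open Polynomial

open scoped LaurentPolynomial

variable {R : Type u} [CommRing R] {s : R}

theorem laurentC_injective (R : Type u) [CommRing R] :
    Function.Injective (LaurentPolynomial.C : R →+* R[T;T⁻¹]) := by
  intro a b h
  simpa using congr(($h).coeff 0)

open LaurentPolynomial in
-- Under `x ↦ T`, `y ↦ s T⁻¹` the two parts of the normal form occupy nonnegative and negative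
-- powers of `T`, so they cannot cancel; the powers of `ρ s` on the negative side are regular.
theorem coeff_eq_zero_of_lift_laurent {R' : Type u} [CommRing R'] {ρ : R →+* R'}
    (hρ : ρ s ∈ nonZeroDivisors R') (G H : R[X])
    (hf : lift ((LaurentPolynomial.C : R' →+* R'[T;T⁻¹]).comp ρ) (T 1)
      (LaurentPolynomial.C (ρ s) * T (-1)) (by
        rw [mul_left_comm, ← T_add]; simp) (aeval (x R s) G + y R s * aeval (y R s) H) = 0) :
    (∀ n, ρ (G.coeff n) = 0) ∧ ∀ n, ρ (H.coeff n) = 0 := by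
  set L := lift (s := s) ((LaurentPolynomial.C : R' →+* R'[T;T⁻¹]).comp ρ) (T 1)
      (LaurentPolynomial.C (ρ s) * T (-1)) (by rw [mul_left_comm, ← T_add]; simp) with hL
  have h₁ : ∀ G : R[X], L (aeval (x R s) G) = toLaurent (G.map ρ) := by
    intro G
    induction G using Polynomial.induction_on' with
    | add p q hp hq => simp only [map_add, hp, hq, Polynomial.map_add]
    | monomial n a =>
      simp [hL, T_pow, ← Polynomial.C_mul_X_pow_eq_monomial]
  -- The image of `y H(y)` is an ordinary polynomial with `T` replaced by `T⁻¹`, which makes its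
  -- coefficients accessible.
  have h₂ : ∀ H : R[X], L (y R s * aeval (y R s) H) =
      invert (toLaurent (Polynomial.X * Polynomial.C (ρ s) * (H.map ρ).comp
        (Polynomial.C (ρ s) * Polynomial.X))) := by
    intro H
    induction H using Polynomial.induction_on' with
    | add p q hp hq =>
      simp only [map_add, mul_add, hp, hq, Polynomial.map_add, Polynomial.add_comp]
    | monomial n a =>
      simp only [aeval_monomial, hL, map_mul, map_pow, lift_y, lift_algebraMap,
        Polynomial.map_monomial, Polynomial.monomial_comp, toLaurent_C, toLaurent_X, invert_C,
        invert_T, RingHom.comp_apply]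
      ring
  rw [map_add, h₁, h₂] at hf
  have hc : ∀ (P : R'[X]) (n : ℤ), n < 0 → (toLaurent P).coeff n = 0 := by
    intro P n hn
    rw [coeff_toLaurent]
    refine Finsupp.mapDomain_of_notMem_range _ _ ?_
    rintro ⟨m, hm⟩
    simp at hm
    omega
  have hc' : ∀ (P : R'[X]) (n : ℕ), (toLaurent P).coeff (n : ℤ) = P.coeff n := by
    intro P n
    rw [coeff_toLaurent]
    exact Finsupp.mapDomain_apply Nat.castEmbedding.injective _ _
  have hf' : ∀ n : ℤ, (toLaurent (G.map ρ)).coeff n + (toLaurent (Polynomial.X *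
      Polynomial.C (ρ s) * (H.map ρ).comp (Polynomial.C (ρ s) * Polynomial.X))).coeff (-n) = 0 := by
    intro n
    rw [← invert_apply]
    exact congr(($hf).coeff n)
  have hG : ∀ n, ρ (G.coeff n) = 0 := by
    intro n
    have := hf' n
    rw [hc'] at this
    rcases n with _ | n
    · rw [Nat.cast_zero, neg_zero, ← Nat.cast_zero (R := ℤ), hc', mul_assoc,
        Polynomial.coeff_X_mul_zero, add_zero, Polynomial.coeff_map] at this
      exact this
    · rw [hc _ (-((n + 1 : ℕ) : ℤ)) (by omega), add_zero, Polynomial.coeff_map] at this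
      exact this
  refine ⟨hG, fun n => ?_⟩
  have := hf' (-((n + 1 : ℕ) : ℤ))
  rw [hc _ _ (by omega), neg_neg, hc', mul_assoc, Polynomial.coeff_X_mul,
    Polynomial.coeff_C_mul, zero_add, Polynomial.comp_C_mul_X_coeff, Polynomial.coeff_map] at this
  exact (mem_nonZeroDivisors_iff_right.mp (pow_mem hρ n)) _
    ((mem_nonZeroDivisors_iff.mp hρ).1 _ this)

open LaurentPolynomial in
-- All coefficients of the normal form lie in `ker ρ`. For `ρ` the reduction modulo a prime not
-- dividing `s`, the fibre thus embeds in a Laurent polynomial ring over a domain.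
theorem mem_map_ker_of_lift_laurent {R' : Type u} [CommRing R'] {ρ : R →+* R'}
    (hρ : ρ s ∈ nonZeroDivisors R') (f : Node R s)
    (hf : lift ((LaurentPolynomial.C : R' →+* R'[T;T⁻¹]).comp ρ) (T 1)
      (LaurentPolynomial.C (ρ s) * T (-1)) (by
        rw [mul_left_comm, ← T_add]; simp) f = 0) :
    f ∈ (RingHom.ker ρ).map (algebraMap R (Node R s)) := by
  obtain ⟨G, H, rfl⟩ := exists_eq f
  obtain ⟨hG, hH⟩ := coeff_eq_zero_of_lift_laurent hρ G H hf
  have key : ∀ (P : R[X]) (z : Node R s), (∀ n, ρ (P.coeff n) = 0) →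
      aeval z P ∈ (RingHom.ker ρ).map (algebraMap R (Node R s)) := by
    intro P z h
    rw [aeval_eq_sum_range]
    refine sum_mem fun i _ => ?_
    rw [Algebra.smul_def]
    exact Ideal.mul_mem_right _ _ (Ideal.mem_map_of_mem _ (h i))
  exact add_mem (key _ _ hG) (Ideal.mul_mem_left _ _ (key _ _ hH))

/-- For regular `s` the normal form is unique, so the ring is isomorphic to `R[X] × R[X]` as a
module. -/
theorem flat_of_mem_nonZeroDivisors (hs : s ∈ nonZeroDivisors R) : Module.Flat R (Node R s) := by
  let Φ : R[X] × R[X] →ₗ[R] Node R s :=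
    LinearMap.coprod (aeval (x R s)).toLinearMap
      (LinearMap.mulLeft R (y R s) ∘ₗ (aeval (y R s)).toLinearMap)
  refine Module.Flat.of_linearEquiv (LinearEquiv.ofBijective Φ ⟨?_, fun f => ?_⟩).symm
  · rw [injective_iff_map_eq_zero]
    rintro ⟨G, H⟩ h
    obtain ⟨hG, hH⟩ := coeff_eq_zero_of_lift_laurent (ρ := RingHom.id R) hs G H
      (by rw [show aeval (x R s) G + y R s * aeval (y R s) H = 0 from h, map_zero])
    exact Prod.ext (Polynomial.ext hG) (Polynomial.ext hH)
  · obtain ⟨G, H, rfl⟩ := exists_eq f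
    exact ⟨(G, H), rfl⟩

/-- Where `s` vanishes the fibre is a pair of crossing lines, and `x ↦ 0`, `y ↦ X` restricts to one
of them. The other line follows by exchanging the coordinates. -/
theorem mem_map_ker_sup_of_lift_polynomial {R' : Type u} [CommRing R'] {ρ : R →+* R'}
    (hρ : ρ s = 0) (f : Node R s)
    (hf : lift ((Polynomial.C : R' →+* R'[X]).comp ρ) 0 X (by simp [hρ]) f = 0) :
    f ∈ (RingHom.ker ρ).map (algebraMap R (Node R s)) ⊔ Ideal.span {x R s} := by
  obtain ⟨G, H, rfl⟩ := exists_eq f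
  set L := lift (s := s) ((Polynomial.C : R' →+* R'[X]).comp ρ) 0 X (by simp [hρ]) with hL
  have h₁ : ∀ G : R[X], aeval (x R s) G - algebraMap R _ (G.coeff 0) ∈ Ideal.span {x R s} := by
    intro G
    rw [Ideal.mem_span_singleton]
    refine ⟨aeval (x R s) G.divX, ?_⟩
    conv_lhs => rw [← G.divX_mul_X_add]
    simp only [map_add, map_mul, aeval_X, aeval_C]
    simp
    ring
  have h₃ : ∀ H : R[X], L (aeval (y R s) H) = H.map ρ := by
    intro H
    induction H using Polynomial.induction_on' with
    | add p q hp hq => simp only [map_add, hp, hq, Polynomial.map_add]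
    | monomial n a =>
      simp [hL, ← Polynomial.C_mul_X_pow_eq_monomial]
  have key : ∀ (P : R[X]) (z : Node R s), P.map ρ = 0 →
      aeval z P ∈ (RingHom.ker ρ).map (algebraMap R (Node R s)) := by
    intro P z h
    rw [aeval_eq_sum_range]
    refine sum_mem fun i _ => ?_
    rw [Algebra.smul_def]
    refine Ideal.mul_mem_right _ _ (Ideal.mem_map_of_mem _ ?_)
    rw [RingHom.mem_ker, ← Polynomial.coeff_map, h, Polynomial.coeff_zero]
  have hx : L (aeval (x R s) G - algebraMap R _ (G.coeff 0)) = 0 := by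
    obtain ⟨w, hw⟩ := Ideal.mem_span_singleton.mp (h₁ G)
    rw [hw, map_mul, hL, lift_x, zero_mul]
  have e : aeval (x R s) G + y R s * aeval (y R s) H =
      (aeval (x R s) G - algebraMap R _ (G.coeff 0)) +
        aeval (y R s) (Polynomial.C (G.coeff 0) + X * H) := by
    simp only [map_add, map_mul, aeval_X, aeval_C]
    ring
  rw [e] at hf ⊢
  rw [map_add, hx, zero_add, h₃] at hf
  exact add_mem (Ideal.mem_sup_right (h₁ G)) (Ideal.mem_sup_left (key _ _ hf))

theorem lift_laurent_injective (hs : s ∈ nonZeroDivisors R) :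
    Function.Injective (lift (s := s) (LaurentPolynomial.C : R →+* R[T;T⁻¹])
      (LaurentPolynomial.T 1) (LaurentPolynomial.C s * LaurentPolynomial.T (-1)) (by
        rw [mul_left_comm, ← LaurentPolynomial.T_add]; simp)) := by
  rw [injective_iff_map_eq_zero]
  intro f hf
  have := mem_map_ker_of_lift_laurent (ρ := RingHom.id R) hs f hf
  rwa [(RingHom.injective_iff_ker_eq_bot _).mp Function.injective_id, Ideal.map_bot] at this

theorem isDomain [IsDomain R] (hs : s ≠ 0) : IsDomain (Node R s) :=
  (lift_laurent_injective (mem_nonZeroDivisors_of_ne_zero hs)).isDomain _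

theorem algebraMap_injective :
    Function.Injective (algebraMap R (Node R s)) := by
  have h := lift_comp_algebraMap (s := s) (LaurentPolynomial.C : R →+* R[T;T⁻¹])
    (LaurentPolynomial.T 1) (LaurentPolynomial.C s * LaurentPolynomial.T (-1)) (by
        rw [mul_left_comm, ← LaurentPolynomial.T_add]; simp)
  refine Function.Injective.of_comp (f := lift (s := s) (LaurentPolynomial.C : R →+* R[T;T⁻¹])
    (LaurentPolynomial.T 1) (LaurentPolynomial.C s * LaurentPolynomial.T (-1)) (by
        rw [mul_left_comm, ← LaurentPolynomial.T_add]; simp)) ?_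
  rw [← RingHom.coe_comp, h]
  exact (laurentC_injective _)

/-- The fibre over `z = 0` is `x y = s` with `s ≠ 0` in the domain `R / z`, hence irreducible;
contrast the next case, where it breaks into two lines. -/
theorem isPrime_span_algebraMap {z : R} (hz : Prime z) (hzs : ¬ z ∣ s) :
    (Ideal.span {algebraMap R (Node R s) z}).IsPrime := by
  have hp : (Ideal.span {z}).IsPrime := (Ideal.span_singleton_prime hz.ne_zero).mpr hz
  set ρ := Ideal.Quotient.mk (Ideal.span {z})
  have hρ : ρ s ≠ 0 := by rwa [Ne, Ideal.Quotient.eq_zero_iff_mem, Ideal.mem_span_singleton]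
  have h := fun f => mem_map_ker_of_lift_laurent (ρ := ρ) (mem_nonZeroDivisors_of_ne_zero hρ) f
  set L := lift (s := s) ((LaurentPolynomial.C : (R ⧸ Ideal.span {z}) →+* _).comp ρ)
    (LaurentPolynomial.T 1) (LaurentPolynomial.C (ρ s) * LaurentPolynomial.T (-1)) (by
      rw [mul_left_comm, ← LaurentPolynomial.T_add]; simp)
  have : RingHom.ker L = Ideal.span {algebraMap R (Node R s) z} := by
    refine le_antisymm (fun f hf => ?_) ?_
    · have := h f hf
      rwa [Ideal.mk_ker, Ideal.map_span, Set.image_singleton] at this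
    · rw [Ideal.span_singleton_le_iff_mem, RingHom.mem_ker, lift_algebraMap, RingHom.comp_apply,
        Ideal.Quotient.eq_zero_iff_mem.mpr (Ideal.mem_span_singleton_self z), map_zero]
  rw [← this]
  exact RingHom.ker_isPrime L

theorem isPrime_span_x_algebraMap {z : R} (hz : Prime z) (hzs : z ∣ s) :
    (Ideal.span {x R s, algebraMap R (Node R s) z}).IsPrime := by
  have hp : (Ideal.span {z}).IsPrime := (Ideal.span_singleton_prime hz.ne_zero).mpr hz
  set ρ := Ideal.Quotient.mk (Ideal.span {z})
  have hρ : ρ s = 0 := by rwa [Ideal.Quotient.eq_zero_iff_mem, Ideal.mem_span_singleton]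
  have h := fun f => mem_map_ker_sup_of_lift_polynomial hρ f
  set L := lift (s := s) ((Polynomial.C : (R ⧸ Ideal.span {z}) →+* _).comp ρ) 0 X (by simp [hρ])
  have : RingHom.ker L = Ideal.span {x R s, algebraMap R (Node R s) z} := by
    refine le_antisymm (fun f hf => ?_) ?_
    · have := h f hf
      rwa [Ideal.mk_ker, Ideal.map_span, Set.image_singleton, sup_comm, ← Ideal.span_insert] at this
    · rw [Ideal.span_le]
      rintro _ (rfl | rfl)
      · exact lift_x ..
      · rw [SetLike.mem_coe, RingHom.mem_ker, lift_algebraMap, RingHom.comp_apply,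
        Ideal.Quotient.eq_zero_iff_mem.mpr (Ideal.mem_span_singleton_self z), map_zero]
  rw [← this]
  exact RingHom.ker_isPrime L

/-- Provides elements outside the prime, so that the generic test of membership can be restricted to
primes avoiding them. -/
theorem notMem_span_x_algebraMap {z r : R} (hz : Prime z) (hzs : z ∣ s) (hr : ¬ z ∣ r) :
    algebraMap R (Node R s) r * y R s ∉ Ideal.span {x R s, algebraMap R (Node R s) z} := by
  have hp : (Ideal.span {z}).IsPrime := (Ideal.span_singleton_prime hz.ne_zero).mpr hz
  set ρ := Ideal.Quotient.mk (Ideal.span {z})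
  have hρ : ρ s = 0 := by rwa [Ideal.Quotient.eq_zero_iff_mem, Ideal.mem_span_singleton]
  set L := lift (s := s) ((Polynomial.C : (R ⧸ Ideal.span {z}) →+* _).comp ρ) 0 X (by simp [hρ])
    with hL
  have : Ideal.span {x R s, algebraMap R (Node R s) z} ≤ RingHom.ker L := by
    rw [Ideal.span_le]
    rintro _ (rfl | rfl)
    · exact lift_x ..
    · rw [SetLike.mem_coe, RingHom.mem_ker, lift_algebraMap, RingHom.comp_apply,
        Ideal.Quotient.eq_zero_iff_mem.mpr (Ideal.mem_span_singleton_self z), map_zero]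
  intro h
  have h := this h
  rw [RingHom.mem_ker, map_mul, hL, lift_y, lift_algebraMap, mul_eq_zero] at h
  rcases h with h | h
  · rw [RingHom.comp_apply, Polynomial.C_eq_zero, Ideal.Quotient.eq_zero_iff_mem,
      Ideal.mem_span_singleton] at h
    exact hr h
  · exact X_ne_zero h

theorem notMem_span_algebraMap {z r : R} (hz : Prime z) (hzs : ¬ z ∣ s) (hr : ¬ z ∣ r) :
    algebraMap R (Node R s) r * y R s ∉ Ideal.span {algebraMap R (Node R s) z} := by
  have := isPrime_span_algebraMap hz hzs
  have key : ∀ r, ¬ z ∣ r → algebraMap R (Node R s) r ∉ Ideal.span {algebraMap R (Node R s) z} := by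
    intro r hr h
    have hp : (Ideal.span {z}).IsPrime := (Ideal.span_singleton_prime hz.ne_zero).mpr hz
    set ρ := Ideal.Quotient.mk (Ideal.span {z})
    set L := lift (s := s) ((LaurentPolynomial.C : (R ⧸ Ideal.span {z}) →+* _).comp ρ)
      (LaurentPolynomial.T 1) (LaurentPolynomial.C (ρ s) * LaurentPolynomial.T (-1)) (by
        rw [mul_left_comm, ← LaurentPolynomial.T_add]; simp) with hL
    have hle : Ideal.span {algebraMap R (Node R s) z} ≤ RingHom.ker L := by
      rw [Ideal.span_singleton_le_iff_mem, RingHom.mem_ker, lift_algebraMap, RingHom.comp_apply,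
        Ideal.Quotient.eq_zero_iff_mem.mpr (Ideal.mem_span_singleton_self z), map_zero]
    have h := hle h
    rw [RingHom.mem_ker, hL, lift_algebraMap, RingHom.comp_apply,
      map_eq_zero_iff _ (laurentC_injective _), Ideal.Quotient.eq_zero_iff_mem,
      Ideal.mem_span_singleton] at h
    exact hr h
  intro h
  rcases this.mem_or_mem h with h | h
  · exact key r hr h
  · refine key s hzs ?_
    rw [← x_mul_y]
    exact Ideal.mul_mem_left _ _ h

/-! ### The closure of the graph of a section -/

section Graph

variable {p q e f u v : R}

variable (p q e f u v) in
/-- The ideal of the closure of the graph of the section `x = u p e / f`, `y = v q f / e`. -/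
noncomputable def graphIdeal : Ideal (Node R (p * q)) :=
  Ideal.span {algebraMap R _ f * x R _ - algebraMap R _ (u * p * e),
    algebraMap R _ e * y R _ - algebraMap R _ (v * q * f)}

/-- Modulo `z` the generators become `-u p e` and `e y`. On `x y = p q` the syzygies between `y` and
`p` are generated, up to units, by `(p, y)` and `(x, q)`, and both lift to exact relations between
the original generators. So a combination divisible by `z` comes from coefficients divisible by `z`.
-/
theorem mem_graphIdeal_of_mul_mem [IsDomain R] (huv : u * v = 1) {z : R} (hz : Prime z) (hp : ¬ z ∣ p)
    (hq : ¬ z ∣ q) (he : ¬ z ∣ e) (hf : z ∣ f) {g : Node R (p * q)}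
    (hg : algebraMap R _ z * g ∈ graphIdeal p q e f u v) : g ∈ graphIdeal p q e f u v := by
  have hp0 : p ≠ 0 := fun h => hp (h ▸ dvd_zero z)
  have hq0 : q ≠ 0 := fun h => hq (h ▸ dvd_zero z)
  have := isDomain (mul_ne_zero hp0 hq0)
  have hinj := algebraMap_injective (R := R) (s := p * q)
  have hpq : ¬ z ∣ p * q := hz.not_dvd_mul hp hq
  have hprime := isPrime_span_algebraMap hz hpq
  set c := algebraMap R (Node R (p * q))
  set X := x R (p * q)
  set Y := y R (p * q)
  have hXY : X * Y = c p * c q := by rw [← map_mul]; exact x_mul_y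
  have huv' : c u * c v = 1 := by rw [← map_mul, huv, map_one]
  obtain ⟨f, rfl⟩ := hf
  obtain ⟨α, β, h⟩ := Ideal.mem_span_pair.mp hg
  change α * (c (z * f) * X - c (u * p * e)) + β * (c e * Y - c (v * q * (z * f))) = c z * g at h
  have hcoprime : ∀ r, ¬ z ∣ r → c r ∉ Ideal.span {c z} := by
    intro r hr h
    exact notMem_span_algebraMap hz hpq hr (Ideal.mul_mem_right _ _ h)
  -- modulo `z`, we have `Y β = u p α`
  obtain ⟨γ, hγ⟩ : ∃ γ, Y * β - c u * c p * α = c z * γ := by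
    have : c e * (Y * β - c u * c p * α) ∈ Ideal.span {c z} := by
      rw [Ideal.mem_span_singleton]
      refine ⟨g - α * c f * X + β * (c v * c q * c f), ?_⟩
      simp only [map_mul] at h
      linear_combination h
    rcases hprime.mem_or_mem this with h | h
    · exact absurd h (hcoprime e he)
    · exact Ideal.mem_span_singleton.mp h
  -- hence `β` lies in the ideal generated by `X`, `p` and `z`
  obtain ⟨r, r', β', hβ⟩ : ∃ r r' β', β = c p * r + X * r' + c z * β' := by
    -- Modulo `(p, z)` one may pass to the line `x = 0`, a polynomial ring in `y`. There `y β`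
    -- vanishes, and `y` is regular.
    set ρ := Ideal.Quotient.mk (Ideal.span {p, z})
    have hρ : ρ (p * q) = 0 := Ideal.Quotient.eq_zero_iff_mem.mpr
      (Ideal.mul_mem_right _ _ (Ideal.subset_span (by simp)))
    have hρp : ρ p = 0 := Ideal.Quotient.eq_zero_iff_mem.mpr (Ideal.subset_span (by simp))
    have hρz : ρ z = 0 := Ideal.Quotient.eq_zero_iff_mem.mpr (Ideal.subset_span (by simp))
    have h' := mem_map_ker_sup_of_lift_polynomial hρ β
    set L := lift (s := p * q) ((Polynomial.C : (R ⧸ Ideal.span {p, z}) →+* _).comp ρ) 0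
      Polynomial.X (by simp [hρ]) with hL
    have h'' : L (Y * β) = 0 := by
      rw [sub_eq_iff_eq_add.mp hγ, map_add, map_mul, map_mul, map_mul, hL]
      simp only [c, lift_algebraMap, RingHom.comp_apply, hρz, hρp]
      simp
    rw [map_mul, hL, lift_y, Polynomial.X_mul, ← hL] at h''
    have h₀ : L β = 0 := by
      ext n
      simpa using congr(($h'').coeff (n + 1))
    have := h' h₀
    rw [Ideal.mk_ker, Ideal.map_span, Set.image_pair, sup_comm, ← Ideal.span_insert,
      Ideal.mem_span_insert] at this
    obtain ⟨r', w, hw, hβ⟩ := this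
    obtain ⟨r, β', hw⟩ := Ideal.mem_span_pair.mp hw
    exact ⟨r, r', β', by rw [hβ, ← hw]; ring⟩
  obtain ⟨α', hα⟩ : ∃ α', α = c v * (Y * r + c q * r') + c z * α' := by
    have : c p * (Y * r + c q * r' - c u * α) ∈ Ideal.span {c z} := by
      rw [Ideal.mem_span_singleton]
      refine ⟨γ - Y * β', ?_⟩
      rw [hβ] at hγ
      linear_combination hγ - r' * hXY
    rcases hprime.mem_or_mem this with h | h
    · exact absurd h (hcoprime p hp)
    · obtain ⟨w, hw⟩ := Ideal.mem_span_singleton.mp h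
      refine ⟨- c v * w, ?_⟩
      linear_combination - c v * hw - α * huv'
  refine Ideal.mem_span_pair.mpr ⟨α', β', ?_⟩
  change α' * (c (z * f) * X - c (u * p * e)) + β' * (c e * Y - c (v * q * (z * f))) = g
  have hz0 : c z ≠ 0 := by rw [Ne, map_eq_zero_iff _ hinj]; exact hz.ne_zero
  -- The parts of `α` and `β` that are not multiples of `z` form a relation of the generators and
  -- contribute nothing.
  apply mul_left_cancel₀ hz0
  rw [← h, hα, hβ]
  simp only [map_mul]
  linear_combination (- c v * r * c z * c f - r' * c e) * hXY + 
    (c p * c e * Y * r + c p * c e * c q * r') * huv'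

end Graph

end Node

end NodalResolution

/-! ### Exchange of the coordinates, and primality of the graph ideal. -/

namespace NodalResolution

namespace Node

variable {R : Type u} [CommRing R]

/-- The isomorphism exchanging `x` and `y`. -/
noncomputable def swap {s s' : R} (h : s = s') : Node R s →+* Node R s' :=
  lift (algebraMap R _) (y R s') (x R s') (by rw [mul_comm, x_mul_y, h])

@[simp] theorem swap_x {s s' : R} (h : s = s') : swap h (x R s) = y R s' := lift_x ..

@[simp] theorem swap_y {s s' : R} (h : s = s') : swap h (y R s) = x R s' := lift_y ..

@[simp] theorem swap_algebraMap {s s' : R} (h : s = s') (r : R) :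
    swap h (algebraMap R _ r) = algebraMap R _ r := lift_algebraMap ..

theorem swap_swap {s s' : R} (h : s = s') (f : Node R s) : swap h.symm (swap h f) = f := by
  have : (swap h.symm).comp (swap h) = RingHom.id _ :=
    ringHom_ext (by ext; simp) (by simp) (by simp)
  exact congr($this f)

theorem swap_bijective {s s' : R} (h : s = s') : Function.Bijective (swap h) :=
  Function.bijective_iff_has_inverse.mpr ⟨swap h.symm, swap_swap h, swap_swap h.symm⟩

theorem swap_mem_graphIdeal {p q e f u v : R} {g : Node R (p * q)}
    (hg : g ∈ graphIdeal p q e f u v) :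
    swap (mul_comm p q) g ∈ graphIdeal q p f e v u := by
  obtain ⟨α, β, rfl⟩ := Ideal.mem_span_pair.mp hg
  refine Ideal.mem_span_pair.mpr ⟨swap (mul_comm p q) β, swap (mul_comm p q) α, ?_⟩
  simp only [map_add, map_mul, map_sub, swap_x, swap_y, swap_algebraMap]
  ring

/-- On the graph `f x` and `e y` are constants, so powers of `e` and `f` turn every element into a
constant. -/
theorem exists_pow_mul_sub_mem_graphIdeal {p q e f u v : R} (g : Node R (p * q)) :
    ∃ (n m : ℕ) (r : R), algebraMap R _ f ^ n * (algebraMap R _ e ^ m * g) - algebraMap R _ r ∈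
      graphIdeal p q e f u v := by
  set J := graphIdeal p q e f u v
  have hx : algebraMap R _ f * x R _ - algebraMap R _ (u * p * e) ∈ J := Ideal.subset_span (by simp)
  have hy : algebraMap R _ e * y R _ - algebraMap R _ (v * q * f) ∈ J := Ideal.subset_span (by simp)
  simp only [← Ideal.Quotient.eq_zero_iff_mem, map_sub, map_mul, map_pow, sub_eq_zero] at hx hy ⊢
  induction g using induction with
  | hC r => exact ⟨0, 0, r, by simp⟩
  | hx => exact ⟨1, 0, u * p * e, by simpa only [pow_one, pow_zero, one_mul, map_mul] using hx⟩
  | hy => exact ⟨0, 1, v * q * f, by simpa only [pow_one, pow_zero, one_mul, map_mul] using hy⟩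
  | hadd a b ha hb =>
    obtain ⟨n, m, r, ha⟩ := ha
    obtain ⟨n', m', r', hb⟩ := hb
    refine ⟨n + n', m + m', f ^ n' * e ^ m' * r + f ^ n * e ^ m * r', ?_⟩
    simp only [map_add, map_mul, map_pow, ← ha, ← hb]
    ring
  | hmul a b ha hb =>
    obtain ⟨n, m, r, ha⟩ := ha
    obtain ⟨n', m', r', hb⟩ := hb
    refine ⟨n + n', m + m', r * r', ?_⟩
    simp only [map_mul, ← ha, ← hb]
    ring

variable [IsDomain R]

theorem mem_graphIdeal_of_mul_mem' {p q e f u v : R} (huv : u * v = 1) {z : R} (hz : Prime z)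
    (hp : ¬ z ∣ p) (hq : ¬ z ∣ q) (hf : ¬ z ∣ f) (he : z ∣ e) {g : Node R (p * q)}
    (hg : algebraMap R _ z * g ∈ graphIdeal p q e f u v) : g ∈ graphIdeal p q e f u v := by
  have h := swap_mem_graphIdeal hg
  rw [map_mul, swap_algebraMap] at h
  have := swap_mem_graphIdeal (mem_graphIdeal_of_mul_mem (mul_comm u v ▸ huv) hz hq hp hf he h)
  rwa [swap_swap] at this

variable {ι : Type*} [DecidableEq ι] {z : ι → R} {E F : Finset ι} {p q u v : R}

/-- The prime factors are cancelled one at a time. A factor of `f` and a factor of `e` play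
symmetric roles under the exchange of `x` and `y`. -/
theorem mem_graphIdeal_of_prod_mul_mem (huv : u * v = 1)
    (hz : ∀ i, IsUnit (z i) ∨ Prime (z i))
    (hp : ∀ i ∈ E ∪ F, ¬ IsUnit (z i) → ¬ z i ∣ p) (hq : ∀ i ∈ E ∪ F, ¬ IsUnit (z i) → ¬ z i ∣ q)
    (hEF : ∀ i ∈ E, ∀ j ∈ F, ¬ IsUnit (z i) → ¬ z i ∣ z j)
    (hFE : ∀ i ∈ F, ∀ j ∈ E, ¬ IsUnit (z i) → ¬ z i ∣ z j) (G : Finset ι) (hG : G ⊆ E ∪ F)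
    {g : Node R (p * q)}
    (hg : algebraMap R _ (∏ i ∈ G, z i) * g ∈ graphIdeal p q (∏ i ∈ E, z i) (∏ i ∈ F, z i) u v) :
    g ∈ graphIdeal p q (∏ i ∈ E, z i) (∏ i ∈ F, z i) u v := by
  induction G using Finset.induction_on with
  | empty => simpa using hg
  | insert i G hi ih =>
    rw [Finset.prod_insert hi, map_mul, mul_assoc] at hg
    refine ih ((Finset.subset_insert _ _).trans hG) ?_
    have hi' := hG (Finset.mem_insert_self i G)
    by_cases hu : IsUnit (z i)
    · exact (Ideal.unit_mul_mem_iff_mem _ (hu.map _)).mp hg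
    have hzi := (hz i).resolve_left hu
    rcases Finset.mem_union.mp hi' with h | h
    · exact mem_graphIdeal_of_mul_mem' huv hzi (hp i hi' hu) (hq i hi' hu)
        (fun h' => by
          obtain ⟨j, hj, hj'⟩ := (hzi.dvd_finsetProd_iff _).mp h'
          exact hEF i h j hj hu hj') (Finset.dvd_prod_of_mem _ h) hg
    · exact mem_graphIdeal_of_mul_mem huv hzi (hp i hi' hu) (hq i hi' hu)
        (fun h' => by
          obtain ⟨j, hj, hj'⟩ := (hzi.dvd_finsetProd_iff _).mp h'
          exact hFE i h j hj hu hj') (Finset.dvd_prod_of_mem _ h) hg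

/-- The ideal is the kernel of evaluation at the section `x = u p e / f`, `y = v q f / e` in the
field of fractions: an element of the kernel is in the ideal after multiplication by powers of `e`
and `f`, and these can be cancelled. Evaluation is injective on constants. -/
theorem isPrime_graphIdeal (huv : u * v = 1) (hz : ∀ i, IsUnit (z i) ∨ Prime (z i))
    (hp : ∀ i ∈ E ∪ F, ¬ IsUnit (z i) → ¬ z i ∣ p) (hq : ∀ i ∈ E ∪ F, ¬ IsUnit (z i) → ¬ z i ∣ q)
    (hEF : ∀ i ∈ E, ∀ j ∈ F, ¬ IsUnit (z i) → ¬ z i ∣ z j)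
    (hFE : ∀ i ∈ F, ∀ j ∈ E, ¬ IsUnit (z i) → ¬ z i ∣ z j) :
    (graphIdeal p q (∏ i ∈ E, z i) (∏ i ∈ F, z i) u v).IsPrime ∧
      ∀ r ≠ 0, algebraMap R _ r ∉ graphIdeal p q (∏ i ∈ E, z i) (∏ i ∈ F, z i) u v := by
  have hz0 : ∀ i, z i ≠ 0 := fun i => (hz i).elim (·.ne_zero) (·.ne_zero)
  have he : ∏ i ∈ E, z i ≠ 0 := Finset.prod_ne_zero_iff.mpr fun i _ => hz0 i
  have hf : ∏ i ∈ F, z i ≠ 0 := Finset.prod_ne_zero_iff.mpr fun i _ => hz0 i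
  have key := mem_graphIdeal_of_prod_mul_mem huv hz hp hq hEF hFE
  have keyE := @key E Finset.subset_union_left
  have keyF := @key F Finset.subset_union_right
  set e := ∏ i ∈ E, z i
  set f := ∏ i ∈ F, z i
  set K := FractionRing R
  have hinj := IsFractionRing.injective R K
  set c := algebraMap R K
  have he' : c e ≠ 0 := by rwa [Ne, map_eq_zero_iff _ hinj]
  have hf' : c f ≠ 0 := by rwa [Ne, map_eq_zero_iff _ hinj]
  set ψ := lift (s := p * q) c (c (u * p * e) / c f) (c (v * q * f) / c e) (by
    rw [div_mul_div_comm, div_eq_iff (mul_ne_zero hf' he'), ← map_mul, ← map_mul, ← map_mul]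
    congr 1
    linear_combination p * q * e * f * huv) with hψ
  have hle : graphIdeal p q e f u v ≤ RingHom.ker ψ := by
    rw [graphIdeal, Ideal.span_le]
    rintro _ (rfl | rfl)
    · rw [SetLike.mem_coe, RingHom.mem_ker, map_sub, map_mul, hψ, lift_x, lift_algebraMap,
        lift_algebraMap, ← mul_div_assoc, mul_div_cancel_left₀ _ hf', sub_self]
    · rw [SetLike.mem_coe, RingHom.mem_ker, map_sub, map_mul, hψ, lift_y, lift_algebraMap,
        lift_algebraMap, ← mul_div_assoc, mul_div_cancel_left₀ _ he', sub_self]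
  have hker : RingHom.ker ψ = graphIdeal p q e f u v := by
    refine le_antisymm (fun g hg => ?_) hle
    obtain ⟨n, m, r, h⟩ := exists_pow_mul_sub_mem_graphIdeal (u := u) (v := v) (e := e) (f := f) g
    have h' := hle h
    rw [RingHom.mem_ker, map_sub, map_mul, map_mul, RingHom.mem_ker.mp hg, mul_zero, mul_zero,
      zero_sub, neg_eq_zero, hψ, lift_algebraMap, map_eq_zero_iff _ hinj] at h'
    rw [h', map_zero, sub_zero] at h
    have hE : ∀ (m : ℕ) (g : Node R (p * q)), algebraMap R _ e ^ m * g ∈ graphIdeal p q e f u v →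
        g ∈ graphIdeal p q e f u v := by
      intro m g hg
      induction m with
      | zero => simpa using hg
      | succ m ih => exact ih (keyE (by rwa [← mul_assoc, ← pow_succ']))
    have hF : ∀ (m : ℕ) (g : Node R (p * q)), algebraMap R _ f ^ m * g ∈ graphIdeal p q e f u v →
        g ∈ graphIdeal p q e f u v := by
      intro m g hg
      induction m with
      | zero => simpa using hg
      | succ m ih => exact ih (keyF (by rwa [← mul_assoc, ← pow_succ']))
    exact hE _ _ (hF _ _ h)
  rw [← hker]
  refine ⟨RingHom.ker_isPrime ψ, fun r hr h => hr ?_⟩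
  rwa [RingHom.mem_ker, hψ, lift_algebraMap, map_eq_zero_iff _ hinj] at h

end Node

end NodalResolution

namespace NodalResolution

open scoped TensorProduct

/-! ## Charts of blowups -/

/-- `C` is the chart `A[I / c]` of the blowup of `A` along `I`. -/
structure IsBlowupChart {A : Type u} (C : Type u) [CommRing A] [CommRing C] [Algebra A C]
    (I : Ideal A) (c : A) : Prop where
  exists_eq_mul : ∀ a ∈ I, ∃ u, algebraMap A C a = algebraMap A C c * u
  isRegular : ∀ u, algebraMap A C c * u = 0 → u = 0
  exists_pow_mul_eq : ∀ u : C, ∃ n, ∃ a ∈ I ^ n, algebraMap A C c ^ n * u = algebraMap A C a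
  exists_pow_mul_eq_zero : ∀ a, algebraMap A C a = 0 → ∃ n : ℕ, c ^ n * a = 0

theorem Node.essEtale_lift_congr {R A : Type u} [CommRing R] [CommRing A] {ρ : R →+* A} {x y : A}
    {s s' : R} {h : x * y = ρ s} (hE : EssEtale (Node.lift ρ x y h)) (hs : s = s') :
    EssEtale (Node.lift ρ x y (hs ▸ h : x * y = ρ s')) := by
  subst hs
  exact hE

theorem EssEtale.swap {R A : Type u} [CommRing R] [CommRing A] {ρ : R →+* A} {x y : A}
    {s : R} {h : x * y = ρ s} (hE : EssEtale (Node.lift ρ x y h)) :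
    EssEtale (Node.lift ρ y x ((mul_comm _ _).trans h)) := by
  have : Node.lift ρ y x ((mul_comm _ _).trans h) =
      (Node.lift ρ x y h).comp (Node.swap (rfl : s = s)) :=
    Node.ringHom_ext (by ext; simp) (by simp) (by simp)
  rw [this]
  exact (EssEtale.of_bijective (Node.swap_bijective _)).comp hE

/-- Put `w = c₁ / c₂`. Then `w y = p` and `x = w q`, as in the chart `R[w, y] / (w y - p)` of the
blowup of `(x, q)` on the model. The chart `C` is the base change of this model chart to `A`.
Injectivity uses that `y` is regular on the base change and that powers of `y` bring every element
into `A`; surjectivity holds because `w` generates `C`. -/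
theorem IsBlowupChart.essEtale {R A C : Type u} [CommRing R] [IsDomain R] [CommRing A] [CommRing C]
    [Algebra A C] {ρ : R →+* A} {x y : A} {p q : R} (hp : p ≠ 0) (hq : q ≠ 0)
    {h : x * y = ρ (p * q)} (hE : EssEtale (Node.lift ρ x y h)) {c₁ c₂ : A}
    (h₁ : y * c₁ = ρ p * c₂) (h₂ : x * c₂ = ρ q * c₁) (hc₂ : ∀ a, c₂ * a = 0 → a = 0)
    (hC : IsBlowupChart C (Ideal.span {c₁, c₂}) c₂) :
    ∃ (w : C) (hw : w * algebraMap A C y = (algebraMap A C).comp ρ p),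
      algebraMap A C x = w * algebraMap A C (ρ q) ∧
      EssEtale (Node.lift ((algebraMap A C).comp ρ) w (algebraMap A C y) hw) := by
  obtain ⟨w, hw⟩ := hC.exists_eq_mul c₁ (Ideal.subset_span (by simp))
  set α := algebraMap A C
  have hreg := hC.isRegular
  have hw' : w * α y = α.comp ρ p := by
    rw [← sub_eq_zero]
    apply hreg
    have := congr(α $h₁)
    simp only [map_mul] at this
    simp only [RingHom.comp_apply]
    linear_combination this - α y * hw
  have hx : α x = w * α (ρ q) := by
    rw [← sub_eq_zero]
    apply hreg
    have := congr(α $h₂)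
    simp only [map_mul] at this
    linear_combination this + α (ρ q) * hw
  refine ⟨w, hw', hx, ?_⟩
  -- the chart is the base change of the corresponding chart of the model
  let φ : Node R (p * q) →+* Node R p := Node.lift (algebraMap R _)
    (algebraMap R _ q * Node.x R p) (Node.y R p) (by
      rw [mul_assoc, Node.x_mul_y, ← map_mul, mul_comm])
  let ψ := Node.lift ρ x y h
  let θ := Node.lift (α.comp ρ) w (α y) hw'
  have hcomm : θ.comp φ = α.comp ψ := by
    refine Node.ringHom_ext ?_ ?_ ?_
    · ext r; simp [θ, φ, ψ]
    · simp [θ, φ, ψ, hx, mul_comm]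
    · simp [θ, φ, ψ]
  let := φ.toAlgebra
  let := ψ.toAlgebra
  let := θ.toAlgebra
  let := (α.comp ψ).toAlgebra
  have : IsScalarTower (Node R (p * q)) A C := .of_algebraMap_eq' rfl
  have : IsScalarTower (Node R (p * q)) (Node R p) C := .of_algebraMap_eq' hcomm.symm
  let Φ : Node R p ⊗[Node R (p * q)] A →ₐ[Node R (p * q)] C := Algebra.TensorProduct.lift
    (IsScalarTower.toAlgHom _ _ _) (IsScalarTower.toAlgHom _ _ _) fun _ _ => .all _ _
  have hE' : EssEtale (algebraMap (Node R p) (Node R p ⊗[Node R (p * q)] A)) :=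
    EssEtale.baseChange (A := Node R (p * q)) (B := A) hE
  have hΦ₁ : ∀ d, Φ (algebraMap _ _ d) = θ d := fun d => by
    simp [Φ, Algebra.TensorProduct.algebraMap_apply, RingHom.algebraMap_toAlgebra]
  have hΦ₂ : ∀ a, Φ (1 ⊗ₜ a) = α a := fun a => by simp [Φ, α]
  have := Node.isDomain hp
  have := Node.isDomain (mul_ne_zero hp hq)
  have hy0 : Node.y R p ≠ 0 := by
    intro h0
    have := Node.x_mul_y (R := R) (s := p)
    rw [h0, mul_zero, eq_comm, map_eq_zero_iff _ Node.algebraMap_injective] at this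
    exact hp this
  have hyreg := hE'.isRegular hy0
  set Y := algebraMap (Node R p) (Node R p ⊗[Node R (p * q)] A) (Node.y R p) with hY
  have htens : ∀ (d : Node R (p * q)) (a : A),
      (algebraMap (Node R p) (Node R p ⊗[Node R (p * q)] A) (φ d)) * (1 ⊗ₜ a) = 1 ⊗ₜ (ψ d * a) := by
    intro d a
    rw [Algebra.TensorProduct.algebraMap_apply, Algebra.TensorProduct.tmul_mul_tmul, one_mul,
      mul_one]
    change φ d ⊗ₜ a = _
    have e₁ : φ d = d • (1 : Node R p) := by rw [Algebra.smul_def, mul_one]; rfl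
    have e₂ : ψ d * a = d • a := by rw [Algebra.smul_def]; rfl
    rw [e₁, e₂, TensorProduct.smul_tmul]
  have hYφ : Y = algebraMap _ _ (φ (Node.y R _)) := by simp [hY, φ]
  -- In the model chart `y` times the new coordinate is the constant `p`, so a power of `y` clears
  -- the new coordinate.
  have hpow : ∀ γ : Node R p ⊗[Node R (p * q)] A, ∃ (n : ℕ) (a : A), Y ^ n * γ = 1 ⊗ₜ a := by
    have hYa : ∀ (n : ℕ) (a : A), Y ^ n * (1 ⊗ₜ a) = 1 ⊗ₜ (ψ (Node.y R _) ^ n * a) := by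
      intro n a
      rw [hYφ, ← map_pow, ← map_pow, htens, map_pow]
    have hd : ∀ d : Node R p, ∃ (n : ℕ) (a : A), Y ^ n * algebraMap _ _ d = 1 ⊗ₜ a := by
      intro d
      induction d using Node.induction with
      | hC r =>
        refine ⟨0, ψ (algebraMap _ _ r), ?_⟩
        have := htens (algebraMap _ _ r) 1
        rw [mul_one, ← Algebra.TensorProduct.one_def, mul_one] at this
        rw [← this]
        simp [φ]
      | hx =>
        refine ⟨1, ψ (algebraMap _ _ p), ?_⟩
        have := htens (algebraMap _ _ p) 1
        rw [mul_one, ← Algebra.TensorProduct.one_def, mul_one] at this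
        rw [← this, pow_one, hY, ← map_mul, mul_comm (Node.y R p) (Node.x R p), Node.x_mul_y]
        simp [φ]
      | hy =>
        refine ⟨0, ψ (Node.y R _), ?_⟩
        have := htens (Node.y R _) 1
        rw [mul_one, ← Algebra.TensorProduct.one_def, mul_one] at this
        rw [← this]
        simp [φ]
      | hadd f g hf hg =>
        obtain ⟨n, a, hf⟩ := hf
        obtain ⟨m, b, hg⟩ := hg
        refine ⟨n + m, ψ (Node.y R _) ^ m * a + ψ (Node.y R _) ^ n * b, ?_⟩
        rw [TensorProduct.tmul_add, ← hYa, ← hYa, ← hf, ← hg, map_add]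
        ring
      | hmul f g hf hg =>
        obtain ⟨n, a, hf⟩ := hf
        obtain ⟨m, b, hg⟩ := hg
        refine ⟨n + m, a * b, ?_⟩
        rw [show (1 : Node R p) ⊗ₜ[Node R (p * q)] (a * b) = (1 ⊗ₜ a) * (1 ⊗ₜ b) by simp, ← hf,
          ← hg, map_mul]
        ring
    intro γ
    induction γ using TensorProduct.induction_on with
    | zero => exact ⟨0, 0, by simp⟩
    | tmul d a =>
      obtain ⟨n, b, hb⟩ := hd d
      refine ⟨n, b * a, ?_⟩
      rw [show d ⊗ₜ[Node R (p * q)] a = algebraMap _ _ d * (1 ⊗ₜ a) by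
        simp [Algebra.TensorProduct.algebraMap_apply], ← mul_assoc, hb]
      simp
    | add γ γ' hγ hγ' =>
      obtain ⟨n, a, hf⟩ := hγ
      obtain ⟨m, b, hg⟩ := hγ'
      refine ⟨n + m, ψ (Node.y R _) ^ m * a + ψ (Node.y R _) ^ n * b, ?_⟩
      rw [TensorProduct.tmul_add, ← hYa, ← hYa, ← hf, ← hg]
      ring
  have hinj : Function.Injective Φ := by
    rw [injective_iff_map_eq_zero]
    intro γ hγ
    obtain ⟨n, a, hn⟩ := hpow γ
    have ha : α a = 0 := by rw [← hΦ₂, ← hn, map_mul, hγ, mul_zero]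
    obtain ⟨m, hm⟩ := hC.exists_pow_mul_eq_zero a ha
    have ha' : a = 0 := by
      induction m with
      | zero => simpa using hm
      | succ m ih => exact ih (hc₂ _ (by rw [← mul_assoc, ← pow_succ', hm]))
    rw [ha', TensorProduct.tmul_zero] at hn
    refine (hyreg.pow n) ?_
    simpa [Y] using hn
  have hsurj : Function.Surjective Φ := by
    -- An element of the `n`-th power of the center is `c₂ ^ n` times a form of degree `n` in `w`
    -- and `1`.
    have key : ∀ n : ℕ, ∀ a ∈ (Ideal.span {c₁, c₂} : Ideal A) ^ n, ∃ γ, α a = α c₂ ^ n * Φ γ := by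
      intro n
      induction n with
      | zero => exact fun a _ => ⟨1 ⊗ₜ a, by rw [hΦ₂]; simp⟩
      | succ n ih =>
        intro a ha
        rw [pow_succ] at ha
        induction ha using Submodule.mul_induction_on' with
        | mem_mul_mem a ha b hb =>
          obtain ⟨γ, hγ⟩ := ih a ha
          obtain ⟨r, s, rfl⟩ := Ideal.mem_span_pair.mp hb
          refine ⟨γ * ((1 ⊗ₜ r) * algebraMap _ _ (Node.x R p) + 1 ⊗ₜ s), ?_⟩
          rw [map_mul, hγ, map_mul, map_add, map_add, map_mul, map_mul, map_mul, hΦ₂, hΦ₂, hΦ₁, hw]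
          simp only [θ, Node.lift_x]
          ring
        | add a _ b _ ha hb =>
          obtain ⟨γ, hγ⟩ := ha
          obtain ⟨γ', hγ'⟩ := hb
          exact ⟨γ + γ', by rw [map_add, hγ, hγ', map_add]; ring⟩
    intro u
    obtain ⟨n, a, ha, hn⟩ := hC.exists_pow_mul_eq u
    obtain ⟨γ, hγ⟩ := key n a ha
    refine ⟨γ, ?_⟩
    rw [hγ] at hn
    have hregn : ∀ n : ℕ, ∀ u, α c₂ ^ n * u = 0 → u = 0 := by
      intro n
      induction n with
      | zero => intro u hu; simpa using hu
      | succ n ih => intro u hu; exact ih u (hreg _ (by rw [← mul_assoc, ← pow_succ', hu]))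
    exact (sub_eq_zero.mp (hregn n (u - Φ γ) (by rw [mul_sub, hn, sub_self]))).symm
  have hfinal : θ = Φ.toRingHom.comp (algebraMap (Node R p) (Node R p ⊗[Node R (p * q)] A)) :=
    RingHom.ext fun d => (hΦ₁ d).symm
  change EssEtale θ
  rw [hfinal]
  exact hE'.comp (EssEtale.of_bijective ⟨hinj, hsurj⟩)

end NodalResolution

namespace NodalResolution

/-! ## Local states of the resolution and local equations of the centers -/

/-- Each member of the family is a unit or prime, and the primes do not divide other members. -/
structure IsPrimeFamily {ι : Type*} {R : Type u} [CommRing R] (z : ι → R) : Prop where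
  isUnit_or_prime : ∀ i, IsUnit (z i) ∨ Prime (z i)
  not_dvd : ∀ i j, i ≠ j → ¬ IsUnit (z i) → ¬ z i ∣ z j

/-- An essentially étale chart `R[x, y] / (x y - ∏_S z) → A`, where `S`, `M`, `N` is a partition of
the index set, and `x₀ = x ∏_M z`, `y₀ = y ∏_N z`. -/
structure State {ι : Type} {R A : Type u} [CommRing R] [CommRing A] (ρ : R →+* A) (z : ι → R)
    (x₀ y₀ : A) (S M N : Finset ι) (x y : A) : Prop where
  disjoint_S_M : Disjoint S M
  disjoint_S_N : Disjoint S N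
  disjoint_M_N : Disjoint M N
  cover : ∀ i, i ∈ S ∨ i ∈ M ∨ i ∈ N
  mul_eq : x * y = ρ (∏ i ∈ S, z i)
  x₀_eq : x₀ = x * ρ (∏ i ∈ M, z i)
  y₀_eq : y₀ = y * ρ (∏ i ∈ N, z i)
  essEtale : EssEtale (Node.lift ρ x y mul_eq)

/-- The ideal `I` is generated by two regular elements `c₁` and `c₂` whose ratio is `x / ∏_T z`. -/
structure IsCenter {ι : Type} {R A : Type u} [CommRing R] [CommRing A] [DecidableEq ι]
    (ρ : R →+* A) (z : ι → R) (S : Finset ι) (x y : A) (I : Ideal A) (T : Finset ι)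
    (c₁ c₂ : A) : Prop where
  subset : T ⊆ S
  eq_span : I = Ideal.span {c₁, c₂}
  y_mul : y * c₁ = ρ (∏ i ∈ S \ T, z i) * c₂
  x_mul : x * c₂ = ρ (∏ i ∈ T, z i) * c₁
  regular₁ : ∀ a, c₁ * a = 0 → a = 0
  regular₂ : ∀ a, c₂ * a = 0 → a = 0

section

variable {ι : Type} {R A : Type u} [CommRing R] [CommRing A]
  {ρ : R →+* A} {z : ι → R} {x₀ y₀ x y : A} {S M N : Finset ι}

theorem State.swap (h : State ρ z x₀ y₀ S M N x y) : State ρ z y₀ x₀ S N M y x where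
  disjoint_S_M := h.disjoint_S_N
  disjoint_S_N := h.disjoint_S_M
  disjoint_M_N := h.disjoint_M_N.symm
  cover i := (h.cover i).imp_right Or.symm
  mul_eq := (mul_comm _ _).trans h.mul_eq
  x₀_eq := h.y₀_eq
  y₀_eq := h.x₀_eq
  essEtale := h.essEtale.swap

theorem State.congr (h : State ρ z x₀ y₀ S M N x y) {B : Type u} [CommRing B] {ψ : A →+* B}
    (hψ : EssEtale ψ) : State (ψ.comp ρ) z (ψ x₀) (ψ y₀) S M N (ψ x) (ψ y) where
  disjoint_S_M := h.disjoint_S_M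
  disjoint_S_N := h.disjoint_S_N
  disjoint_M_N := h.disjoint_M_N
  cover := h.cover
  mul_eq := by rw [← map_mul, h.mul_eq]; rfl
  x₀_eq := by rw [h.x₀_eq, map_mul]; rfl
  y₀_eq := by rw [h.y₀_eq, map_mul]; rfl
  essEtale := by
    convert h.essEtale.comp hψ
    exact Node.ringHom_ext (by ext; simp) (by simp) (by simp)

theorem IsPrimeFamily.ne_zero [IsDomain R] (hz : IsPrimeFamily z) (i : ι) : z i ≠ 0 :=
  (hz.isUnit_or_prime i).elim (·.ne_zero) (·.ne_zero)

theorem IsPrimeFamily.prod_ne_zero [IsDomain R] (hz : IsPrimeFamily z) (S : Finset ι) :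
    ∏ i ∈ S, z i ≠ 0 :=
  Finset.prod_ne_zero_iff.mpr fun i _ => hz.ne_zero i

theorem IsPrimeFamily.not_dvd_prod (hz : IsPrimeFamily z) {S : Finset ι} {i : ι} (hi : i ∉ S)
    (hu : ¬ IsUnit (z i)) : ¬ z i ∣ ∏ j ∈ S, z j := by
  intro h
  obtain ⟨j, hj, hj'⟩ := (((hz.isUnit_or_prime i).resolve_left hu).dvd_finsetProd_iff _).mp h
  exact hz.not_dvd i j (by rintro rfl; exact hi hj) hu hj'

theorem EssEtale.node_mem_map_of_forall_prime {s : R} {h : x * y = ρ s}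
    (hE : EssEtale (Node.lift ρ x y h)) {J : Ideal (Node R s)} [J.IsPrime] {τ : Node R s}
    (hτ : τ ∉ J) {b : A} (hb : ∀ P : Ideal A, P.IsPrime → J.map (Node.lift ρ x y h) ≤ P →
      Node.lift ρ x y h τ ∉ P → b ∈ P) :
    b ∈ J.map (Node.lift ρ x y h) := by
  let := (Node.lift ρ x y h).toAlgebra
  have hE : EssEtale (algebraMap (Node R s) A) := hE
  exact hE.mem_map_of_forall_prime hτ fun P hP hJ => hb P hP (Ideal.map_le_iff_le_comap.mpr hJ)

theorem Node.x_ne_zero [IsDomain R] {s : R} (hs : s ≠ 0) : Node.x R s ≠ 0 := by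
  intro h0
  have := Node.x_mul_y (R := R) (s := s)
  rw [h0, zero_mul, eq_comm, map_eq_zero_iff _ Node.algebraMap_injective] at this
  exact hs this

theorem Node.y_ne_zero [IsDomain R] {s : R} (hs : s ≠ 0) : Node.y R s ≠ 0 := by
  intro h0
  have := Node.x_mul_y (R := R) (s := s)
  rw [h0, mul_zero, eq_comm, map_eq_zero_iff _ Node.algebraMap_injective] at this
  exact hs this

open Polynomial in
open scoped LaurentPolynomial in
open LaurentPolynomial in
theorem Node.mul_x_sub_ne_zero {s f g : R} (hf : f ≠ 0) :
    algebraMap R _ f * Node.x R s - algebraMap R _ g ≠ 0 := by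
  intro h
  have h' := congrArg (Node.lift (s := s) (LaurentPolynomial.C : R →+* R[T;T⁻¹]) (T 1)
      (LaurentPolynomial.C s * T (-1)) (by rw [mul_left_comm, ← T_add]; simp)) h
  rw [map_sub, map_mul, Node.lift_algebraMap, Node.lift_algebraMap, Node.lift_x, map_zero,
    sub_eq_zero] at h'
  rw [show LaurentPolynomial.C f * T 1 = Polynomial.toLaurent (Polynomial.monomial 1 f) from
    (Polynomial.toLaurent_C_mul_T 1 f).symm, ← Polynomial.toLaurent_C] at h'
  exact hf (by simpa using congr(($(Polynomial.toLaurent_injective h')).coeff 1))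

theorem Node.mul_y_sub_ne_zero {s f g : R} (hf : f ≠ 0) :
    algebraMap R _ f * Node.y R s - algebraMap R _ g ≠ 0 := by
  intro h
  have := congrArg (Node.swap (rfl : s = s)) h
  simp only [map_sub, map_mul, Node.swap_algebraMap, Node.swap_y, map_zero] at this
  exact Node.mul_x_sub_ne_zero hf this

theorem EssEtale.node_regular [IsDomain R] {s : R} (hs : s ≠ 0) {h : x * y = ρ s}
    (hE : EssEtale (Node.lift ρ x y h)) {g : Node R s} (hg : g ≠ 0) (a : A)
    (ha : Node.lift ρ x y h g * a = 0) : a = 0 := by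
  have := Node.isDomain hs
  let := (Node.lift ρ x y h).toAlgebra
  have hE : EssEtale (algebraMap (Node R s) A) := hE
  exact hE.isRegular hg (by simpa [RingHom.algebraMap_toAlgebra] using ha)

variable [DecidableEq ι]

/-- Reduces the chart where `c₁` generates the center to the one where `c₂` does, at the price of
replacing `T` by its complement in `S`. -/
theorem IsCenter.swap {I : Ideal A} {T : Finset ι} {c₁ c₂ : A}
    (h : IsCenter ρ z S x y I T c₁ c₂) : IsCenter ρ z S y x I (S \ T) c₂ c₁ where
  subset := Finset.sdiff_subset
  eq_span := by rw [h.eq_span, Set.pair_comm]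
  y_mul := by rw [Finset.sdiff_sdiff_eq_self h.subset]; exact h.x_mul
  x_mul := h.y_mul
  regular₁ := h.regular₂
  regular₂ := h.regular₁

/-- The state of the chart of the blowup in which `c₂` generates the center. -/
theorem IsCenter.exists_state_chart [IsDomain R] (hz : IsPrimeFamily z)
    (h : State ρ z x₀ y₀ S M N x y) {I : Ideal A} {T : Finset ι} {c₁ c₂ : A}
    (hI : IsCenter ρ z S x y I T c₁ c₂) {C : Type u} [CommRing C] [Algebra A C]
    (hC : IsBlowupChart C I c₂) : ∃ x' y', State ((algebraMap A C).comp ρ) z (algebraMap A C x₀)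
      (algebraMap A C y₀) (S \ T) (M ∪ T) N x' y' := by
  have hdisj : Disjoint M T := (h.disjoint_S_M.mono_left hI.subset).symm
  have hprod : ∏ i ∈ S, z i = (∏ i ∈ S \ T, z i) * ∏ i ∈ T, z i :=
    (Finset.prod_sdiff hI.subset).symm
  -- Here `p = ∏_{S \ T} z` and `q = ∏_T z`; the relation `x = w q` moves the indices of `T` from
  -- `S` to `M`.
  obtain ⟨w, hw, hx, hE⟩ := IsBlowupChart.essEtale (hz.prod_ne_zero _) (hz.prod_ne_zero _)
    (Node.essEtale_lift_congr h.essEtale hprod) hI.y_mul hI.x_mul hI.regular₂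
    (hI.eq_span ▸ hC)
  refine ⟨w, algebraMap A C y, ?_, ?_, ?_, ?_, hw, ?_, ?_, hE⟩
  · exact Disjoint.sup_right (h.disjoint_S_M.mono_left Finset.sdiff_subset) Finset.sdiff_disjoint
  · exact h.disjoint_S_N.mono_left Finset.sdiff_subset
  · exact Disjoint.sup_left h.disjoint_M_N (h.disjoint_S_N.mono_left hI.subset)
  · intro i
    have := h.cover i
    simp only [Finset.mem_sdiff, Finset.mem_union]
    tauto
  · rw [h.x₀_eq, map_mul, hx, mul_assoc, ← map_mul, ← map_mul, Finset.prod_union hdisj,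
      mul_comm (∏ i ∈ M, z i)]
    rfl
  · rw [h.y₀_eq, map_mul]
    rfl

/-- If the products are units except for one index, the center is principal. -/
theorem IsCenter.principal {I : Ideal A} {T : Finset ι} {c₁ c₂ : A}
    (hI : IsCenter ρ z S x y I T c₁ c₂)
    (hu : ∀ i j, i ≠ j → IsUnit (ρ (z i)) ∨ IsUnit (ρ (z j))) :
    ∃ c, I = Ideal.span {c} ∧ ∀ a, c * a = 0 → a = 0 := by
  -- Nonunit factors in both products would have two different indices.
  have key : IsUnit (ρ (∏ i ∈ S \ T, z i)) ∨ IsUnit (ρ (∏ i ∈ T, z i)) := by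
    simp only [map_prod, IsUnit.prod_iff]
    by_contra! hc
    obtain ⟨⟨i, hi, hi'⟩, j, hj, hj'⟩ := hc
    exact (hu i j (by rintro rfl; exact (Finset.mem_sdiff.mp hi).2 hj)).elim hi' hj'
  rcases key with hk | hk
  · refine ⟨c₁, ?_, hI.regular₁⟩
    rw [hI.eq_span]
    refine le_antisymm (Ideal.span_le.mpr ?_) (Ideal.span_mono (by simp))
    rintro _ (rfl | rfl)
    · exact Ideal.subset_span rfl
    · refine (Ideal.unit_mul_mem_iff_mem _ hk).mp ?_
      rw [← hI.y_mul]
      exact Ideal.mul_mem_left _ _ (Ideal.subset_span rfl)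
  · refine ⟨c₂, ?_, hI.regular₂⟩
    rw [hI.eq_span]
    refine le_antisymm (Ideal.span_le.mpr ?_) (Ideal.span_mono (by simp))
    rintro _ (rfl | rfl)
    · refine (Ideal.unit_mul_mem_iff_mem _ hk).mp ?_
      rw [← hI.x_mul]
      exact Ideal.mul_mem_left _ _ (Ideal.subset_span rfl)
    · exact Ideal.subset_span rfl

end

end NodalResolution

/-! ### Local equations of the products of components and of the diagonals. -/

namespace NodalResolution

variable {ι : Type} {R A : Type u} [CommRing R] [CommRing A]
  {ρ : R →+* A} {z : ι → R} {x₀ y₀ x y : A} {S M N : Finset ι}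

/-- The prime `P` contains `z i`, no other member of the family, and `x₀`. -/
structure MemProduct (ρ : R →+* A) (z : ι → R) (x₀ : A) (i : ι) (P : Ideal A) : Prop where
  mem : ρ (z i) ∈ P
  notMem : ∀ l, l ≠ i → ρ (z l) ∉ P
  x₀_mem : x₀ ∈ P

theorem prod_notMem {P : Ideal A} [P.IsPrime] (h : ∀ i ∈ S, ρ (z i) ∉ P) :
    ρ (∏ i ∈ S, z i) ∉ P := by
  rw [map_prod, Ideal.IsPrime.prod_mem_iff]
  rintro ⟨i, hi, hi'⟩
  exact h i hi hi'

theorem State.notMem_of_prod_notMem (h : State ρ z x₀ y₀ S M N x y) {P : Ideal A}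
    (hp : ρ (∏ i ∈ S, z i) ∉ P) : x ∉ P ∧ y ∉ P := by
  rw [← h.mul_eq] at hp
  exact ⟨fun hx => hp (P.mul_mem_right _ hx), fun hy => hp (P.mul_mem_left _ hy)⟩

variable [DecidableEq ι]

/-- Lets points away from the center be treated like the others: `1 / y` is the ratio `x / ∏_S z`,
so `T = S`. -/
theorem IsCenter.of_eq_top [IsDomain R] (hz : IsPrimeFamily z) (h : State ρ z x₀ y₀ S M N x y)
    {I : Ideal A} (hI : I = ⊤) : IsCenter ρ z S x y I S 1 y where
  subset := subset_rfl
  eq_span := by rw [hI, eq_comm, Ideal.eq_top_iff_one]; exact Ideal.subset_span (by simp)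
  y_mul := by simp
  x_mul := by rw [h.mul_eq, mul_one]
  regular₁ := by simp
  regular₂ := by simpa using h.essEtale.node_regular (hz.prod_ne_zero S) (Node.y_ne_zero (hz.prod_ne_zero S))

/-- The center given by a product of components is principal up to the factor `x / z i`. -/
theorem State.exists_isCenter_product [IsDomain R] (hz : IsPrimeFamily z)
    (h : State ρ z x₀ y₀ S M N x y) (i : ι) {I : Ideal A}
    (hI : ∀ a, a ∈ I ↔ ∀ P : Ideal A, P.IsPrime → MemProduct ρ z x₀ i P → a ∈ P) :
    ∃ T c₁ c₂, IsCenter ρ z S x y I T c₁ c₂ ∧ (i ∈ S → T = {i}) ∧ (i ∉ S → T = S) := by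
  by_cases hS : i ∈ S
  -- For `i ∈ S` the locus is generically `x = z i = 0`, since the remaining factors of `x₀` are
  -- invertible there.
  · refine ⟨{i}, x, ρ (z i), ⟨by simpa using hS, ?_, ?_, ?_, ?_, ?_⟩, fun _ => rfl,
      fun h => (h hS).elim⟩
    · refine le_antisymm (fun a ha => ?_) (Ideal.span_le.mpr ?_)
      · by_cases hu : IsUnit (z i)
        · exact (Ideal.eq_top_of_isUnit_mem _ (Ideal.subset_span (by simp)) (hu.map ρ)).ge trivial
        have hzi := (hz.isUnit_or_prime i).resolve_left hu
        have hdvd : z i ∣ ∏ i ∈ S, z i := Finset.dvd_prod_of_mem _ hS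
        have hprime := Node.isPrime_span_x_algebraMap hzi hdvd
        have hJ : (Ideal.span {Node.x R (∏ i ∈ S, z i), algebraMap _ _ (z i)}).map
            (Node.lift ρ x y h.mul_eq) = Ideal.span {x, ρ (z i)} := by
          rw [Ideal.map_span, Set.image_pair, Node.lift_x, Node.lift_algebraMap]
        rw [← hJ]
        -- Primes over `(x, z i)` avoiding `τ` contain no other member of the family, hence belong
        -- to the locus, and they suffice for the test of membership.
        let τ : R := ∏ l ∈ (S ∪ M ∪ N) \ {i}, z l
        have hcov : ∀ l, l ≠ i → l ∈ (S ∪ M ∪ N) \ {i} := fun l hl => by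
          simpa [hl, or_assoc] using h.cover l
        have hτ : ¬ z i ∣ τ := hz.not_dvd_prod (by simp) hu
        refine h.essEtale.node_mem_map_of_forall_prime (τ := algebraMap _ _ τ) (fun h' =>
          Node.notMem_span_x_algebraMap hzi hdvd hτ (Ideal.mul_mem_right _ _ h')) ?_
        intro P hP hJP hτP
        rw [hJ, Ideal.span_le] at hJP
        rw [Node.lift_algebraMap, map_prod, Ideal.IsPrime.prod_mem_iff] at hτP
        refine (hI a).mp ha P hP ⟨hJP (by simp), fun l hl hl' => hτP ⟨l, hcov l hl, hl'⟩, ?_⟩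
        rw [h.x₀_eq]
        exact P.mul_mem_right _ (hJP (by simp))
      · rintro _ (rfl | rfl)
        · refine (hI _).mpr fun P hP hP' => ?_
          have := hP'.x₀_mem
          rw [h.x₀_eq] at this
          exact (hP.mem_or_mem this).resolve_right (prod_notMem fun l hl => hP'.notMem l
            (by rintro rfl; exact Finset.disjoint_left.mp h.disjoint_S_M hS hl))
        · exact (hI _).mpr fun P hP hP' => hP'.mem
    · rw [mul_comm, h.mul_eq, ← map_mul, ← Finset.prod_sdiff (Finset.singleton_subset_iff.mpr hS),
        Finset.prod_singleton]
    · rw [Finset.prod_singleton, mul_comm]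
    · simpa using h.essEtale.node_regular (hz.prod_ne_zero S) (Node.x_ne_zero (hz.prod_ne_zero S))
    · have := h.essEtale.node_regular (hz.prod_ne_zero S) (g := algebraMap _ _ (z i)) (by
        rw [Ne, map_eq_zero_iff _ Node.algebraMap_injective]; exact hz.ne_zero i)
      simpa using this
  rcases (h.cover i).resolve_left hS with hM | hN
  -- For `i ∈ M` the element `x₀` is a multiple of `z i`, so the ideal is principal, generated by `z
  -- i`. It is written as `(z i, y z i)` to fit the general form with `T = S`.
  · have hreg : ∀ a, ρ (z i) * a = 0 → a = 0 := by
      have := h.essEtale.node_regular (hz.prod_ne_zero S) (g := algebraMap _ _ (z i)) (by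
        rw [Ne, map_eq_zero_iff _ Node.algebraMap_injective]; exact hz.ne_zero i)
      simpa using this
    have hyreg : ∀ a, y * a = 0 → a = 0 := by
      simpa using h.essEtale.node_regular (hz.prod_ne_zero S) (Node.y_ne_zero (hz.prod_ne_zero S))
    refine ⟨S, ρ (z i), y * ρ (z i), ⟨subset_rfl, ?_, by simp, ?_, hreg, ?_⟩,
      fun h => (hS h).elim, fun _ => rfl⟩
    · refine le_antisymm (fun a ha => ?_) (Ideal.span_le.mpr ?_)
      · by_cases hu : IsUnit (z i)
        · exact (Ideal.eq_top_of_isUnit_mem _ (Ideal.subset_span (by simp)) (hu.map ρ)).ge trivial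
        have hzi := (hz.isUnit_or_prime i).resolve_left hu
        have hdvd : ¬ z i ∣ ∏ i ∈ S, z i := hz.not_dvd_prod hS hu
        have hprime := Node.isPrime_span_algebraMap hzi hdvd
        have hJ : (Ideal.span {algebraMap R (Node R (∏ i ∈ S, z i)) (z i)}).map
            (Node.lift ρ x y h.mul_eq) = Ideal.span {ρ (z i)} := by
          rw [Ideal.map_span, Set.image_singleton, Node.lift_algebraMap]
        refine Ideal.span_mono (s := {ρ (z i)}) (by simp) ?_
        rw [← hJ]
        let τ : R := ∏ l ∈ (S ∪ M ∪ N) \ {i}, z l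
        have hcov : ∀ l, l ≠ i → l ∈ (S ∪ M ∪ N) \ {i} := fun l hl => by
          simpa [hl, or_assoc] using h.cover l
        have hτ : ¬ z i ∣ τ := hz.not_dvd_prod (by simp) hu
        refine h.essEtale.node_mem_map_of_forall_prime (τ := algebraMap _ _ τ) (fun h' =>
          Node.notMem_span_algebraMap hzi hdvd hτ (Ideal.mul_mem_right _ _ h')) ?_
        intro P hP hJP hτP
        rw [hJ, Ideal.span_le] at hJP
        rw [Node.lift_algebraMap, map_prod, Ideal.IsPrime.prod_mem_iff] at hτP
        have hi : ρ (z i) ∈ P := hJP (by simp)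
        refine (hI a).mp ha P hP ⟨hi, fun l hl hl' => hτP ⟨l, hcov l hl, hl'⟩, ?_⟩
        rw [h.x₀_eq]
        exact P.mul_mem_left _ (Ideal.mem_of_dvd _ (map_dvd ρ (Finset.dvd_prod_of_mem _ hM)) hi)
      · rintro _ (rfl | rfl)
        · exact (hI _).mpr fun P hP hP' => hP'.mem
        · exact I.mul_mem_left _ ((hI _).mpr fun P hP hP' => hP'.mem)
    · rw [← mul_assoc, h.mul_eq]
    · intro a ha
      exact hreg _ (hyreg _ (by rw [← mul_assoc, ha]))
  -- For `i ∈ N` no factor of `x₀` can vanish: the members indexed by `S` and `M` are outside `P`,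
  -- and `x` divides `∏_S z`. The locus is empty.
  · have hI' : I = ⊤ := by
      rw [Ideal.eq_top_iff_one, hI]
      intro P hP hP'
      have h₁ : ρ (∏ i ∈ S, z i) ∉ P := prod_notMem fun l hl => hP'.notMem l
        (by rintro rfl; exact hS hl)
      have h₂ : ρ (∏ i ∈ M, z i) ∉ P := prod_notMem fun l hl => hP'.notMem l
        (by rintro rfl; exact Finset.disjoint_left.mp h.disjoint_M_N hl hN)
      have := hP'.x₀_mem
      rw [h.x₀_eq] at this
      exact ((hP.mem_or_mem this).elim (h.notMem_of_prod_notMem h₁).1 h₂).elim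
    exact ⟨S, 1, y, .of_eq_top hz h hI', fun h => (hS h).elim, fun _ => rfl⟩

/-- The prime `P` contains `x₀ - a` and `y₀ - b`, and at most one member of the family. -/
structure MemDiagonal (ρ : R →+* A) (z : ι → R) (x₀ y₀ : A) (a b : R) (P : Ideal A) : Prop where
  x₀_sub_mem : x₀ - ρ a ∈ P
  y₀_sub_mem : y₀ - ρ b ∈ P
  notMem : ∀ i j, i ≠ j → ρ (z i) ∉ P ∨ ρ (z j) ∉ P

/-- The graph ideal is prime and contains no nonzero constant, so membership in its extension can be
tested at primes avoiding every `z i`. -/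
theorem EssEtale.mem_graphIdeal_iff [IsDomain R] [Fintype ι] (hz : IsPrimeFamily z) {p q u v : R}
    {E F : Finset ι} (hEF : Disjoint E F) {h : x * y = ρ (p * q)}
    (hE : EssEtale (Node.lift ρ x y h)) (hp : ∀ i ∈ E ∪ F, ¬ IsUnit (z i) → ¬ z i ∣ p)
    (hq : ∀ i ∈ E ∪ F, ¬ IsUnit (z i) → ¬ z i ∣ q) (huv : u * v = 1) {a : A}
    (ha : ∀ P : Ideal A, P.IsPrime → (∀ i, ρ (z i) ∉ P) →
      ρ (∏ i ∈ F, z i) * x - ρ (u * p * ∏ i ∈ E, z i) ∈ P →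
      ρ (∏ i ∈ E, z i) * y - ρ (v * q * ∏ i ∈ F, z i) ∈ P → a ∈ P) :
    a ∈ Ideal.span {ρ (∏ i ∈ F, z i) * x - ρ (u * p * ∏ i ∈ E, z i),
      ρ (∏ i ∈ E, z i) * y - ρ (v * q * ∏ i ∈ F, z i)} := by
  obtain ⟨hJ, hJ'⟩ := Node.isPrime_graphIdeal (p := p) (q := q) (E := E) (F := F) huv
    hz.isUnit_or_prime hp hq
    (fun i hi j hj hu => hz.not_dvd i j (by
      rintro rfl; exact Finset.disjoint_left.mp hEF hi hj) hu)
    (fun i hi j hj hu => hz.not_dvd i j (by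
      rintro rfl; exact Finset.disjoint_left.mp hEF hj hi) hu)
  have hmap : (Node.graphIdeal p q (∏ i ∈ E, z i) (∏ i ∈ F, z i) u v).map (Node.lift ρ x y h) =
      Ideal.span {ρ (∏ i ∈ F, z i) * x - ρ (u * p * ∏ i ∈ E, z i),
        ρ (∏ i ∈ E, z i) * y - ρ (v * q * ∏ i ∈ F, z i)} := by
    rw [Node.graphIdeal, Ideal.map_span, Set.image_pair]
    simp only [map_sub, map_mul, Node.lift_x, Node.lift_y, Node.lift_algebraMap]
  rw [← hmap]
  refine hE.node_mem_map_of_forall_prime (hJ' (∏ i, z i) (hz.prod_ne_zero _)) fun P hP hJP hτ => ?_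
  rw [hmap, Ideal.span_le] at hJP
  rw [Node.lift_algebraMap, map_prod, Ideal.IsPrime.prod_mem_iff] at hτ
  exact ha P hP (fun i hi => hτ ⟨i, Finset.mem_univ _, hi⟩) (hJP (by simp)) (hJP (by simp))

/-- On `x y = p q` one has `q (f x - u p e) = -u x (e y - v q f)`, so one equation of the graph
implies the other wherever `q` is invertible. -/
theorem sub_mem_of_sub_mem {P : Ideal A} [P.IsPrime] {p q e f u v : R} (huv : u * v = 1)
    (hxy : x * y = ρ (p * q)) (h : ρ e * y - ρ (v * q * f) ∈ P) (hq : ρ q ∉ P) :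
    ρ f * x - ρ (u * p * e) ∈ P := by
  have h₁ : ρ q * (ρ f * x - ρ (u * p * e)) ∈ P := by
    convert P.mul_mem_left (- (ρ u * x)) h using 1
    simp only [map_mul] at hxy ⊢
    have := congr(ρ $huv)
    rw [map_mul, map_one] at this
    linear_combination ρ e * ρ u * hxy - x * ρ q * ρ f * this
  exact (Ideal.IsPrime.mem_or_mem ‹_› h₁).resolve_left hq

/-- The two equations of the diagonal are the equations of the graph times the spurious factors `∏_G
z` and `∏_H z`. A prime of the locus contains at most one `z i`: if it contains one spurious factor,
then it contains neither the other one nor the cofactor needed to recover the lost equation from the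
remaining one. -/
theorem EssEtale.isCenter_diagonal [IsDomain R] [Fintype ι] (hz : IsPrimeFamily z) {u v : R}
    {E F G H Q Q' : Finset ι}
    {h : x * y = ρ ((∏ i ∈ Q, z i) * ∏ i ∈ Q', z i)}
    (hE : EssEtale (Node.lift ρ x y h))
    (hEF : Disjoint E F) (hGH : Disjoint G H)
    (hQE : Disjoint Q (E ∪ F)) (hQE' : Disjoint Q' (E ∪ F))
    (hG : Disjoint G (E ∪ Q')) (hH : Disjoint H (F ∪ Q))
    (huv : u * v = 1) {I : Ideal A}
    (hx₀ : x₀ = x * ρ ((∏ i ∈ G, z i) * ∏ i ∈ F, z i))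
    (hy₀ : y₀ = y * ρ ((∏ i ∈ E, z i) * ∏ i ∈ H, z i))
    (hI : ∀ a, a ∈ I ↔ ∀ P : Ideal A, P.IsPrime → MemDiagonal ρ z x₀ y₀
      (u * ((∏ i ∈ Q, z i) * (∏ i ∈ G, z i) * ∏ i ∈ E, z i))
      (v * ((∏ i ∈ Q', z i) * (∏ i ∈ F, z i) * ∏ i ∈ H, z i)) P → a ∈ P) :
    I = Ideal.span {ρ (∏ i ∈ F, z i) * x - ρ (u * (∏ i ∈ Q, z i) * ∏ i ∈ E, z i),
      ρ (∏ i ∈ E, z i) * y - ρ (v * (∏ i ∈ Q', z i) * ∏ i ∈ F, z i)} := by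
  have e₁ : x₀ - ρ (u * ((∏ i ∈ Q, z i) * (∏ i ∈ G, z i) * ∏ i ∈ E, z i)) =
      ρ (∏ i ∈ G, z i) * (ρ (∏ i ∈ F, z i) * x - ρ (u * (∏ i ∈ Q, z i) * ∏ i ∈ E, z i)) := by
    rw [hx₀]; simp only [map_mul]; ring
  have e₂ : y₀ - ρ (v * ((∏ i ∈ Q', z i) * (∏ i ∈ F, z i) * ∏ i ∈ H, z i)) =
      ρ (∏ i ∈ H, z i) * (ρ (∏ i ∈ E, z i) * y - ρ (v * (∏ i ∈ Q', z i) * ∏ i ∈ F, z i)) := by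
    rw [hy₀]; simp only [map_mul]; ring
  have hnot : ∀ {P : Ideal A} [P.IsPrime] {G₁ G₂ : Finset ι}, Disjoint G₁ G₂ →
      (∀ i j, i ≠ j → ρ (z i) ∉ P ∨ ρ (z j) ∉ P) → ρ (∏ i ∈ G₁, z i) ∈ P →
      ρ (∏ i ∈ G₂, z i) ∉ P := by
    intro P _ G₁ G₂ hdis hP h₁ h₂
    rw [map_prod, Ideal.IsPrime.prod_mem_iff] at h₁ h₂
    obtain ⟨i, hi, hi'⟩ := h₁
    obtain ⟨j, hj, hj'⟩ := h₂
    exact (hP i j (by rintro rfl; exact Finset.disjoint_left.mp hdis hi hj)).elim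
      (· hi') (· hj')
  refine le_antisymm (fun a ha => ?_) (Ideal.span_le.mpr ?_)
  · refine hE.mem_graphIdeal_iff hz hEF (fun i hi => hz.not_dvd_prod
      (Finset.disjoint_right.mp hQE hi)) (fun i hi => hz.not_dvd_prod
      (Finset.disjoint_right.mp hQE' hi)) huv fun P hP hzP h₁ h₂ => (hI a).mp ha P hP ⟨?_, ?_, ?_⟩
    · rw [e₁]; exact P.mul_mem_left _ h₁
    · rw [e₂]; exact P.mul_mem_left _ h₂
    · exact fun i _ _ => .inl (hzP i)
  · rintro _ (rfl | rfl)
    · refine (hI _).mpr fun P hP ⟨h₁, h₂, h₃⟩ => ?_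
      rw [e₁] at h₁
      refine (hP.mem_or_mem h₁).elim (fun hG' => ?_) id
      rw [e₂] at h₂
      have hH' := (hP.mem_or_mem h₂).resolve_left (hnot hGH h₃ hG')
      exact sub_mem_of_sub_mem huv h hH'
        (hnot (hG.mono_right Finset.subset_union_right) h₃ hG')
    · refine (hI _).mpr fun P hP ⟨h₁, h₂, h₃⟩ => ?_
      rw [e₂] at h₂
      refine (hP.mem_or_mem h₂).elim (fun hG' => ?_) id
      rw [e₁] at h₁
      have hH' := (hP.mem_or_mem h₁).resolve_left (hnot hGH.symm h₃ hG')
      exact sub_mem_of_sub_mem ((mul_comm v u).trans huv)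
        ((mul_comm y x).trans (h.trans (congrArg ρ (mul_comm _ _)))) hH'
        (hnot (hH.mono_right Finset.subset_union_right) h₃ hG')

/-- Intersecting `S`, `M`, `N` with `T₀` and its complement and cancelling common factors leaves the
graph `x = u p e / f`, `y = v q f / e` with `p = ∏_{S ∩ T₀} z`, `q = ∏_{S \ T₀} z`, `e = ∏_{N ∩ T₀}
z`, `f = ∏_{M \ T₀} z`. The quotient of its two equations is `x / q` up to a unit. -/
theorem State.exists_isCenter_diagonal [IsDomain R] [Fintype ι] (hz : IsPrimeFamily z)
    (h : State ρ z x₀ y₀ S M N x y) (T₀ : Finset ι) {u v : R} (huv : u * v = 1) {I : Ideal A}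
    (hI : ∀ a, a ∈ I ↔ ∀ P : Ideal A, P.IsPrime → MemDiagonal ρ z x₀ y₀ (u * ∏ i ∈ T₀, z i)
      (v * ∏ i ∈ T₀ᶜ, z i) P → a ∈ P) :
    ∃ c₁ c₂, IsCenter ρ z S x y I (S \ T₀) c₁ c₂ := by
  have hS : ∏ i ∈ S, z i = (∏ i ∈ S ∩ T₀, z i) * ∏ i ∈ S \ T₀, z i :=
    (Finset.prod_inter_mul_prod_sdiff ..).symm
  have hM : ∏ i ∈ M, z i = (∏ i ∈ M ∩ T₀, z i) * ∏ i ∈ M \ T₀, z i :=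
    (Finset.prod_inter_mul_prod_sdiff ..).symm
  have hN : ∏ i ∈ N, z i = (∏ i ∈ N ∩ T₀, z i) * ∏ i ∈ N \ T₀, z i :=
    (Finset.prod_inter_mul_prod_sdiff ..).symm
  have huniv : S ∪ M ∪ N = Finset.univ := by ext i; simpa [or_assoc] using h.cover i
  have hprod (G : Finset ι) : ∏ i ∈ G, z i = (∏ i ∈ S ∩ G, z i) * (∏ i ∈ M ∩ G, z i) *
      ∏ i ∈ N ∩ G, z i := by
    rw [← Finset.prod_union, ← Finset.prod_union, ← Finset.union_inter_distrib_right,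
      ← Finset.union_inter_distrib_right, huniv, Finset.univ_inter]
    · rw [← Finset.union_inter_distrib_right]
      exact (Finset.disjoint_union_left.mpr ⟨h.disjoint_S_N, h.disjoint_M_N⟩).mono
        Finset.inter_subset_left Finset.inter_subset_left
    · exact h.disjoint_S_M.mono Finset.inter_subset_left Finset.inter_subset_left
  have hT₀ := hprod T₀
  have hT₁ := hprod T₀ᶜ
  simp only [← Finset.sdiff_eq_inter_compl] at hT₁
  rw [hT₀, hT₁] at hI
  have hxy := h.mul_eq
  have hx₀ := h.x₀_eq
  have hy₀ := h.y₀_eq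
  have hE := Node.essEtale_lift_congr h.essEtale hS
  rw [hM] at hx₀
  rw [hN] at hy₀
  have hdiff : ∀ {G H : Finset ι}, Disjoint (G ∩ T₀) (H \ T₀) := fun {G H} =>
    (Finset.sdiff_disjoint.mono_right Finset.inter_subset_right).symm
  have hSM : ∀ {G H : Finset ι}, Disjoint (S ∩ G) (M ∩ H) := fun {G H} =>
    h.disjoint_S_M.mono Finset.inter_subset_left Finset.inter_subset_left
  have hinter : ∀ {G H : Finset ι}, Disjoint G H → Disjoint (G ∩ T₀) (H ∩ T₀) := fun {G H} h =>
    h.mono Finset.inter_subset_left Finset.inter_subset_left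
  have hsdiff : ∀ {G H : Finset ι}, Disjoint G H → Disjoint (G \ T₀) (H \ T₀) := fun {G H} h =>
    h.mono Finset.sdiff_subset Finset.sdiff_subset
  have hI' := hE.isCenter_diagonal hz (E := N ∩ T₀) (F := M \ T₀) (G := M ∩ T₀) (H := N \ T₀) hdiff hdiff
    (Finset.disjoint_union_right.mpr ⟨hinter h.disjoint_S_N, hdiff⟩)
    (Finset.disjoint_union_right.mpr ⟨hdiff.symm, hsdiff h.disjoint_S_M⟩)
    (Finset.disjoint_union_right.mpr ⟨hinter h.disjoint_M_N, hdiff⟩)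
    (Finset.disjoint_union_right.mpr ⟨hsdiff h.disjoint_M_N.symm, hdiff.symm⟩)
    huv hx₀ hy₀ hI
  have huv' : ρ u * ρ v = 1 := by rw [← map_mul, huv, map_one]
  have hpq : (∏ i ∈ S ∩ T₀, z i) * ∏ i ∈ S \ T₀, z i ≠ 0 :=
    mul_ne_zero (hz.prod_ne_zero _) (hz.prod_ne_zero _)
  have hr₁ := hE.node_regular hpq (Node.mul_x_sub_ne_zero (f := ∏ i ∈ M \ T₀, z i)
    (g := u * (∏ i ∈ S ∩ T₀, z i) * ∏ i ∈ N ∩ T₀, z i) (hz.prod_ne_zero _))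
  have hr₂ := hE.node_regular hpq (Node.mul_y_sub_ne_zero (f := ∏ i ∈ N ∩ T₀, z i)
    (g := v * (∏ i ∈ S \ T₀, z i) * ∏ i ∈ M \ T₀, z i) (hz.prod_ne_zero _))
  simp only [map_sub, map_mul, Node.lift_x, Node.lift_y, Node.lift_algebraMap] at hr₁ hr₂
  rw [hS] at hxy
  simp only [map_mul] at hI' hxy
  set p := ρ (∏ i ∈ S ∩ T₀, z i) with hp
  set q := ρ (∏ i ∈ S \ T₀, z i)
  set e := ρ (∏ i ∈ N ∩ T₀, z i)
  set f := ρ (∏ i ∈ M \ T₀, z i)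
  -- The factor `-u` makes the ratio of the generators equal to `x / q` exactly.
  refine ⟨f * x - ρ u * p * e, - ρ u * (e * y - ρ v * q * f), Finset.sdiff_subset, ?_, ?_, ?_,
    hr₁, ?_⟩
  · rw [hI', Ideal.span_insert, Ideal.span_insert, Ideal.span_singleton_mul_left_unit
      (IsUnit.of_mul_eq_one (-ρ v) (by rw [neg_mul_neg, huv']))]
  · rw [sdiff_sdiff_right_self, Finset.inf_eq_inter, ← hp]
    linear_combination f * hxy - p * q * f * huv'
  · linear_combination (- ρ u * e) * hxy + x * q * f * huv'
  · intro a ha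
    refine hr₂ a ?_
    linear_combination -ρ v * ha - (e * y - ρ v * q * f) * a * huv'

end NodalResolution

namespace NodalResolution

/-! ## Regular local rings and regular systems of parameters -/

section Regular

open IsLocalRing

variable {R : Type u} [CommRing R] [IsLocalRing R]

theorem isLocalRing_quotient_span_singleton {x : R} (hx : x ∈ maximalIdeal R) :
    IsLocalRing (R ⧸ Ideal.span {x}) := by
  have : Nontrivial (R ⧸ Ideal.span {x}) := Ideal.Quotient.nontrivial_iff.mpr fun h =>
    (maximalIdeal.isMaximal R).ne_top (top_le_iff.mp (h ▸ (Ideal.span_singleton_le_iff_mem _).mpr hx))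
  exact .of_surjective' (Ideal.Quotient.mk (Ideal.span {x})) Ideal.Quotient.mk_surjective

/-- Outside `m ^ 2` some coefficient of `x` in terms of the generators is a unit, and `x` can be
exchanged for that generator. -/
theorem exists_mem_span_insert_erase [DecidableEq R] {s : Finset R}
    (hs : maximalIdeal R = Ideal.span (s : Set R))
    {x : R} (hx : x ∈ maximalIdeal R) (hx2 : x ∉ maximalIdeal R ^ 2) :
    ∃ s' : Finset R, s'.card ≤ s.card ∧ x ∈ s' ∧ maximalIdeal R = Ideal.span (s' : Set R) := by
  rw [hs] at hx
  obtain ⟨c, -, hc⟩ := Submodule.mem_span_finset.mp hx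
  obtain ⟨y, hy, hcy⟩ : ∃ y ∈ s, IsUnit (c y) := by
    by_contra! h
    refine hx2 (hc ▸ Ideal.sum_mem _ fun y hy => ?_)
    rw [pow_two]
    exact Ideal.mul_mem_mul ((mem_maximalIdeal _).mpr (h y hy)) (hs ▸ Ideal.subset_span hy)
  refine ⟨insert x (s.erase y), ?_, Finset.mem_insert_self _ _, ?_⟩
  · have := Finset.card_insert_le x (s.erase y)
    have := Finset.card_erase_add_one hy
    omega
  · rw [hs]
    refine le_antisymm (Ideal.span_le.mpr fun a ha => ?_) (Ideal.span_le.mpr fun a ha => ?_)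
    · by_cases hay : a = y
      · subst hay
        refine (Ideal.unit_mul_mem_iff_mem _ hcy).mp ?_
        rw [← Finset.add_sum_erase s _ hy] at hc
        have : c a * a = x - ∑ b ∈ s.erase a, c b * b := by
          rw [← hc]; simp
        rw [this]
        refine sub_mem (Ideal.subset_span (by simp)) (Ideal.sum_mem _ fun b hb =>
          Ideal.mul_mem_left _ _ (Ideal.subset_span (by simp at hb; simp [hb])))
      · exact Ideal.subset_span (by simp at ha; simp [ha, hay])
    · simp only [Finset.coe_insert, Finset.coe_erase, Set.mem_insert_iff, Set.mem_sdiff] at ha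
      rcases ha with rfl | ha
      · exact hx
      · exact Ideal.subset_span ha.1

variable [IsNoetherianRing R]

theorem ringKrullDim_le_card {s : Finset R} (hs : maximalIdeal R = Ideal.span (s : Set R)) :
    ringKrullDim R ≤ s.card := by
  refine (ringKrullDim_le_spanFinrank_maximalIdeal R).trans ?_
  have : (Ideal.span (s : Set R)).spanFinrank ≤ (s : Set R).ncard :=
    Submodule.spanFinrank_span_le_ncard_of_finite s.finite_toSet
  rw [Set.ncard_coe_finset] at this
  rw [hs]
  exact_mod_cast this

theorem isRegularLocalRing_of_card_le {s : Finset R}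
    (hs : maximalIdeal R = Ideal.span (s : Set R)) (hd : (s.card : WithBot ℕ∞) ≤ ringKrullDim R) :
    IsRegularLocalRing R := by
  refine .of_spanFinrank_maximalIdeal_le R (le_trans ?_ hd)
  have : (Ideal.span (s : Set R)).spanFinrank ≤ (s : Set R).ncard :=
    Submodule.spanFinrank_span_le_ncard_of_finite s.finite_toSet
  rw [Set.ncard_coe_finset] at this
  rw [hs]
  exact_mod_cast this

/-- Dividing by one of the generators removes it, while the dimension drops by at most one; so
quotients by parameters stay regular. -/
theorem exists_finset_quotient [DecidableEq R] {s : Finset R}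
    (hs : maximalIdeal R = Ideal.span (s : Set R))
    (hd : (s.card : WithBot ℕ∞) ≤ ringKrullDim R) {x : R} (hx : x ∈ s)
    [IsLocalRing (R ⧸ Ideal.span {x})] :
    ∃ s' : Finset (R ⧸ Ideal.span {x}), s'.card + 1 ≤ s.card ∧
      maximalIdeal (R ⧸ Ideal.span {x}) = Ideal.span (s' : Set (R ⧸ Ideal.span {x})) ∧
      (s'.card : WithBot ℕ∞) ≤ ringKrullDim (R ⧸ Ideal.span {x}) := by
  classical
  have hcard : ((s.erase x).image (Ideal.Quotient.mk (Ideal.span {x}))).card + 1 ≤ s.card := by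
    have := Finset.card_image_le (s := s.erase x) (f := Ideal.Quotient.mk (Ideal.span {x}))
    have h' := Finset.card_erase_add_one hx
    omega
  refine ⟨(s.erase x).image (Ideal.Quotient.mk _), hcard, ?_, ?_⟩
  · have h₁ : maximalIdeal (R ⧸ Ideal.span {x}) =
        (maximalIdeal R).map (Ideal.Quotient.mk (Ideal.span {x})) :=
      (map_maximalIdeal_of_surjective _ Ideal.Quotient.mk_surjective).symm
    rw [h₁, hs, Ideal.map_span]
    refine le_antisymm (Ideal.span_le.mpr ?_) (Ideal.span_mono ?_)
    · rintro _ ⟨y, hy, rfl⟩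
      by_cases hyx : y = x
      · rw [hyx, Ideal.Quotient.eq_zero_iff_mem.mpr (Ideal.mem_span_singleton_self x)]
        exact zero_mem _
      · exact Ideal.subset_span (by simpa using ⟨y, ⟨hy, hyx⟩, rfl⟩)
    · intro y
      simp only [Finset.coe_image, Set.mem_image]
      rintro ⟨a, ha, rfl⟩
      exact ⟨a, Finset.mem_of_mem_erase ha, rfl⟩
  · have hxm : x ∈ maximalIdeal R := hs ▸ Ideal.subset_span hx
    have h₁ : ringKrullDim R ≤ ringKrullDim (R ⧸ Ideal.span {x}) + 1 := by
      rw [← maximalIdeal_height_eq_ringKrullDim]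
      exact Ideal.height_le_ringKrullDim_quotient_add_one hxm
    have h₂ := hd.trans h₁
    have h₃ : ((((s.erase x).image (Ideal.Quotient.mk (Ideal.span {x}))).card + 1 : ℕ) :
        WithBot ℕ∞) ≤ ringKrullDim (R ⧸ Ideal.span {x}) + 1 :=
      le_trans (by exact_mod_cast hcard) h₂
    push_cast at h₃
    exact (ENat.WithBot.add_le_add_one_right_iff).mp h₃

/-- Choose `x` outside `m ^ 2` and outside all minimal primes. By induction `R / x` is a domain, so
`(x)` is prime and contains a minimal prime `p`. As `x ∉ p`, one gets `p = x p`, and Nakayama gives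
`p = 0`. -/
theorem isDomain_of_card_le {s : Finset R} (hs : maximalIdeal R = Ideal.span (s : Set R))
    (hd : (s.card : WithBot ℕ∞) ≤ ringKrullDim R) : IsDomain R := by
  classical
  induction hn : s.card using Nat.strong_induction_on generalizing R with
  | _ n ih =>
  by_cases hm : maximalIdeal R = ⊥
  · exact (isField_iff_maximalIdeal_eq.mpr hm).isDomain
  have hm2 : ¬ maximalIdeal R ≤ maximalIdeal R ^ 2 := by
    intro h
    apply hm
    refine Submodule.eq_bot_of_le_smul_of_le_jacobson_bot (maximalIdeal R) _
      (IsNoetherian.noetherian _) ?_ (maximalIdeal_le_jacobson _)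
    rwa [smul_eq_mul, ← pow_two]
  have hdim : ringKrullDim R ≠ 0 := by
    intro h0
    apply hm
    have h' : s.card = 0 := by
      rw [h0] at hd
      exact_mod_cast Nat.le_zero.mp (by exact_mod_cast hd)
    rw [hs, Finset.card_eq_zero.mp h']
    simp
  obtain ⟨x, hx, hx2, hxp⟩ : ∃ x ∈ maximalIdeal R, x ∉ maximalIdeal R ^ 2 ∧
      ∀ p ∈ minimalPrimes R, x ∉ p := by
    have hfin := minimalPrimes.finite_of_isNoetherianRing R
    by_contra! hc
    -- Prime avoidance; `m ^ 2` is the one member of the covering that need not be prime.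
    have hsub : (maximalIdeal R : Set R) ⊆
        ⋃ i ∈ (insert (maximalIdeal R ^ 2) hfin.toFinset : Finset (Ideal R)), (i : Set R) := by
      intro x hx
      by_cases hx2 : x ∈ maximalIdeal R ^ 2
      · exact Set.mem_biUnion (by simp) hx2
      · obtain ⟨p, hp, hxp⟩ := hc x hx hx2
        exact Set.mem_biUnion (x := p) (by simp [hp]) hxp
    obtain ⟨p, hp, hle⟩ := (Ideal.subset_union_prime (maximalIdeal R ^ 2) (maximalIdeal R ^ 2)
      (by
        intro i hi h1 h2
        simp only [Finset.mem_insert, Set.Finite.mem_toFinset] at hi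
        exact (hi.resolve_left h1).1.1)).mp hsub
    simp only [Finset.mem_insert, Set.Finite.mem_toFinset] at hp
    rcases hp with rfl | hp
    · exact hm2 hle
    · have := hp.1.1
      have hpm : p = maximalIdeal R := le_antisymm (le_maximalIdeal hp.1.1.ne_top) hle
      apply hdim
      rw [← maximalIdeal_height_eq_ringKrullDim, ← hpm]
      have : p.height = 0 := Ideal.height_eq_zero_iff.mpr hp
      rw [this]
      rfl
  obtain ⟨s', hs'card, hxs', hs'⟩ := exists_mem_span_insert_erase hs hx hx2
  have := isLocalRing_quotient_span_singleton hx
  obtain ⟨s'', hs''card, hs'', hd''⟩ := exists_finset_quotient hs'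
    (le_trans (by exact_mod_cast hs'card) hd) hxs'
  have hdom : IsDomain (R ⧸ Ideal.span {x}) := ih s''.card (by omega) hs'' hd'' rfl
  have hprime : (Ideal.span {x}).IsPrime := (Ideal.Quotient.isDomain_iff_prime _).mp hdom
  obtain ⟨p, hp, hpx⟩ := Ideal.exists_minimalPrimes_le (I := ⊥) (J := Ideal.span {x}) bot_le
  have := hp.1.1
  have hpbot : p = ⊥ := by
    refine Submodule.eq_bot_of_le_smul_of_le_jacobson_bot (maximalIdeal R) _
      (IsNoetherian.noetherian _) ?_ (maximalIdeal_le_jacobson _)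
    intro a ha
    obtain ⟨b, rfl⟩ := Ideal.mem_span_singleton.mp (hpx ha)
    have hb : b ∈ p := (hp.1.1.mem_or_mem ha).resolve_left (hxp p hp)
    exact Submodule.smul_mem_smul hx hb
  have : (⊥ : Ideal R).IsPrime := hpbot ▸ hp.1.1
  exact IsDomain.of_bot_isPrime R

/-- The quotient by a parameter is again regular, hence a domain. The parameter is nonzero, for
otherwise it could be dropped and too few generators would remain for the dimension. -/
theorem prime_of_mem_of_card_le {s : Finset R} (hs : maximalIdeal R = Ideal.span (s : Set R))
    (hd : (s.card : WithBot ℕ∞) ≤ ringKrullDim R) {x : R} (hx : x ∈ s) : Prime x := by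
  classical
  have hx' : x ∈ maximalIdeal R := hs ▸ Ideal.subset_span hx
  have := isLocalRing_quotient_span_singleton hx'
  obtain ⟨s', hs'card, hs', hd'⟩ := exists_finset_quotient hs hd hx
  have := isDomain_of_card_le hs' hd'
  have hprime : (Ideal.span {x}).IsPrime := (Ideal.Quotient.isDomain_iff_prime _).mp this
  refine (Ideal.span_singleton_prime ?_).mp hprime
  rintro rfl
  have h1 : maximalIdeal R = Ideal.span ((s.erase 0 : Finset R) : Set R) := by
    rw [hs, Finset.coe_erase]
    exact (Submodule.span_sdiff_singleton_zero).symm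
  have h2 := hd.trans (ringKrullDim_le_card h1)
  have h3 := Finset.card_erase_add_one hx
  have h4 : s.card ≤ (s.erase 0).card := by exact_mod_cast h2
  omega

theorem not_dvd_of_mem_of_card_le {s : Finset R} (hs : maximalIdeal R = Ideal.span (s : Set R))
    (hd : (s.card : WithBot ℕ∞) ≤ ringKrullDim R) {x y : R} (hx : x ∈ s) (hy : y ∈ s)
    (hxy : x ≠ y) : ¬ x ∣ y := by
  classical
  rintro ⟨c, rfl⟩
  have h1 : maximalIdeal R = Ideal.span ((s.erase (x * c) : Finset R) : Set R) := by
    rw [hs]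
    refine le_antisymm (Ideal.span_le.mpr fun a ha => ?_) (Ideal.span_mono (by simp))
    by_cases hac : a = x * c
    · rw [hac]
      exact Ideal.mul_mem_right _ _ (Ideal.subset_span (by simp [hxy]; exact hx))
    · exact Ideal.subset_span (by simp [hac]; exact ha)
  have h2 := hd.trans (ringKrullDim_le_card h1)
  have h3 := Finset.card_erase_add_one hy
  have h4 : s.card ≤ (s.erase (x * c)).card := by exact_mod_cast h2
  omega

theorem exists_finset_of_isRegularLocalRing (R : Type u) [CommRing R] [IsRegularLocalRing R] :
    ∃ s : Finset R, maximalIdeal R = Ideal.span (s : Set R) ∧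
      (s.card : WithBot ℕ∞) ≤ ringKrullDim R := by
  classical
  obtain ⟨s, hs, hs'⟩ := Submodule.FG.exists_span_finset_card_eq_spanFinrank
    (maximalIdeal R).fg_of_isNoetherianRing
  exact ⟨s, hs'.symm, by rw [← IsRegularLocalRing.spanFinrank_maximalIdeal, hs]⟩

theorem isDomain_of_isRegularLocalRing (R : Type u) [CommRing R] [IsRegularLocalRing R] :
    IsDomain R := by
  obtain ⟨s, hs, hd⟩ := exists_finset_of_isRegularLocalRing R
  exact isDomain_of_card_le hs hd

end Regular

end NodalResolution

/-! ### Families of parameters, and dimension along essentially étale maps. -/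

namespace NodalResolution

open IsLocalRing

/-- The nonunits among the `z i` are distinct members of a regular system of parameters. -/
def IsParameterFamily {ι : Type*} {R : Type u} [CommRing R] [IsLocalRing R] (z : ι → R) : Prop :=
  ∃ (G : Finset ι) (F : Finset R), (∀ i, i ∈ G ↔ ¬ IsUnit (z i)) ∧
    maximalIdeal R = Ideal.span (z '' G ∪ F) ∧
    ((G.card + F.card : ℕ) : WithBot ℕ∞) ≤ ringKrullDim R

section

variable {ι : Type*} {R : Type u} [CommRing R] [IsLocalRing R] [IsNoetherianRing R] {z : ι → R}

/-- The maximal ideal needs at least `dim R` generators, so the listed ones cannot coincide and the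
nonunits of the family are distinct. -/
theorem IsParameterFamily.exists_finset (hz : IsParameterFamily z) :
    ∃ s : Finset R, maximalIdeal R = Ideal.span (s : Set R) ∧
      (s.card : WithBot ℕ∞) ≤ ringKrullDim R ∧ (∀ i, ¬ IsUnit (z i) → z i ∈ s) ∧
      ∀ i j, ¬ IsUnit (z i) → ¬ IsUnit (z j) → z i = z j → i = j := by
  classical
  obtain ⟨G, F, hG, hs, hd⟩ := hz
  have hs' : maximalIdeal R = Ideal.span ((G.image z ∪ F : Finset R) : Set R) := by
    rw [hs]; push_cast; rfl
  have h₁ : (G.image z ∪ F).card ≤ (G.image z).card + F.card := Finset.card_union_le _ _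
  have h₂ : (G.image z).card ≤ G.card := Finset.card_image_le
  have h₃ : G.card + F.card ≤ (G.image z ∪ F).card := by
    exact_mod_cast hd.trans (ringKrullDim_le_card hs')
  have hinj := Finset.card_image_iff.mp (show (G.image z).card = G.card by omega)
  refine ⟨_, hs', le_trans (by exact_mod_cast h₁.trans (Nat.add_le_add_right h₂ _)) hd,
    fun i hi => ?_, fun i j hi hj hij => hinj ((hG i).mpr hi) ((hG j).mpr hj) hij⟩
  exact Finset.mem_union_left _ (Finset.mem_image_of_mem _ ((hG i).mpr hi))

theorem IsParameterFamily.isRegularLocalRing (hz : IsParameterFamily z) :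
    IsRegularLocalRing R := by
  obtain ⟨s, hs, hd, -⟩ := hz.exists_finset
  exact isRegularLocalRing_of_card_le hs hd

theorem IsParameterFamily.isDomain (hz : IsParameterFamily z) : IsDomain R := by
  obtain ⟨s, hs, hd, -⟩ := hz.exists_finset
  exact isDomain_of_card_le hs hd

theorem IsParameterFamily.isPrimeFamily (hz : IsParameterFamily z) : IsPrimeFamily z := by
  obtain ⟨s, hs, hd, hzs, hinj⟩ := hz.exists_finset
  refine ⟨fun i => or_iff_not_imp_left.mpr fun hi => prime_of_mem_of_card_le hs hd (hzs i hi),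
    fun i j hij hi hdvd => ?_⟩
  by_cases hj : IsUnit (z j)
  · exact hi (isUnit_of_dvd_unit hdvd hj)
  · exact not_dvd_of_mem_of_card_le hs hd (hzs i hi) (hzs j hj)
      (fun h => hij (hinj i j hi hj h)) hdvd

end

section

variable {R D A : Type u} [CommRing R] [CommRing D] [CommRing A]

/-- After localizing below at the contracted prime, this is the behaviour of the maximal ideal under
an unramified local homomorphism. -/
theorem EssEtale.map_comap_maximalIdeal [IsLocalRing A] {φ : D →+* A} (hφ : EssEtale φ) :
    ((maximalIdeal A).comap φ).map φ = maximalIdeal A := by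
  algebraize [φ]
  set p := (maximalIdeal A).comap φ
  have hp : ∀ m : p.primeCompl, IsUnit (φ m) := fun m => by
    have := m.2
    simpa [p, Ideal.primeCompl] using! this
  let ψ : Localization.AtPrime p →+* A := IsLocalization.lift hp
  have hψ : ψ.comp (algebraMap D (Localization.AtPrime p)) = φ := IsLocalization.lift_comp hp
  algebraize [ψ]
  have : IsScalarTower D (Localization.AtPrime p) A := .of_algebraMap_eq' hψ.symm
  obtain ⟨_, _, _⟩ := essEtale_algebraMap.mp (EssEtale.of_comp_isLocalization
    (B := Localization.AtPrime p) p.primeCompl (show EssEtale (algebraMap D A) from hφ))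
  have : IsLocalHom (algebraMap (Localization.AtPrime p) A) := by
    refine ((local_hom_TFAE (algebraMap (Localization.AtPrime p) A)).out 0 2).mpr ?_
    rw [← Localization.AtPrime.map_eq_maximalIdeal, Ideal.map_map]
    change p.map (ψ.comp (algebraMap D _)) ≤ _
    rw [hψ]
    exact Ideal.map_comap_le
  have h := Algebra.FormallyUnramified.map_maximalIdeal (R := Localization.AtPrime p) (S := A)
  rw [← Localization.AtPrime.map_eq_maximalIdeal, Ideal.map_map] at h
  change p.map (ψ.comp (algebraMap D _)) = _ at h
  rwa [hψ] at h

variable [IsLocalRing R] [IsLocalRing A] [IsNoetherianRing A]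

theorem ringKrullDim_le_of_flat [IsNoetherianRing R] {ρ : R →+* A} [hloc : IsLocalHom ρ]
    (hρ : ρ.Flat) :
    ringKrullDim R ≤ ringKrullDim A := by
  algebraize [ρ]
  have := ((local_hom_TFAE (algebraMap R A)).out 0 4).mp hloc
  have : (maximalIdeal A).LiesOver (maximalIdeal R) := ⟨this.symm⟩
  have h := Ideal.height_eq_height_add_of_liesOver_of_hasGoingDown (maximalIdeal R) (maximalIdeal A)
  rw [← maximalIdeal_height_eq_ringKrullDim, ← maximalIdeal_height_eq_ringKrullDim, h]
  exact WithBot.coe_le_coe.mpr le_self_add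

/-- If a flat local homomorphism factors through a flat homomorphism from a ring in which there is a
prime lying over the maximal ideal and strictly below the contraction of the maximal ideal, then
the dimension increases. -/
theorem ringKrullDim_add_one_le_of_flat [IsNoetherianRing R] {ρ : R →+* A} [IsLocalHom ρ]
    (hρ : ρ.Flat) {α : R →+* D} {φ : D →+* A} (hφ : φ.Flat) (hαφ : φ.comp α = ρ) {q : Ideal D}
    [q.IsPrime] (hq : q.comap α = maximalIdeal R) (hlt : q < (maximalIdeal A).comap φ) :
    ringKrullDim R + 1 ≤ ringKrullDim A := by
  subst hαφ
  algebraize [φ, α, φ.comp α]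
  have : (maximalIdeal A).LiesOver ((maximalIdeal A).comap φ) := ⟨rfl⟩
  obtain ⟨Q, hQ, _, ⟨hQq⟩⟩ := Ideal.exists_ideal_lt_liesOver_of_lt (R := D) (maximalIdeal A) hlt
  have : Q.LiesOver (maximalIdeal R) := ⟨by
    rw [← hq, hQq]
    rfl⟩
  have h := Ideal.height_eq_height_add_of_liesOver_of_hasGoingDown (maximalIdeal R) Q
  rw [← maximalIdeal_height_eq_ringKrullDim, ← maximalIdeal_height_eq_ringKrullDim]
  have h' := Ideal.height_add_one_le_of_lt_of_isPrime hQ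
  have h'' : (maximalIdeal R).height + 1 ≤ (maximalIdeal A).height :=
    le_trans (by rw [h]; gcongr; exact le_self_add) h'
  exact_mod_cast h''

open Polynomial in
-- A prime of `R[X]` over the maximal ideal is either its extension or that extension plus one more
-- element. In the second case the extension is a smaller prime of the same fibre, so the dimension
-- pays for the extra generator.
theorem exists_maximalIdeal_eq_of_polynomial [IsNoetherianRing R] {ρ : R →+* A}
    [hloc : IsLocalHom ρ] {φ : R[X] →+* A} (hφ : EssEtale φ) (hC : φ.comp C = ρ) :
    ∃ g : Finset A, maximalIdeal A = (maximalIdeal R).map ρ ⊔ Ideal.span (g : Set A) ∧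
      ringKrullDim R + g.card ≤ ringKrullDim A := by
  have hρ : ρ.Flat := by
    rw [← hC]
    refine RingHom.Flat.comp ?_ hφ.flat
    exact RingHom.flat_algebraMap_iff.mpr (inferInstanceAs (Module.Flat R R[X]))
  have hmax := hφ.map_comap_maximalIdeal
  have hcomap : ((maximalIdeal A).comap φ).comap C = maximalIdeal R := by
    rw [Ideal.comap_comap, hC]
    exact ((local_hom_TFAE ρ).out 0 4).mp hloc
  by_cases heq : (maximalIdeal A).comap φ = (maximalIdeal R).map C
  · refine ⟨∅, ?_, by simpa using ringKrullDim_le_of_flat hρ⟩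
    rw [heq, Ideal.map_map, hC] at hmax
    simp [hmax]
  · have hm : (((maximalIdeal A).comap φ).comap C).IsMaximal := hcomap ▸ maximalIdeal.isMaximal R
    obtain ⟨f, -, hf⟩ := Polynomial.exists_monic_span_sup_map_eq R ((maximalIdeal A).comap φ) hm
      (by rwa [hcomap])
    rw [hcomap] at hf
    refine ⟨{φ f}, ?_, ?_⟩
    · rw [hf, Ideal.map_sup, Ideal.map_map, hC, Ideal.map_span] at hmax
      simp [← hmax]
    · have := (maximalIdeal.isMaximal R).isPrime
      have hprime : ((maximalIdeal R).map (C : R →+* R[X])).IsPrime := Ideal.isPrime_map_C_of_isPrime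
      have := ringKrullDim_add_one_le_of_flat hρ hφ.flat hC (q := (maximalIdeal R).map C)
        (by
          ext r
          rw [Ideal.mem_comap, Ideal.mem_map_C_iff]
          exact ⟨fun h => by simpa using h 0, fun h n => by
            rw [Polynomial.coeff_C]; split_ifs <;> simp [h]⟩)
        (lt_of_le_of_ne (by
          rw [Ideal.map_le_iff_le_comap, hcomap]) (Ne.symm heq))
      simpa using this

open Polynomial in
open scoped LaurentPolynomial in
open LaurentPolynomial in
-- Where `x` is invertible `y = s / x` is redundant, and the chart is simply étale over the affine
-- line.
theorem EssEtale.of_isUnit_x {R A : Type u} [CommRing R] [CommRing A] {ρ : R →+* A} {x y : A} {s : R}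
    {h : x * y = ρ s} (hE : EssEtale (Node.lift ρ x y h)) (hx : IsUnit x) :
    EssEtale (Polynomial.eval₂RingHom ρ x) := by
  let D := Localization.Away (Node.x R s)
  let δ : Node R s →+* D := algebraMap _ _
  let g : R[X] →+* D := Polynomial.eval₂RingHom (δ.comp (algebraMap R _)) (δ (Node.x R s))
  have hg : ∀ G : R[X], g G = δ (aeval (Node.x R s) G) := by
    intro G
    rw [Polynomial.aeval_def, Polynomial.hom_eval₂]
    rfl
  let := g.toAlgebra
  -- Inverting `x` in `R[x, y] / (x y - s)` gives the Laurent polynomials in `x`.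
  have hloc : IsLocalization.Away (X : R[X]) D := by
    refine Blowup.isLocalization_away_of g X ?_ ?_ ?_
    · rw [hg, aeval_X]
      exact IsLocalization.Away.algebraMap_isUnit _
    · intro d
      obtain ⟨⟨n, ⟨_, k, rfl⟩⟩, hn⟩ := IsLocalization.surj (Submonoid.powers (Node.x R s)) d
      obtain ⟨G, H, rfl⟩ := Node.exists_eq n
      have key : ∀ H : R[X], ∃ (m : ℕ) (H' : R[X]), Node.x R s ^ m * aeval (Node.y R s) H =
          aeval (Node.x R s) H' := by
        intro H
        induction H using Polynomial.induction_on' with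
        | add p q hp hq =>
          obtain ⟨m, p', hp⟩ := hp
          obtain ⟨n, q', hq⟩ := hq
          refine ⟨m + n, X ^ n * p' + X ^ m * q', ?_⟩
          simp only [map_add, map_mul, map_pow, aeval_X, ← hp, ← hq]
          ring
        | monomial n a =>
          refine ⟨n, C (s ^ n * a), ?_⟩
          rw [aeval_monomial, mul_left_comm, ← mul_pow, Node.x_mul_y, aeval_C, map_mul, map_pow,
            mul_comm]
      obtain ⟨m, H', hH⟩ := key H
      refine ⟨X ^ (m + 1) * G + Polynomial.C s * H', m + 1 + k, ?_⟩
      have hn' : d * δ (Node.x R s) ^ k = δ (aeval (Node.x R s) G + Node.y R s * aeval (Node.y R s) H) := by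
        rw [← map_pow]; exact hn
      rw [hg, hg, map_pow, aeval_X, pow_add, map_mul, mul_assoc, map_pow δ _ k, mul_comm _ d, hn',
        ← map_mul]
      congr 1
      simp only [map_add, map_mul, map_pow, aeval_X, aeval_C, ← hH, ← Node.x_mul_y]
      ring
    · intro G hG
      rw [hg] at hG
      obtain ⟨⟨_, k, rfl⟩, hk⟩ := (IsLocalization.map_eq_zero_iff
        (Submonoid.powers (Node.x R s)) D _).mp hG
      refine ⟨k, ?_⟩
      have h' := congrArg (Node.lift (s := s) (LaurentPolynomial.C : R →+* R[T;T⁻¹]) (T 1)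
        (LaurentPolynomial.C s * T (-1)) (by rw [mul_left_comm, ← T_add]; simp)) hk
      apply Polynomial.toLaurent_injective
      have h'' : ∀ G : R[X], Node.lift (s := s) (LaurentPolynomial.C : R →+* R[T;T⁻¹]) (T 1)
        (LaurentPolynomial.C s * T (-1)) (by rw [mul_left_comm, ← T_add]; simp)
          (aeval (Node.x R s) G) = toLaurent G := by
        intro G
        induction G using Polynomial.induction_on' with
        | add p q hp hq => simp only [map_add, hp, hq]
        | monomial n a => simp [T_pow, ← Polynomial.C_mul_X_pow_eq_monomial]
      rw [map_mul, h'', map_pow, Node.lift_x, map_zero] at h'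
      rw [map_mul, map_pow, toLaurent_X, map_zero, h']
  have hu : IsUnit (Node.lift ρ x y h (Node.x R s)) := by rwa [Node.lift_x]
  let θ : D →+* A := IsLocalization.Away.lift (Node.x R s) hu
  have hθ : θ.comp δ = Node.lift ρ x y h := IsLocalization.Away.lift_comp _ hu
  let := (Node.lift ρ x y h).toAlgebra
  let := θ.toAlgebra
  have : IsScalarTower (Node R s) D A := .of_algebraMap_eq' hθ.symm
  have hE' : EssEtale θ := EssEtale.of_comp_isLocalization (A := Node R s) (B := D)
    (Submonoid.powers (Node.x R s)) hE
  have hg' : EssEtale g := EssEtale.of_isLocalization (A := R[X]) (B := D) (Submonoid.powers X)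
  convert hg'.comp hE'
  refine Polynomial.ringHom_ext (fun a => ?_) ?_
  · have := congr($hθ (algebraMap R _ a))
    simp [g]
    simpa using this.symm
  · have := congr($hθ (Node.x R s))
    simp [g]
    simpa using this.symm

end

end NodalResolution

/-! ### Regularity of the charts in which at most one factor is left. -/

namespace NodalResolution

open IsLocalRing

section

variable {R A : Type u} [CommRing R] [CommRing A] [IsLocalRing R] [IsLocalRing A]
  {ρ : R →+* A} [hloc : IsLocalHom ρ]

open Polynomial in
-- The prime is that of the axis `x = 0` in the closed fibre. It lies strictly below the prime of
-- the origin, so the dimension of the chart exceeds that of the base.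
theorem Node.exists_prime_of_nonunit {x y : A} {s : R} {h : x * y = ρ s}
    (hx : x ∈ maximalIdeal A) (hy : y ∈ maximalIdeal A) :
    ∃ q : Ideal (Node R s), q.IsPrime ∧ q.comap (algebraMap R _) = maximalIdeal R ∧
      q < (maximalIdeal A).comap (Node.lift ρ x y h) ∧
      (maximalIdeal A).comap (Node.lift ρ x y h) =
        (maximalIdeal R).map (algebraMap R _) ⊔ Ideal.span {Node.x R s, Node.y R s} := by
  have hs : residue R s = 0 := by
    rw [residue_eq_zero_iff, mem_maximalIdeal, mem_nonunits_iff, ← isUnit_map_iff ρ, ← h]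
    exact fun hu => (mem_maximalIdeal _).mp hx (isUnit_of_mul_isUnit_left hu)
  have hρ : ∀ r, ρ r ∈ maximalIdeal A ↔ r ∈ maximalIdeal R := fun r => by
    rw [mem_maximalIdeal, mem_maximalIdeal, mem_nonunits_iff, mem_nonunits_iff, isUnit_map_iff ρ]
  let φ : Node R s →+* (ResidueField R)[X] := Node.lift (C.comp (residue R)) 0 X (by simp [hs])
  have hexp : ∀ f : Node R s, ∃ r, f - algebraMap R _ r ∈ Ideal.span {Node.x R s, Node.y R s} := by
    intro f
    induction f using Node.induction with
    | hC r => exact ⟨r, by simp⟩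
    | hx => exact ⟨0, Ideal.subset_span (by simp)⟩
    | hy => exact ⟨0, Ideal.subset_span (by simp)⟩
    | hadd f g hf hg =>
      obtain ⟨r, hf⟩ := hf
      obtain ⟨r', hg⟩ := hg
      refine ⟨r + r', ?_⟩
      rw [map_add, add_sub_add_comm]
      exact add_mem hf hg
    | hmul f g hf hg =>
      obtain ⟨r, hf⟩ := hf
      obtain ⟨r', hg⟩ := hg
      refine ⟨r * r', ?_⟩
      rw [map_mul, show f * g - algebraMap R _ r * algebraMap R _ r' =
        (f - algebraMap R _ r) * g + algebraMap R _ r * (g - algebraMap R _ r') by ring]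
      exact add_mem (Ideal.mul_mem_right _ _ hf) (Ideal.mul_mem_left _ _ hg)
  have hle : Ideal.span {Node.x R s, Node.y R s} ≤ (maximalIdeal A).comap (Node.lift ρ x y h) := by
    rw [Ideal.span_le]
    rintro _ (rfl | rfl)
    · simpa using! hx
    · simpa using! hy
  have heq : (maximalIdeal A).comap (Node.lift ρ x y h) =
        (maximalIdeal R).map (algebraMap R _) ⊔ Ideal.span {Node.x R s, Node.y R s} := by
    refine le_antisymm (fun f hf => ?_) (sup_le (Ideal.map_le_iff_le_comap.mpr fun r hr => ?_) hle)
    · obtain ⟨r, hr⟩ := hexp f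
      have h' : algebraMap R (Node R s) r ∈ (maximalIdeal A).comap (Node.lift ρ x y h) := by
        have := sub_mem hf (hle hr)
        rwa [sub_sub_cancel] at this
      rw [Ideal.mem_comap, Node.lift_algebraMap, hρ] at h'
      rw [← add_sub_cancel (algebraMap R (Node R s) r) f]
      exact Submodule.add_mem_sup (Ideal.mem_map_of_mem _ h') hr
    · rw [Ideal.mem_comap, Ideal.mem_comap, Node.lift_algebraMap, hρ]
      exact hr
  refine ⟨RingHom.ker φ, RingHom.ker_isPrime φ, ?_, lt_of_le_of_ne ?_ ?_, heq⟩
  · ext r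
    rw [Ideal.mem_comap, RingHom.mem_ker, Node.lift_algebraMap]
    simp [residue_eq_zero_iff]
  · intro f hf
    obtain ⟨r, hr⟩ := hexp f
    have h1 : ∀ g ∈ Ideal.span {Node.x R s, Node.y R s}, (φ g).coeff 0 = 0 := by
      intro g hg
      obtain ⟨a, b, rfl⟩ := Ideal.mem_span_pair.mp hg
      simp [φ]
    have h2 := h1 _ hr
    rw [map_sub, RingHom.mem_ker.mp hf, Node.lift_algebraMap] at h2
    simp only [zero_sub, coeff_neg, neg_eq_zero, RingHom.comp_apply, coeff_C_zero,
      residue_eq_zero_iff] at h2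
    rw [heq, ← add_sub_cancel (algebraMap R (Node R s) r) f]
    exact Submodule.add_mem_sup (Ideal.mem_map_of_mem _ h2) hr
  · intro h'
    have : Node.y R s ∈ RingHom.ker φ := by
      rw [h']
      exact hle (Ideal.subset_span (by simp))
    rw [RingHom.mem_ker, Node.lift_y] at this
    exact X_ne_zero this

end

section

open scoped Classical in
/-- The family of local equations on the resolution. -/
noncomputable def newFamily {ι : Type} {R A : Type u} [CommRing R] [CommRing A] (ρ : R →+* A)
    (z : ι → R) (S M : Finset ι) (x y : A) (i : ι) (c : Fin 2) : A :=
  if i ∈ S then (if c = 0 then x else y) else if i ∈ M then (if c = 0 then ρ (z i) else 1) else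
    (if c = 0 then 1 else ρ (z i))

variable {ι : Type} {R A : Type u} [CommRing R] [CommRing A]
  {ρ : R →+* A} {z : ι → R} {x₀ y₀ x y : A} {S M N : Finset ι}

theorem State.newFamily_mul (h : State ρ z x₀ y₀ S M N x y)
    (hS : ∀ i ∈ S, S = {i}) (i : ι) :
    newFamily ρ z S M x y i 0 * newFamily ρ z S M x y i 1 = ρ (z i) := by
  unfold newFamily
  split_ifs with h1 h2 <;> simp_all
  rw [h.mul_eq, hS i h1, Finset.prod_singleton]

theorem State.exists_x₀_eq [Fintype ι] (h : State ρ z x₀ y₀ S M N x y)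
    (hS : ∀ i ∈ S, S = {i}) : ∃ u, IsUnit u ∧ x₀ = u * ∏ i, newFamily ρ z S M x y i 0 := by
  classical
  have h₁ : ∀ i, newFamily ρ z S M x y i 0 = (if i ∈ S then x else 1) *
      (if i ∈ M then ρ (z i) else 1) := by
    intro i
    have : i ∈ S → i ∉ M := fun hi => Finset.disjoint_left.mp h.disjoint_S_M hi
    unfold newFamily
    split_ifs <;> simp_all
  simp only [h₁, Finset.prod_mul_distrib, Finset.prod_ite_mem, Finset.univ_inter]
  -- If `S` is empty then `x y = 1` and `x` is the unit; if `S = {i}` then `x` is itself a member of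
  -- the family.
  rcases S.eq_empty_or_nonempty with rfl | ⟨i, hi⟩
  · refine ⟨x, IsUnit.of_mul_eq_one y (by rw [h.mul_eq]; simp), ?_⟩
    rw [h.x₀_eq, map_prod]
    simp
  · refine ⟨1, isUnit_one, ?_⟩
    rw [h.x₀_eq, hS i hi, map_prod]
    simp

theorem State.exists_y₀_eq [Fintype ι] (h : State ρ z x₀ y₀ S M N x y)
    (hS : ∀ i ∈ S, S = {i}) : ∃ u, IsUnit u ∧ y₀ = u * ∏ i, newFamily ρ z S M x y i 1 := by
  obtain ⟨u, hu, h'⟩ := h.swap.exists_x₀_eq hS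
  refine ⟨u, hu, ?_⟩
  rw [h']
  congr 1
  refine Finset.prod_congr rfl fun i _ => ?_
  have h1 : i ∈ S → i ∉ M := fun hi => Finset.disjoint_left.mp h.disjoint_S_M hi
  have h2 : i ∈ S → i ∉ N := fun hi => Finset.disjoint_left.mp h.disjoint_S_N hi
  have h3 : i ∈ M → i ∉ N := fun hi => Finset.disjoint_left.mp h.disjoint_M_N hi
  have h4 := h.cover i
  unfold newFamily
  split_ifs <;> simp_all

variable [IsLocalRing R] [IsLocalRing A] [hloc : IsLocalHom ρ]

/-- Each `z i` corresponds to the only member of its pair that may be a nonunit, and the increase of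
the dimension accounts for the extra generators `g`. -/
theorem isParameterFamily_of_unit [DecidableEq A] (hz : IsParameterFamily z) {w : ι → Fin 2 → A} {c : ι → Fin 2}
    (hw₁ : ∀ i, Associated (w i (c i)) (ρ (z i))) (hw₂ : ∀ i j, j ≠ c i → IsUnit (w i j))
    {g : Finset A} (hg : maximalIdeal A = (maximalIdeal R).map ρ ⊔ Ideal.span (g : Set A))
    (hd : ringKrullDim R + g.card ≤ ringKrullDim A) :
    IsParameterFamily (fun i : ι × Fin 2 => w i.1 i.2) := by
  classical
  obtain ⟨G, F, hG, hm, hdim⟩ := hz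
  refine ⟨G.image fun i => (i, c i), F.image ρ ∪ g, ?_, ?_, ?_⟩
  · rintro ⟨i, j⟩
    simp only [Finset.mem_image, Prod.mk.injEq, ↓existsAndEq, true_and]
    by_cases hj : j = c i
    · subst hj
      rw [(hw₁ i).isUnit_iff, isUnit_map_iff, ← hG]
      simp
    · simp [hw₂ i j hj, Ne.symm hj]
  · rw [hg, hm, Ideal.map_span, ← Ideal.span_union]
    have h₁ : ∀ i, w i (c i) ∣ ρ (z i) := fun i => (hw₁ i).dvd
    have h₂ : ∀ i, ρ (z i) ∣ w i (c i) := fun i => (hw₁ i).symm.dvd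
    refine le_antisymm (Ideal.span_le.mpr ?_) (Ideal.span_le.mpr ?_)
    · rintro a (⟨b, ⟨i, hi, rfl⟩ | hb, rfl⟩ | ha)
      · exact Ideal.mem_of_dvd _ (h₁ i) (Ideal.subset_span (.inl ⟨(i, c i), by simpa using hi, rfl⟩))
      · exact Ideal.subset_span (.inr (by simpa using .inl ⟨b, hb, rfl⟩))
      · exact Ideal.subset_span (.inr (by simpa using .inr ha))
    · rintro a (⟨b, hb, rfl⟩ | ha)
      · simp only [Finset.coe_image, Set.mem_image] at hb
        obtain ⟨i, hi, rfl⟩ := hb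
        exact Ideal.mem_of_dvd _ (h₂ i) (Ideal.subset_span (.inl ⟨z i, .inl ⟨i, hi, rfl⟩, rfl⟩))
      · simp only [Finset.coe_union, Finset.coe_image, Set.mem_union, Set.mem_image] at ha
        rcases ha with ⟨b, hb, rfl⟩ | ha
        · exact Ideal.subset_span (.inl ⟨b, .inr hb, rfl⟩)
        · exact Ideal.subset_span (.inr ha)
  · refine le_trans ?_ hd
    refine le_trans ?_ (add_le_add_left hdim _)
    have h₁ : (G.image fun i => (i, c i)).card ≤ G.card := Finset.card_image_le
    have h₂ := Finset.card_union_le (F.image ρ) g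
    have h₃ : (F.image ρ).card ≤ F.card := Finset.card_image_le
    have : (G.image fun i => (i, c i)).card + (F.image ρ ∪ g).card ≤ G.card + F.card + g.card := by
      omega
    exact_mod_cast this

/-- The parameter `z l` is traded for its two factors: one more generator, matched by one more
dimension. -/
theorem isParameterFamily_of_nonunit {l : ι} (hz : IsParameterFamily z) {w : ι → Fin 2 → A}
    {c : ι → Fin 2} (hw₁ : ∀ i ≠ l, Associated (w i (c i)) (ρ (z i)))
    (hw₂ : ∀ i ≠ l, ∀ j, j ≠ c i → IsUnit (w i j)) (hl : ¬ IsUnit (z l))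
    (hl₀ : ¬ IsUnit (w l 0)) (hl₁ : ¬ IsUnit (w l 1)) (hl₂ : w l 0 * w l 1 = ρ (z l))
    (hg : maximalIdeal A = (maximalIdeal R).map ρ ⊔ Ideal.span {w l 0, w l 1})
    (hd : ringKrullDim R + 1 ≤ ringKrullDim A) :
    IsParameterFamily (fun i : ι × Fin 2 => w i.1 i.2) := by
  classical
  obtain ⟨G, F, hG, hm, hdim⟩ := hz
  have hfin : ∀ j : Fin 2, j = 0 ∨ j = 1 := by decide
  refine ⟨((G.erase l).image fun i => (i, c i)) ∪ {(l, 0), (l, 1)}, F.image ρ, ?_, ?_, ?_⟩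
  · rintro ⟨i, j⟩
    by_cases hi : i = l
    · subst hi
      rcases hfin j with rfl | rfl <;> simp [hl₀, hl₁]
    simp only [Finset.mem_union, Finset.mem_image, Prod.mk.injEq, ↓existsAndEq, true_and,
      Finset.mem_erase, hi, Finset.mem_insert, Finset.mem_singleton, false_and, or_false]
    by_cases hj : j = c i
    · subst hj
      rw [(hw₁ i hi).isUnit_iff, isUnit_map_iff, ← hG]
      simp [hi]
    · simp [hw₂ i hi j hj, Ne.symm hj]
  · rw [hg, hm, Ideal.map_span, ← Ideal.span_union]
    have h₁ : ∀ i ≠ l, w i (c i) ∣ ρ (z i) := fun i hi => (hw₁ i hi).dvd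
    have h₂ : ∀ i ≠ l, ρ (z i) ∣ w i (c i) := fun i hi => (hw₁ i hi).symm.dvd
    refine le_antisymm (Ideal.span_le.mpr ?_) (Ideal.span_le.mpr ?_)
    · rintro a (⟨b, ⟨i, hi, rfl⟩ | hb, rfl⟩ | ha)
      · by_cases hil : i = l
        · subst hil
          rw [← hl₂]
          exact Ideal.mul_mem_left _ _ (Ideal.subset_span (.inl ⟨(i, 1), by simp, rfl⟩))
        · exact Ideal.mem_of_dvd _ (h₁ i hil)
            (Ideal.subset_span (.inl ⟨(i, c i), by simpa [hil] using hi, rfl⟩))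
      · exact Ideal.subset_span (.inr (by simpa using ⟨b, hb, rfl⟩))
      · rcases ha with rfl | rfl
        · exact Ideal.subset_span (.inl ⟨(l, 0), by simp, rfl⟩)
        · exact Ideal.subset_span (.inl ⟨(l, 1), by simp, rfl⟩)
    · rintro a (⟨⟨i, j⟩, hb, rfl⟩ | ha)
      · by_cases hil : i = l
        · subst hil
          rcases hfin j with rfl | rfl
          · exact Ideal.subset_span (.inr (by simp))
          · exact Ideal.subset_span (.inr (by simp))
        · simp [hil] at hb
          obtain ⟨hi, rfl⟩ := hb
          exact Ideal.mem_of_dvd _ (h₂ i hil) (Ideal.subset_span (.inl ⟨z i, .inl ⟨i, hi, rfl⟩, rfl⟩))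
      · simp only [Finset.coe_image, Set.mem_image] at ha
        obtain ⟨b, hb, rfl⟩ := ha
        exact Ideal.subset_span (.inl ⟨b, .inr hb, rfl⟩)
  · refine le_trans ?_ hd
    refine le_trans ?_ (add_le_add_left hdim _)
    have h₁ : ((G.erase l).image fun i => (i, c i)).card ≤ (G.erase l).card := Finset.card_image_le
    have h₂ := Finset.card_union_le ((G.erase l).image fun i => (i, c i)) {(l, (0 : Fin 2)), (l, 1)}
    have h₃ : (F.image ρ).card ≤ F.card := Finset.card_image_le
    have h₄ := Finset.card_le_two (a := (l, (0 : Fin 2))) (b := (l, 1))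
    have h₅ := Finset.card_erase_add_one ((hG l).mpr hl)
    have : (((G.erase l).image fun i => (i, c i)) ∪ {(l, 0), (l, 1)}).card + (F.image ρ).card ≤
        G.card + F.card + 1 := by
      omega
    exact_mod_cast this

variable [IsNoetherianRing R] [IsNoetherianRing A]

/-- If `x` or `y` is a unit, the chart is étale over a polynomial ring over `R`. Otherwise `S =
{l}`, the maximal ideal is generated by that of `R` together with `x` and `y`, the relation `x y = z
l` makes `z l` superfluous, and the dimension increases by at least one. -/
theorem State.isParameterFamily (h : State ρ z x₀ y₀ S M N x y) (hz : IsParameterFamily z)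
    (hS : ∀ i ∈ S, S = {i}) :
    IsParameterFamily (fun i : ι × Fin 2 => newFamily ρ z S M x y i.1 i.2) := by
  classical
  have hfin : ∀ j : Fin 2, j = 0 ∨ j = 1 := by decide
  have := hz.isDomain
  have key : ∀ {g : Finset A}, maximalIdeal A = (maximalIdeal R).map ρ ⊔ Ideal.span (g : Set A) →
      ringKrullDim R + g.card ≤ ringKrullDim A → (IsUnit x ∨ IsUnit y) →
      IsParameterFamily (fun i : ι × Fin 2 => newFamily ρ z S M x y i.1 i.2) := by
    intro g hg hd hu
    -- `c i` is the letter whose member carries `z i` up to a unit; the member for the other letter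
    -- is a unit.
    let c : ι → Fin 2 := fun i => if i ∈ S then (if IsUnit x then 1 else 0) else
      if i ∈ M then 0 else 1
    have hmul : ∀ i, newFamily ρ z S M x y i 0 * newFamily ρ z S M x y i 1 = ρ (z i) :=
      h.newFamily_mul hS
    have hunit : ∀ i j, j ≠ c i → IsUnit (newFamily ρ z S M x y i j) := by
      intro i j hj
      rcases hfin j with rfl | rfl <;> simp only [c, newFamily] at hj ⊢ <;> split_ifs at hj ⊢ <;>
        simp_all
    refine isParameterFamily_of_unit hz (c := c) (fun i => ?_) hunit hg hd
    rw [← hmul i]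
    rcases hfin (c i) with hc | hc
    · obtain ⟨u, hu⟩ := hunit i 1 (by simp [hc])
      rw [hc]
      exact ⟨u, by rw [hu]⟩
    · obtain ⟨u, hu⟩ := hunit i 0 (by simp [hc])
      rw [hc]
      exact ⟨u, by rw [hu, mul_comm]⟩
  by_cases hx : IsUnit x
  · obtain ⟨g, hg, hd⟩ := exists_maximalIdeal_eq_of_polynomial (h.essEtale.of_isUnit_x hx)
      (RingHom.ext fun r => Polynomial.eval₂_C ρ x)
    exact key hg hd (.inl hx)
  by_cases hy : IsUnit y
  · obtain ⟨g, hg, hd⟩ := exists_maximalIdeal_eq_of_polynomial (h.swap.essEtale.of_isUnit_x hy)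
      (RingHom.ext fun r => Polynomial.eval₂_C ρ y)
    exact key hg hd (.inr hy)
  obtain ⟨l, hl⟩ : S.Nonempty := by
    by_contra hne
    rw [Finset.not_nonempty_iff_eq_empty] at hne
    subst hne
    exact hx (IsUnit.of_mul_eq_one y (by rw [h.mul_eq]; simp))
  obtain rfl := hS l hl
  have hxy : x * y = ρ (z l) := by rw [h.mul_eq, Finset.prod_singleton]
  obtain ⟨q, hq, hqR, hlt, hmax⟩ := Node.exists_prime_of_nonunit (h := h.mul_eq)
    ((mem_maximalIdeal _).mpr hx) ((mem_maximalIdeal _).mpr hy)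
  have hmax' := h.essEtale.map_comap_maximalIdeal
  rw [hmax, Ideal.map_sup, Ideal.map_map, Node.lift_comp_algebraMap, Ideal.map_span, Set.image_pair,
    Node.lift_x, Node.lift_y] at hmax'
  have hzl : z l ≠ 0 := hz.isPrimeFamily.ne_zero l
  have hflat := Node.flat_of_mem_nonZeroDivisors
    (mem_nonZeroDivisors_of_ne_zero (hz.isPrimeFamily.prod_ne_zero {l}))
  have hρ : ρ.Flat := by
    rw [← Node.lift_comp_algebraMap ρ x y h.mul_eq]
    exact RingHom.Flat.comp (RingHom.flat_algebraMap_iff.mpr hflat) h.essEtale.flat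
  have hd := ringKrullDim_add_one_le_of_flat hρ h.essEtale.flat
    (Node.lift_comp_algebraMap ρ x y h.mul_eq) hqR hlt
  have hnu : ¬ IsUnit (z l) := fun hu => by
    rw [← isUnit_map_iff ρ, ← hxy] at hu
    exact hx (isUnit_of_mul_isUnit_left hu)
  refine isParameterFamily_of_nonunit (l := l) (c := fun i => if i ∈ M then 0 else 1) hz ?_ ?_ hnu
    (by simpa [newFamily] using hx) (by simpa [newFamily] using hy) (h.newFamily_mul hS l)
    (by simpa [newFamily] using hmax'.symm) hd
  · intro i hi
    simp only [newFamily, Finset.mem_singleton, hi, if_false]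
    split_ifs <;> simp_all
  · intro i hi j hj
    rcases hfin j with rfl | rfl <;> simp only [newFamily] at hj ⊢ <;> split_ifs at hj ⊢ <;>
        simp_all

end

end NodalResolution

namespace NodalResolution

/-! ## Charts of blowups of schemes -/

section Chart

variable {A C : Type u} [CommRing A] [CommRing C] [Algebra A C] {I : Ideal A} {c : A}

theorem IsBlowupChart.pow_regular (h : IsBlowupChart C I c) (n : ℕ) (u : C)
    (hu : algebraMap A C c ^ n * u = 0) : u = 0 := by
  induction n with
  | zero => simpa using hu
  | succ n ih => exact ih (h.isRegular _ (by rw [← mul_assoc, ← pow_succ', hu]))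

/-- The chart is generated over `A` by the quotients by `c` of finitely many generators of `I`. -/
theorem IsBlowupChart.isNoetherianRing [IsNoetherianRing A] (h : IsBlowupChart C I c) :
    IsNoetherianRing C := by
  classical
  obtain ⟨s, hs⟩ := (IsNoetherian.noetherian I : I.FG)
  choose! v hv using h.exists_eq_mul
  let B : Subalgebra A C := Algebra.adjoin A (s.image v : Finset C)
  have hvB : ∀ a ∈ s, v a ∈ B := fun a ha =>
    Algebra.subset_adjoin (by simpa using ⟨a, ha, rfl⟩)
  have key₁ : ∀ a ∈ I, ∃ b ∈ B, algebraMap A C a = algebraMap A C c * b := by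
    intro a ha
    rw [← hs] at ha
    induction ha using Submodule.span_induction with
    | mem a ha => exact ⟨v a, hvB a ha, hv a (hs ▸ Ideal.subset_span ha)⟩
    | zero => exact ⟨0, zero_mem _, by simp⟩
    | add a a' _ _ h h' =>
      obtain ⟨b, hb, h⟩ := h
      obtain ⟨b', hb', h'⟩ := h'
      exact ⟨b + b', add_mem hb hb', by rw [map_add, h, h', mul_add]⟩
    | smul r a _ h =>
      obtain ⟨b, hb, h⟩ := h
      refine ⟨algebraMap A C r * b, mul_mem (B.algebraMap_mem r) hb, ?_⟩
      rw [smul_eq_mul, map_mul, h]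
      ring
  have key₂ : ∀ n : ℕ, ∀ a ∈ I ^ n, ∃ b ∈ B, algebraMap A C a = algebraMap A C c ^ n * b := by
    intro n
    induction n with
    | zero => exact fun a _ => ⟨algebraMap A C a, B.algebraMap_mem a, by simp⟩
    | succ n ih =>
      intro a ha
      rw [pow_succ] at ha
      induction ha using Submodule.mul_induction_on' with
      | mem_mul_mem a ha b hb =>
        obtain ⟨d, hd, ha⟩ := ih a ha
        obtain ⟨e, he, hb⟩ := key₁ b hb
        exact ⟨d * e, mul_mem hd he, by rw [map_mul, ha, hb]; ring⟩
      | add a _ b _ ha hb =>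
        obtain ⟨d, hd, ha⟩ := ha
        obtain ⟨e, he, hb⟩ := hb
        exact ⟨d + e, add_mem hd he, by rw [map_add, ha, hb]; ring⟩
  have htop : B = ⊤ := by
    refine top_le_iff.mp fun u _ => ?_
    obtain ⟨n, a, ha, hu⟩ := h.exists_pow_mul_eq u
    obtain ⟨b, hb, hb'⟩ := key₂ n a ha
    rw [hb'] at hu
    rwa [sub_eq_zero.mp (h.pow_regular n (u - b) (by rw [mul_sub, hu, sub_self]))]
  have : Algebra.FiniteType A C := ⟨⟨s.image v, htop⟩⟩
  exact Algebra.FiniteType.isNoetherianRing A C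

/-- Charts of blowups localize. -/
theorem IsBlowupChart.localization (h : IsBlowupChart C I c) (M : Submonoid A) {A' C' : Type u}
    [CommRing A'] [CommRing C'] [Algebra A A'] [Algebra C C'] [Algebra A' C'] [Algebra A C']
    [IsScalarTower A C C'] [IsScalarTower A A' C'] [IsLocalization M A']
    [IsLocalization (Algebra.algebraMapSubmonoid C M) C'] :
    IsBlowupChart C' (I.map (algebraMap A A')) (algebraMap A A' c) := by
  have hcomp : ∀ a, algebraMap A' C' (algebraMap A A' a) = algebraMap C C' (algebraMap A C a) :=
    fun a => by rw [← IsScalarTower.algebraMap_apply, ← IsScalarTower.algebraMap_apply]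
  have hunit : ∀ m ∈ M, IsUnit (algebraMap A' C' (algebraMap A A' m)) := fun m hm =>
    (IsLocalization.map_units A' ⟨m, hm⟩).map _
  have hfrac : ∀ u : C', ∃ m ∈ M, ∃ u₀ : C,
      algebraMap A' C' (algebraMap A A' m) * u = algebraMap C C' u₀ := by
    intro u
    obtain ⟨⟨u₀, ⟨_, m, hm, rfl⟩⟩, hu⟩ :=
      IsLocalization.surj (Algebra.algebraMapSubmonoid C M) u
    exact ⟨m, hm, u₀, by rw [hcomp, mul_comm]; exact hu⟩
  have hzero : ∀ u₀ : C, algebraMap C C' u₀ = 0 → ∃ m ∈ M, algebraMap A C m * u₀ = 0 := by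
    intro u₀ hu
    obtain ⟨⟨_, m, hm, rfl⟩, hu⟩ :=
      (IsLocalization.map_eq_zero_iff (Algebra.algebraMapSubmonoid C M) C' u₀).mp hu
    exact ⟨m, hm, hu⟩
  constructor
  · intro a ha
    obtain ⟨⟨⟨a₀, ha₀⟩, ⟨m, hm⟩⟩, ha'⟩ := (IsLocalization.mem_map_algebraMap_iff M A').mp ha
    obtain ⟨u, hu⟩ := h.exists_eq_mul a₀ ha₀
    obtain ⟨w, hw⟩ := hunit m hm
    refine ⟨algebraMap C C' u * ↑w⁻¹, ?_⟩
    rw [← mul_assoc, Units.eq_mul_inv_iff_mul_eq, hw, ← map_mul]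
    rw [ha']
    change algebraMap A' C' (algebraMap A A' a₀) = _
    rw [hcomp, hcomp, hu, map_mul]
  · intro u hu
    obtain ⟨m, hm, u₀, hu₀⟩ := hfrac u
    have : algebraMap C C' (algebraMap A C c * u₀) = 0 := by
      rw [map_mul, ← hu₀, ← hcomp, mul_left_comm, hu, mul_zero]
    obtain ⟨m', hm', hu'⟩ := hzero _ this
    have h₁ := h.isRegular (algebraMap A C m' * u₀) (by rw [mul_left_comm, hu'])
    have h₂ := congrArg (algebraMap C C') h₁
    rw [map_mul, ← hcomp, ← hu₀, map_zero] at h₂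
    exact (hunit m hm).mul_right_eq_zero.mp ((hunit m' hm').mul_right_eq_zero.mp h₂)
  · intro u
    obtain ⟨m, hm, u₀, hu₀⟩ := hfrac u
    obtain ⟨n, a, ha, hn⟩ := h.exists_pow_mul_eq u₀
    obtain ⟨w, hw⟩ := IsLocalization.map_units A' (⟨m, hm⟩ : M)
    refine ⟨n, ↑w⁻¹ * algebraMap A A' a, ?_, ?_⟩
    · rw [← Ideal.map_pow]
      exact Ideal.mul_mem_left _ _ (Ideal.mem_map_of_mem _ ha)
    · rw [map_mul, hcomp a, ← hn, map_mul, map_pow, ← hu₀, ← hw, hcomp c, mul_left_comm,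
        ← mul_assoc (algebraMap A' C' ↑w⁻¹), ← map_mul, Units.inv_mul, map_one, one_mul]
  · intro a ha
    obtain ⟨⟨a₀, ⟨m, hm⟩⟩, ha'⟩ := IsLocalization.surj M a
    change a * algebraMap A A' m = algebraMap A A' a₀ at ha'
    have h₁ : algebraMap C C' (algebraMap A C a₀) = 0 := by
      rw [← hcomp, ← ha', map_mul, ha, zero_mul]
    obtain ⟨m', hm', h₂⟩ := hzero _ h₁
    rw [← map_mul] at h₂
    obtain ⟨n, hn⟩ := h.exists_pow_mul_eq_zero _ h₂
    refine ⟨n, ?_⟩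
    have h₃ := congrArg (algebraMap A A') hn
    rw [map_mul, map_mul, ← ha', map_pow, map_zero] at h₃
    have hm₁ : IsUnit (algebraMap A A' m) := IsLocalization.map_units A' (⟨m, hm⟩ : M)
    have hm₂ : IsUnit (algebraMap A A' m') := IsLocalization.map_units A' (⟨m', hm'⟩ : M)
    have h₄ : algebraMap A A' c ^ n * a * (algebraMap A A' m * algebraMap A A' m') = 0 := by
      linear_combination h₃
    exact (hm₁.mul hm₂).mul_left_eq_zero.mp h₄

end Chart

/-- The element `c T` of the Rees algebra. -/
noncomputable def reesGen {A : Type u} [CommRing A] {I : Ideal A} {c : A} (hc : c ∈ I) :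
    reesAlgebra I :=
  ⟨Polynomial.monomial 1 c, reesAlgebra.monomial_mem.mpr (by simpa using hc)⟩

open Blowup in
theorem reesGen_mem {A : Type u} [CommRing A] {I : Ideal A} {c : A} (hc : c ∈ I) :
    reesGen hc ∈ reesGrading I 1 := ⟨c, rfl⟩

open Blowup in
-- Every element of the chart is a fraction `a T ^ n / (c T) ^ n`, which becomes `a` after
-- multiplication by `c ^ n`, and which vanishes exactly when a power of `c` kills `a`.
theorem isBlowupChart_toAway {A : Type u} [CommRing A] {I : Ideal A} {c : A} (hc : c ∈ I) :
    @IsBlowupChart A (HomogeneousLocalization.Away (reesGrading I) (reesGen hc)) _ _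
      (toAway I (reesGen hc)).toAlgebra I c := by
  set f : reesAlgebra I := reesGen hc with hf
  have hfd : f ∈ reesGrading I 1 := reesGen_mem hc
  have hone : ∀ (n : ℕ) (h : c ^ n ∈ I ^ (n • 1)), awayMk hfd n (c ^ n) h = 1 := by
    intro n h
    apply HomogeneousLocalization.val_injective
    rw [awayMk, HomogeneousLocalization.Away.val_mk, HomogeneousLocalization.val_one,
      Localization.mk_eq_mk', IsLocalization.mk'_eq_iff_eq_mul, one_mul]
    congr 1
    refine Subtype.ext ?_
    change Polynomial.monomial (n • 1) (c ^ n) = (Polynomial.monomial 1 c) ^ n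
    rw [Polynomial.monomial_pow]
    simp
  have hpow : ∀ n : ℕ, c ^ n ∈ I ^ (n • 1) := fun n => by simpa using Ideal.pow_mem_pow hc n
  have hmk : ∀ (n : ℕ) (a : A) (ha : a ∈ I ^ (n • 1)),
      toAway I f (c ^ n) * awayMk hfd n a ha = toAway I f a := by
    intro n a ha
    have h₁ := toAway_mul_awayMk (I := I) a hfd n (c ^ n) (hpow n)
    rw [hone] at h₁
    rw [toAway_mul_awayMk]
    refine Eq.trans ?_ (h₁.symm.trans (mul_one (toAway I f a)))
    congr 1
    exact mul_comm _ _
  let := (toAway I f).toAlgebra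
  constructor
  · intro a ha
    refine ⟨awayMk hfd 1 a (by simpa using ha), ?_⟩
    have := hmk 1 a (by simpa using ha)
    rw [pow_one] at this
    exact this.symm
  · intro u hu
    obtain ⟨n, a, ha, rfl⟩ := exists_awayMk hfd u
    have hu' : toAway I f c * awayMk hfd n a ha = 0 := hu
    rw [toAway_mul_awayMk, awayMk_eq_zero_iff hfd c rfl] at hu'
    obtain ⟨k, hk⟩ := hu'
    exact (awayMk_eq_zero_iff hfd c rfl n a ha).mpr ⟨k + 1, by rw [pow_succ, mul_assoc, hk]⟩
  · intro u
    obtain ⟨n, a, ha, rfl⟩ := exists_awayMk hfd u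
    refine ⟨n, a, by simpa using ha, ?_⟩
    have := hmk n a ha
    rw [map_pow] at this
    exact this
  · intro a ha
    have h₁ : toAway I f a = awayMk hfd 0 a (by simp) := by
      have := hmk 0 a (by simp)
      rw [pow_zero, map_one] at this
      exact this.symm.trans (one_mul (awayMk hfd 0 a (by simp)))
    have ha' : toAway I f a = 0 := ha
    rw [h₁, awayMk_eq_zero_iff hfd c rfl] at ha'
    exact ha'

end NodalResolution

namespace NodalResolution

/-! ## Local rings of schemes -/

theorem isLocalization_toStalk {B : CommRingCat.{u}} (P : Spec B) :
    ∃ M : Submonoid B, @IsLocalization B _ M ((Spec B).presheaf.stalk P) _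
      (StructureSheaf.toStalk B P).hom.toAlgebra :=
  ⟨_, StructureSheaf.IsLocalization.to_stalk B P⟩

/-- Only the isomorphism on one stalk is required, because the result is also applied to spectra of
local rings and to fibre products of such, which are not open in `W`. -/
theorem exists_stalk_of_isIso_stalkMap {W : Scheme.{u}} {B : CommRingCat.{u}}
    (h : Spec B ⟶ W) {w : W} {P : Spec B} (hP : h P = w) [IsIso (h.stalkMap P)] :
    ∃ ψ : B ⟶ W.presheaf.stalk w, (∃ M : Submonoid B,
      @IsLocalization B _ M (W.presheaf.stalk w) _ ψ.hom.toAlgebra) ∧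
      Spec.map ψ ≫ h = W.fromSpecStalk w := by
  subst hP
  let e : W.presheaf.stalk (h P) ≅ (Spec B).presheaf.stalk P := asIso (h.stalkMap P)
  let τ : B ⟶ (Spec B).presheaf.stalk P := StructureSheaf.toStalk B P
  have hτ : (Spec B).fromSpecStalk P = Spec.map τ := Spec.fromSpecStalk_eq' _ P
  obtain ⟨M, hM⟩ := isLocalization_toStalk P
  refine ⟨τ ≫ e.inv, ⟨M, ?_⟩, ?_⟩
  · let := τ.hom.toAlgebra
    let := (τ ≫ e.inv).hom.toAlgebra
    let e' : ((Spec B).presheaf.stalk P) ≃ₐ[B] (W.presheaf.stalk (h P)) :=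
      { e.symm.commRingCatIsoToRingEquiv with commutes' := fun _ => rfl }
    have : IsLocalization M ((Spec B).presheaf.stalk P) := hM
    exact IsLocalization.isLocalization_of_algEquiv M e'
  · rw [Spec.map_comp, ← hτ, Category.assoc,
      ← Scheme.SpecMap_stalkMap_fromSpecStalk, ← Category.assoc, ← Spec.map_comp]
    have : h.stalkMap P ≫ e.inv = 𝟙 _ := e.hom_inv_id
    rw [this, Spec.map_id, Category.id_comp]

theorem exists_stalk_of_isOpenImmersion {W : Scheme.{u}} {B : CommRingCat.{u}}
    (h : Spec B ⟶ W) [IsOpenImmersion h] {w : W} {P : Spec B} (hP : h P = w) :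
    ∃ ψ : B ⟶ W.presheaf.stalk w, (∃ M : Submonoid B,
      @IsLocalization B _ M (W.presheaf.stalk w) _ ψ.hom.toAlgebra) ∧
      Spec.map ψ ≫ h = W.fromSpecStalk w :=
  exists_stalk_of_isIso_stalkMap h hP

theorem comp_eq_stalkMap_comp_germ {W W' : Scheme.{u}} (g : W' ⟶ W) {B : CommRingCat.{u}}
    (h : Spec B ⟶ W') {w : W'} {ψ : B ⟶ W'.presheaf.stalk w}
    (hψ : Spec.map ψ ≫ h = W'.fromSpecStalk w)
    {U : W.Opens} (hU : IsAffineOpen U) (hw : g w ∈ U) (θ : Γ(W, U) ⟶ B)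
    (hθ : h ≫ g = Spec.map θ ≫ hU.fromSpec) :
    θ ≫ ψ = W.presheaf.germ U (g w) hw ≫ g.stalkMap w := by
  apply Spec.map_injective
  rw [← cancel_mono hU.fromSpec, Spec.map_comp, Category.assoc, ← hθ,
    ← Category.assoc, hψ, Spec.map_comp, Category.assoc,
    ← Scheme.SpecMap_stalkMap_fromSpecStalk]
  congr 1
  exact (hU.fromSpecStalk_eq_fromSpecStalk hw).symm

/-- Write `F` as the zero set of `J` and the complement of `N` as that of `G`. Vanishing on `F ∩ N`
means that the products with elements of `G` lie in the radical of `J`; this is compatible with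
localization because `G` is finitely generated, so that one denominator serves all of it. -/
theorem mem_map_vanishingIdeal_iff {R A : Type u} [CommRing R] [CommRing A] [Algebra R A]
    [IsNoetherianRing R] (M : Submonoid R) [IsLocalization M A] {F N : Set (PrimeSpectrum R)}
    (hF : IsClosed F) (hN : IsOpen N) (a : A) :
    a ∈ (PrimeSpectrum.vanishingIdeal (F ∩ N)).map (algebraMap R A) ↔
      ∀ P : PrimeSpectrum A, PrimeSpectrum.comap (algebraMap R A) P ∈ F ∩ N → a ∈ P.asIdeal := by
  set φ := algebraMap R A with hφ
  constructor
  · intro ha P hP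
    revert ha a
    change Ideal.map φ _ ≤ P.asIdeal
    rw [Ideal.map_le_iff_le_comap]
    intro b hb
    exact (PrimeSpectrum.mem_vanishingIdeal _ _).mp hb (PrimeSpectrum.comap φ P) hP
  · intro ha
    obtain ⟨J, hJ⟩ := (PrimeSpectrum.isClosed_iff_zeroLocus_ideal _).mp hF
    obtain ⟨G, hG⟩ := (PrimeSpectrum.isClosed_iff_zeroLocus_ideal _).mp hN.isClosed_compl
    obtain ⟨b, ⟨s, hs⟩, hb⟩ := IsLocalization.exists_mk'_eq M a
    have hsu : IsUnit (φ s) := IsLocalization.map_units A (⟨s, hs⟩ : M)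
    have hab : φ b = a * φ s := by
      rw [← hb]; exact (IsLocalization.mk'_spec A b ⟨s, hs⟩).symm
    have key : ∀ f ∈ G, ∃ r ∈ M, r * (b * f) ∈ J.radical := by
      intro f hf
      have h₁ : φ (b * f) ∈ (J.map φ).radical := by
        rw [Ideal.radical_eq_sInf, Ideal.mem_sInf]
        rintro Q ⟨hQ, hQ'⟩
        rw [map_mul]
        by_cases hfQ : φ f ∈ Q
        · exact Ideal.mul_mem_left _ _ hfQ
        · refine Ideal.mul_mem_right _ _ ?_
          rw [hab]
          refine Ideal.mul_mem_right _ _ (ha ⟨Q, hQ'⟩ ⟨?_, ?_⟩)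
          · rw [hJ]
            exact fun x hx => hQ (Ideal.mem_map_of_mem φ hx)
          · by_contra hN
            have : PrimeSpectrum.comap φ ⟨Q, hQ'⟩ ∈ PrimeSpectrum.zeroLocus (G : Set R) := by
              rw [← hG]; exact hN
            exact hfQ (this hf)
      obtain ⟨n, hn⟩ := h₁
      rw [← map_pow] at hn
      obtain ⟨⟨⟨j, hj⟩, ⟨r, hr⟩⟩, hjr⟩ := (IsLocalization.mem_map_algebraMap_iff M A).mp hn
      change φ ((b * f) ^ n) * φ r = φ j at hjr
      rw [← map_mul] at hjr
      obtain ⟨⟨r', hr'⟩, h₂⟩ := (IsLocalization.eq_iff_exists M A).mp hjr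
      change r' * _ = r' * j at h₂
      refine ⟨r' * r, mul_mem hr' hr, n + 1, ?_⟩
      have : (r' * r * (b * f)) ^ (n + 1) =
          (r' * r) ^ n * (b * f) * (r' * ((b * f) ^ n * r)) := by ring
      rw [this, h₂]
      exact Ideal.mul_mem_left _ _ (Ideal.mul_mem_left _ _ hj)
    obtain ⟨r, hr, hrG⟩ : ∃ r ∈ M, ∀ f ∈ G, r * (b * f) ∈ J.radical := by
      classical
      obtain ⟨T, rfl⟩ := (IsNoetherian.noetherian G : G.FG)
      have : ∀ T' : Finset R, T' ⊆ T → ∃ r ∈ M,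
          ∀ f ∈ Submodule.span R (T' : Set R), r * (b * f) ∈ J.radical := by
        intro T'
        induction T' using Finset.induction_on with
        | empty => exact fun _ => ⟨1, one_mem _, fun f hf => by
            rw [Finset.coe_empty, Submodule.span_empty, Submodule.mem_bot] at hf
            simp [hf]⟩
        | insert f T' _ ih =>
          intro hT'
          obtain ⟨r, hr, h⟩ := ih ((Finset.subset_insert _ _).trans hT')
          obtain ⟨r', hr', h'⟩ := key f (Submodule.subset_span (hT' (Finset.mem_insert_self _ _)))
          refine ⟨r * r', mul_mem hr hr', fun f' hf' => ?_⟩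
          rw [Finset.coe_insert, Submodule.mem_span_insert] at hf'
          obtain ⟨c, f₁, hf₁, rfl⟩ := hf'
          have : r * r' * (b * (c • f + f₁)) =
            (r * c) * (r' * (b * f)) + r' * (r * (b * f₁)) := by rw [smul_eq_mul]; ring
          rw [this]
          exact add_mem (Ideal.mul_mem_left _ _ h') (Ideal.mul_mem_left _ _ (h _ hf₁))
      exact this T le_rfl
    have hmem : r * b ∈ PrimeSpectrum.vanishingIdeal (F ∩ N) := by
      rw [PrimeSpectrum.mem_vanishingIdeal]
      intro Q hQ
      have hQJ : Q ∈ PrimeSpectrum.zeroLocus (J : Set R) := by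
        rw [← hJ]; exact hQ.1
      have hQG : Q ∉ PrimeSpectrum.zeroLocus (G : Set R) := by
        rw [← hG]; exact fun h => h hQ.2
      obtain ⟨f, hf, hfQ⟩ : ∃ f ∈ G, f ∉ Q.asIdeal := by
        by_contra! h
        exact hQG fun f hf => h f hf
      have h₁ : r * (b * f) ∈ Q.asIdeal :=
        (Q.isPrime.radical_le_iff.mpr hQJ) (hrG f hf)
      rw [← mul_assoc] at h₁
      exact (Q.isPrime.mem_or_mem h₁).resolve_right hfQ
    have hru : IsUnit (φ r) := IsLocalization.map_units A (⟨r, hr⟩ : M)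
    have h₁ := Ideal.mem_map_of_mem φ hmem
    rw [map_mul, hab] at h₁
    exact (Ideal.mul_unit_mem_iff_mem _ hsu).mp ((Ideal.unit_mul_mem_iff_mem _ hru).mp h₁)

theorem fromSpecStalk_apply {W : Scheme.{u}} {U : W.Opens} (hU : IsAffineOpen U) {w : W}
    (hw : w ∈ U) (P : PrimeSpectrum (W.presheaf.stalk w)) :
    W.fromSpecStalk w P =
      hU.fromSpec (PrimeSpectrum.comap (W.presheaf.germ U w hw).hom P) := by
  rw [← hU.fromSpecStalk_eq_fromSpecStalk hw]
  rfl

theorem vanishingIdeal_closure_ideal {W : Scheme.{u}} (S : Set W) {U : W.Opens}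
    (hU : IsAffineOpen U) :
    (Scheme.IdealSheafData.vanishingIdeal (Closeds.closure S)).ideal ⟨U, hU⟩ =
      PrimeSpectrum.vanishingIdeal (hU.fromSpec ⁻¹' S) := by
  change PrimeSpectrum.vanishingIdeal (hU.fromSpec ⁻¹' (closure S)) = _
  exact (congrArg PrimeSpectrum.vanishingIdeal
    (hU.fromSpec.isOpenEmbedding.isOpenMap.preimage_closure_eq_closure_preimage
      hU.fromSpec.continuous S)).trans (PrimeSpectrum.vanishingIdeal_closure _)

/-- Turns the stalk of the ideal of a center into a condition on primes of the local ring,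
independent of the affine neighbourhood. Local equations are tested in this form. -/
theorem mem_map_germ_vanishingIdeal_iff {W : Scheme.{u}} [IsLocallyNoetherian W] {F : Set W}
    (hF : IsClosed F) {N : Set W} (hN : IsOpen N) {U : W.Opens} (hU : IsAffineOpen U) {w : W}
    (hw : w ∈ U) (a : W.presheaf.stalk w) :
    a ∈ ((Scheme.IdealSheafData.vanishingIdeal (Closeds.closure (F ∩ N))).ideal ⟨U, hU⟩).map
        (W.presheaf.germ U w hw).hom ↔
      ∀ P : PrimeSpectrum (W.presheaf.stalk w), W.fromSpecStalk w P ∈ F ∩ N → a ∈ P.asIdeal := by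
  have : IsNoetherianRing Γ(W, U) := IsLocallyNoetherian.component_noetherian ⟨U, hU⟩
  let : Algebra Γ(W, U) (W.presheaf.stalk w) := (W.presheaf.germ U w hw).hom.toAlgebra
  have hloc : IsLocalization.AtPrime (W.presheaf.stalk w) (hU.primeIdealOf ⟨w, hw⟩).asIdeal :=
    hU.isLocalization_stalk ⟨w, hw⟩
  rw [vanishingIdeal_closure_ideal]
  refine (mem_map_vanishingIdeal_iff (hU.primeIdealOf ⟨w, hw⟩).asIdeal.primeCompl
    (hF.preimage hU.fromSpec.continuous) (hN.preimage hU.fromSpec.continuous) a).trans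
    (forall_congr' fun P => ?_)
  rw [fromSpecStalk_apply hU hw]
  rfl

/-! ## The locus over which a morphism is an isomorphism -/

theorem isIso_morphismRestrict_of_forall {Y Z : Scheme.{u}} (f : Y ⟶ Z) (N : Z.Opens)
    (h : ∀ z ∈ N, ∃ V : Z.Opens, z ∈ V ∧ IsIso (f ∣_ V)) : IsIso (f ∣_ N) := by
  choose! V hV hf using h
  change MorphismProperty.isomorphisms Scheme (f ∣_ N)
  have hle : ∀ z ∈ N, MorphismProperty.isomorphisms Scheme (f ∣_ (V z ⊓ N)) := by
    intro z hz
    have h₁ : MorphismProperty.isomorphisms Scheme (f ∣_ V z) := hf z hz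
    have h₂ := IsZariskiLocalAtTarget.restrict h₁ ((V z).ι ⁻¹ᵁ N)
    have h₃ := (MorphismProperty.arrow_mk_iso_iff (MorphismProperty.isomorphisms Scheme)
      (morphismRestrictRestrict f (V z) _)).mp h₂
    rwa [Scheme.Hom.image_preimage_eq_opensRange_inf, Scheme.Opens.opensRange_ι] at h₃
  refine (IsZariskiLocalAtTarget.iff_of_iSup_eq_top
    (fun z : N => N.ι ⁻¹ᵁ (V z.1)) ?_).mpr fun z => ?_
  · refine top_le_iff.mp fun z _ => Opens.mem_iSup.mpr ⟨z, hV z.1 z.2⟩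
  · refine (MorphismProperty.arrow_mk_iso_iff (MorphismProperty.isomorphisms Scheme)
      (morphismRestrictRestrict f N _)).mpr ?_
    rw [Scheme.Hom.image_preimage_eq_opensRange_inf, Scheme.Opens.opensRange_ι, inf_comm]
    exact hle z.1 z.2

theorem le_isoLocus_iff {Y Z : Scheme.{u}} (f : Y ⟶ Z) (N : Z.Opens) :
    N ≤ isoLocus f ↔ IsIso (f ∣_ N) := by
  constructor
  · intro h
    refine isIso_morphismRestrict_of_forall f N fun z hz => ?_
    obtain ⟨V, hV, hz⟩ := Opens.mem_sSup.mp (h hz)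
    exact ⟨V, hz, hV⟩
  · exact fun h => le_sSup h

theorem le_isoLocus_comp {W Y Z : Scheme.{u}} {g : W ⟶ Y} {f : Y ⟶ Z} {N : Z.Opens}
    (hg : f ⁻¹ᵁ N ≤ isoLocus g) (hf : N ≤ isoLocus f) : N ≤ isoLocus (g ≫ f) := by
  rw [le_isoLocus_iff] at *
  rw [morphismRestrict_comp]
  exact IsIso.comp_isIso' hg hf

theorem isIso_isoLocus {Y Z : Scheme.{u}} (f : Y ⟶ Z) : IsIso (f ∣_ isoLocus f) :=
  (le_isoLocus_iff f _).mp le_rfl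

end NodalResolution

namespace NodalResolution

/-! ## Local structure of blowups -/

theorem IsBlowupChart.of_unit_mul {A C : Type u} [CommRing A] [CommRing C] [Algebra A C]
    {I : Ideal A} {c u : A} (hu : IsUnit u) (h : IsBlowupChart C I (u * c)) :
    IsBlowupChart C I c := by
  obtain ⟨v, rfl⟩ := hu
  have hv : algebraMap A C ↑v⁻¹ * algebraMap A C v = 1 := by
    rw [← map_mul, Units.inv_mul, map_one]
  constructor
  · intro a ha
    obtain ⟨w, hw⟩ := h.exists_eq_mul a ha
    exact ⟨algebraMap A C v * w, by rw [hw, map_mul]; ring⟩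
  · intro w hw
    exact h.isRegular w (by rw [map_mul, mul_assoc, hw, mul_zero])
  · intro w
    obtain ⟨n, a, ha, hn⟩ := h.exists_pow_mul_eq w
    refine ⟨n, ↑v⁻¹ ^ n * a, Ideal.mul_mem_left _ _ ha, ?_⟩
    rw [map_mul, ← hn, map_pow, map_mul, ← mul_assoc, ← mul_pow, ← mul_assoc, hv, one_mul]
  · intro a ha
    obtain ⟨n, hn⟩ := h.exists_pow_mul_eq_zero a ha
    refine ⟨n, ?_⟩
    rw [mul_pow, mul_assoc] at hn
    exact ((v.isUnit.pow n).mul_right_eq_zero).mp hn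

/-- Elements of `M` become units in `O` because `σ` is defined on `A`, so `ψ` factors through the
localization of the chart, which is a chart over `A`. -/
theorem IsBlowupChart.exists_localization {R A B O : Type u} [CommRing R] [CommRing A]
    [CommRing B] [CommRing O] [Algebra R A] [Algebra R B] (M : Submonoid R) [IsLocalization M A]
    {I : Ideal R} {a : R} (h : IsBlowupChart B I a) {ψ : B →+* O} (hψ : EssEtale ψ)
    (σ : A →+* O) (hσ : ψ.comp (algebraMap R B) = σ.comp (algebraMap R A)) :
    ∃ (C : Type u) (_ : CommRing C) (_ : Algebra A C),
      IsBlowupChart C (I.map (algebraMap R A)) (algebraMap R A a) ∧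
      ∃ ψ' : C →+* O, EssEtale ψ' ∧ ψ'.comp (algebraMap A C) = σ := by
  let C := Localization (Algebra.algebraMapSubmonoid B M)
  let : Algebra A C := localizationAlgebra M B
  have : IsScalarTower R A C := IsScalarTower.of_algebraMap_eq' (by
    rw [IsScalarTower.algebraMap_eq R B C]
    exact (IsLocalization.map_comp _).symm)
  have hunit : ∀ y : Algebra.algebraMapSubmonoid B M, IsUnit (ψ y) := by
    rintro ⟨_, m, hm, rfl⟩
    have := congr($hσ m)
    change IsUnit ((ψ.comp (algebraMap R B)) m)
    rw [this]
    exact (IsLocalization.map_units A (⟨m, hm⟩ : M)).map σ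
  let ψ' : C →+* O := IsLocalization.lift hunit
  have hψ' : ψ'.comp (algebraMap B C) = ψ := IsLocalization.lift_comp hunit
  refine ⟨C, inferInstance, inferInstance, h.localization M, ψ', ?_, ?_⟩
  · let := ψ.toAlgebra
    let := ψ'.toAlgebra
    have : IsScalarTower B C O := IsScalarTower.of_algebraMap_eq' hψ'.symm
    exact EssEtale.of_comp_isLocalization (B := C) (Algebra.algebraMapSubmonoid B M) hψ
  · refine IsLocalization.ringHom_ext M ?_
    rw [RingHom.comp_assoc, ← IsScalarTower.algebraMap_eq, IsScalarTower.algebraMap_eq R B C,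
      ← RingHom.comp_assoc, hψ', hσ]

/-- Clearing denominators turns the `c i` into elements of `I`; finitely many generators of `I` need
only one common denominator `s`. Generators of a stalk thereby spread to a neighbourhood. -/
theorem exists_generators_of_localization {R A : Type u} [CommRing R] [CommRing A] [Algebra R A]
    (M : Submonoid R) [IsLocalization M A] {I : Ideal R} (hI : I.FG) {ι : Type*} [Finite ι]
    {c : ι → A} (hc : I.map (algebraMap R A) = Ideal.span (Set.range c)) :
    ∃ s ∈ M, ∃ a : ι → R, (∀ i, a i ∈ I) ∧
      (∀ i, ∃ u, IsUnit u ∧ algebraMap R A (a i) = u * c i) ∧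
      ∀ b ∈ I, s * b ∈ Ideal.span (Set.range a) := by
  classical
  have h₁ : ∀ i, ∃ a ∈ I, ∃ u, IsUnit u ∧ algebraMap R A a = u * c i := by
    intro i
    obtain ⟨⟨⟨a, ha⟩, ⟨m, hm⟩⟩, h⟩ := (IsLocalization.mem_map_algebraMap_iff M A).mp
      (hc ▸ Ideal.subset_span ⟨i, rfl⟩ : c i ∈ I.map (algebraMap R A))
    exact ⟨a, ha, _, IsLocalization.map_units A (⟨m, hm⟩ : M), by rw [mul_comm]; exact h.symm⟩
  choose a ha hu using h₁
  have hspan : (Ideal.span (Set.range a)).map (algebraMap R A) = I.map (algebraMap R A) := by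
    refine le_antisymm (Ideal.map_mono (Ideal.span_le.mpr (by rintro _ ⟨i, rfl⟩; exact ha i))) ?_
    rw [hc, Ideal.span_le]
    rintro _ ⟨i, rfl⟩
    obtain ⟨u, hu, h⟩ := hu i
    have := Ideal.mem_map_of_mem (algebraMap R A) (Ideal.subset_span ⟨i, rfl⟩ : a i ∈ Ideal.span (Set.range a))
    rw [h] at this
    exact (Ideal.unit_mul_mem_iff_mem _ hu).mp this
  obtain ⟨T, rfl⟩ := hI
  have key : ∀ T' : Finset R, T' ⊆ T → ∃ s ∈ M, ∀ b ∈ Submodule.span R (T' : Set R),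
      s * b ∈ Ideal.span (Set.range a) := by
    intro T'
    induction T' using Finset.induction_on with
    | empty => exact fun _ => ⟨1, one_mem _, fun f hf => by
        rw [Finset.coe_empty, Submodule.span_empty, Submodule.mem_bot] at hf
        simp [hf]⟩
    | insert f T' _ ih =>
      intro hT'
      obtain ⟨r, hr, h⟩ := ih ((Finset.subset_insert _ _).trans hT')
      have hf := Ideal.mem_map_of_mem (algebraMap R A)
        (Submodule.subset_span (hT' (Finset.mem_insert_self _ _)) : f ∈ Submodule.span R (T : Set R))
      rw [← hspan] at hf
      obtain ⟨⟨⟨b, hb⟩, ⟨m, hm⟩⟩, h'⟩ := (IsLocalization.mem_map_algebraMap_iff M A).mp hf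
      change algebraMap R A f * algebraMap R A m = algebraMap R A b at h'
      rw [← map_mul] at h'
      obtain ⟨⟨m', hm'⟩, h''⟩ := (IsLocalization.eq_iff_exists M A).mp h'
      change m' * (f * m) = m' * b at h''
      refine ⟨r * (m' * m), mul_mem hr (mul_mem hm' hm), fun f' hf' => ?_⟩
      rw [Finset.coe_insert, Submodule.mem_span_insert] at hf'
      obtain ⟨c, f₁, hf₁, rfl⟩ := hf'
      have : r * (m' * m) * (c • f + f₁) = r * c * (m' * (f * m)) + m' * m * (r * f₁) := by
        rw [smul_eq_mul]; ring
      rw [this, h'']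
      exact add_mem (Ideal.mul_mem_left _ _ (Ideal.mul_mem_left _ _ hb))
        (Ideal.mul_mem_left _ _ (h _ hf₁))
  obtain ⟨s, hs, h⟩ := key T le_rfl
  exact ⟨s, hs, a, ha, hu, h⟩

/-- The annihilator of `a` becomes zero in the localization, that is, it is generated there by the
empty family. -/
theorem exists_annihilator_of_localization {R A : Type u} [CommRing R] [CommRing A] [Algebra R A]
    [IsNoetherianRing R] (M : Submonoid R) [IsLocalization M A] {a : R}
    (ha : ∀ b, algebraMap R A a * b = 0 → b = 0) :
    ∃ s ∈ M, ∀ b, a * b = 0 → s * b = 0 := by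
  obtain ⟨s, hs, a', ha', -, h⟩ := exists_generators_of_localization (A := A) M
    (IsNoetherian.noetherian (LinearMap.ker (LinearMap.mulLeft R a)))
    (ι := Empty) (c := Empty.elim) (by
      rw [Set.range_eq_empty, Ideal.span_empty, eq_bot_iff, Ideal.map_le_iff_le_comap]
      intro b hb
      exact ha _ (by rw [← map_mul, show a * b = 0 from hb, map_zero]))
  refine ⟨s, hs, fun b hb => ?_⟩
  have := h b hb
  rwa [Set.range_eq_empty, Ideal.span_empty] at this

section Shrink

variable {W : Scheme.{u}} [IsLocallyNoetherian W] {w : W}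

theorem exists_affineOpen_ideal_eq_span (J : W.IdealSheafData)
    {ι : Type*} [Finite ι] {c : ι → W.presheaf.stalk w}
    (hc : ∀ (U : W.Opens) (hU : IsAffineOpen U) (hw : w ∈ U),
      (J.ideal ⟨U, hU⟩).map (W.presheaf.germ U w hw).hom = Ideal.span (Set.range c)) :
    ∃ (U : W.Opens) (hU : IsAffineOpen U) (hw : w ∈ U) (a : ι → Γ(W, U)),
      J.ideal ⟨U, hU⟩ = Ideal.span (Set.range a) ∧
      ∀ i, ∃ u, IsUnit u ∧ (W.presheaf.germ U w hw).hom (a i) = u * c i := by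
  obtain ⟨_, ⟨U, hU, rfl⟩, hw, -⟩ := W.isBasis_affineOpens.exists_subset_of_mem_open
    (Set.mem_univ w) isOpen_univ
  replace hU : IsAffineOpen U := hU
  replace hw : w ∈ U := hw
  have : IsNoetherianRing Γ(W, U) := IsLocallyNoetherian.component_noetherian ⟨U, hU⟩
  let : Algebra Γ(W, U) (W.presheaf.stalk w) := (W.presheaf.germ U w hw).hom.toAlgebra
  have hloc : IsLocalization.AtPrime (W.presheaf.stalk w) (hU.primeIdealOf ⟨w, hw⟩).asIdeal :=
    hU.isLocalization_stalk ⟨w, hw⟩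
  obtain ⟨s, hs, a, haI, hau, h⟩ := exists_generators_of_localization
    (hU.primeIdealOf ⟨w, hw⟩).asIdeal.primeCompl (IsNoetherian.noetherian (J.ideal ⟨U, hU⟩))
    (hc U hU hw)
  have hsu : IsUnit ((W.presheaf.germ U w hw).hom s) :=
    IsLocalization.map_units (W.presheaf.stalk w)
      (⟨s, hs⟩ : (hU.primeIdealOf ⟨w, hw⟩).asIdeal.primeCompl)
  have hwV : w ∈ W.basicOpen s := (W.mem_basicOpen s w hw).mpr hsu
  let ρ : Γ(W, U) →+* Γ(W, W.basicOpen s) :=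
    (W.presheaf.map (homOfLE (W.basicOpen_le s)).op).hom
  have hρs : IsUnit (ρ s) := RingedSpace.isUnit_res_basicOpen W.toRingedSpace s
  refine ⟨W.basicOpen s, hU.basicOpen s, hwV, fun i => ρ (a i), ?_, fun i => ?_⟩
  · have hJ : J.ideal ⟨W.basicOpen s, hU.basicOpen s⟩ = (J.ideal ⟨U, hU⟩).map ρ :=
      (J.map_ideal (U := ⟨W.basicOpen s, hU.basicOpen s⟩) (V := ⟨U, hU⟩) (W.basicOpen_le s)).symm
    rw [hJ]
    apply le_antisymm
    · rw [Ideal.map_le_iff_le_comap]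
      intro b hb
      have h₁ := Ideal.mem_map_of_mem ρ (h b hb)
      rw [map_mul, Ideal.map_span, ← Set.range_comp] at h₁
      exact (Ideal.unit_mul_mem_iff_mem _ hρs).mp h₁
    · rw [Ideal.span_le]
      rintro _ ⟨i, rfl⟩
      exact Ideal.mem_map_of_mem ρ (haI i)
  · obtain ⟨u, hu, h'⟩ := hau i
    refine ⟨u, hu, h' ▸ ?_⟩
    exact W.presheaf.germ_res_apply (homOfLE (W.basicOpen_le s)) w hwV (a i)

theorem exists_affineOpen_isRegular {U : W.Opens} (hU : IsAffineOpen U) (hw : w ∈ U)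
    {a : Γ(W, U)} (ha : ∀ b, (W.presheaf.germ U w hw).hom a * b = 0 → b = 0) :
    ∃ (V : W.Opens) (_ : IsAffineOpen V) (_ : w ∈ V) (hVU : V ≤ U),
      ∀ b, W.presheaf.map (homOfLE hVU).op a * b = 0 → b = 0 := by
  have : IsNoetherianRing Γ(W, U) := IsLocallyNoetherian.component_noetherian ⟨U, hU⟩
  let : Algebra Γ(W, U) (W.presheaf.stalk w) := (W.presheaf.germ U w hw).hom.toAlgebra
  have hloc : IsLocalization.AtPrime (W.presheaf.stalk w) (hU.primeIdealOf ⟨w, hw⟩).asIdeal :=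
    hU.isLocalization_stalk ⟨w, hw⟩
  obtain ⟨s, hs, h⟩ := exists_annihilator_of_localization
    (hU.primeIdealOf ⟨w, hw⟩).asIdeal.primeCompl ha
  have hsu : IsUnit ((W.presheaf.germ U w hw).hom s) :=
    IsLocalization.map_units (W.presheaf.stalk w)
      (⟨s, hs⟩ : (hU.primeIdealOf ⟨w, hw⟩).asIdeal.primeCompl)
  refine ⟨W.basicOpen s, hU.basicOpen s, (W.mem_basicOpen s w hw).mpr hsu, W.basicOpen_le s,
    fun b hb => ?_⟩
  let ρ : Γ(W, U) →+* Γ(W, W.basicOpen s) :=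
    (W.presheaf.map (homOfLE (W.basicOpen_le s)).op).hom
  let := ρ.toAlgebra
  have hloc' : IsLocalization.Away s Γ(W, W.basicOpen s) := hU.isLocalization_basicOpen s
  obtain ⟨⟨b₀, ⟨_, n, rfl⟩⟩, hb₀⟩ := IsLocalization.surj (Submonoid.powers s) b
  change b * ρ (s ^ n) = ρ b₀ at hb₀
  have h₁ : ρ (a * b₀) = 0 := by
    rw [map_mul, ← hb₀, ← mul_assoc]
    exact (congrArg (· * _) hb).trans (zero_mul _)
  obtain ⟨⟨_, m, rfl⟩, hm⟩ :=
    (IsLocalization.map_eq_zero_iff (Submonoid.powers s) Γ(W, W.basicOpen s) _).mp h₁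
  change s ^ m * (a * b₀) = 0 at hm
  have h₂ := h (s ^ m * b₀) (by rw [← hm]; ring)
  have hρs : IsUnit (ρ s) := IsLocalization.Away.algebraMap_isUnit s
  have h₃ := congrArg ρ h₂
  rw [map_mul, map_mul, map_zero, map_pow, ← hb₀] at h₃
  rw [map_pow] at h₃
  exact ((hρs.pow n).mul_left_eq_zero).mp (((hρs.pow m).mul_right_eq_zero).mp
    ((hρs.mul_right_eq_zero).mp h₃))

end Shrink

open Blowup in
-- Since `I ^ (n + 1) = I I ^ n`, the elements `a i T` of degree one generate the irrelevant ideal.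
theorem iSup_basicOpen_reesGen {A : Type u} [CommRing A] {I : Ideal A} {ι : Type*} {a : ι → A}
    (haI : ∀ i, a i ∈ I) (hI : I = Ideal.span (Set.range a)) :
    ⨆ i, Proj.basicOpen (reesGrading I) (reesGen (haI i)) = ⊤ := by
  apply Proj.iSup_basicOpen_eq_top
  refine (HomogeneousIdeal.toIdeal_irrelevant_le _).mpr ?_
  rintro n hn ⟨f, hf⟩ ⟨r, hr⟩
  obtain rfl : Polynomial.monomial n r = f := hr
  obtain ⟨n, rfl⟩ := Nat.exists_eq_succ_of_ne_zero hn.ne'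
  have hr : r ∈ I ^ (n + 1) := reesAlgebra.monomial_mem.mp hf
  have key : ∀ b ∈ Ideal.span (Set.range a), ∀ e ∈ I ^ n,
      ∃ g ∈ Ideal.span (Set.range fun i => reesGen (haI i)),
        (g : Polynomial A) = Polynomial.monomial (n + 1) (b * e) := by
    intro b hb
    induction hb using Submodule.span_induction with
    | zero => exact fun e _ => ⟨0, zero_mem _, by simp⟩
    | mem b hb =>
      obtain ⟨i, rfl⟩ := hb
      intro e he
      refine ⟨reesGen (haI i) * ⟨Polynomial.monomial n e, reesAlgebra.monomial_mem.mpr he⟩,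
        Ideal.mul_mem_right _ _ (Ideal.subset_span ⟨i, rfl⟩), ?_⟩
      change Polynomial.monomial 1 (a i) * Polynomial.monomial n e = _
      rw [Polynomial.monomial_mul_monomial, add_comm 1 n]
    | add b b' _ _ h h' =>
      intro e he
      obtain ⟨g, hg, h⟩ := h e he
      obtain ⟨g', hg', h'⟩ := h' e he
      exact ⟨g + g', add_mem hg hg', by rw [add_mul, map_add, ← h, ← h']; rfl⟩
    | smul r b _ h =>
      intro e he
      obtain ⟨g, hg, h⟩ := h (r * e) (Ideal.mul_mem_left _ _ he)
      exact ⟨g, hg, by rw [h, smul_eq_mul]; congr 1; ring⟩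
  have key' : ∀ r ∈ I ^ (n + 1), ∃ g ∈ Ideal.span (Set.range fun i => reesGen (haI i)),
      (g : Polynomial A) = Polynomial.monomial (n + 1) r := by
    intro r hr
    rw [pow_succ'] at hr
    induction hr using Submodule.mul_induction_on' with
    | mem_mul_mem b hb e he => exact key b (hI ▸ hb) e he
    | add b _ b' _ h h' =>
      obtain ⟨g, hg, h⟩ := h
      obtain ⟨g', hg', h'⟩ := h'
      exact ⟨g + g', add_mem hg hg', by rw [map_add, ← h, ← h']; rfl⟩
  obtain ⟨g, hg, h⟩ := key' r hr
  have : (⟨Polynomial.monomial (n + 1) r, hf⟩ : reesAlgebra I) = g := Subtype.ext h.symm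
  change (⟨Polynomial.monomial (n + 1) r, hf⟩ : reesAlgebra I) ∈ Ideal.span _
  rw [this]
  exact hg

end NodalResolution

/-! ### Charts of the blowup of a scheme, and their local rings. -/

namespace NodalResolution
open Blowup Scheme

theorem isNoetherianRing_opensRange {W : Scheme.{u}} {B : Type u} [CommRing B]
    [IsNoetherianRing B] (h : Spec (.of B) ⟶ W) [IsOpenImmersion h] :
    IsNoetherianRing Γ(W, h.opensRange) :=
  isNoetherianRing_of_ringEquiv B
    ((IsOpenImmersion.ΓIsoTop h).symm ≪≫ Scheme.ΓSpecIso (.of B)).symm.commRingCatIsoToRingEquiv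

theorem IsBlowupChart.bijective_algebraMap {A C : Type u} [CommRing A] [CommRing C] [Algebra A C]
    {I : Ideal A} {a : A} (h : IsBlowupChart C I a) (hI : I = Ideal.span {a})
    (ha : ∀ b, a * b = 0 → b = 0) : Function.Bijective (algebraMap A C) := by
  constructor
  · refine (injective_iff_map_eq_zero _).mpr fun b hb => ?_
    obtain ⟨n, hn⟩ := h.exists_pow_mul_eq_zero b hb
    clear hb
    induction n with
    | zero => simpa using hn
    | succ n ih => exact ih (ha _ (by rw [← mul_assoc, ← pow_succ', hn]))
  · intro z
    obtain ⟨n, b, hb, h'⟩ := h.exists_pow_mul_eq z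
    rw [hI, Ideal.span_singleton_pow, Ideal.mem_span_singleton] at hb
    obtain ⟨b', rfl⟩ := hb
    refine ⟨b', sub_eq_zero.mp (h.pow_regular n _ ?_)⟩
    rw [map_mul, map_pow] at h'
    rw [mul_sub, h', sub_self]

section Blowup

variable {W : Scheme.{u}} (J : W.IdealSheafData)

/-- The inclusion of the blowup of an affine open subscheme in the blowup. -/
noncomputable def blowupAffineι (U : W.affineOpens) : Proj (reesGrading (J.ideal U)) ⟶ blowup J :=
  colimit.ι (blowupFunctor J) (U : W.AffineZariskiSite)

instance (U : W.affineOpens) : IsOpenImmersion (blowupAffineι J U) :=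
  MorphismProperty.of_isPullback (P := @IsOpenImmersion)
    (isPullback_blowupπ J (U : W.AffineZariskiSite)) inferInstance

theorem isPullback_blowupAffineι (U : W.affineOpens) :
    IsPullback (projToSpec (J.ideal U)) (blowupAffineι J U)
      (IsAffineOpen.fromSpec U.2) (blowupπ J) := by
  have h := isPullback_blowupπ J (U : W.AffineZariskiSite)
  exact h.of_iso (Iso.refl _) (IsAffineOpen.isoSpec U.2) (Iso.refl _) (Iso.refl _)
    ((Category.assoc _ _ _).trans ((congrArg (projToSpec (J.ideal U) ≫ ·)
      (IsAffineOpen.isoSpec U.2).inv_hom_id).trans ((Category.comp_id _).trans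
        (Category.id_comp _).symm)))
    ((Category.comp_id _).trans (Category.id_comp _).symm)
    ((Category.comp_id _).trans (IsAffineOpen.isoSpec_hom_fromSpec U.2).symm)
    ((Category.comp_id _).trans (Category.id_comp _).symm)

/-- The inclusion of the chart `D₊(a T)` in the blowup. -/
noncomputable def blowupChart (U : W.affineOpens) {a : Γ(W, U.1)} (ha : a ∈ J.ideal U) :
    Spec (.of (HomogeneousLocalization.Away (reesGrading (J.ideal U)) (reesGen ha))) ⟶ blowup J :=
  Proj.awayι (reesGrading (J.ideal U)) (reesGen ha) (reesGen_mem ha) one_pos ≫ blowupAffineι J U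

instance (U : W.affineOpens) {a : Γ(W, U.1)} (ha : a ∈ J.ideal U) :
    IsOpenImmersion (blowupChart J U ha) :=
  IsOpenImmersion.comp _ _

theorem blowupChart_blowupπ (U : W.affineOpens) {a : Γ(W, U.1)} (ha : a ∈ J.ideal U) :
    blowupChart J U ha ≫ blowupπ J =
      Spec.map (CommRingCat.ofHom (toAway (J.ideal U) (reesGen ha))) ≫
        IsAffineOpen.fromSpec U.2 := by
  rw [blowupChart, Category.assoc, ← (isPullback_blowupAffineι J U).w, ← Category.assoc,
    awayι_projToSpec]

theorem exists_blowupChart_apply (U : W.affineOpens) {ι : Type*}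
    {a : ι → Γ(W, U.1)} (ha : ∀ i, a i ∈ J.ideal U)
    (hJ : J.ideal U = Ideal.span (Set.range a)) (w : blowup J) (hw : blowupπ J w ∈ U.1) :
    ∃ i P, blowupChart J U (ha i) P = w := by
  obtain ⟨x, hx⟩ : ∃ x, blowupAffineι J U x = w := by
    obtain ⟨y, hy⟩ : blowupπ J w ∈ Set.range (IsAffineOpen.fromSpec U.2) := by
      exact (IsAffineOpen.range_fromSpec U.2).ge hw
    obtain ⟨x, -, hx⟩ := exists_preimage_of_isPullback (isPullback_blowupAffineι J U) y w hy
    exact ⟨x, hx⟩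
  obtain ⟨i, hi⟩ := Opens.mem_iSup.mp ((iSup_basicOpen_reesGen ha hJ).ge (Set.mem_univ x))
  rw [← Proj.opensRange_awayι _ _ (reesGen_mem (ha i)) one_pos] at hi
  obtain ⟨P, hP⟩ := hi
  refine ⟨i, P, ?_⟩
  rw [blowupChart, Scheme.Hom.comp_apply, hP, hx]

theorem exists_stalk_of_isBlowupChart {W W' : Scheme.{u}} (g : W' ⟶ W) {U : W.Opens}
    (hU : IsAffineOpen U) {B : Type u} [CommRing B] [Algebra Γ(W, U) B] {I : Ideal Γ(W, U)}
    {a : Γ(W, U)} (hB : IsBlowupChart B I a) (h : Spec (.of B) ⟶ W') [IsOpenImmersion h]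
    (hg : h ≫ g = Spec.map (CommRingCat.ofHom (algebraMap Γ(W, U) B)) ≫ hU.fromSpec)
    (w : W') (P) (hP : h P = w) (hw : g w ∈ U) :
    ∃ (C : Type u) (_ : CommRing C) (_ : Algebra (W.presheaf.stalk (g w)) C),
      IsBlowupChart C (I.map (W.presheaf.germ U _ hw).hom) ((W.presheaf.germ U _ hw).hom a) ∧
      ∃ ψ : C →+* W'.presheaf.stalk w, EssEtale ψ ∧
        ψ.comp (algebraMap _ C) = (g.stalkMap w).hom := by
  obtain ⟨ψ, ⟨M, hM⟩, hψ⟩ := exists_stalk_of_isOpenImmersion h hP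
  have hcomp := comp_eq_stalkMap_comp_germ g h hψ hU hw _ hg
  let : Algebra Γ(W, U) (W.presheaf.stalk (g w)) := (W.presheaf.germ U (g w) hw).hom.toAlgebra
  have hloc : IsLocalization.AtPrime (W.presheaf.stalk (g w)) (hU.primeIdealOf ⟨_, hw⟩).asIdeal :=
    hU.isLocalization_stalk ⟨_, hw⟩
  have hEE : EssEtale ψ.hom := by
    let := ψ.hom.toAlgebra
    exact EssEtale.of_isLocalization M
  exact IsBlowupChart.exists_localization (hU.primeIdealOf ⟨_, hw⟩).asIdeal.primeCompl hB hEE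
    (g.stalkMap w).hom (congrArg CommRingCat.Hom.hom hcomp)

theorem exists_stalk_blowupChart_apply (U : W.affineOpens) {a : Γ(W, U.1)} (ha : a ∈ J.ideal U)
    (w : blowup J) (P) (hP : blowupChart J U ha P = w) (hw : blowupπ J w ∈ U.1) :
    ∃ (C : Type u) (_ : CommRing C) (_ : Algebra (W.presheaf.stalk (blowupπ J w)) C),
      IsBlowupChart C ((J.ideal U).map (W.presheaf.germ U.1 _ hw).hom)
        ((W.presheaf.germ U.1 _ hw).hom a) ∧
      ∃ ψ : C →+* (blowup J).presheaf.stalk w, EssEtale ψ ∧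
        ψ.comp (algebraMap _ C) = ((blowupπ J).stalkMap w).hom :=
  @exists_stalk_of_isBlowupChart W (blowup J) (blowupπ J) U.1 U.2 _ _
    (toAway (J.ideal U) (reesGen ha)).toAlgebra _ _ (isBlowupChart_toAway ha)
    (blowupChart J U ha) _ (blowupChart_blowupπ J U ha) w P hP hw

/-- For a principal ideal with regular generator the single chart covers the blowup, and its ring
`A[I / a]` is `A`. -/
theorem isIso_projToSpec {A : Type u} [CommRing A] {I : Ideal A} {a : A}
    (hI : I = Ideal.span {a}) (ha : ∀ b, a * b = 0 → b = 0) : IsIso (projToSpec I) := by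
  have haI : a ∈ I := hI ▸ Ideal.subset_span rfl
  have htop := iSup_basicOpen_reesGen (I := I) (ι := Unit) (a := fun _ => a) (fun _ => haI)
    (by rw [hI, Set.range_const])
  rw [iSup_const] at htop
  have : IsIso (Proj.awayι (reesGrading I) (reesGen haI) (reesGen_mem haI) one_pos) := by
    have : Surjective (Proj.awayι (reesGrading I) (reesGen haI) (reesGen_mem haI) one_pos) := by
      refine ⟨Set.range_eq_univ.mp ?_⟩
      have h := Proj.opensRange_awayι (reesGrading I) (reesGen haI) (reesGen_mem haI) one_pos
      rw [htop] at h
      exact congrArg SetLike.coe h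
    exact IsOpenImmersion.isIso _
  have hch := isBlowupChart_toAway haI
  have hbij : Function.Bijective (toAway I (reesGen haI)) := by
    let := (toAway I (reesGen haI)).toAlgebra
    exact hch.bijective_algebraMap hI ha
  have h := awayι_projToSpec I (reesGen haI) (reesGen_mem haI) one_pos
  have : IsIso (Spec.map (CommRingCat.ofHom (toAway I (reesGen haI)))) := by
    have : IsIso (CommRingCat.ofHom (toAway I (reesGen haI))) :=
      (ConcreteCategory.isIso_iff_bijective _).mpr hbij
    infer_instance
  rw [← h] at this
  exact IsIso.of_isIso_comp_left (Proj.awayι (reesGrading I) (reesGen haI) (reesGen_mem haI) one_pos) _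

theorem isIso_blowupπ_of_ideal_eq_span (U : W.affineOpens) {a : Γ(W, U.1)}
    (hJ : J.ideal U = Ideal.span {a}) (ha : ∀ b, a * b = 0 → b = 0) :
    IsIso (blowupπ J ∣_ U.1) := by
  have h₁ : IsPullback (projToSpec (J.ideal U) ≫ (IsAffineOpen.isoSpec U.2).inv)
    (blowupAffineι J U) U.1.ι (blowupπ J) := isPullback_blowupπ J (U : W.AffineZariskiSite)
  have := isIso_projToSpec hJ ha
  have h₂ := (isPullback_morphismRestrict (blowupπ J) U.1).isoIsPullback_hom_fst _ _ h₁
  rw [← h₂]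
  infer_instance

variable [IsLocallyNoetherian W]

/-- The generators of the stalk spread out, up to units, to an affine neighbourhood, whose charts
cover the blowup; localizing brings the chart back to the local ring below. The units do not affect
the chart. -/
theorem exists_stalk_blowupChart (w : blowup J) {ι : Type*} [Finite ι]
    {c : ι → W.presheaf.stalk (blowupπ J w)}
    (hc : ∀ (U : W.Opens) (hU : IsAffineOpen U) (hw : blowupπ J w ∈ U),
      (J.ideal ⟨U, hU⟩).map (W.presheaf.germ U _ hw).hom = Ideal.span (Set.range c)) :
    ∃ (i : ι) (C : Type u) (_ : CommRing C) (_ : Algebra (W.presheaf.stalk (blowupπ J w)) C),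
      IsBlowupChart C (Ideal.span (Set.range c)) (c i) ∧
      ∃ ψ : C →+* (blowup J).presheaf.stalk w, EssEtale ψ ∧
        ψ.comp (algebraMap _ C) = ((blowupπ J).stalkMap w).hom := by
  obtain ⟨U, hU, hw, a, ha, hu⟩ := exists_affineOpen_ideal_eq_span J hc
  have haI : ∀ i, a i ∈ J.ideal ⟨U, hU⟩ := fun i => ha ▸ Ideal.subset_span ⟨i, rfl⟩
  obtain ⟨i, P, hP⟩ := exists_blowupChart_apply J ⟨U, hU⟩ haI ha w hw
  obtain ⟨C, _, _, hC, ψ, hψ, hψ'⟩ := exists_stalk_blowupChart_apply J ⟨U, hU⟩ (haI i) w P hP hw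
  refine ⟨i, C, inferInstance, inferInstance, ?_, ψ, hψ, hψ'⟩
  obtain ⟨u, hu, h⟩ := hu i
  rw [h] at hC
  have h₂ := hc U hU hw
  exact (h₂ ▸ hC).of_unit_mul hu

theorem isLocallyNoetherian_blowup : IsLocallyNoetherian (blowup J) := by
  have hB : ∀ (U : W.affineOpens) (a : Γ(W, U.1)) (ha : a ∈ J.ideal U), IsNoetherianRing
      (HomogeneousLocalization.Away (reesGrading (J.ideal U)) (reesGen ha)) := by
    intro U a ha
    have : IsNoetherianRing Γ(W, U.1) := IsLocallyNoetherian.component_noetherian U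
    exact @IsBlowupChart.isNoetherianRing _ _ _ _ (toAway (J.ideal U) (reesGen ha)).toAlgebra _ _ _
      (isBlowupChart_toAway ha)
  let S : (Σ U : W.affineOpens, {a : Γ(W, U.1) // a ∈ J.ideal U}) → (blowup J).affineOpens :=
    fun i => ⟨(blowupChart J i.1 i.2.2).opensRange, isAffineOpen_opensRange _⟩
  have hS : ⨆ i, (S i : (blowup J).Opens) = ⊤ := by
    refine top_le_iff.mp fun w _ => ?_
    obtain ⟨_, ⟨U, hU, rfl⟩, hw, -⟩ := W.isBasis_affineOpens.exists_subset_of_mem_open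
      (Set.mem_univ (blowupπ J w)) isOpen_univ
    let U' : W.affineOpens := ⟨U, hU⟩
    have hw' : blowupπ J w ∈ U'.1 := hw
    obtain ⟨i, P, hP⟩ := exists_blowupChart_apply J U'
      (ι := {a : Γ(W, U'.1) // a ∈ J.ideal U'}) (a := Subtype.val) (fun i => i.2)
      (by rw [Subtype.range_coe_subtype]; exact (Ideal.span_eq _).symm) w hw'
    have : w ∈ (S ⟨U', i⟩ : (blowup J).Opens) := ⟨P, hP⟩
    exact Opens.mem_iSup.mpr ⟨⟨U', i⟩, this⟩
  refine isLocallyNoetherian_of_affine_cover hS ?_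
  rintro ⟨U, a, ha⟩
  have := hB U a ha
  exact isNoetherianRing_opensRange (blowupChart J U ha)

/-- Both the principal generator and its regularity extend from the stalk to a neighbourhood. -/
theorem exists_isIso_blowupπ {w : W} {c : W.presheaf.stalk w}
    (hreg : ∀ b, c * b = 0 → b = 0)
    (hc : ∀ (U : W.Opens) (hU : IsAffineOpen U) (hw : w ∈ U),
      (J.ideal ⟨U, hU⟩).map (W.presheaf.germ U w hw).hom = Ideal.span {c}) :
    ∃ V : W.Opens, w ∈ V ∧ IsIso (blowupπ J ∣_ V) := by
  obtain ⟨U, hU, hw, a, ha, hu⟩ := exists_affineOpen_ideal_eq_span J (ι := Unit) (c := fun _ => c)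
    (by simpa using hc)
  obtain ⟨u, hu, h⟩ := hu ()
  obtain ⟨V, hV, hwV, hVU, hreg'⟩ := exists_affineOpen_isRegular hU hw (a := a ()) (by
    intro b hb
    rw [h, mul_assoc] at hb
    exact hreg b ((hu.mul_right_eq_zero).mp hb))
  refine ⟨V, hwV, isIso_blowupπ_of_ideal_eq_span J ⟨V, hV⟩
    (a := W.presheaf.map (homOfLE hVU).op (a ())) ?_ hreg'⟩
  rw [← J.map_ideal (U := ⟨V, hV⟩) (V := ⟨U, hU⟩) hVU, ha, Ideal.map_span, ← Set.range_comp,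
    Set.range_unique]
  rfl

end Blowup

end NodalResolution

namespace NodalResolution
open Scheme

/-! ## The resolution process -/

section

variable {R A B : Type u} [CommRing R] [CommRing A] [CommRing B] {ι : Type}

theorem memProduct_comap_iff {ρ : R →+* A} {z : ι → R} {x₀ : A} {i : ι} {φ : A →+* B}
    {P : Ideal B} :
    MemProduct ρ z x₀ i (P.comap φ) ↔ MemProduct (φ.comp ρ) z (φ x₀) i P :=
  ⟨fun h => ⟨h.1, h.2, h.3⟩, fun h => ⟨h.1, h.2, h.3⟩⟩

theorem memDiagonal_comap_iff {ρ : R →+* A} {z : ι → R} {x₀ y₀ : A} {a b : R} {φ : A →+* B}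
    {P : Ideal B} :
    MemDiagonal ρ z x₀ y₀ a b (P.comap φ) ↔ MemDiagonal (φ.comp ρ) z (φ x₀) (φ y₀) a b P := by
  constructor
  · exact fun h => ⟨by simpa using h.1, by simpa using h.2, h.3⟩
  · exact fun h => ⟨by simpa using h.1, by simpa using h.2, h.3⟩

end

theorem apply_fromSpecStalk {W W' : Scheme.{u}} (g : W' ⟶ W) (w : W')
    (P : PrimeSpectrum (W'.presheaf.stalk w)) :
    g (W'.fromSpecStalk w P) =
      W.fromSpecStalk (g w) (PrimeSpectrum.comap (g.stalkMap w).hom P) := by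
  have := congr($(SpecMap_stalkMap_fromSpecStalk (f := g) (x := w)) P)
  exact this.symm

variable {Y X : Scheme.{u}} {ι : Type} (z : ∀ y : Y, ι → Y.presheaf.stalk y)
  (c : ∀ p : X, Fin 2 → X.presheaf.stalk p)

/-- All points of `W` have a chart compatible with the functions `z` and `c`. -/
def HasState {W : Scheme.{u}} (r : W ⟶ Y) (v : W ⟶ X) (Q : Finset ι → Prop) : Prop :=
  ∀ w, ∃ S M N x y, State (r.stalkMap w).hom (z (r w)) ((v.stalkMap w).hom (c (v w) 0))
    ((v.stalkMap w).hom (c (v w) 1)) S M N x y ∧ Q S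

/-- The set `E` is locally cut out by the equations of a product of components. -/
def IsProductLocus {W : Scheme.{u}} (r : W ⟶ Y) (v : W ⟶ X) (E : Set W) (i : ι) (k : Fin 2) :
    Prop :=
  ∀ w (P : PrimeSpectrum (W.presheaf.stalk w)), W.fromSpecStalk w P ∈ E ↔
    MemProduct (r.stalkMap w).hom (z (r w)) ((v.stalkMap w).hom (c (v w) k)) i P.asIdeal

/-- Near points of `F`, the set `E` is locally cut out by the equations of a diagonal. -/
def IsDiagonalLocus [Fintype ι] [DecidableEq ι] {W : Scheme.{u}} (r : W ⟶ Y) (v : W ⟶ X)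
    (F E : Set W) : Prop :=
  ∀ w ∈ F, ∃ (T : Finset ι) (a b : Y.presheaf.stalk (r w)), a * b = 1 ∧
    ∀ P : PrimeSpectrum (W.presheaf.stalk w), W.fromSpecStalk w P ∈ E ↔
      MemDiagonal (r.stalkMap w).hom (z (r w)) ((v.stalkMap w).hom (c (v w) 0))
        ((v.stalkMap w).hom (c (v w) 1)) (a * ∏ i ∈ T, z (r w) i) (b * ∏ i ∈ Tᶜ, z (r w) i)
        P.asIdeal

variable {z c}

theorem IsProductLocus.preimage {W W' : Scheme.{u}} {r : W ⟶ Y} {v : W ⟶ X} {E : Set W} {i : ι}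
    {k : Fin 2} (h : IsProductLocus z c r v E i k) (g : W' ⟶ W) :
    IsProductLocus z c (g ≫ r) (g ≫ v) (g ⁻¹' E) i k := by
  intro w P
  rw [Set.mem_preimage, apply_fromSpecStalk, h, Hom.stalkMap_comp, Hom.stalkMap_comp]
  exact memProduct_comap_iff

theorem IsDiagonalLocus.preimage [Fintype ι] [DecidableEq ι] {W W' : Scheme.{u}} {r : W ⟶ Y}
    {v : W ⟶ X} {F E : Set W} (h : IsDiagonalLocus z c r v F E) (g : W' ⟶ W) :
    IsDiagonalLocus z c (g ≫ r) (g ≫ v) (g ⁻¹' F) (g ⁻¹' E) := by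
  intro w hw
  obtain ⟨T, a, b, hab, hT⟩ := h (g w) hw
  refine ⟨T, a, b, hab, fun P => ?_⟩
  rw [Set.mem_preimage, apply_fromSpecStalk, hT, Hom.stalkMap_comp, Hom.stalkMap_comp]
  exact memDiagonal_comap_iff

/-- The condition on an ideal sheaf that ensures that the blowup has charts again. -/
def HasCenters [DecidableEq ι] (z : ∀ y : Y, ι → Y.presheaf.stalk y)
    (c : ∀ p : X, Fin 2 → X.presheaf.stalk p) {W : Scheme.{u}} (r : W ⟶ Y) (v : W ⟶ X)
    (J : W.IdealSheafData) (Q : Finset ι → Prop) : Prop :=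
  ∀ w, ∃ S M N x y T c₁ c₂, State (r.stalkMap w).hom (z (r w)) ((v.stalkMap w).hom (c (v w) 0))
    ((v.stalkMap w).hom (c (v w) 1)) S M N x y ∧ Q (S \ T) ∧ Q T ∧
    ∀ (U : W.Opens) (hU : IsAffineOpen U) (hw : w ∈ U),
      IsCenter (r.stalkMap w).hom (z (r w)) S x y
        ((J.ideal ⟨U, hU⟩).map (W.presheaf.germ U w hw).hom) T c₁ c₂

/-- Near a point of the blowup one of `c₁`, `c₂` generates the center. The index set left is `T` in
the first case and `S \ T` in the second, which is why `Q` is required of both. -/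
theorem HasCenters.hasState_blowup [DecidableEq ι] {W : Scheme.{u}} [IsLocallyNoetherian W]
    {r : W ⟶ Y} {v : W ⟶ X} {J : W.IdealSheafData} {Q : Finset ι → Prop}
    (h : HasCenters z c r v J Q) (hz : ∀ y, IsPrimeFamily (z y))
    (hY : ∀ y, IsDomain (Y.presheaf.stalk y)) :
    HasState z c (blowupπ J ≫ r) (blowupπ J ≫ v) Q := by
  intro w'
  obtain ⟨S, M, N, x, y, T, c₁, c₂, hst, hQ₁, hQ₂, hcen⟩ := h (blowupπ J w')
  have hdom := hY (r (blowupπ J w'))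
  have hspan : ∀ (U : W.Opens) (hU : IsAffineOpen U) (hw : blowupπ J w' ∈ U),
      (J.ideal ⟨U, hU⟩).map (W.presheaf.germ U _ hw).hom = Ideal.span (Set.range ![c₁, c₂]) := by
    intro U hU hw
    rw [(hcen U hU hw).eq_span, Matrix.range_cons, Matrix.range_cons, Matrix.range_empty,
      Set.union_empty, Set.singleton_union]
  obtain ⟨U, hU, hw, -⟩ := exists_affineOpen_ideal_eq_span J hspan
  have hc := hcen U hU hw
  rw [hspan U hU hw] at hc
  obtain ⟨i, C, _, _, hC, ψ, hψ, hψ'⟩ := exists_stalk_blowupChart J w' hspan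
  have hr : ((blowupπ J ≫ r).stalkMap w').hom =
      ψ.comp ((algebraMap _ C).comp (r.stalkMap (blowupπ J w')).hom) := by
    rw [← RingHom.comp_assoc, hψ', Hom.stalkMap_comp]
    rfl
  have hv : ∀ a, ((blowupπ J ≫ v).stalkMap w').hom a =
      ψ (algebraMap _ C ((v.stalkMap (blowupπ J w')).hom a)) := by
    intro a
    rw [Hom.stalkMap_comp]
    exact congr($hψ'.symm _)
  have key : ∃ S M N x' y', State ((algebraMap _ C).comp (r.stalkMap (blowupπ J w')).hom)
      (z (r (blowupπ J w')))
      (algebraMap _ C ((v.stalkMap (blowupπ J w')).hom (c (v (blowupπ J w')) 0)))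
      (algebraMap _ C ((v.stalkMap (blowupπ J w')).hom (c (v (blowupπ J w')) 1))) S M N x' y' ∧
      Q S := by
    fin_cases i
    · obtain ⟨y', x', h'⟩ := hc.swap.exists_state_chart (hz _) hst.swap hC
      refine ⟨_, _, _, _, _, h'.swap, ?_⟩
      rwa [sdiff_sdiff_right_self, Finset.inf_eq_inter, Finset.inter_eq_right.mpr hc.subset]
    · obtain ⟨x', y', h'⟩ := hc.exists_state_chart (hz _) hst hC
      exact ⟨_, _, _, _, _, h', hQ₁⟩
  obtain ⟨S, M, N, x', y', h', hQ⟩ := key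
  refine ⟨S, M, N, ψ x', ψ y', ?_, hQ⟩
  rw [hr, hv, hv]
  exact h'.congr hψ

/-- With at most one nonunit among the `z i`, one of the products over `T` and `S \ T` is a unit, so
one generator of the center divides the other. -/
theorem HasCenters.le_isoLocus [DecidableEq ι] {W : Scheme.{u}} [IsLocallyNoetherian W]
    {r : W ⟶ Y} {v : W ⟶ X} {J : W.IdealSheafData} {Q : Finset ι → Prop}
    (h : HasCenters z c r v J Q) {N : W.Opens} (hN : ∀ w ∈ N, ∀ i j, i ≠ j →
      IsUnit ((r.stalkMap w).hom (z (r w) i)) ∨ IsUnit ((r.stalkMap w).hom (z (r w) j))) :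
    N ≤ isoLocus (blowupπ J) := by
  rw [le_isoLocus_iff]
  refine isIso_morphismRestrict_of_forall _ _ fun w hw => ?_
  obtain ⟨S, M, N, x, y, T, c₁, c₂, hst, hQ₁, hQ₂, hcen⟩ := h w
  obtain ⟨_, ⟨U, hU, rfl⟩, hwU, -⟩ := W.isBasis_affineOpens.exists_subset_of_mem_open
    (Set.mem_univ w) isOpen_univ
  obtain ⟨a, ha, hreg⟩ := (hcen U hU hwU).principal (hN w hw)
  refine exists_isIso_blowupπ J hreg fun V hV hwV => ?_
  rw [(hcen V hV hwV).eq_span, ← ha, (hcen U hU hwU).eq_span]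

section Steps

variable [DecidableEq ι] {W : Scheme.{u}} [IsLocallyNoetherian W]
  {r : W ⟶ Y} {v : W ⟶ X} {Q : Finset ι → Prop} {F N : Set W}

/-- For `i ∈ S` one of `T` and `S \ T` is `{i}`, so one chart loses `i` and the other keeps nothing
else; for `i ∉ S` neither contains `i`. The letter `k = 1` is the letter `0` with the coordinates
exchanged. -/
theorem HasState.hasCenters_product (h : HasState z c r v Q) (hz : ∀ y, IsPrimeFamily (z y))
    (hY : ∀ y, IsDomain (Y.presheaf.stalk y)) (hQ : ∀ S S', S' ⊆ S → Q S → Q S')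
    (hF : IsClosed F) (hN : IsOpen N) {i : ι} {k : Fin 2}
    (hP : IsProductLocus z c r v (F ∩ N) i k) :
    HasCenters z c r v (IdealSheafData.vanishingIdeal (Closeds.closure (F ∩ N)))
      (fun S => Q S ∧ (i ∈ S → S = {i})) := by
  intro w
  obtain ⟨S, M, N', x, y, hst, hQS⟩ := h w
  have hdom := hY (r w)
  obtain ⟨_, ⟨U, hU, rfl⟩, hw, -⟩ := W.isBasis_affineOpens.exists_subset_of_mem_open
    (Set.mem_univ w) isOpen_univ
  set I := ((IdealSheafData.vanishingIdeal (Closeds.closure (F ∩ N))).ideal ⟨U, hU⟩).map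
    (W.presheaf.germ U w hw).hom with hIdef
  have hI : ∀ a, a ∈ I ↔ ∀ P : Ideal (W.presheaf.stalk w), P.IsPrime →
      MemProduct (r.stalkMap w).hom (z (r w)) ((v.stalkMap w).hom (c (v w) k)) i P → a ∈ P :=
    fun a => (mem_map_germ_vanishingIdeal_iff hF hN hU hw a).trans
      ⟨fun h P hP' hPm => h ⟨P, hP'⟩ ((hP w ⟨P, hP'⟩).mpr hPm),
        fun h P hPm => h P.asIdeal P.isPrime ((hP w P).mp hPm)⟩
  have hIU : ∀ (V : W.Opens) (hV : IsAffineOpen V) (hw : w ∈ V),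
      ((IdealSheafData.vanishingIdeal (Closeds.closure (F ∩ N))).ideal ⟨V, hV⟩).map
        (W.presheaf.germ V w hw).hom = I := by
    intro V hV hwV
    ext a
    rw [mem_map_germ_vanishingIdeal_iff hF hN hV hwV, mem_map_germ_vanishingIdeal_iff hF hN hU hw]
  obtain ⟨T, c₁, c₂, hcen, hT⟩ : ∃ T c₁ c₂, IsCenter (r.stalkMap w).hom (z (r w)) S x y I T c₁ c₂ ∧
      ((i ∉ S \ T ∧ (i ∈ T → T = {i})) ∨ (i ∉ T ∧ (i ∈ S \ T → S \ T = {i}))) := by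
    obtain rfl | rfl : k = 0 ∨ k = 1 := by fin_cases k <;> simp
    · obtain ⟨T, c₁, c₂, hcen, h₁, h₂⟩ := hst.exists_isCenter_product (hz _) i hI
      refine ⟨T, c₁, c₂, hcen, .inl ?_⟩
      by_cases hi : i ∈ S
      · simp [h₁ hi]
      · simp [hi, h₂ hi]
    · obtain ⟨T, c₁, c₂, hcen, h₁, h₂⟩ := hst.swap.exists_isCenter_product (hz _) i hI
      refine ⟨S \ T, c₂, c₁, hcen.swap, .inr ?_⟩
      rw [sdiff_sdiff_right_self, Finset.inf_eq_inter, Finset.inter_eq_right.mpr hcen.subset]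
      by_cases hi : i ∈ S
      · simp [h₁ hi]
      · simp [hi, h₂ hi]
  refine ⟨S, M, N', x, y, T, c₁, c₂, hst, ⟨hQ _ _ Finset.sdiff_subset hQS, ?_⟩,
    ⟨hQ _ _ hcen.subset hQS, ?_⟩, fun V hV hwV => by rwa [hIU V hV hwV]⟩
  · rcases hT with ⟨h₁, -⟩ | ⟨-, h₂⟩
    · exact fun h => (h₁ h).elim
    · exact h₂
  · rcases hT with ⟨-, h₁⟩ | ⟨h₂, -⟩
    · exact h₁
    · exact fun h => (h₂ h).elim

theorem HasState.hasCenters_diagonal [Fintype ι] (h : HasState z c r v Q)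
    (hz : ∀ y, IsPrimeFamily (z y)) (hY : ∀ y, IsDomain (Y.presheaf.stalk y))
    (hQ : ∀ S S', S' ⊆ S → Q S → Q S') (hF : IsClosed F) (hN : IsOpen N)
    (hP : IsDiagonalLocus z c r v F (F ∩ N)) :
    HasCenters z c r v (IdealSheafData.vanishingIdeal (Closeds.closure (F ∩ N))) Q := by
  intro w
  obtain ⟨S, M, N', x, y, hst, hQS⟩ := h w
  have hdom := hY (r w)
  obtain ⟨_, ⟨U, hU, rfl⟩, hw, -⟩ := W.isBasis_affineOpens.exists_subset_of_mem_open
    (Set.mem_univ w) isOpen_univ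
  set I := ((IdealSheafData.vanishingIdeal (Closeds.closure (F ∩ N))).ideal ⟨U, hU⟩).map
    (W.presheaf.germ U w hw).hom with hIdef
  have hI : ∀ a, a ∈ I ↔ ∀ P : PrimeSpectrum (W.presheaf.stalk w),
      W.fromSpecStalk w P ∈ F ∩ N → a ∈ P.asIdeal :=
    fun a => mem_map_germ_vanishingIdeal_iff hF hN hU hw a
  have hIU : ∀ (V : W.Opens) (hV : IsAffineOpen V) (hw : w ∈ V),
      ((IdealSheafData.vanishingIdeal (Closeds.closure (F ∩ N))).ideal ⟨V, hV⟩).map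
        (W.presheaf.germ V w hw).hom = I := by
    intro V hV hwV
    ext a
    rw [mem_map_germ_vanishingIdeal_iff hF hN hV hwV, hI]
  obtain ⟨T, c₁, c₂, hcen⟩ : ∃ T c₁ c₂,
      IsCenter (r.stalkMap w).hom (z (r w)) S x y I T c₁ c₂ := by
    by_cases hwF : w ∈ F
    · obtain ⟨T₀, a, b, hab, hP'⟩ := hP w hwF
      obtain ⟨c₁, c₂, hcen⟩ := hst.exists_isCenter_diagonal (hz _) T₀ hab (I := I)
        (fun a => (hI a).trans ⟨fun h P hP₁ hPm => h ⟨P, hP₁⟩ ((hP' ⟨P, hP₁⟩).mpr hPm),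
          fun h P hPm => h P.asIdeal P.isPrime ((hP' P).mp hPm)⟩)
      exact ⟨_, _, _, hcen⟩
    -- Points seen by the local ring specialize to `w`, so they cannot lie in the closed set `F`
    -- when `w` does not. The center is empty near `w`.
    · refine ⟨_, _, _, IsCenter.of_eq_top (hz _) hst ?_⟩
      refine (Ideal.eq_top_iff_one _).mpr ((hI 1).mpr fun P hPm => (hwF ?_).elim)
      have : W.fromSpecStalk w P ⤳ w := by
        have : W.fromSpecStalk w P ∈ Set.range (W.fromSpecStalk w) := ⟨_, rfl⟩
        rwa [range_fromSpecStalk] at this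
      exact this.mem_closed hF hPm.1
  exact ⟨S, M, N', x, y, T, c₁, c₂, hst, hQ _ _ Finset.sdiff_subset hQS,
    hQ _ _ hcen.subset hQS, fun V hV hwV => by rwa [hIU V hV hwV]⟩

end Steps

/-- Over the locus of isomorphism `g` is a homeomorphism, so the density of `D ∩ N` in `D` carries
over to the preimages. -/
theorem closure_preimage_inter_isoLocus {W Z : Scheme.{u}} (g : W ⟶ Z) {D : Set Z} {N : Z.Opens}
    (hN : N ≤ isoLocus g) (hD : D ⊆ closure (D ∩ N)) :
    closure (g ⁻¹' (D ∩ isoLocus g)) = closure (g ⁻¹' (D ∩ N)) := by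
  apply le_antisymm
  · refine closure_minimal ?_ isClosed_closure
    intro w hw
    rw [mem_closure_iff]
    intro U hU hwU
    have := isIso_isoLocus g
    set e := g ∣_ isoLocus g
    let U' : Set (g ⁻¹ᵁ isoLocus g) := Subtype.val ⁻¹' U
    have hU' : IsOpen (Subtype.val '' (e '' U')) := by
      refine (isoLocus g).isOpen.isOpenEmbedding_subtypeVal.isOpenMap _ ?_
      exact e.homeomorph.isOpenMap _ (hU.preimage continuous_subtype_val)
    have hval : ∀ p, (e p).1 = g p.1 := fun p => by
      exact morphismRestrict_base_coe g (isoLocus g) p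
    obtain ⟨q, ⟨_, ⟨⟨p, hp⟩, hpU, rfl⟩, rfl⟩, hq⟩ := mem_closure_iff.mp (hD hw.1) _ hU'
      ⟨_, ⟨⟨w, hw.2⟩, hwU, rfl⟩, hval _⟩
    exact ⟨p, hpU, Eq.subst (motive := (· ∈ D ∩ N)) (hval ⟨p, hp⟩) hq⟩
  · exact closure_mono (Set.preimage_mono (Set.inter_subset_inter_right _ hN))

section Iterate

variable {Y X : Scheme.{u}} {ι : Type} [DecidableEq ι]

/-- The properties of the steps of an iterated blowup. -/
structure IsStage (z : ∀ y : Y, ι → Y.presheaf.stalk y) (c : ∀ p : X, Fin 2 → X.presheaf.stalk p)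
    {W₀ : Scheme.{u}} (r : W₀ ⟶ Y) (v : W₀ ⟶ X) (N : W₀.Opens) (Q : Finset ι → Prop)
    (W : Over W₀) : Prop where
  isLocallyNoetherian : IsLocallyNoetherian W.left
  le_isoLocus : N ≤ isoLocus W.hom
  hasState : HasState z c (W.hom ≫ r) (W.hom ≫ v) Q

/-- The blowup of the strict transform of `D`. -/
noncomputable def blowupStep {W₀ : Scheme.{u}} (W : Over W₀) (D : Set W₀) : Over W₀ :=
  Over.mk (blowupπ (IdealSheafData.vanishingIdeal
    (strictTransform (W.hom : W.left ⟶ W₀) D)) ≫ W.hom)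

variable {z : ∀ y : Y, ι → Y.presheaf.stalk y} {c : ∀ p : X, Fin 2 → X.presheaf.stalk p}
  {W₀ : Scheme.{u}} {r : W₀ ⟶ Y} {v : W₀ ⟶ X} {N : W₀.Opens} {Q : Finset ι → Prop} {W : Over W₀}

/-- Replaces the full locus of isomorphism, which is not determined, by an explicit open set
contained in it. -/
theorem strictTransform_eq {W Z : Scheme.{u}} (g : W ⟶ Z) {D : Set Z} {N : Z.Opens}
    (hN : N ≤ isoLocus g) (hD : D ⊆ closure (D ∩ N)) :
    strictTransform g D = Closeds.closure (g ⁻¹' D ∩ g ⁻¹' N) :=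
  Closeds.ext (closure_preimage_inter_isoLocus g hN hD)

theorem IsStage.of_hasCenters (h : IsStage z c r v N Q W) {Q' : Finset ι → Prop} {D : Set W₀}
    (hN : ∀ w ∈ N, ∀ i j, i ≠ j →
      IsUnit ((r.stalkMap w).hom (z (r w) i)) ∨ IsUnit ((r.stalkMap w).hom (z (r w) j)))
    (hz : ∀ y, IsPrimeFamily (z y)) (hY : ∀ y, IsDomain (Y.presheaf.stalk y))
    (hcen : HasCenters z c (W.hom ≫ r) (W.hom ≫ v) (IdealSheafData.vanishingIdeal
      (strictTransform (W.hom : W.left ⟶ W₀) D)) Q') :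
    IsStage z c r v N Q' (blowupStep W D) := by
  have := h.isLocallyNoetherian
  refine ⟨isLocallyNoetherian_blowup _, ?_, ?_⟩
  · refine le_isoLocus_comp (hcen.le_isoLocus fun w hw i j hij => ?_) h.le_isoLocus
    have h' : ∀ i, IsUnit ((r.stalkMap (W.hom w)).hom (z (r (W.hom w)) i)) →
        IsUnit (((W.hom ≫ r).stalkMap w).hom (z ((W.hom ≫ r) w) i)) := by
      intro i hi
      rw [Hom.stalkMap_comp]
      exact hi.map (W.hom.stalkMap w).hom
    exact (hN (W.hom w) hw i j hij).imp (h' i) (h' j)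
  · have := hcen.hasState_blowup hz hY
    rw [← Category.assoc, ← Category.assoc] at this
    exact this

theorem IsStage.foldl_diagonal [Fintype ι]
    (hN : ∀ w ∈ N, ∀ i j, i ≠ j →
        IsUnit ((r.stalkMap w).hom (z (r w) i)) ∨ IsUnit ((r.stalkMap w).hom (z (r w) j)))
    (hz : ∀ y, IsPrimeFamily (z y)) (hY : ∀ y, IsDomain (Y.presheaf.stalk y))
    (hQ : ∀ S S', S' ⊆ S → Q S → Q S') (L : List (Set W₀))
    (hL : ∀ D ∈ L, IsClosed D ∧ D ⊆ closure (D ∩ N) ∧ IsDiagonalLocus z c r v D (D ∩ N)) :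
    ∀ {W : Over W₀}, IsStage z c r v N Q W → IsStage z c r v N Q (L.foldl blowupStep W) := by
  induction L with
  | nil => exact id
  | cons D L ih =>
    intro W h
    obtain ⟨hDc, hD, hDl⟩ := hL D (by simp)
    refine ih (fun D' hD' => hL D' (by simp [hD'])) (h.of_hasCenters hN hz hY ?_)
    have := h.isLocallyNoetherian
    rw [strictTransform_eq _ h.le_isoLocus hD]
    exact h.hasState.hasCenters_diagonal hz hY hQ (hDc.preimage W.hom.continuous)
      (N.isOpen.preimage W.hom.continuous) (hDl.preimage W.hom)

/-- `Q` varies in the induction because every blowup adds its own condition on `S`; earlier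
conditions survive later blowups because they are inherited by subsets. -/
theorem IsStage.foldl_product
    (hN : ∀ w ∈ N, ∀ i j, i ≠ j →
        IsUnit ((r.stalkMap w).hom (z (r w) i)) ∨ IsUnit ((r.stalkMap w).hom (z (r w) j)))
    (hz : ∀ y, IsPrimeFamily (z y)) (hY : ∀ y, IsDomain (Y.presheaf.stalk y))
    {α : Type*} (L : List α) (D : α → Set W₀) (i : α → ι) (k : α → Fin 2)
    (hL : ∀ a ∈ L, IsClosed (D a) ∧ D a ⊆ closure (D a ∩ N) ∧
      IsProductLocus z c r v (D a ∩ N) (i a) (k a)) :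
    ∀ {Q : Finset ι → Prop} {W : Over W₀}, (∀ S S', S' ⊆ S → Q S → Q S') → IsStage z c r v N Q W →
      IsStage z c r v N (fun S => Q S ∧ ∀ a ∈ L, i a ∈ S → S = {i a})
        ((L.map D).foldl blowupStep W) := by
  induction L with
  | nil => intro Q W _ h; simpa using h
  | cons a L ih =>
    intro Q W hQ h
    obtain ⟨hDc, hD, hDl⟩ := hL a (by simp)
    have h' : IsStage z c r v N (fun S => Q S ∧ (i a ∈ S → S = {i a})) (blowupStep W (D a)) := by
      refine h.of_hasCenters hN hz hY ?_
      have := h.isLocallyNoetherian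
      rw [strictTransform_eq _ h.le_isoLocus hD]
      exact h.hasState.hasCenters_product hz hY hQ (hDc.preimage W.hom.continuous)
        (N.isOpen.preimage W.hom.continuous) (hDl.preimage W.hom)
    -- A subset of `{i a}` that contains `i a` is `{i a}`.
    have hQ' : ∀ S S', S' ⊆ S → Q S ∧ (i a ∈ S → S = {i a}) → Q S' ∧ (i a ∈ S' → S' = {i a}) := by
      refine fun S S' hS hQS => ⟨hQ S S' hS hQS.1, fun ha => ?_⟩
      have h₁ := hQS.2 (hS ha)
      subst h₁
      exact (Finset.subset_singleton_iff.mp hS).resolve_left (fun h => by simp [h] at ha)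
    simpa [and_assoc] using ih (fun a' ha' => hL a' (by simp [ha'])) hQ' h'

end Iterate

end NodalResolution

namespace NodalResolution

/-! ## Charts on fibre products -/

section BaseHom

variable {R₀ : Type u} [CommRing R₀] {Z : Scheme.{u}} (q : Z ⟶ Spec (.of R₀))

/-- The structure homomorphism of the local ring of a scheme over an affine base. -/
noncomputable def baseHom (z : Z) : R₀ →+* Z.presheaf.stalk z :=
  (Spec.preimage (Z.fromSpecStalk z ≫ q)).hom

theorem specMap_baseHom (z : Z) :
    Spec.map (CommRingCat.ofHom (baseHom q z)) = Z.fromSpecStalk z ≫ q :=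
  Spec.map_preimage _

theorem stalkMap_comp_baseHom {Z' : Scheme.{u}} (g : Z' ⟶ Z) (z : Z') :
    (g.stalkMap z).hom.comp (baseHom q (g z)) = baseHom (g ≫ q) z := by
  have : CommRingCat.ofHom (baseHom q (g z)) ≫ g.stalkMap z =
      CommRingCat.ofHom (baseHom (g ≫ q) z) := by
    apply Spec.map_injective
    rw [Spec.map_comp, specMap_baseHom, specMap_baseHom, ← Category.assoc,
      Scheme.SpecMap_stalkMap_fromSpecStalk, Category.assoc]
  exact congrArg CommRingCat.Hom.hom this

theorem stalkMap_baseHom {Z' : Scheme.{u}} (g : Z' ⟶ Z) (z : Z') (a : R₀) :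
    (g.stalkMap z).hom (baseHom q (g z) a) = baseHom (g ≫ q) z a :=
  congr($(stalkMap_comp_baseHom q g z) a)

end BaseHom

instance {X : Scheme.{u}} (x : X) : Flat (X.fromSpecStalk x) := by
  obtain ⟨_, ⟨U, hU, rfl⟩, hxU, -⟩ := X.isBasis_affineOpens.exists_subset_of_mem_open
    (Set.mem_univ x) isOpen_univ
  replace hU : IsAffineOpen U := hU
  rw [← hU.fromSpecStalk_eq_fromSpecStalk hxU, IsAffineOpen.fromSpecStalk]
  have : Flat (Spec.map (X.presheaf.germ U x hxU)) := by
    rw [Flat.SpecMap_iff]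
    let : Algebra Γ(X, U) (X.presheaf.stalk x) := (X.presheaf.germ U x hxU).hom.toAlgebra
    have := hU.isLocalization_stalk ⟨x, hxU⟩
    exact IsLocalization.flat (X.presheaf.stalk x) (hU.primeIdealOf ⟨x, hxU⟩).asIdeal.primeCompl
  infer_instance

/-- The map on stalks is surjective for a preimmersion and injective because a flat local
homomorphism is faithfully flat. -/
theorem isIso_stalkMap_of_isPreimmersion {X Y : Scheme.{u}} (f : X ⟶ Y) [IsPreimmersion f] [Flat f]
    (x : X) : IsIso (f.stalkMap x) := by
  have hflat := Flat.stalkMap f x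
  have hsurj := f.stalkMap_surjective x
  refine (ConcreteCategory.isIso_iff_bijective _).mpr ⟨?_, hsurj⟩
  let := (f.stalkMap x).hom.toAlgebra
  have : Module.Flat (Y.presheaf.stalk (f x)) (X.presheaf.stalk x) := hflat
  have : IsLocalHom (algebraMap (Y.presheaf.stalk (f x)) (X.presheaf.stalk x)) :=
    inferInstanceAs (IsLocalHom (f.stalkMap x).hom)
  have := Module.FaithfullyFlat.of_flat_of_isLocalHom (A := Y.presheaf.stalk (f x))
    (B := X.presheaf.stalk x)
  exact FaithfulSMul.algebraMap_injective (Y.presheaf.stalk (f x)) (X.presheaf.stalk x)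

section Node

variable {R₀ R : Type u} [CommRing R₀] [CommRing R] (α : R₀ →+* R) (s : R₀)

/-- The homomorphism of node rings induced by a homomorphism of the base rings. -/
noncomputable def Node.map : Node R₀ s →+* Node R (α s) :=
  Node.lift ((algebraMap R _).comp α) (Node.x R _) (Node.y R _) Node.x_mul_y

theorem Node.isPushout_map :
    IsPushout (CommRingCat.ofHom α) (CommRingCat.ofHom (algebraMap R₀ (Node R₀ s)))
      (CommRingCat.ofHom (algebraMap R (Node R (α s)))) (CommRingCat.ofHom (Node.map α s)) := by
  have hc (c : PushoutCocone (CommRingCat.ofHom α)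
      (CommRingCat.ofHom (algebraMap R₀ (Node R₀ s)))) :
      c.inr.hom (Node.x R₀ s) * c.inr.hom (Node.y R₀ s) = c.inl.hom (α s) := by
    rw [← map_mul, Node.x_mul_y]
    exact congr($(c.condition).hom s).symm
  refine ⟨⟨?_⟩, ⟨PushoutCocone.IsColimit.mk _ (fun c => CommRingCat.ofHom
    (Node.lift c.inl.hom (c.inr.hom (Node.x R₀ s)) (c.inr.hom (Node.y R₀ s)) (hc c))) ?_ ?_ ?_⟩⟩
  · rw [← CommRingCat.ofHom_comp, ← CommRingCat.ofHom_comp, Node.map, Node.lift_comp_algebraMap]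
  · intro c
    ext1
    exact Node.lift_comp_algebraMap (h := hc c)
  · intro c
    ext1
    refine Node.ringHom_ext ?_ ?_ ?_
    · ext r
      refine Eq.trans ?_ (congr($(c.condition).hom r))
      change Node.lift _ _ _ (hc c) (Node.map α s (algebraMap R₀ _ r)) = c.inl.hom (α r)
      rw [Node.map, Node.lift_algebraMap]
      exact Node.lift_algebraMap _ _ _ (hc c) _
    · change Node.lift _ _ _ (hc c) (Node.map α s (Node.x R₀ s)) = _
      rw [Node.map, Node.lift_x, Node.lift_x]
    · change Node.lift _ _ _ (hc c) (Node.map α s (Node.y R₀ s)) = _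
      rw [Node.map, Node.lift_y, Node.lift_y]
  · intro c m h₁ h₂
    ext1
    refine Node.ringHom_ext ?_ ?_ ?_
    · ext r
      exact (congr($(h₁).hom r)).trans (Node.lift_algebraMap _ _ _ (hc c) r).symm
    · refine Eq.trans ?_ (Node.lift_x _ _ _ (hc c)).symm
      have := congr($(h₂).hom (Node.x R₀ s))
      rw [← this]
      change _ = m.hom (Node.map α s (Node.x R₀ s))
      rw [Node.map, Node.lift_x]
    · refine Eq.trans ?_ (Node.lift_y _ _ _ (hc c)).symm
      have := congr($(h₂).hom (Node.y R₀ s))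
      rw [← this]
      change _ = m.hom (Node.map α s (Node.y R₀ s))
      rw [Node.map, Node.lift_y]

open TensorProduct in
/-- The base change of an essentially étale chart. -/
theorem Node.exists_isPushout {O : Type u} [CommRing O] {β : R₀ →+* O} {x y : O} (h : x * y = β s)
    (hE : EssEtale (Node.lift β x y h)) :
    ∃ (T : CommRingCat.{u}) (i : CommRingCat.of R ⟶ T) (j : CommRingCat.of O ⟶ T),
      IsPushout (CommRingCat.ofHom α) (CommRingCat.ofHom β) i j ∧
      ∀ h' : j.hom x * j.hom y = i.hom (α s),
        EssEtale (Node.lift i.hom (j.hom x) (j.hom y) h') := by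
  let := (Node.lift β x y h).toAlgebra
  let := (Node.map α s).toAlgebra
  have h₁ := (Node.isPushout_map α s).paste_vert
    (CommRingCat.isPushout_tensorProduct (Node R₀ s) (Node R (α s)) O)
  have h₂ : CommRingCat.ofHom (algebraMap R₀ (Node R₀ s)) ≫
      CommRingCat.ofHom (algebraMap (Node R₀ s) O) = CommRingCat.ofHom β := by
    rw [← CommRingCat.ofHom_comp]
    congr 1
    exact Node.lift_comp_algebraMap (h := h)
  rw [h₂] at h₁
  refine ⟨_, _, _, h₁, fun h' => ?_⟩
  have hE' : EssEtale (algebraMap (Node R₀ s) O) := hE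
  have h₃ : EssEtale (algebraMap (Node R (α s)) (Node R (α s) ⊗[Node R₀ s] O)) :=
    hE'.baseChange
  refine (congrArg EssEtale (Node.ringHom_ext ?_ ?_ ?_)).mpr h₃
  · rw [Node.lift_comp_algebraMap]
    rfl
  · rw [Node.lift_x]
    have : x = algebraMap (Node R₀ s) O (Node.x R₀ s) := (Node.lift_x ..).symm
    rw [this]
    refine (Algebra.TensorProduct.tmul_one_eq_one_tmul (A := Node R (α s)) (B := O) (Node.x R₀ s)).symm.trans ?_
    change (Node.map α s (Node.x R₀ s)) ⊗ₜ[Node R₀ s] (1 : O) = _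
    rw [Node.map, Node.lift_x]
    rfl
  · rw [Node.lift_y]
    have : y = algebraMap (Node R₀ s) O (Node.y R₀ s) := (Node.lift_y ..).symm
    rw [this]
    refine (Algebra.TensorProduct.tmul_one_eq_one_tmul (A := Node R (α s)) (B := O) (Node.y R₀ s)).symm.trans ?_
    change (Node.map α s (Node.y R₀ s)) ⊗ₜ[Node R₀ s] (1 : O) = _
    rw [Node.map, Node.lift_y]
    rfl

end Node

/-- The fibre product of the spectra of two local rings is a flat preimmersion into the fibre
product of the schemes. So the local ring at `w` is a localization of a tensor product of local
rings, and the chart on `X` may be base changed there. -/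
theorem essEtale_lift_pullback {R₀ : Type u} [CommRing R₀] {Y X : Scheme.{u}}
    (q : Y ⟶ Spec (.of R₀)) (π : X ⟶ Spec (.of R₀)) (w : ↥(pullback q π)) {s : R₀}
    {x y : X.presheaf.stalk (pullback.snd q π w)} (h : x * y = baseHom π _ s)
    (hE : EssEtale (Node.lift (baseHom π _) x y h))
    (h' : ((pullback.snd q π).stalkMap w).hom x * ((pullback.snd q π).stalkMap w).hom y =
      ((pullback.fst q π).stalkMap w).hom (baseHom q _ s)) :
    EssEtale (Node.lift ((pullback.fst q π).stalkMap w).hom (((pullback.snd q π).stalkMap w).hom x)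
      (((pullback.snd q π).stalkMap w).hom y) h') := by
  let a := pullback.fst q π w
  let b := pullback.snd q π w
  have : MorphismProperty.IsStableUnderComposition @IsPreimmersion :=
    ⟨fun f g _ _ => IsPreimmersion.comp f g⟩
  obtain ⟨T, i, j, hT, hE'⟩ := Node.exists_isPushout (baseHom q a) s h hE
  have hpb := isPullback_SpecMap_of_isPushout _ _ _ _ hT
  rw [specMap_baseHom, specMap_baseHom] at hpb
  let f : pullback (Y.fromSpecStalk a ≫ q) (X.fromSpecStalk b ≫ π) ⟶ pullback q π :=
    pullback.map _ _ q π (Y.fromSpecStalk a) (X.fromSpecStalk b) (𝟙 _)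
      (Category.comp_id _) (Category.comp_id _)
  have hf₁ : IsPreimmersion f := MorphismProperty.pullbackMap (P := @IsPreimmersion)
    (inferInstance : IsPreimmersion (Y.fromSpecStalk a))
    (inferInstance : IsPreimmersion (X.fromSpecStalk b)) rfl rfl
  have hf₂ : Flat f := MorphismProperty.pullbackMap (P := @Flat)
    (inferInstance : Flat (Y.fromSpecStalk a))
    (inferInstance : Flat (X.fromSpecStalk b)) rfl rfl
  let g : Spec T ⟶ pullback q π := hpb.isoPullback.hom ≫ f
  have hg₁ : g ≫ pullback.fst q π = Spec.map i ≫ Y.fromSpecStalk a := by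
    rw [Category.assoc, show f ≫ pullback.fst q π = pullback.fst _ _ ≫ Y.fromSpecStalk a from
      pullback.lift_fst _ _ _, ← Category.assoc, hpb.isoPullback_hom_fst]
  have hg₂ : g ≫ pullback.snd q π = Spec.map j ≫ X.fromSpecStalk b := by
    rw [Category.assoc, show f ≫ pullback.snd q π = pullback.snd _ _ ≫ X.fromSpecStalk b from
      pullback.lift_snd _ _ _, ← Category.assoc, hpb.isoPullback_hom_snd]
  have hw : w ∈ Set.range f := by
    rw [Scheme.Pullback.range_map]
    refine ⟨?_, ?_⟩
    · rw [Set.mem_preimage, Scheme.range_fromSpecStalk]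
      exact specializes_rfl
    · rw [Set.mem_preimage, Scheme.range_fromSpecStalk]
      exact specializes_rfl
  obtain ⟨P', hP'⟩ := hw
  obtain ⟨P, rfl⟩ := hpb.isoPullback.hom.homeomorph.surjective P'
  have hP : g P = w := hP'
  have : IsPreimmersion g := inferInstance
  have : Flat g := inferInstance
  have := isIso_stalkMap_of_isPreimmersion g P
  obtain ⟨ψ, ⟨M, hM⟩, hψ⟩ := exists_stalk_of_isIso_stalkMap g hP
  have h₁ : i ≫ ψ = (pullback.fst q π).stalkMap w := by
    apply Spec.map_injective
    rw [← cancel_mono (Y.fromSpecStalk a), Spec.map_comp, Category.assoc, ← hg₁,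
      Scheme.SpecMap_stalkMap_fromSpecStalk, ← Category.assoc, hψ]
  have h₂ : j ≫ ψ = (pullback.snd q π).stalkMap w := by
    apply Spec.map_injective
    rw [← cancel_mono (X.fromSpecStalk b), Spec.map_comp, Category.assoc, ← hg₂,
      Scheme.SpecMap_stalkMap_fromSpecStalk, ← Category.assoc, hψ]
  have hψE : EssEtale ψ.hom := by
    let := ψ.hom.toAlgebra
    exact EssEtale.of_isLocalization M
  have hm : j.hom x * j.hom y = i.hom (baseHom q a s) := by
    rw [← map_mul, h]
    exact congr($(hT.w).hom s).symm
  have := (hE' hm).comp hψE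
  convert this using 1
  refine Node.ringHom_ext ?_ ?_ ?_
  · rw [RingHom.comp_assoc, Node.lift_comp_algebraMap, Node.lift_comp_algebraMap, ← h₁]
    rfl
  · rw [RingHom.comp_apply, Node.lift_x, Node.lift_x, ← h₂]
    rfl
  · rw [RingHom.comp_apply, Node.lift_y, Node.lift_y, ← h₂]
    rfl

end NodalResolution

namespace NodalResolution

/-! ## Resolutions of fibre powers -/

section

variable {R₀ : Type u} [CommRing R₀] {X : Scheme.{u}} (π : X ⟶ Spec (.of R₀)) (t : R₀)

/-- At the point `p`, the sections `c 0` and `c 1` are the coordinates of an essentially étale chart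
of `X` over one of `x y = t`, `𝔸¹ ∖ 0`. -/
def IsNodeChart (p : X) (c : Fin 2 → X.presheaf.stalk p) : Prop :=
  ∃ (m s n : R₀) (x y : X.presheaf.stalk p) (h : x * y = baseHom π p s),
    ((m = t ∧ s = 1 ∧ n = 1) ∨ (m = 1 ∧ s = t ∧ n = 1) ∨ (m = 1 ∧ s = 1 ∧ n = t)) ∧
    EssEtale (Node.lift (baseHom π p) x y h) ∧
    c 0 = x * baseHom π p m ∧ c 1 = y * baseHom π p n

variable {π t}

theorem IsNodeChart.mul_eq {p : X} {c : Fin 2 → X.presheaf.stalk p} (h : IsNodeChart π t p c) :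
    c 0 * c 1 = baseHom π p t := by
  obtain ⟨m, s, n, x, y, h, hms, -, h₀, h₁⟩ := h
  rw [h₀, h₁, mul_mul_mul_comm, h, ← map_mul, ← map_mul]
  rcases hms with ⟨rfl, rfl, rfl⟩ | ⟨rfl, rfl, rfl⟩ | ⟨rfl, rfl, rfl⟩ <;> simp

/-- The sets `C k` are locally defined by the equations `c k`. -/
def IsLocalEquation (C : Fin 2 → Set X) (c : ∀ p : X, Fin 2 → X.presheaf.stalk p) : Prop :=
  ∀ (p : X) (P : PrimeSpectrum (X.presheaf.stalk p)) (k : Fin 2),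
    X.fromSpecStalk p P ∈ C k ↔ c p k ∈ P.asIdeal

/-- Since `t` is the product of all `z i`, the three kinds of chart on `X` put all indices in `M`,
in `S` or in `N`. The exact shape is recorded because the equations of the diagonal depend on it. -/
theorem IsNodeChart.exists_state {ι : Type} [Fintype ι] {Y : Scheme.{u}} {q : Y ⟶ Spec (.of R₀)}
    (w : ↥(pullback q π)) {z : ι → Y.presheaf.stalk (pullback.fst q π w)}
    (hz : ∏ i, z i = baseHom q _ t) {c : Fin 2 → X.presheaf.stalk (pullback.snd q π w)}
    (hc : IsNodeChart π t _ c) :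
    ∃ S M N x y, State ((pullback.fst q π).stalkMap w).hom z
      (((pullback.snd q π).stalkMap w).hom (c 0)) (((pullback.snd q π).stalkMap w).hom (c 1))
      S M N x y ∧ ((S = ∅ ∧ M = Finset.univ ∧ N = ∅) ∨ (M = ∅ ∧ N = ∅) ∨
        (S = ∅ ∧ M = ∅ ∧ N = Finset.univ)) := by
  obtain ⟨m, s, n, x, y, h, hms, hE, h₀, h₁⟩ := hc
  have hbase : ∀ a, ((pullback.snd q π).stalkMap w).hom (baseHom π _ a) =
      ((pullback.fst q π).stalkMap w).hom (baseHom q _ a) := by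
    intro a
    rw [stalkMap_baseHom, stalkMap_baseHom]
    congr 2
    exact pullback.condition.symm
  have h' : ((pullback.snd q π).stalkMap w).hom x * ((pullback.snd q π).stalkMap w).hom y =
      ((pullback.fst q π).stalkMap w).hom (baseHom q _ s) := by
    rw [← map_mul, h, hbase]
  have hE' := essEtale_lift_pullback q π w h hE h'
  have key : ∀ S M N : Finset ι, Disjoint S M → Disjoint S N → Disjoint M N →
      (∀ i, i ∈ S ∨ i ∈ M ∨ i ∈ N) → baseHom q _ s = ∏ i ∈ S, z i →
      baseHom q _ m = ∏ i ∈ M, z i → baseHom q _ n = ∏ i ∈ N, z i →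
      State ((pullback.fst q π).stalkMap w).hom z
      (((pullback.snd q π).stalkMap w).hom (c 0)) (((pullback.snd q π).stalkMap w).hom (c 1))
      S M N (((pullback.snd q π).stalkMap w).hom x) (((pullback.snd q π).stalkMap w).hom y) := by
    intro S M N hSM hSN hMN hcov hS hM hN
    refine ⟨hSM, hSN, hMN, hcov, by rw [h', hS], ?_, ?_, Node.essEtale_lift_congr hE' hS⟩
    · rw [h₀, map_mul, hbase, hM]
    · rw [h₁, map_mul, hbase, hN]
  rcases hms with ⟨rfl, rfl, rfl⟩ | ⟨rfl, rfl, rfl⟩ | ⟨rfl, rfl, rfl⟩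
  · exact ⟨∅, Finset.univ, ∅, _, _, key _ _ _ (by simp) (by simp) (by simp) (by simp) (by simp)
      hz.symm (by simp), .inl ⟨rfl, rfl, rfl⟩⟩
  · exact ⟨Finset.univ, ∅, ∅, _, _, key _ _ _ (by simp) (by simp) (by simp) (by simp) hz.symm
      (by simp) (by simp), .inr (.inl ⟨rfl, rfl⟩)⟩
  · exact ⟨∅, ∅, Finset.univ, _, _, key _ _ _ (by simp) (by simp) (by simp) (by simp) (by simp)
      (by simp) hz.symm, .inr (.inr ⟨rfl, rfl, rfl⟩)⟩

/-- Locally at `y`, the pullbacks of the coordinates along `φ` are, up to units, the products of the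
`z i` with `l i = 0` and of the `z i` with `l i = 1`. -/
def HasCoord (c : ∀ p : X, Fin 2 → X.presheaf.stalk p) {Y : Scheme.{u}} {ι : Type} [Fintype ι]
    (φ : Y ⟶ X) (y : Y) (z : ι → Y.presheaf.stalk y) (l : ι → Fin 2) : Prop :=
  ∀ k, ∃ v, IsUnit v ∧ (φ.stalkMap y).hom (c (φ y) k) =
    v * ∏ i ∈ Finset.univ.filter (fun i => l i = k), z i

variable {C : Fin 2 → Set X} {c : ∀ p : X, Fin 2 → X.presheaf.stalk p}

theorem HasCoord.apply_mem_iff (hC : IsLocalEquation C c) {Y : Scheme.{u}} {ι : Type} [Fintype ι]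
    {φ : Y ⟶ X} {y : Y} {z : ι → Y.presheaf.stalk y} {l : ι → Fin 2} (h : HasCoord c φ y z l)
    (P : PrimeSpectrum (Y.presheaf.stalk y)) (k : Fin 2) :
    φ (Y.fromSpecStalk y P) ∈ C k ↔ ∃ i, l i = k ∧ z i ∈ P.asIdeal := by
  obtain ⟨v, hv, hk⟩ := h k
  rw [apply_fromSpecStalk, hC, PrimeSpectrum.comap_asIdeal, Ideal.mem_comap, hk,
    Ideal.unit_mul_mem_iff_mem _ hv, Ideal.IsPrime.prod_mem_iff]
  simp

variable (π C) in
/-- The points of `X ^ d` none of whose coordinates lies on `C 0 ∩ C 1`. -/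
def nodeFree (hC : ∀ k, IsClosed (C k)) (d : ℕ) : (fiberPower π d).Opens where
  carrier := {x | ∀ j, ∃ k, fiberPowerProj π j x ∉ C k}
  is_open' := by
    simp only [Set.ofPred_forall, Set.ofPred_exists]
    exact isOpen_iInter_of_finite fun j => isOpen_iUnion fun k =>
      ((hC k).preimage (fiberPowerProj π j).continuous).isOpen_compl

variable (π C) in
/-- The points of `X ^ (d + 1)` none of whose first `d` coordinates lies on `C 0 ∩ C 1`. -/
def initNodeFree (hC : ∀ k, IsClosed (C k)) (d : ℕ) : (fiberPower π (d + 1)).Opens where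
  carrier := {x | ∀ j : Fin d, ∃ k, fiberPowerProj π j.castSucc x ∉ C k}
  is_open' := by
    simp only [Set.ofPred_forall, Set.ofPred_exists]
    exact isOpen_iInter_of_finite fun j => isOpen_iUnion fun k =>
      ((hC k).preimage (fiberPowerProj π j.castSucc).continuous).isOpen_compl

variable (π t C c) in
/-- The local structure of the resolution `f : Y ⟶ X ^ d`: the local rings of `Y` are regular, with a
partial system of parameters indexed by words of length `d` whose product is `t`, and such that the
pullbacks of the coordinates of `X` are products of these. -/
structure IsResolved (hC : ∀ k, IsClosed (C k)) {d : ℕ} {Y : Scheme.{u}}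
    (f : Y ⟶ fiberPower π d) : Prop where
  isLocallyNoetherian : IsLocallyNoetherian Y
  le_isoLocus : nodeFree π C hC d ≤ isoLocus f
  exists_family : ∀ y : Y, ∃ z : (Fin d → Fin 2) → Y.presheaf.stalk y, IsParameterFamily z ∧
    ∏ ε, z ε = baseHom (f ≫ fiberPowerBase π d) y t ∧
    ∀ j, HasCoord c (f ≫ fiberPowerProj π j) y z (fun ε => ε j)

section Step

variable {d : ℕ} {Y : Scheme.{u}} (f : Y ⟶ fiberPower π d)

variable (π) in
theorem prodTotalToPower_castSucc (j : Fin d) :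
    prodTotalToPower π f ≫ fiberPowerProj π j.castSucc =
      pullback.fst _ _ ≫ f ≫ fiberPowerProj π j := by
  rw [prodTotalToPower, WidePullback.lift_π, Fin.snoc_castSucc]

variable (π) in
theorem prodTotalToPower_last :
    prodTotalToPower π f ≫ fiberPowerProj π (Fin.last d) = pullback.snd _ _ := by
  rw [prodTotalToPower, WidePullback.lift_π, Fin.snoc_last]

theorem prodTotalToPower_castSucc_apply (j : Fin d) (w : ↥(prodTotal π f)) :
    fiberPowerProj π j.castSucc (prodTotalToPower π f w) =
      (f ≫ fiberPowerProj π j) (pullback.fst (f ≫ fiberPowerBase π d) π w) := by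
  rw [← Scheme.Hom.comp_apply, prodTotalToPower_castSucc, Scheme.Hom.comp_apply]

theorem prodTotalToPower_last_apply (w : ↥(prodTotal π f)) :
    fiberPowerProj π (Fin.last d) (prodTotalToPower π f w) =
      pullback.snd (f ≫ fiberPowerBase π d) π w := by
  rw [← Scheme.Hom.comp_apply, prodTotalToPower_last]

variable {f} (hC : ∀ k, IsClosed (C k)) {z : ∀ y : Y, (Fin d → Fin 2) → Y.presheaf.stalk y}

/-- Two distinct words differ in some letter `j`; if both functions vanish, the `j`-th coordinate
lies on both components. Conversely, a coordinate on both components makes two functions vanish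
whose words have different letters there. -/
theorem fromSpecStalk_mem_initNodeFree_iff (hC' : IsLocalEquation C c)
    (hz : ∀ y j, HasCoord c (f ≫ fiberPowerProj π j) y (z y) (fun ε => ε j))
    (w : ↥(prodTotal π f)) (P : PrimeSpectrum ((prodTotal π f).presheaf.stalk w)) :
    (prodTotal π f).fromSpecStalk w P ∈ prodTotalToPower π f ⁻¹ᵁ initNodeFree π C hC d ↔
      ∀ ε ε', ε ≠ ε' → (((pullback.fst (f ≫ fiberPowerBase π d) π).stalkMap w).hom (z _ ε) ∉
        P.asIdeal ∨ ((pullback.fst (f ≫ fiberPowerBase π d) π).stalkMap w).hom (z _ ε') ∉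
        P.asIdeal) := by
  change (∀ j : Fin d, ∃ k, fiberPowerProj π j.castSucc (prodTotalToPower π f _) ∉ C k) ↔ _
  simp_rw [prodTotalToPower_castSucc_apply]
  rw [apply_fromSpecStalk]
  simp_rw [(hz _ _).apply_mem_iff hC', PrimeSpectrum.comap_asIdeal, Ideal.mem_comap]
  constructor
  · intro h ε ε' hne
    obtain ⟨j, hj⟩ := Function.ne_iff.mp hne
    by_contra! hcon
    obtain ⟨k, hk⟩ := h j
    have : k = ε j ∨ k = ε' j := by omega
    rcases this with rfl | rfl
    · exact hk ⟨ε, rfl, hcon.1⟩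
    · exact hk ⟨ε', rfl, hcon.2⟩
  · intro h j
    by_contra! hcon
    obtain ⟨ε, h0, hε⟩ := hcon 0
    obtain ⟨ε', h1, hε'⟩ := hcon 1
    rcases h ε ε' (fun h => by subst h; rw [h0] at h1; exact absurd h1 (by decide)) with h | h
    · exact h hε
    · exact h hε'

theorem isUnit_of_mem_initNodeFree (hC' : IsLocalEquation C c)
    (hz : ∀ y j, HasCoord c (f ≫ fiberPowerProj π j) y (z y) (fun ε => ε j))
    (w : ↥(prodTotal π f)) (hw : w ∈ prodTotalToPower π f ⁻¹ᵁ initNodeFree π C hC d)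
    (ε ε' : Fin d → Fin 2) (hne : ε ≠ ε') :
    IsUnit (((pullback.fst (f ≫ fiberPowerBase π d) π).stalkMap w).hom (z _ ε)) ∨
      IsUnit (((pullback.fst (f ≫ fiberPowerBase π d) π).stalkMap w).hom (z _ ε')) := by
  have := (fromSpecStalk_mem_initNodeFree_iff hC hC' hz w (IsLocalRing.closedPoint _)).mp (by
    rw [Scheme.fromSpecStalk_closedPoint]
    exact hw) ε ε' hne
  simpa [IsLocalRing.closedPoint] using this

/-- The last coordinate lies on a component, so `t`, and hence some `z ε'`, vanishes. Away from the
nodes only one does, and the positions of the other coordinates force its word to be the initial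
part of `ε`. -/
theorem isProductLocus_preimage_productDivisor (hC' : IsLocalEquation C c)
    (hc : ∀ p, IsNodeChart π t p (c p))
    (hz : ∀ y j, HasCoord c (f ≫ fiberPowerProj π j) y (z y) (fun ε => ε j))
    (hprod : ∀ y, ∏ ε, z y ε = baseHom (f ≫ fiberPowerBase π d) y t) (ε : Fin (d + 1) → Fin 2) :
    IsProductLocus z c (pullback.fst (f ≫ fiberPowerBase π d) π) (pullback.snd _ π)
      (prodTotalToPower π f ⁻¹' productDivisor π C ε ∩
        (prodTotalToPower π f ⁻¹ᵁ initNodeFree π C hC d)) (Fin.init ε) (ε (Fin.last d)) := by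
  intro w P
  rw [Set.mem_inter_iff, SetLike.mem_coe, fromSpecStalk_mem_initNodeFree_iff hC hC' hz]
  have h₁ : (prodTotal π f).fromSpecStalk w P ∈ prodTotalToPower π f ⁻¹' productDivisor π C ε ↔
      (∀ j : Fin d, ∃ ε' : Fin d → Fin 2, ε' j = ε j.castSucc ∧
        ((pullback.fst (f ≫ fiberPowerBase π d) π).stalkMap w).hom (z _ ε') ∈ P.asIdeal) ∧
      ((pullback.snd (f ≫ fiberPowerBase π d) π).stalkMap w).hom (c _ (ε (Fin.last d))) ∈
        P.asIdeal := by
    change (∀ j, _) ↔ _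
    rw [Fin.forall_fin_succ']
    simp_rw [prodTotalToPower_castSucc_apply, prodTotalToPower_last_apply]
    rw [apply_fromSpecStalk, apply_fromSpecStalk, hC']
    simp_rw [(hz _ _).apply_mem_iff hC', PrimeSpectrum.comap_asIdeal, Ideal.mem_comap]
  rw [h₁]
  constructor
  · rintro ⟨⟨h₂, h₃⟩, h₄⟩
    have ht : ((pullback.fst (f ≫ fiberPowerBase π d) π).stalkMap w).hom (∏ ε, z _ ε) ∈
        P.asIdeal := by
      have : ((pullback.snd (f ≫ fiberPowerBase π d) π).stalkMap w).hom (c _ 0 * c _ 1) ∈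
          P.asIdeal := by
        rw [map_mul]
        generalize ε (Fin.last d) = k at h₃
        obtain rfl | rfl : k = 0 ∨ k = 1 := by omega
        · exact Ideal.mul_mem_right _ _ h₃
        · exact Ideal.mul_mem_left _ _ h₃
      rw [(hc _).mul_eq, stalkMap_baseHom] at this
      rw [hprod, stalkMap_baseHom]
      convert this using 3
      exact pullback.condition
    rw [map_prod, Ideal.IsPrime.prod_mem_iff] at ht
    obtain ⟨ε', -, hε'⟩ := ht
    have heq : ∀ ε'', ((pullback.fst (f ≫ fiberPowerBase π d) π).stalkMap w).hom (z _ ε'') ∈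
        P.asIdeal → ε'' = ε' := by
      intro ε'' h
      by_contra hne
      rcases h₄ _ _ hne with h' | h'
      · exact h' h
      · exact h' hε'
    have hε : ε' = Fin.init ε := by
      funext j
      obtain ⟨ε'', h, h'⟩ := h₂ j
      rw [← heq _ h', h]
      rfl
    subst hε
    exact ⟨hε', fun l hl h => hl (heq l h), h₃⟩
  · rintro ⟨h₂, h₃, h₄⟩
    refine ⟨⟨fun j => ⟨_, rfl, h₂⟩, h₄⟩, fun ε₁ ε₂ hne => ?_⟩
    by_cases h : ε₁ = Fin.init ε
    · exact .inr (h₃ _ (fun h' => hne (h.trans h'.symm)))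
    · exact .inl (h₃ _ h)

end Step

end

end NodalResolution

namespace NodalResolution

/-! ## Diagonals as local centers -/

section Section

variable {R A R' : Type u} [CommRing R] [CommRing A] [CommRing R'] {ρ : R →+* A} {x y : A} {s : R}
  {h : x * y = ρ s}

/-- Modulo `J + K ^ 2` the quotient map and its composite with the retraction through the section
agree on the coordinates and differ by nilpotents; being unramified, the chart forces them to agree.
Thus `K ≤ J + K ^ 2`. -/
theorem EssEtale.ker_eq_span [IsLocalRing A] [IsNoetherianRing A] [Nontrivial R']
    (hE : EssEtale (Node.lift ρ x y h))
    {σ : A →+* R'} (hσ : Function.Bijective (σ.comp ρ)) {a b : R} (ha : σ x = σ (ρ a))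
    (hb : σ y = σ (ρ b)) : RingHom.ker σ = Ideal.span {x - ρ a, y - ρ b} := by
  set K := RingHom.ker σ with hK
  set J := Ideal.span {x - ρ a, y - ρ b} with hJ
  have hJK : J ≤ K := by
    rw [hJ, Ideal.span_le]
    rintro _ (rfl | rfl)
    · simp [hK, RingHom.mem_ker, ha]
    · simp [hK, RingHom.mem_ker, hb]
  -- Nakayama, applied with the ideal `K` itself, which lies in the maximal ideal.
  refine le_antisymm (Submodule.le_of_le_smul_of_le_jacobson_bot (I := K)
    ((isNoetherianRing_iff_ideal_fg A).mp inferInstance K) ?_ ?_) hJK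
  · rw [IsLocalRing.jacobson_eq_maximalIdeal _ bot_ne_top]
    exact IsLocalRing.le_maximalIdeal (RingHom.ker_ne_top σ)
  let e : R ≃+* R' := RingEquiv.ofBijective _ hσ
  have he : ∀ r, e r = σ (ρ r) := fun r => rfl
  let B := A ⧸ (J ⊔ K * K)
  let q : A →+* B := Ideal.Quotient.mk _
  let τ : A →+* B := (q.comp ρ).comp (e.symm.toRingHom.comp σ)
  have hτ : ∀ r, τ r = q (ρ (e.symm (σ r))) := fun r => rfl
  have h₁ : q.comp (Node.lift ρ x y h) = τ.comp (Node.lift ρ x y h) := by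
    have key : ∀ c d, c - ρ d ∈ J → q c = τ c := by
      intro c d hc
      have h2 : σ c = e d := by
        rw [he, ← sub_eq_zero, ← map_sub]
        exact hJK hc
      rw [hτ, h2, RingEquiv.symm_apply_apply, Ideal.Quotient.mk_eq_mk_iff_sub_mem]
      exact Ideal.mem_sup_left hc
    refine Node.ringHom_ext ?_ ?_ ?_
    · rw [RingHom.comp_assoc, RingHom.comp_assoc, Node.lift_comp_algebraMap]
      ext r
      exact key (ρ r) r (by simp)
    · rw [RingHom.comp_apply, RingHom.comp_apply, Node.lift_x]
      exact key x a (Ideal.subset_span (by simp))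
    · rw [RingHom.comp_apply, RingHom.comp_apply, Node.lift_y]
      exact key y b (Ideal.subset_span (by simp))
  have h₂ : q = τ := by
    obtain ⟨-, hu, -⟩ := hE
    let := (Node.lift ρ x y h).toAlgebra
    let := (q.comp (Node.lift ρ x y h)).toAlgebra
    have : Algebra.FormallyUnramified (Node R s) A := hu
    let q' : A →ₐ[Node R s] B := { q with commutes' := fun r => rfl }
    let τ' : A →ₐ[Node R s] B := { τ with commutes' := fun r => congr($h₁ r).symm }
    have hnil : IsNilpotent (K.map q) := by
      refine ⟨2, ?_⟩
      rw [pow_two, ← Ideal.map_mul]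
      exact (Ideal.map_eq_bot_iff_le_ker _).mpr (by
        rw [Ideal.mk_ker]
        exact le_sup_right)
    have : q' = τ' := by
      refine Algebra.FormallyUnramified.ext (K.map q) hnil fun r => ?_
      rw [Ideal.Quotient.mk_eq_mk_iff_sub_mem]
      change q r - q (ρ (e.symm (σ r))) ∈ _
      rw [← map_sub]
      refine Ideal.mem_map_of_mem _ ?_
      rw [hK, RingHom.mem_ker, map_sub, ← he, RingEquiv.apply_symm_apply, sub_self]
    exact RingHom.ext fun r => congr($this r)
  intro k hk
  have : q k = 0 := by
    rw [h₂, hτ, RingHom.mem_ker.mp hk]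
    simp
  rwa [Ideal.Quotient.eq_zero_iff_mem] at this

/-- In the initial charts `x = x₀` or `y = y₀`. If only one of these holds, then `x y = 1`, and the
equation of one coordinate of the section implies that of its inverse. -/
theorem State.ker_le_of_mem {ι : Type} [Fintype ι] [IsLocalRing A] [IsNoetherianRing A]
    [Nontrivial R'] {z : ι → R} {x₀ y₀ : A} {S M N : Finset ι} (hst : State ρ z x₀ y₀ S M N x y)
    (hSMN : (S = ∅ ∧ M = Finset.univ ∧ N = ∅) ∨ (M = ∅ ∧ N = ∅) ∨
        (S = ∅ ∧ M = ∅ ∧ N = Finset.univ))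
    {σ : A →+* R'} (hσ : Function.Bijective (σ.comp ρ)) {a b : R} (ha : σ x₀ = σ (ρ a))
    (hb : σ y₀ = σ (ρ b)) {P : Ideal A} (hx : x₀ - ρ a ∈ P) (hy : y₀ - ρ b ∈ P) :
    RingHom.ker σ ≤ P := by
  obtain ⟨a', ha'⟩ := hσ.2 (σ x)
  obtain ⟨b', hb'⟩ := hσ.2 (σ y)
  rw [RingHom.comp_apply] at ha' hb'
  rw [hst.essEtale.ker_eq_span hσ ha'.symm hb'.symm, Ideal.span_le]
  have hinj : ∀ {r r'}, σ (ρ r) = σ (ρ r') → r = r' := fun h => hσ.1 h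
  have key : ∀ {x y : A} {a' b' : R}, x * y = 1 → σ (ρ a') = σ x → σ (ρ b') = σ y →
      y - ρ b' ∈ P → x - ρ a' ∈ P := by
    intro x y a' b' hxy ha' hb' hP
    have h1 : ρ a' * ρ b' = 1 := by
      rw [← map_mul, hinj (r := a' * b') (r' := 1) ?_, map_one]
      rw [map_mul, map_mul, ha', hb', ← map_mul, hxy, map_one, map_one, map_one]
    have : x - ρ a' = - (x * ρ a') * (y - ρ b') := by
      linear_combination ρ a' * hxy - x * h1
    rw [this]
    exact Ideal.mul_mem_left _ _ hP
  rintro _ (rfl | rfl)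
  · rcases hSMN with ⟨rfl, rfl, rfl⟩ | ⟨rfl, rfl⟩ | ⟨rfl, rfl, rfl⟩
    · have hxy := hst.mul_eq
      have hy₀ := hst.y₀_eq
      simp only [Finset.prod_empty, map_one, mul_one] at hxy hy₀
      subst hy₀
      refine key hxy ha' hb' ?_
      rwa [hinj (hb'.trans hb)]
    · have hx₀ := hst.x₀_eq
      simp only [Finset.prod_empty, map_one, mul_one] at hx₀
      subst hx₀
      rwa [hinj (ha'.trans ha)]
    · have hx₀ := hst.x₀_eq
      simp only [Finset.prod_empty, map_one, mul_one] at hx₀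
      subst hx₀
      rwa [hinj (ha'.trans ha)]
  · rcases hSMN with ⟨rfl, rfl, rfl⟩ | ⟨rfl, rfl⟩ | ⟨rfl, rfl, rfl⟩
    · have hy₀ := hst.y₀_eq
      simp only [Finset.prod_empty, map_one, mul_one] at hy₀
      subst hy₀
      rwa [hinj (hb'.trans hb)]
    · have hy₀ := hst.y₀_eq
      simp only [Finset.prod_empty, map_one, mul_one] at hy₀
      subst hy₀
      rwa [hinj (hb'.trans hb)]
    · have hxy := hst.mul_eq
      have hx₀ := hst.x₀_eq
      simp only [Finset.prod_empty, map_one, mul_one] at hxy hx₀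
      subst hx₀
      refine key ((mul_comm _ _).trans hxy) hb' ha' ?_
      rwa [hinj (ha'.trans ha)]

end Section

theorem exists_fromSpecStalk_eq {Y : Scheme.{u}} {y y' : Y} (h : y' ⤳ y) :
    ∃ Q, Y.fromSpecStalk y Q = y' := by
  have : y' ∈ Set.range (Y.fromSpecStalk y) := by
    rw [Scheme.range_fromSpecStalk]
    exact h
  exact this

theorem fromSpecStalk_mem_range_iff {Y W : Scheme.{u}} (σ : Y ⟶ W) [IsPreimmersion σ] (y : Y)
    (P : PrimeSpectrum (W.presheaf.stalk (σ y))) :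
    W.fromSpecStalk (σ y) P ∈ Set.range σ ↔ RingHom.ker (σ.stalkMap y).hom ≤ P.asIdeal := by
  constructor
  · rintro ⟨y', hy'⟩
    have h₁ : W.fromSpecStalk (σ y) P ⤳ σ y := by
      have : W.fromSpecStalk (σ y) P ∈ Set.range (W.fromSpecStalk (σ y)) := ⟨P, rfl⟩
      rwa [Scheme.range_fromSpecStalk] at this
    rw [← hy', σ.isEmbedding.isInducing.specializes_iff] at h₁
    obtain ⟨Q, rfl⟩ := exists_fromSpecStalk_eq h₁
    have := (W.fromSpecStalk (σ y)).isEmbedding.injective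
      ((apply_fromSpecStalk σ y Q).symm.trans hy')
    rw [← this]
    exact Ideal.comap_mono bot_le
  · intro h
    obtain ⟨Q, hQ⟩ : ∃ Q, PrimeSpectrum.comap (σ.stalkMap y).hom Q = P := by
      have := range_comap_of_surjective _ (σ.stalkMap y).hom
        (σ.stalkMap_surjective y)
      rw [← Set.mem_range, this]
      exact h
    refine ⟨Y.fromSpecStalk y Q, ?_⟩
    rw [apply_fromSpecStalk, hQ]

theorem stalkMap_apply_congr {Y X : Scheme.{u}} {φ ψ : Y ⟶ X} (h : φ = ψ) {α : Type*}
    (c : ∀ p : X, α → X.presheaf.stalk p) (y : Y) (k : α) :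
    (φ.stalkMap y).hom (c (φ y) k) = (ψ.stalkMap y).hom (c (ψ y) k) := by
  subst h
  rfl

section

variable {R₀ : Type u} [CommRing R₀] {X : Scheme.{u}} {π : X ⟶ Spec (.of R₀)} {t : R₀}
  {C : Fin 2 → Set X} {c : ∀ p : X, Fin 2 → X.presheaf.stalk p} {d : ℕ} {Y : Scheme.{u}}
  {f : Y ⟶ fiberPower π d} {z : ∀ y : Y, (Fin d → Fin 2) → Y.presheaf.stalk y}

theorem diagonalSection_fst (j : Fin d) : diagonalSection π f j ≫ pullback.fst _ _ = 𝟙 Y :=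
  pullback.lift_fst _ _ _

theorem diagonalSection_snd (j : Fin d) :
    diagonalSection π f j ≫ pullback.snd _ _ = f ≫ fiberPowerProj π j :=
  pullback.lift_snd _ _ _

instance [IsSeparated π] (j : Fin d) : IsClosedImmersion (diagonalSection π f j) := by
  have : IsClosedImmersion (diagonalSection π f j ≫ pullback.fst _ _) := by
    rw [diagonalSection_fst]
    infer_instance
  exact IsClosedImmersion.of_comp _ (pullback.fst (f ≫ fiberPowerBase π d) π)

/-- The `j`-th coordinate of the section has equations `u` and `v` times the products over the words
with `j`-th letter `0` and `1`. The unramified chart shows that these two equations already cut out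
the section. -/
theorem isDiagonalLocus_range [IsSeparated π] [IsLocallyNoetherian (prodTotal π f)]
    (hC : ∀ k, IsClosed (C k)) (hC' : IsLocalEquation C c)
    (hc : ∀ p, IsNodeChart π t p (c p)) (hY : ∀ y, IsDomain (Y.presheaf.stalk y))
    (hz : ∀ y j, HasCoord c (f ≫ fiberPowerProj π j) y (z y) (fun ε => ε j))
    (hz' : ∀ y, IsPrimeFamily (z y))
    (hprod : ∀ y, ∏ ε, z y ε = baseHom (f ≫ fiberPowerBase π d) y t) (j : Fin d) :
    IsDiagonalLocus z c (pullback.fst (f ≫ fiberPowerBase π d) π) (pullback.snd _ π)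
      (Set.range (diagonalSection π f j)) (Set.range (diagonalSection π f j) ∩
        (prodTotalToPower π f ⁻¹ᵁ initNodeFree π C hC d)) := by
  rintro _ ⟨y', rfl⟩
  let σ := diagonalSection π f j
  let r := pullback.fst (f ≫ fiberPowerBase π d) π
  let y := r (σ y')
  have := hY y
  obtain ⟨u, hu, hu'⟩ := hz y j 0
  obtain ⟨v, hv, hv'⟩ := hz y j 1
  -- Both `c 0 * c 1` and the product of all `z ε` are `t`, which can be cancelled in the domain.
  have huv : u * v = 1 := by
    refine mul_right_cancel₀ ((hz' y).prod_ne_zero Finset.univ) ?_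
    rw [one_mul]
    have h1 := congrArg ((f ≫ fiberPowerProj π j).stalkMap y).hom (hc _).mul_eq
    rw [map_mul, hu', hv', stalkMap_baseHom, Category.assoc, WidePullback.π_arrow, ← hprod,
      mul_mul_mul_comm] at h1
    refine Eq.trans ?_ h1
    rw [← Finset.prod_filter_mul_prod_filter_not Finset.univ (fun ε => ε j = 0)]
    have h2 : ∀ ε : Fin d → Fin 2, ¬ (ε j = 0) ↔ ε j = 1 := fun ε => by omega
    simp_rw [h2]
  have hcomp : Finset.univ.filter (fun ε : Fin d → Fin 2 => ε j = 1) =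
      (Finset.univ.filter (fun ε : Fin d → Fin 2 => ε j = 0))ᶜ := by
    ext ε
    simp only [Finset.mem_filter, Finset.mem_univ, true_and, Finset.mem_compl]
    omega
  refine ⟨Finset.univ.filter (fun ε => ε j = 0), u, v, huv, fun P => ?_⟩
  rw [← hcomp, ← hu', ← hv', Set.mem_inter_iff, SetLike.mem_coe,
    fromSpecStalk_mem_initNodeFree_iff hC hC' hz]
  rw [fromSpecStalk_mem_range_iff]
  have hbij : Function.Bijective ((σ.stalkMap y').hom.comp (r.stalkMap (σ y')).hom) := by
    have h1 : IsIso (σ ≫ r) := by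
      rw [diagonalSection_fst]
      infer_instance
    have h2 : IsIso ((σ ≫ r).stalkMap y') := inferInstance
    rw [Scheme.Hom.stalkMap_comp] at h2
    exact (ConcreteCategory.isIso_iff_bijective _).mp h2
  have hcoord : ∀ k, (σ.stalkMap y').hom
      (((pullback.snd (f ≫ fiberPowerBase π d) π).stalkMap (σ y')).hom (c _ k)) =
      (σ.stalkMap y').hom ((r.stalkMap (σ y')).hom
        (((f ≫ fiberPowerProj π j).stalkMap y).hom (c _ k))) := by
    intro k
    have h1 := stalkMap_apply_congr (φ := σ ≫ pullback.snd (f ≫ fiberPowerBase π d) π)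
      (ψ := (σ ≫ r) ≫ f ≫ fiberPowerProj π j)
      (by rw [diagonalSection_snd, diagonalSection_fst, Category.id_comp]) c y' k
    rw [Scheme.Hom.stalkMap_comp, Scheme.Hom.stalkMap_comp (σ ≫ r),
      Scheme.Hom.stalkMap_comp σ r] at h1
    exact h1
  have hsub : ∀ k, ((pullback.snd (f ≫ fiberPowerBase π d) π).stalkMap (σ y')).hom (c _ k) -
      (r.stalkMap (σ y')).hom (((f ≫ fiberPowerProj π j).stalkMap y).hom (c _ k)) ∈
      RingHom.ker (σ.stalkMap y').hom := by
    intro k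
    rw [RingHom.mem_ker, map_sub, hcoord, sub_self]
  constructor
  · rintro ⟨h₁, h₂⟩
    exact ⟨h₁ (hsub 0), h₁ (hsub 1), h₂⟩
  · rintro ⟨h₁, h₂, h₃⟩
    refine ⟨?_, h₃⟩
    obtain ⟨S, M, N, x, y₁, hst, hSMN⟩ := (hc _).exists_state (q := f ≫ fiberPowerBase π d)
      (σ y') (hprod y)
    exact hst.ker_le_of_mem hSMN hbij (hcoord 0) (hcoord 1) h₁ h₂

/-- No `z ε` vanishes at the generic point of the local ring of `Y` at `y`, so its image lies in the
open set and specializes to the given point. -/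
theorem range_diagonalSection_subset (hC : ∀ k, IsClosed (C k)) (hC' : IsLocalEquation C c)
    (hY : ∀ y, IsDomain (Y.presheaf.stalk y))
    (hz : ∀ y j, HasCoord c (f ≫ fiberPowerProj π j) y (z y) (fun ε => ε j))
    (hz' : ∀ y, IsPrimeFamily (z y)) (j : Fin d) :
    Set.range (diagonalSection π f j) ⊆ closure (Set.range (diagonalSection π f j) ∩
        (prodTotalToPower π f ⁻¹ᵁ initNodeFree π C hC d)) := by
  rintro _ ⟨y, rfl⟩
  have := hY y
  let η := Y.fromSpecStalk y (⊥ : PrimeSpectrum (Y.presheaf.stalk y))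
  have hη : η ⤳ y := by
    have : η ∈ Set.range (Y.fromSpecStalk y) := ⟨_, rfl⟩
    rwa [Scheme.range_fromSpecStalk] at this
  have hmem : diagonalSection π f j η ∈ Set.range (diagonalSection π f j) ∩
        (prodTotalToPower π f ⁻¹ᵁ initNodeFree π C hC d) := by
    refine ⟨⟨_, rfl⟩, ?_⟩
    intro i
    refine ⟨0, ?_⟩
    have h1 : pullback.fst (f ≫ fiberPowerBase π d) π (diagonalSection π f j η) = η := by
      rw [← Scheme.Hom.comp_apply, diagonalSection_fst]
      rfl
    rw [prodTotalToPower_castSucc_apply, h1, (hz y i).apply_mem_iff hC']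
    rintro ⟨ε, -, hε⟩
    exact (hz' y).ne_zero ε hε
  exact (hη.map (diagonalSection π f j).continuous).mem_closed isClosed_closure
    (subset_closure hmem)

end

end NodalResolution

namespace NodalResolution

/-! ## Generizations in fibre products -/

/-- Over a fixed point of the base, the second coordinate of a point of a fibre product can be
generized without changing the first one. -/
theorem exists_specializes_pullback {P Q B : Scheme.{u}} (p : P ⟶ B) (q : Q ⟶ B)
    (w : ↥(pullback p q)) {b : Q} (hb : b ⤳ pullback.snd p q w)
    (hbq : q b = q (pullback.snd p q w)) :
    ∃ w' : ↥(pullback p q), w' ⤳ w ∧ pullback.fst p q w' = pullback.fst p q w ∧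
      pullback.snd p q w' = b := by
  let a := pullback.fst p q w
  let W := pullback p q
  have hs : q b = p a := by
    rw [hbq, ← Scheme.Hom.comp_apply, ← pullback.condition]
    rfl
  let F := q.fiber (p a)
  let k : Spec (P.residueField a) ⟶ Spec (B.residueField (p a)) := Spec.map (p.residueFieldMap a)
  -- `Z` plays the role of the fibre of the first projection over `a`. It is flat over the fibre of
  -- `q`, as a base change of a field extension, so generizations lift along its projection.
  let Z := pullback k (q.fiberToSpecResidueField (p a))
  let m : Z ⟶ W := pullback.lift (pullback.fst _ _ ≫ P.fromSpecResidueField a)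
    (pullback.snd _ _ ≫ q.fiberι (p a)) (by
      rw [Category.assoc, Category.assoc, Scheme.Hom.fiber_fac, ← pullback.condition_assoc,
        ← Scheme.Hom.SpecMap_residueFieldMap_fromSpecResidueField])
  have hm₁ : m ≫ pullback.fst p q = pullback.fst _ _ ≫ P.fromSpecResidueField a :=
    pullback.lift_fst _ _ _
  have hm₂ : m ≫ pullback.snd p q = pullback.snd _ _ ≫ q.fiberι (p a) := pullback.lift_snd _ _ _
  let κw := W.fromSpecResidueField w
  let e₁ : Spec (W.residueField w) ⟶ Spec (P.residueField a) :=
    Spec.map ((pullback.fst p q).residueFieldMap w)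
  have he₁ : e₁ ≫ P.fromSpecResidueField a = κw ≫ pullback.fst p q :=
    Scheme.Hom.SpecMap_residueFieldMap_fromSpecResidueField _ _
  have hk₀ : k ≫ B.fromSpecResidueField (p a) = P.fromSpecResidueField a ≫ p :=
    Scheme.Hom.SpecMap_residueFieldMap_fromSpecResidueField _ _
  let e₂ : Spec (W.residueField w) ⟶ F := pullback.lift (κw ≫ pullback.snd p q) (e₁ ≫ k) (by
    rw [Category.assoc, Category.assoc, hk₀, reassoc_of% he₁, pullback.condition])
  have he₂ : e₂ ≫ q.fiberι (p a) = κw ≫ pullback.snd p q := pullback.lift_fst _ _ _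
  have he₂' : e₂ ≫ q.fiberToSpecResidueField (p a) = e₁ ≫ k := pullback.lift_snd _ _ _
  let e : Spec (W.residueField w) ⟶ Z := pullback.lift e₁ e₂ he₂'.symm
  have he : e ≫ m = κw := by
    apply pullback.hom_ext
    · rw [Category.assoc, hm₁, pullback.lift_fst_assoc, he₁]
    · rw [Category.assoc, hm₂, pullback.lift_snd_assoc, he₂]
  let w₀ : Z := e (IsLocalRing.closedPoint (W.residueField w))
  have hw₀ : m w₀ = w := by
    refine (Scheme.Hom.comp_apply e m _).symm.trans ?_
    rw [he]
    exact Scheme.fromSpecResidueField_apply _ _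
  let g : Z ⟶ F := pullback.snd _ _
  have hg : q.fiberι (p a) (g w₀) = pullback.snd p q w := by
    rw [← hw₀, ← Scheme.Hom.comp_apply m, hm₂, Scheme.Hom.comp_apply]
  obtain ⟨b', rfl⟩ : ∃ b', q.fiberι (p a) b' = b := by
    have : b ∈ Set.range (q.fiberι (p a)) := by
      rw [Scheme.Hom.range_fiberι]
      exact hs
    exact this
  rw [← hg, (q.fiberι (p a)).isEmbedding.isInducing.specializes_iff] at hb
  have hk : Flat k := by
    rw [Flat.SpecMap_iff]
    let := (p.residueFieldMap a).hom.toAlgebra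
    exact (inferInstance : Module.Flat (B.residueField (p a)) (P.residueField a))
  have hflat : Flat g := inferInstance
  obtain ⟨w₁, hw₁, hw₁'⟩ := Flat.generalizingMap g hb
  refine ⟨m w₁, ?_, ?_, ?_⟩
  · rw [← hw₀]
    exact hw₁.map m.continuous
  · rw [← Scheme.Hom.comp_apply, hm₁, Scheme.Hom.comp_apply]
    exact Scheme.fromSpecResidueField_apply _ _
  · rw [← Scheme.Hom.comp_apply, hm₂, Scheme.Hom.comp_apply, ← hw₁']

theorem exists_specializes_pullback_fst {P Q B : Scheme.{u}} (p : P ⟶ B) (q : Q ⟶ B)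
    (w : ↥(pullback p q)) {a : P} (ha : a ⤳ pullback.fst p q w)
    (hap : p a = p (pullback.fst p q w)) :
    ∃ w' : ↥(pullback p q), w' ⤳ w ∧ pullback.fst p q w' = a ∧
      pullback.snd p q w' = pullback.snd p q w := by
  let e := (pullbackSymmetry p q).hom
  have h₁ : ∀ v, pullback.snd q p (e v) = pullback.fst p q v := fun v => by
    rw [← Scheme.Hom.comp_apply, pullbackSymmetry_hom_comp_snd]
  have h₂ : ∀ v, pullback.fst q p (e v) = pullback.snd p q v := fun v => by
    rw [← Scheme.Hom.comp_apply, pullbackSymmetry_hom_comp_fst]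
  obtain ⟨w', hw', hw₁, hw₂⟩ := exists_specializes_pullback q p (e w) (b := a) (by rwa [h₁])
    (by rwa [h₁])
  obtain ⟨w', rfl⟩ := e.homeomorph.surjective w'
  change e w' ⤳ _ at hw'
  change pullback.fst q p (e w') = _ at hw₁
  change pullback.snd q p (e w') = _ at hw₂
  exact ⟨w', e.isEmbedding.isInducing.specializes_iff.mp hw', by rw [← h₁, hw₂],
    by rw [← h₂, hw₁, h₂]⟩

section

variable {X B : Scheme.{u}} (π : X ⟶ B) {d : ℕ}

/-- The projection of `X ^ (d + 1)` onto the first `d` factors. -/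
noncomputable def initProj (d : ℕ) : fiberPower π (d + 1) ⟶ fiberPower π d :=
  WidePullback.lift (fiberPowerBase π (d + 1)) (fun j => fiberPowerProj π j.castSucc)
    (fun _ => WidePullback.π_arrow _ _)

theorem initProj_proj (j : Fin d) :
    initProj π d ≫ fiberPowerProj π j = fiberPowerProj π j.castSucc :=
  WidePullback.lift_π ..

theorem initProj_base : initProj π d ≫ fiberPowerBase π d = fiberPowerBase π (d + 1) :=
  WidePullback.lift_base ..

theorem prodTotalToPower_base {Y : Scheme.{u}} (f : Y ⟶ fiberPower π d) :
    prodTotalToPower π f ≫ fiberPowerBase π (d + 1) = pullback.snd _ _ ≫ π :=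
  WidePullback.lift_base ..

/-- Allows the locus over which `Y` is isomorphic to `X ^ d` to be pulled back to `X ^ (d + 1)`. -/
theorem isPullback_prodTotalToPower {Y : Scheme.{u}} (f : Y ⟶ fiberPower π d) :
    IsPullback (prodTotalToPower π f) (pullback.fst (f ≫ fiberPowerBase π d) π)
      (initProj π d) f := by
  have hproj : ∀ j : Fin (d + 1), fiberPowerProj π j ≫ π = fiberPowerBase π (d + 1) :=
    fun j => WidePullback.π_arrow _ _
  refine ⟨⟨?_⟩, ⟨PullbackCone.IsLimit.mk _ (fun s => pullback.lift s.snd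
    (s.fst ≫ fiberPowerProj π (Fin.last d)) ?_) ?_ ?_ ?_⟩⟩
  · apply WidePullback.hom_ext
    · intro j
      rw [Category.assoc, initProj_proj, prodTotalToPower, WidePullback.lift_π, Fin.snoc_castSucc,
        Category.assoc]
    · rw [Category.assoc, initProj_base, prodTotalToPower_base, Category.assoc, pullback.condition]
  · rw [← Category.assoc, ← s.condition, Category.assoc, initProj_base, Category.assoc, hproj]
  · intro s
    apply WidePullback.hom_ext
    · intro j
      refine Fin.lastCases ?_ (fun i => ?_) j
      · rw [Category.assoc, prodTotalToPower, WidePullback.lift_π, Fin.snoc_last,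
          pullback.lift_snd]
      · rw [Category.assoc, prodTotalToPower, WidePullback.lift_π, Fin.snoc_castSucc,
          pullback.lift_fst_assoc, ← Category.assoc, ← s.condition, Category.assoc, initProj_proj]
    · rw [Category.assoc, prodTotalToPower_base, pullback.lift_snd_assoc, Category.assoc, hproj]
  · intro s
    exact pullback.lift_fst _ _ _
  · intro s m h₁ h₂
    apply pullback.hom_ext
    · rw [pullback.lift_fst, h₂]
    · rw [pullback.lift_snd, ← h₁, Category.assoc]
      congr 1
      rw [prodTotalToPower, WidePullback.lift_π, Fin.snoc_last]

end

/-- Isomorphism loci are preserved by base change. -/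
theorem le_isoLocus_of_isPullback {P Y Z' Z : Scheme.{u}} {h : P ⟶ Z'} {g : P ⟶ Y} {p : Z' ⟶ Z}
    {f : Y ⟶ Z} (hp : IsPullback h g p f) {N : Z.Opens} (hN : N ≤ isoLocus f) :
    p ⁻¹ᵁ N ≤ isoLocus h := by
  rw [le_isoLocus_iff] at hN ⊢
  have h₁ := ((isPullback_morphismRestrict h (p ⁻¹ᵁ N)).flip.paste_horiz hp.flip)
  have h₂ := (isPullback_morphismRestrict f N).flip
  rw [← (isPullback_morphismRestrict p N).w] at h₁
  exact (h₁.of_right' h₂).isIso_snd_of_isIso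

section

variable {R₀ : Type u} [CommRing R₀] {X : Scheme.{u}} {π : X ⟶ Spec (.of R₀)} {C : Fin 2 → Set X}

/-- Every point of a product of components is a specialization of a point whose coordinates lie on
no other component. -/
theorem exists_specializes_productDivisor
    (hgen : ∀ k, ∀ p ∈ C k, ∃ p', p' ⤳ p ∧ p' ∈ C k ∧ π p' = π p ∧ ∃ k', p' ∉ C k') :
    ∀ {d : ℕ} (ε : Fin d → Fin 2) (w : fiberPower π d), w ∈ productDivisor π C ε →
      ∃ w', w' ⤳ w ∧ fiberPowerBase π d w' = fiberPowerBase π d w ∧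
        w' ∈ productDivisor π C ε ∧ ∀ j, ∃ k, fiberPowerProj π j w' ∉ C k := by
  intro d
  induction d with
  | zero => exact fun ε w hw => ⟨w, specializes_rfl, rfl, hw, fun j => j.elim0⟩
  | succ d ih =>
    intro ε w hw
    -- As a base change of an identity, the comparison identifies `X ^ (d + 1)` with `X ^ d ×_B X`,
    -- where the coordinates can be generized in turn.
    have hsq := isPullback_prodTotalToPower π (𝟙 (fiberPower π d))
    have hiso : IsIso (prodTotalToPower π (𝟙 (fiberPower π d))) := hsq.isIso_fst_of_isIso
    let h := prodTotalToPower π (𝟙 (fiberPower π d))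
    obtain ⟨w, rfl⟩ := h.homeomorph.surjective w
    change h w ∈ _ at hw
    have hfst : ∀ (j : Fin d) v, fiberPowerProj π j.castSucc (h v) = fiberPowerProj π j
        (pullback.fst (𝟙 (fiberPower π d) ≫ fiberPowerBase π d) π v) := by
      intro j v
      rw [prodTotalToPower_castSucc_apply, Category.id_comp]
    have hsnd : ∀ v, fiberPowerProj π (Fin.last d) (h v) =
        pullback.snd (𝟙 (fiberPower π d) ≫ fiberPowerBase π d) π v :=
      fun v => prodTotalToPower_last_apply _ v
    obtain ⟨b, hb, hbC, hbπ, hb'⟩ := hgen _ _ (hw (Fin.last d))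
    rw [hsnd] at hb hbπ
    obtain ⟨w₁, hw₁, hw₁f, hw₁s⟩ := exists_specializes_pullback _ _ w hb hbπ
    have hw₁C : pullback.fst (𝟙 (fiberPower π d) ≫ fiberPowerBase π d) π w₁ ∈
        productDivisor π C (Fin.init ε) := by
      intro j
      rw [← hfst, hfst, hw₁f, ← hfst]
      exact hw j.castSucc
    obtain ⟨a, ha, haπ, haC, ha'⟩ := ih _ _ hw₁C
    obtain ⟨w₂, hw₂, hw₂f, hw₂s⟩ := exists_specializes_pullback_fst _ _ w₁ ha
      haπ
    rw [hw₁s] at hw₂s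
    refine ⟨h w₂, (hw₂.trans hw₁).map h.continuous, ?_, ?_, ?_⟩
    · have hbase : ∀ v, fiberPowerBase π (d + 1) (h v) = π (fiberPowerProj π (Fin.last d) (h v)) := by
        intro v
        rw [← Scheme.Hom.comp_apply (fiberPowerProj _ _), WidePullback.π_arrow]
      change fiberPowerBase π (d + 1) (h w₂) = fiberPowerBase π (d + 1) (h w)
      rw [hbase, hbase, hsnd, hsnd, hw₂s, hbπ]
    · intro j
      refine Fin.lastCases ?_ (fun i => ?_) j
      · rwa [hsnd, hw₂s]
      · rw [hfst, hw₂f]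
        exact haC i
    · intro j
      refine Fin.lastCases ?_ (fun i => ?_) j
      · rwa [hsnd, hw₂s]
      · rw [hfst, hw₂f]
        exact ha' i

theorem productDivisor_subset_closure (hC : ∀ k, IsClosed (C k))
    (hgen : ∀ k, ∀ p ∈ C k, ∃ p', p' ⤳ p ∧ p' ∈ C k ∧ π p' = π p ∧ ∃ k', p' ∉ C k')
    {d : ℕ} (ε : Fin (d + 1) → Fin 2) :
    productDivisor π C ε ⊆ closure (productDivisor π C ε ∩ initNodeFree π C hC d) := by
  intro w hw
  obtain ⟨w', hw', -, hmem, hfree⟩ := exists_specializes_productDivisor hgen ε w hw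
  exact hw'.mem_closed isClosed_closure (subset_closure ⟨hmem, fun j => hfree j.castSucc⟩)

theorem isClosed_productDivisor (hC : ∀ k, IsClosed (C k)) {d : ℕ} (ε : Fin d → Fin 2) :
    IsClosed (productDivisor π C ε) := by
  simp only [productDivisor, Set.ofPred_forall]
  exact isClosed_iInter fun j => (hC _).preimage (fiberPowerProj π j).continuous

theorem initNodeFree_eq (hC : ∀ k, IsClosed (C k)) (d : ℕ) :
    initNodeFree π C hC d = initProj π d ⁻¹ᵁ nodeFree π C hC d := by
  ext x
  change (∀ j : Fin d, _) ↔ ∀ j : Fin d, _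
  simp_rw [← Scheme.Hom.comp_apply, initProj_proj]

end

end NodalResolution

namespace NodalResolution

/-! ## The inductive step -/

theorem mem_lexWords : ∀ {n : ℕ} (ε : Fin n → Fin 2), ε ∈ lexWords n := by
  intro n
  induction n with
  | zero => exact fun ε => List.mem_singleton.mpr (Subsingleton.elim _ _)
  | succ n ih =>
    intro ε
    rw [lexWords, List.mem_flatMap]
    refine ⟨Fin.init ε, ih _, ?_⟩
    have h := Fin.snoc_init_self ε
    obtain h0 | h1 : ε (Fin.last n) = 0 ∨ ε (Fin.last n) = 1 := by omega
    · rw [h0] at h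
      exact List.mem_cons.mpr (.inl h.symm)
    · rw [h1] at h
      exact List.mem_cons_of_mem _ (List.mem_singleton.mpr h.symm)

/-- A word of length `d + 1` is a word of length `d` followed by a letter. -/
def wordEquiv (d : ℕ) : (Fin (d + 1) → Fin 2) ≃ (Fin d → Fin 2) × Fin 2 where
  toFun ε := (Fin.init ε, ε (Fin.last d))
  invFun p := Fin.snoc (α := fun _ => Fin 2) p.1 p.2
  left_inv ε := Fin.snoc_init_self ε
  right_inv p := by simp

theorem IsParameterFamily.comp_equiv {ι κ : Type*} {R : Type u} [CommRing R] [IsLocalRing R]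
    {z : ι → R} (hz : IsParameterFamily z) (e : κ ≃ ι) : IsParameterFamily (z ∘ e) := by
  obtain ⟨G, F, hG, hm, hd⟩ := hz
  refine ⟨G.map e.symm.toEmbedding, F, fun i => ?_, ?_, by rwa [Finset.card_map]⟩
  · simp [hG]
  · rw [hm, Finset.coe_map, ← Set.image_comp]
    congr 3
    funext i
    simp

theorem IsParameterFamily.map_ringEquiv {ι : Type*} {R S : Type u} [CommRing R] [IsLocalRing R]
    [CommRing S] [IsLocalRing S] {z : ι → R} (hz : IsParameterFamily z) (e : R ≃+* S) :
    IsParameterFamily (e ∘ z) := by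
  classical
  obtain ⟨G, F, hG, hm, hd⟩ := hz
  refine ⟨G, F.image e, fun i => by simp [hG], ?_, ?_⟩
  · rw [← IsLocalRing.map_ringEquiv_maximalIdeal e, hm, Ideal.map_span, Set.image_union,
      Finset.coe_image, Set.image_comp]
  · rw [Finset.card_image_of_injective _ e.injective, ← ringKrullDim_eq_of_ringEquiv e]
    exact hd

section

variable {R₀ : Type u} [CommRing R₀] {X : Scheme.{u}} {π : X ⟶ Spec (.of R₀)} {t : R₀}
  {C : Fin 2 → Set X} {c : ∀ p : X, Fin 2 → X.presheaf.stalk p} {d : ℕ} {Y : Scheme.{u}}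
  {f : Y ⟶ fiberPower π d} {z : ∀ y : Y, (Fin d → Fin 2) → Y.presheaf.stalk y}

theorem prod_filter_wordEquiv_fst {A : Type*} [CommMonoid A] (g : (Fin d → Fin 2) × Fin 2 → A)
    (p : (Fin d → Fin 2) → Prop) [DecidablePred p] :
    ∏ ε ∈ Finset.univ.filter (fun ε : Fin (d + 1) → Fin 2 => p (Fin.init ε)), g (wordEquiv d ε) =
      ∏ i ∈ Finset.univ.filter p, g (i, 0) * g (i, 1) := by
  rw [Finset.prod_filter, Finset.prod_filter]
  refine ((wordEquiv d).prod_comp (fun a => if p a.1 then g a else 1)).trans ?_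
  rw [Fintype.prod_prod_type]
  refine Finset.prod_congr rfl fun i _ => ?_
  split_ifs <;> simp

theorem prod_filter_wordEquiv_snd {A : Type*} [CommMonoid A] (g : (Fin d → Fin 2) × Fin 2 → A)
    (k : Fin 2) :
    ∏ ε ∈ Finset.univ.filter (fun ε : Fin (d + 1) → Fin 2 => ε (Fin.last d) = k),
      g (wordEquiv d ε) = ∏ i, g (i, k) := by
  rw [Finset.prod_filter]
  refine ((wordEquiv d).prod_comp (fun a => if a.2 = k then g a else 1)).trans ?_
  rw [Fintype.prod_prod_type]
  refine Finset.prod_congr rfl fun i _ => ?_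
  simp

/-- A pair of an old word and a letter is a word of length `d + 1`. The product over the last letter
gives back the old `z i`, hence the old coordinates and `t`; the product over the old words with
fixed last letter is, up to a unit, the new coordinate. -/
theorem IsStage.isResolved (hC : ∀ k, IsClosed (C k)) [IsLocallyNoetherian Y]
    (hf : nodeFree π C hC d ≤ isoLocus f)
    (hpar : ∀ y, IsParameterFamily (z y))
    (hz : ∀ y j, HasCoord c (f ≫ fiberPowerProj π j) y (z y) (fun ε => ε j))
    (hprod : ∀ y, ∏ ε, z y ε = baseHom (f ≫ fiberPowerBase π d) y t)
    {Q : Finset (Fin d → Fin 2) → Prop} (hQ : ∀ S, Q S → ∀ i ∈ S, S = {i})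
    {W : Over (prodTotal π f)}
    (hW : IsStage z c (pullback.fst (f ≫ fiberPowerBase π d) π) (pullback.snd _ π)
      (prodTotalToPower π f ⁻¹ᵁ initNodeFree π C hC d) Q W) :
    IsResolved π t C c hC (W.hom ≫ prodTotalToPower π f) := by
  have hLN := hW.isLocallyNoetherian
  have hinit : initNodeFree π C hC d ≤ isoLocus (prodTotalToPower π f) := by
    rw [initNodeFree_eq]
    exact le_isoLocus_of_isPullback (isPullback_prodTotalToPower π f) hf
  have hle : nodeFree π C hC (d + 1) ≤ initNodeFree π C hC d := fun x hx j => hx j.castSucc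
  let r := pullback.fst (f ≫ fiberPowerBase π d) π
  let v := pullback.snd (f ≫ fiberPowerBase π d) π
  refine ⟨hLN, le_isoLocus_comp (le_trans (fun w hw => hle hw) hW.le_isoLocus)
    (hle.trans hinit), fun w => ?_⟩
  obtain ⟨S, M, N, x, y, hst, hS⟩ := hW.hasState w
  replace hS := hQ S hS
  let g := newFamily ((W.hom ≫ r).stalkMap w).hom (z ((W.hom ≫ r) w)) S M x y
  have hg : ∀ i, g i 0 * g i 1 = ((W.hom ≫ r).stalkMap w).hom (z ((W.hom ≫ r) w) i) :=
    hst.newFamily_mul hS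
  have hYn : IsNoetherianRing (Y.presheaf.stalk ((W.hom ≫ r) w)) := inferInstance
  have hWn : IsNoetherianRing (W.left.presheaf.stalk w) := inferInstance
  refine ⟨fun ε => g (Fin.init ε) (ε (Fin.last d)),
    (hst.isParameterFamily (hpar _) hS).comp_equiv (wordEquiv d), ?_, ?_⟩
  · have h₁ := prod_filter_wordEquiv_fst (d := d) (fun a => g a.1 a.2) (fun _ => True)
    simp only [Finset.filter_true, hg] at h₁
    refine h₁.trans ?_
    rw [← map_prod, hprod, stalkMap_baseHom]
    congr 2
    simp only [Category.assoc, prodTotalToPower_base]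
    rw [← pullback.condition]
  · intro j
    refine Fin.lastCases ?_ (fun j => ?_) j
    · rw [Category.assoc, prodTotalToPower_last]
      intro k
      have := prod_filter_wordEquiv_snd (d := d) (fun a => g a.1 a.2) k
      dsimp only [wordEquiv, Equiv.coe_fn_mk] at this
      rw [this]
      obtain rfl | rfl : k = 0 ∨ k = 1 := by omega
      · exact hst.exists_x₀_eq hS
      · exact hst.exists_y₀_eq hS
    · rw [Category.assoc, prodTotalToPower_castSucc, ← Category.assoc]
      intro k
      obtain ⟨a, ha, ha'⟩ := hz ((W.hom ≫ r) w) j k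
      have := prod_filter_wordEquiv_fst (d := d) (fun a => g a.1 a.2) (fun ε => ε j = k)
      dsimp only [wordEquiv, Equiv.coe_fn_mk] at this
      refine ⟨((W.hom ≫ r).stalkMap w).hom a, ha.map _, ?_⟩
      rw [Scheme.Hom.stalkMap_comp]
      refine (congrArg ((W.hom ≫ r).stalkMap w).hom ha').trans ?_
      rw [map_mul, map_prod]
      congr 1
      refine Eq.trans ?_ this.symm
      exact Finset.prod_congr rfl fun i _ => (hg i).symm

theorem isStage_id (hC : ∀ k, IsClosed (C k)) [LocallyOfFiniteType π] [IsLocallyNoetherian Y]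
    (hc : ∀ p, IsNodeChart π t p (c p))
    (hprod : ∀ y, ∏ ε, z y ε = baseHom (f ≫ fiberPowerBase π d) y t) :
    IsStage z c (pullback.fst (f ≫ fiberPowerBase π d) π) (pullback.snd _ π)
      (prodTotalToPower π f ⁻¹ᵁ initNodeFree π C hC d) (fun _ => True) (Over.mk (𝟙 _)) where
  isLocallyNoetherian :=
    LocallyOfFiniteType.isLocallyNoetherian (pullback.fst (f ≫ fiberPowerBase π d) π)
  le_isoLocus := by
    rw [le_isoLocus_iff]
    exact inferInstanceAs (IsIso (𝟙 (prodTotal π f) ∣_ _))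
  hasState := by
    change HasState z c (𝟙 (prodTotal π f) ≫ _) (𝟙 (prodTotal π f) ≫ _) _
    rw [Category.id_comp, Category.id_comp]
    intro w
    obtain ⟨S, M, N, x, y, hst, -⟩ := (hc _).exists_state (q := f ≫ fiberPowerBase π d) w (hprod _)
    exact ⟨S, M, N, x, y, hst, trivial⟩

/-- The diagonals preserve the shape of the charts without any condition on `S`; the products of
components then reduce `S` to at most one element. -/
theorem IsResolved.iteratedBlowup (hC : ∀ k, IsClosed (C k)) [LocallyOfFiniteType π]
    [IsSeparated π] (hC' : IsLocalEquation C c) (hc : ∀ p, IsNodeChart π t p (c p))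
    (hgen : ∀ k, ∀ p ∈ C k, ∃ p', p' ⤳ p ∧ p' ∈ C k ∧ π p' = π p ∧ ∃ k', p' ∉ C k')
    (hf : IsResolved π t C c hC f) :
    IsResolved π t C c hC ((iteratedBlowup (blowupCenters π f C)).hom ≫ prodTotalToPower π f) := by
  have := hf.isLocallyNoetherian
  choose z hpar hprod hz using hf.exists_family
  have hLN := LocallyOfFiniteType.isLocallyNoetherian (pullback.fst (f ≫ fiberPowerBase π d) π)
  have hprime : ∀ y, IsPrimeFamily (z y) := fun y => (hpar y).isPrimeFamily
  have hdom : ∀ y, IsDomain (Y.presheaf.stalk y) := fun y => (hpar y).isDomain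
  let h := prodTotalToPower π f
  let N := h ⁻¹ᵁ initNodeFree π C hC d
  have hinit : initNodeFree π C hC d ≤ isoLocus h := by
    rw [initNodeFree_eq]
    exact le_isoLocus_of_isPullback (isPullback_prodTotalToPower π f) hf.le_isoLocus
  have hunit : ∀ w ∈ N, ∀ i j, i ≠ j →
      IsUnit (((pullback.fst (f ≫ fiberPowerBase π d) π).stalkMap w).hom (z _ i)) ∨
      IsUnit (((pullback.fst (f ≫ fiberPowerBase π d) π).stalkMap w).hom (z _ j)) :=
    fun w hw i j hij => isUnit_of_mem_initNodeFree hC hC' hz w hw i j hij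
  have h₁ := (isStage_id (z := z) (f := f) hC hc hprod).foldl_diagonal hunit hprime hdom
    (fun _ _ _ _ => trivial) ((List.finRange d).reverse.map fun i => Set.range (diagonalSection π f i))
    (by
      intro D hD
      obtain ⟨j, -, rfl⟩ := List.mem_map.mp hD
      exact ⟨(diagonalSection π f j).isClosedEmbedding.isClosed_range,
        range_diagonalSection_subset hC hC' hdom hz hprime j,
        isDiagonalLocus_range hC hC' hc hdom hz hprime hprod j⟩)
  -- Inside `N` the strict transform of a product is its whole preimage, which is what the local
  -- equations describe.
  have hD : ∀ ε, ((strictTransform h (productDivisor π C ε) : Closeds _) : Set ↥(prodTotal π f)) ∩ N =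
      h ⁻¹' productDivisor π C ε ∩ N := by
    intro ε
    rw [strictTransform_eq h hinit (productDivisor_subset_closure hC hgen ε)]
    refine Set.Subset.antisymm (fun w hw => ⟨?_, hw.2⟩) (fun w hw => ⟨subset_closure hw, hw.2⟩)
    exact closure_minimal Set.inter_subset_left
      ((isClosed_productDivisor hC ε).preimage h.continuous) hw.1
  have h₂ := IsStage.foldl_product hunit hprime hdom (lexWords (d + 1))
    (fun ε => ((strictTransform h (productDivisor π C ε) : Closeds _) : Set ↥(prodTotal π f)))
    (fun ε => Fin.init ε) (fun ε => ε (Fin.last d)) (by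
      intro ε _
      refine ⟨(strictTransform h (productDivisor π C ε)).isClosed, ?_, ?_⟩
      · rw [hD, strictTransform_eq h hinit (productDivisor_subset_closure hC hgen ε)]
        exact subset_rfl
      · rw [hD]
        exact isProductLocus_preimage_productDivisor hC hC' hc hz hprod ε)
    (fun _ _ _ _ => trivial) h₁
  rw [← List.foldl_append] at h₂
  refine IsStage.isResolved hC hf.le_isoLocus hpar hz hprod ?_ h₂
  rintro S ⟨-, hS⟩ i hi
  -- Every old word is the initial part of some center; either last letter would do.
  have := hS (Fin.snoc (α := fun _ => Fin 2) i 0) (mem_lexWords _)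
  rw [Fin.init_snoc] at this
  exact this hi

end

end NodalResolution

namespace NodalResolution

/-! ## The induction -/

section

variable {R₀ : Type u} [CommRing R₀] {X : Scheme.{u}} {π : X ⟶ Spec (.of R₀)} {t : R₀}
  {C : Fin 2 → Set X} {c : ∀ p : X, Fin 2 → X.presheaf.stalk p} {d : ℕ} {Y : Scheme.{u}}
  {f : Y ⟶ fiberPower π d}

theorem IsResolved.comp_of_isIso {hC : ∀ k, IsClosed (C k)} (hf : IsResolved π t C c hC f)
    {Y' : Scheme.{u}} (e : Y' ⟶ Y) [IsIso e] : IsResolved π t C c hC (e ≫ f) where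
  isLocallyNoetherian :=
    have := hf.isLocallyNoetherian
    isLocallyNoetherian_of_isOpenImmersion e
  le_isoLocus := le_isoLocus_comp ((le_isoLocus_iff _ _).mpr inferInstance) hf.le_isoLocus
  exists_family y := by
    obtain ⟨z, hz, hprod, hcoord⟩ := hf.exists_family (e y)
    let φ := (asIso (e.stalkMap y)).commRingCatIsoToRingEquiv
    refine ⟨φ ∘ z, hz.map_ringEquiv φ, ?_, fun j k => ?_⟩
    · have := congrArg φ hprod
      rw [map_prod] at this
      refine this.trans ?_
      rw [Category.assoc]
      exact stalkMap_baseHom _ e y t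
    · obtain ⟨v, hv, hv'⟩ := hcoord j k
      refine ⟨φ v, hv.map φ, ?_⟩
      rw [Category.assoc, Scheme.Hom.stalkMap_comp]
      refine (congrArg φ hv').trans ?_
      rw [map_mul, map_prod]
      rfl

theorem IsResolved.isRegularScheme {hC : ∀ k, IsClosed (C k)} (hf : IsResolved π t C c hC f) :
    IsRegularScheme Y where
  isLocallyNoetherian := hf.isLocallyNoetherian
  isRegularLocalRing_stalk y := by
    have := hf.isLocallyNoetherian
    obtain ⟨z, hz, -⟩ := hf.exists_family y
    exact hz.isRegularLocalRing

instance isIso_fiberPowerBase_zero {B : Scheme.{u}} (π : X ⟶ B) : IsIso (fiberPowerBase π 0) := by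
  let i : B ⟶ fiberPower π 0 := WidePullback.lift (𝟙 B) (fun j => j.elim0) (fun j => j.elim0)
  have h : i ≫ fiberPowerBase π 0 = 𝟙 B := WidePullback.lift_base ..
  refine ⟨i, ?_, h⟩
  apply WidePullback.hom_ext
  · exact fun j => j.elim0
  · rw [Category.assoc, h, Category.comp_id, Category.id_comp]

/-- A uniformizer of a discrete valuation ring is a parameter in all local rings. -/
theorem isParameterFamily_of_isLocalization {ι : Type*} [Unique ι] [IsDomain R₀]
    [IsDiscreteValuationRing R₀] (ht : Irreducible t) {A : Type u} [CommRing A] [IsLocalRing A]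
    [Algebra R₀ A] (M : Submonoid R₀) [IsLocalization M A] :
    IsParameterFamily (fun _ : ι => algebraMap R₀ A t) := by
  classical
  let P := (IsLocalRing.maximalIdeal A).comap (algebraMap R₀ A)
  have hP : P.map (algebraMap R₀ A) = IsLocalRing.maximalIdeal A :=
    IsLocalization.map_under M A _
  have hPp : P.IsPrime := inferInstance
  have hmax := ht.maximalIdeal_eq
  by_cases htP : t ∈ P
  · have hPm : P = Ideal.span {t} := by
      refine le_antisymm ?_ ((Ideal.span_singleton_le_iff_mem _).mpr htP)
      rw [← hmax]
      exact IsLocalRing.le_maximalIdeal hPp.ne_top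
    refine ⟨{default}, ∅, fun i => ?_, ?_, ?_⟩
    · rw [Subsingleton.elim i default]
      simpa using (show ¬ IsUnit (algebraMap R₀ A t) from htP)
    · rw [← hP, hPm, Ideal.map_span]
      simp
    -- The contracted prime is the maximal ideal, so only units were inverted and `A` is `R₀`, of
    -- dimension one.
    · have hM : M ≤ IsUnit.submonoid R₀ := by
        intro m hmM
        by_contra hm
        have : m ∈ P := by
          rw [hPm, ← hmax]
          exact hm
        exact this (IsLocalization.map_units A ⟨m, hmM⟩)
      have e := (IsLocalization.atUnits R₀ M (S := A) hM).toRingEquiv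
      rw [← ringKrullDim_eq_of_ringEquiv e,
        IsPrincipalIdealRing.ringKrullDim_eq_one R₀ (IsDiscreteValuationRing.not_isField R₀)]
      simp
  -- Otherwise the contracted prime is zero, so the maximal ideal of `A` is zero, and `t` is a unit.
  · have hP0 : P = ⊥ := by
      by_contra h
      have hPm := hPp.isMaximal h
      rw [IsLocalRing.eq_maximalIdeal hPm, hmax] at htP
      exact htP (Ideal.mem_span_singleton_self t)
    have hu : IsUnit (algebraMap R₀ A t) := by
      by_contra h
      exact htP h
    refine ⟨∅, ∅, fun i => by simp [hu], ?_, ?_⟩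
    · rw [← hP, hP0, Ideal.map_bot]
      simp
    · simpa using ringKrullDim_nonneg_of_nontrivial

/-- `X ^ 0` is the base, and the only word is empty: the family consists of the uniformizer. -/
theorem isResolved_zero (hC : ∀ k, IsClosed (C k)) [IsDomain R₀] [IsDiscreteValuationRing R₀]
    (ht : Irreducible t) : IsResolved π t C c hC (𝟙 (fiberPower π 0)) where
  isLocallyNoetherian := isLocallyNoetherian_of_isOpenImmersion (fiberPowerBase π 0)
  le_isoLocus := (le_isoLocus_iff _ _).mpr inferInstance
  exists_family y := by
    refine ⟨fun _ => baseHom (𝟙 _ ≫ fiberPowerBase π 0) y t, ?_, by simp, fun j => j.elim0⟩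
    let i := inv (fiberPowerBase π 0)
    obtain ⟨P, hP⟩ := i.homeomorph.surjective y
    obtain ⟨ψ, ⟨M, hM⟩, hψ⟩ := exists_stalk_of_isIso_stalkMap i hP
    have h : ψ.hom = baseHom (𝟙 _ ≫ fiberPowerBase π 0) y := by
      have : ψ = CommRingCat.ofHom (baseHom (𝟙 _ ≫ fiberPowerBase π 0) y) := by
        apply Spec.map_injective
        rw [specMap_baseHom, ← hψ, Category.id_comp, Category.assoc, IsIso.inv_hom_id,
          Category.comp_id]
      exact congrArg CommRingCat.Hom.hom this
    rw [← h]
    let := ψ.hom.toAlgebra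
    exact isParameterFamily_of_isLocalization ht M

/-- Obtained from `d = 0` without any blowup, since over a single word `S` has at most one element
from the start. -/
theorem isResolved_one (hC : ∀ k, IsClosed (C k)) [IsDomain R₀] [IsDiscreteValuationRing R₀]
    (ht : Irreducible t) [LocallyOfFiniteType π] (hc : ∀ p, IsNodeChart π t p (c p)) :
    IsResolved π t C c hC (𝟙 (fiberPower π 1)) := by
  have h₀ := isResolved_zero (π := π) (t := t) (c := c) hC ht
  have := h₀.isLocallyNoetherian
  choose z hpar hprod hz using h₀.exists_family
  have h₁ := (isStage_id (z := z) hC hc hprod).isResolved hC h₀.le_isoLocus hpar hz hprod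
    (fun S _ i hi => Finset.eq_singleton_iff_unique_mem.mpr ⟨hi, fun j _ => Subsingleton.elim j i⟩)
  have hiso : IsIso (prodTotalToPower π (𝟙 (fiberPower π 0))) :=
    (isPullback_prodTotalToPower π (𝟙 (fiberPower π 0))).isIso_fst_of_isIso
  have h₂ : IsResolved π t C c hC (prodTotalToPower π (𝟙 (fiberPower π 0))) := by
    have : (Over.mk (𝟙 (prodTotal π (𝟙 (fiberPower π 0))))).hom ≫
        prodTotalToPower π (𝟙 (fiberPower π 0)) = prodTotalToPower π (𝟙 (fiberPower π 0)) :=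
      Category.id_comp _
    rwa [this] at h₁
  have h₃ := h₂.comp_of_isIso (inv (prodTotalToPower π (𝟙 (fiberPower π 0))))
  rwa [IsIso.inv_hom_id] at h₃

theorem isResolved_desingularization (hC : ∀ k, IsClosed (C k)) [IsDomain R₀]
    [IsDiscreteValuationRing R₀] (ht : Irreducible t) [LocallyOfFiniteType π] [IsSeparated π]
    (hC' : IsLocalEquation C c) (hc : ∀ p, IsNodeChart π t p (c p))
    (hgen : ∀ k, ∀ p ∈ C k, ∃ p', p' ⤳ p ∧ p' ∈ C k ∧ π p' = π p ∧ ∃ k', p' ∉ C k') (d : ℕ) :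
    IsResolved π t C c hC ((desingularization π C (d + 1)).hom :
      (desingularization π C (d + 1)).left ⟶ fiberPower π (d + 1)) := by
  induction d with
  | zero => exact isResolved_one hC ht hc
  | succ d ih => exact ih.iteratedBlowup hC hC' hc hgen

end

end NodalResolution

namespace NodalResolution

open IsLocalRing

/-! ## A criterion for essentially étale homomorphisms to regular local rings -/

section

variable {A O : Type u} [CommRing A] [CommRing O]

/-- The bound on the generators makes `D` a regular domain of dimension at most that of `O`; a
nonzero element of the kernel would lower the dimension. -/
theorem injective_of_surjective_of_card_le {D : Type u} [CommRing D] [IsLocalRing D]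
    [IsNoetherianRing D] {ψ : D →+* O} (hψ : Function.Surjective ψ) {s : Finset D}
    (hs : maximalIdeal D = Ideal.span (s : Set D))
    (hd : (s.card : WithBot ℕ∞) ≤ ringKrullDim O) : Function.Injective ψ := by
  have hDO := ringKrullDim_le_of_surjective ψ hψ
  have := isDomain_of_card_le hs (hd.trans hDO)
  refine (injective_iff_map_eq_zero ψ).mpr fun r hr => ?_
  by_contra hr0
  have h₁ := ringKrullDim_quotient_succ_le_of_nonZeroDivisor (mem_nonZeroDivisors_of_ne_zero hr0)
  have h₂ : ringKrullDim O ≤ ringKrullDim (D ⧸ Ideal.span {r}) :=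
    ringKrullDim_le_of_surjective (Ideal.Quotient.lift _ ψ fun a ha => by
        obtain ⟨b, rfl⟩ := Ideal.mem_span_singleton.mp ha
        rw [map_mul, hr, zero_mul])
      (Ideal.Quotient.lift_surjective_of_surjective _ _ hψ)
  have h₃ : (s.card : WithBot ℕ∞) + 1 ≤ s.card :=
    (add_le_add_left (hd.trans h₂) 1).trans (h₁.trans (ringKrullDim_le_card hs))
  have h₄ : s.card + 1 ≤ s.card := by exact_mod_cast h₃
  omega

variable [IsLocalRing O]

/-- Locally an unramified algebra is a quotient of a standard étale one. Its local ring `D` has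
maximal ideal generated by the image of `s`, so the dimension of `O` leaves no room for a kernel of
`D → O`. -/
theorem essEtale_of_formallyUnramified [IsNoetherianRing A] [Algebra A O]
    [Algebra.EssFiniteType A O] [Algebra.FormallyUnramified A O] {s : Finset A}
    (hs : (maximalIdeal O).comap (algebraMap A O) = Ideal.span (s : Set A))
    (hd : (s.card : WithBot ℕ∞) ≤ ringKrullDim O) : EssEtale (algebraMap A O) := by
  classical
  let S := Algebra.EssFiniteType.subalgebra A O
  let Q := (maximalIdeal O).comap (algebraMap S O)
  have hQ : Q.primeCompl = Algebra.EssFiniteType.submonoid A O := by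
    ext a
    simp [Q, Ideal.primeCompl, Algebra.EssFiniteType.submonoid, IsUnit.mem_submonoid_iff, S]
  have : IsLocalization.AtPrime O Q := by
    rw [IsLocalization.AtPrime, hQ]
    infer_instance
  let e : O ≃ₐ[A] Localization.AtPrime Q :=
    (IsLocalization.algEquiv Q.primeCompl O (Localization.AtPrime Q)).restrictScalars A
  have : Algebra.IsUnramifiedAt A Q := Algebra.FormallyUnramified.of_equiv e
  obtain ⟨f, hfQ, P, φ, hφ⟩ :=
    Algebra.IsUnramifiedAt.exists_hasStandardEtaleSurjectionOn (R := A) Q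
  have hf : IsUnit (algebraMap S O f) := by simpa [Q] using hfQ
  let g : Localization.Away f →+* O := IsLocalization.Away.lift f hf
  have hg : ∀ a : S, g (algebraMap _ _ a) = algebraMap S O a := IsLocalization.Away.lift_eq f hf
  let ψ : P.Ring →+* O := g.comp φ.toRingHom
  have hψ : ψ.comp (algebraMap A P.Ring) = algebraMap A O := by
    ext a
    change g (φ (algebraMap _ _ a)) = _
    rw [AlgHom.commutes, IsScalarTower.algebraMap_apply A S (Localization.Away f), hg]
    rfl
  let Q' := (maximalIdeal O).comap ψ
  have hQ' : ∀ m : Q'.primeCompl, IsUnit (ψ m) := fun m => by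
    have := m.2
    simpa [Q', Ideal.primeCompl] using! this
  let D := Localization.AtPrime Q'
  let ψ' : D →+* O := IsLocalization.lift hQ'
  have hψ' : ∀ a, ψ' (algebraMap P.Ring D a) = ψ a := fun a => IsLocalization.lift_eq hQ' a
  have hsurj : Function.Surjective ψ' := by
    intro z
    obtain ⟨a, b, hb⟩ := IsLocalization.exists_mk'_eq Q.primeCompl z
    obtain ⟨a', ha'⟩ := hφ (algebraMap _ _ a)
    obtain ⟨b', hb'⟩ := hφ (algebraMap _ _ (b : S))
    have ha : ψ a' = algebraMap S O a := by
      change g (φ a') = _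
      rw [ha', hg]
    have hbb : ψ b' = algebraMap S O b := by
      change g (φ b') = _
      rw [hb', hg]
    have hu : IsUnit (ψ b') := hbb ▸ IsLocalization.map_units O b
    have hbQ : b' ∈ Q'.primeCompl := by
      simpa [Q', Ideal.primeCompl] using! hu
    refine ⟨IsLocalization.mk' D a' ⟨b', hbQ⟩, ?_⟩
    rw [IsLocalization.lift_mk'_spec, ha, hbb, mul_comm, ← hb]
    exact (IsLocalization.mk'_spec O a b).symm
  have : IsNoetherianRing P.Ring := Algebra.FiniteType.isNoetherianRing A _
  have : IsNoetherianRing D := IsLocalization.isNoetherianRing Q'.primeCompl _ inferInstance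
  have hE : EssEtale (algebraMap A D) := by
    rw [IsScalarTower.algebraMap_eq A P.Ring D]
    refine EssEtale.comp ?_ (EssEtale.of_isLocalization Q'.primeCompl)
    exact essEtale_algebraMap.mpr ⟨inferInstance, inferInstance, inferInstance⟩
  have hcomp : ψ'.comp (algebraMap A D) = algebraMap A O := by
    ext a
    rw [← hψ, RingHom.comp_apply, IsScalarTower.algebraMap_apply A P.Ring D, hψ']
    rfl
  have hlocal : (maximalIdeal O).comap ψ' = maximalIdeal D := by
    ext a
    obtain ⟨a, b, rfl⟩ := IsLocalization.exists_mk'_eq Q'.primeCompl a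
    rw [IsLocalization.AtPrime.mk'_mem_maximal_iff D Q', Ideal.mem_comap,
      ← Ideal.unit_mul_mem_iff_mem _ (hQ' b)]
    change _ ↔ ψ a ∈ maximalIdeal O
    rw [← hψ' (b : P.Ring), ← map_mul, IsLocalization.mk'_spec', hψ']
  -- Since `D` is étale over `A`, its maximal ideal is extended from `A`.
  have hD := hE.map_comap_maximalIdeal
  rw [← hlocal, Ideal.comap_comap, hcomp, hs, Ideal.map_span, ← Finset.coe_image, hlocal] at hD
  have hinj := injective_of_surjective_of_card_le hsurj hD.symm
    (le_trans (by exact_mod_cast Finset.card_image_le) hd)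
  rw [← hcomp]
  exact hE.comp (EssEtale.of_bijective ⟨hinj, hsurj⟩)

/-- The residue extension is trivial, hence separable, and the maximal ideal is extended from below:
the map is unramified. -/
theorem essEtale_of_surjective_residue [IsNoetherianRing A] {φ : A →+* O}
    (hφ : φ.EssFiniteType) (hres : Function.Surjective ((residue O).comp φ)) {s : Finset A}
    (hs : (maximalIdeal O).comap φ = Ideal.span (s : Set A))
    (hm : ((maximalIdeal O).comap φ).map φ = maximalIdeal O)
    (hd : (s.card : WithBot ℕ∞) ≤ ringKrullDim O) : EssEtale φ := by
  algebraize [φ]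
  set p := (maximalIdeal O).comap φ
  have hp : ∀ m : p.primeCompl, IsUnit (φ m) := fun m => by
    have := m.2
    simpa [p, Ideal.primeCompl] using! this
  let ψ : Localization.AtPrime p →+* O := IsLocalization.lift hp
  have hψ : ψ.comp (algebraMap A (Localization.AtPrime p)) = φ := IsLocalization.lift_comp hp
  algebraize [ψ]
  have : IsScalarTower A (Localization.AtPrime p) O := .of_algebraMap_eq' hψ.symm
  have H : (maximalIdeal (Localization.AtPrime p)).map
      (algebraMap (Localization.AtPrime p) O) = maximalIdeal O := by
    rw [← Localization.AtPrime.map_eq_maximalIdeal, Ideal.map_map]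
    change p.map (ψ.comp (algebraMap A _)) = _
    rw [hψ, hm]
  have : IsLocalHom (algebraMap (Localization.AtPrime p) O) :=
    ((local_hom_TFAE (algebraMap (Localization.AtPrime p) O)).out 0 2).mpr H.le
  have : Algebra.IsSeparable (ResidueField (Localization.AtPrime p)) (ResidueField O) := by
    refine ⟨fun z => ?_⟩
    obtain ⟨a, rfl⟩ := hres z
    have : (residue O).comp φ a = algebraMap (ResidueField (Localization.AtPrime p)) _
        (residue _ (algebraMap A _ a)) :=
      congrArg (residue O) congr($hψ a).symm
    rw [this]
    exact isSeparable_algebraMap _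
  have : Algebra.EssFiniteType (Localization.AtPrime p) O := .of_comp A _ _
  have : Algebra.FormallyUnramified (Localization.AtPrime p) O := .of_map_maximalIdeal H
  have : Algebra.FormallyUnramified A (Localization.AtPrime p) := .of_isLocalization p.primeCompl
  have : Algebra.FormallyUnramified A O := .comp _ (Localization.AtPrime p) _
  exact essEtale_of_formallyUnramified hs hd

end

end NodalResolution

/-! ### Étale coordinates from generators of the maximal ideal. -/

namespace NodalResolution

open IsLocalRing

section

theorem Node.exists_sub_mem {R₀ : Type u} [CommRing R₀] {s : R₀} {J : Ideal (Node R₀ s)} {a b : R₀}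
    (hx : Node.x R₀ s - algebraMap R₀ _ a ∈ J) (hy : Node.y R₀ s - algebraMap R₀ _ b ∈ J)
    (f : Node R₀ s) : ∃ c : R₀, f - algebraMap R₀ _ c ∈ J := by
  induction f using Node.induction with
  | hC r => exact ⟨r, by simp⟩
  | hx => exact ⟨a, hx⟩
  | hy => exact ⟨b, hy⟩
  | hadd f g hf hg =>
    obtain ⟨c, hc⟩ := hf
    obtain ⟨d, hd⟩ := hg
    exact ⟨c + d, by simpa [add_sub_add_comm] using! add_mem hc hd⟩
  | hmul f g hf hg =>
    obtain ⟨c, hc⟩ := hf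
    obtain ⟨d, hd⟩ := hg
    refine ⟨c * d, ?_⟩
    rw [map_mul, show f * g - algebraMap R₀ _ c * algebraMap R₀ _ d =
      g * (f - algebraMap R₀ _ c) + algebraMap R₀ _ c * (g - algebraMap R₀ _ d) by ring]
    exact add_mem (J.mul_mem_left _ hc) (J.mul_mem_left _ hd)

variable {R₀ O : Type u} [CommRing R₀] [CommRing O] [IsLocalRing R₀] [IsLocalRing O]
  [IsNoetherianRing R₀] {t : R₀} {β : R₀ →+* O}

/-- Modulo `G` both coordinates are constants and the uniformizer vanishes, so the contraction of
the maximal ideal is exactly `(G)`. -/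
theorem essEtale_nodeLift (ht : maximalIdeal R₀ = Ideal.span {t}) [IsLocalHom β]
    (hβ : β.EssFiniteType) (hres : Function.Surjective ((residue O).comp β)) {x y : O} {s : R₀}
    (h : x * y = β s) {G : Finset (Node R₀ s)} {a b : R₀}
    (hx : Node.x R₀ s - algebraMap R₀ _ a ∈ Ideal.span (G : Set (Node R₀ s)))
    (hy : Node.y R₀ s - algebraMap R₀ _ b ∈ Ideal.span (G : Set (Node R₀ s)))
    (hG : algebraMap R₀ _ t ∈ Ideal.span (G : Set (Node R₀ s)))
    (hm : maximalIdeal O = (Ideal.span (G : Set (Node R₀ s))).map (Node.lift β x y h))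
    (hd : (G.card : WithBot ℕ∞) ≤ ringKrullDim O) : EssEtale (Node.lift β x y h) := by
  have hcomp := Node.lift_comp_algebraMap β x y h
  have hle : Ideal.span (G : Set (Node R₀ s)) ≤ (maximalIdeal O).comap (Node.lift β x y h) := by
    rw [hm]
    exact Ideal.le_comap_map
  have hcomap : (maximalIdeal O).comap (Node.lift β x y h) =
      Ideal.span (G : Set (Node R₀ s)) := by
    refine le_antisymm (fun f hf => ?_) hle
    obtain ⟨c, hc⟩ := Node.exists_sub_mem hx hy f
    have hc' : β c ∈ maximalIdeal O := by
      have := sub_mem hf (hle hc)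
      rwa [sub_sub_cancel, Ideal.mem_comap, Node.lift_algebraMap] at this
    have hc'' : c ∈ maximalIdeal R₀ := by
      have : (maximalIdeal O).comap β = maximalIdeal R₀ :=
        ((local_hom_TFAE β).out 0 4).mp ‹IsLocalHom β›
      rwa [← this, Ideal.mem_comap]
    rw [ht, Ideal.mem_span_singleton] at hc''
    obtain ⟨d, rfl⟩ := hc''
    rw [← sub_add_cancel f (algebraMap R₀ _ (t * d))]
    exact add_mem hc (by rw [map_mul]; exact Ideal.mul_mem_right _ _ hG)
  refine essEtale_of_surjective_residue ?_ ?_ hcomap ?_ hd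
  · rw [← hcomp] at hβ
    algebraize [Node.lift β x y h, (Node.lift β x y h).comp (algebraMap R₀ _)]
    exact Algebra.EssFiniteType.of_comp R₀ _ _
  · refine Function.Surjective.of_comp (g := algebraMap R₀ (Node R₀ s)) ?_
    rw [← RingHom.coe_comp, RingHom.comp_assoc, hcomp]
    exact hres
  · rw [hcomap, ← hm]

theorem essEtale_nodeLift_node (ht : maximalIdeal R₀ = Ideal.span {t}) [IsLocalHom β]
    (hβ : β.EssFiniteType) (hres : Function.Surjective ((residue O).comp β)) {x y : O}
    (h : x * y = β t) (hm : maximalIdeal O = Ideal.span {x, y}) (hd : 2 ≤ ringKrullDim O) :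
    EssEtale (Node.lift β x y h) := by
  classical
  have hx : Node.x R₀ t ∈ Ideal.span
      (({Node.x R₀ t, Node.y R₀ t} : Finset (Node R₀ t)) : Set (Node R₀ t)) :=
    Ideal.subset_span (by simp)
  have hy : Node.y R₀ t ∈ Ideal.span
      (({Node.x R₀ t, Node.y R₀ t} : Finset (Node R₀ t)) : Set (Node R₀ t)) :=
    Ideal.subset_span (by simp)
  refine essEtale_nodeLift ht hβ hres h (G := {Node.x R₀ t, Node.y R₀ t}) (a := 0) (b := 0)
    (by simpa using! hx) (by simpa using! hy) ?_ ?_ (le_trans ?_ hd)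
  · rw [← Node.x_mul_y]
    exact Ideal.mul_mem_right _ _ hx
  · rw [Ideal.map_span, hm]
    congr 1
    simp [Set.image_pair]
  · exact_mod_cast Finset.card_le_two

/-- The image point is `x = y = 1` on `x y = 1`, where `y - 1 = -y (x - 1)` needs no generator of
its own. -/
theorem essEtale_nodeLift_smooth (ht : maximalIdeal R₀ = Ideal.span {t}) [IsLocalHom β]
    (hβ : β.EssFiniteType) (hres : Function.Surjective ((residue O).comp β)) {x y : O}
    (h : x * y = β 1) (hm : maximalIdeal O = Ideal.span {β t, x - 1}) (hd : 2 ≤ ringKrullDim O) :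
    EssEtale (Node.lift β x y h) := by
  classical
  have ht' : algebraMap R₀ _ t ∈ Ideal.span
      (({algebraMap R₀ _ t, Node.x R₀ 1 - 1} : Finset (Node R₀ 1)) : Set (Node R₀ 1)) :=
    Ideal.subset_span (by simp)
  have hx : Node.x R₀ 1 - 1 ∈ Ideal.span
      (({algebraMap R₀ _ t, Node.x R₀ 1 - 1} : Finset (Node R₀ 1)) : Set (Node R₀ 1)) :=
    Ideal.subset_span (by simp)
  refine essEtale_nodeLift ht hβ hres h (G := {algebraMap R₀ _ t, Node.x R₀ 1 - 1}) (a := 1)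
    (b := 1) (by simpa using! hx) ?_ ht' ?_ (le_trans ?_ hd)
  · have : Node.y R₀ 1 - algebraMap R₀ _ 1 = -Node.y R₀ 1 * (Node.x R₀ 1 - 1) := by
      have := Node.x_mul_y (R := R₀) (s := 1)
      rw [map_one] at *
      linear_combination this
    rw [this]
    exact Ideal.mul_mem_left _ _ hx
  · rw [Ideal.map_span, hm]
    congr 1
    simp [Set.image_pair]
  · exact_mod_cast Finset.card_le_two

end

section

variable {R₀ : Type u} [CommRing R₀] [IsLocalRing R₀] [IsNoetherianRing R₀] {X : Scheme.{u}}
  {π : X ⟶ Spec (.of R₀)} {t : R₀} {p : X}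

theorem isNodeChart_of_node (ht : maximalIdeal R₀ = Ideal.span {t}) (hloc : IsLocalHom (baseHom π p))
    (hβ : (baseHom π p).EssFiniteType)
    (hres : Function.Surjective ((residue (X.presheaf.stalk p)).comp (baseHom π p)))
    (hd : 2 ≤ ringKrullDim (X.presheaf.stalk p)) {x y : X.presheaf.stalk p}
    (h : x * y = baseHom π p t) (hm : maximalIdeal _ = Ideal.span {x, y}) :
    IsNodeChart π t p ![x, y] :=
  ⟨1, t, 1, x, y, h, .inr (.inl ⟨rfl, rfl, rfl⟩), essEtale_nodeLift_node ht hβ hres h hm hd,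
    by simp, by simp⟩

/-- The parameter `z` is shifted to the unit `z + 1`, which with its inverse gives coordinates on `x
y = 1`; the factor `t` is then put on the side of the component through the point. -/
theorem exists_isNodeChart_of_smooth (ht : maximalIdeal R₀ = Ideal.span {t})
    (hloc : IsLocalHom (baseHom π p)) (hβ : (baseHom π p).EssFiniteType)
    (hres : Function.Surjective ((residue (X.presheaf.stalk p)).comp (baseHom π p)))
    (hd : 2 ≤ ringKrullDim (X.presheaf.stalk p)) {z : X.presheaf.stalk p}
    (hm : maximalIdeal _ = Ideal.span {baseHom π p t, z}) (k : Fin 2) :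
    ∃ c, IsNodeChart π t p c ∧ Associated (c k) (baseHom π p t) ∧ ∀ j ≠ k, IsUnit (c j) := by
  have hz : z ∈ maximalIdeal (X.presheaf.stalk p) := hm ▸ Ideal.subset_span (by simp)
  have hu : IsUnit (z + 1) := by
    by_contra hu
    exact (Ideal.ne_top_iff_one _).mp (maximalIdeal.isMaximal _).ne_top
      ((Ideal.add_mem_iff_right _ hz).mp ((mem_maximalIdeal _).mpr hu))
  obtain ⟨u, hu⟩ := hu
  have h : (u : X.presheaf.stalk p) * (u⁻¹ : (X.presheaf.stalk p)ˣ) = baseHom π p 1 := by simp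
  have hE := essEtale_nodeLift_smooth ht hβ hres h (by rw [hu, add_sub_cancel_right, hm]) hd
  fin_cases k
  · refine ⟨![u * baseHom π p t, (u⁻¹ : (X.presheaf.stalk p)ˣ)],
      ⟨t, 1, 1, u, _, h, .inl ⟨rfl, rfl, rfl⟩, hE, by simp, by simp⟩, ?_, ?_⟩
    · exact (associated_unit_mul_left _ _ u.isUnit)
    · intro j hj
      fin_cases j
      · exact absurd rfl hj
      · exact (u⁻¹).isUnit
  · refine ⟨![u, (u⁻¹ : (X.presheaf.stalk p)ˣ) * baseHom π p t],
      ⟨1, 1, t, u, _, h, .inr (.inr ⟨rfl, rfl, rfl⟩), hE, by simp, by simp⟩, ?_, ?_⟩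
    · exact (associated_unit_mul_left _ _ (u⁻¹).isUnit)
    · intro j hj
      fin_cases j
      · exact u.isUnit
      · exact absurd rfl hj

end

end NodalResolution

namespace NodalResolution

open IsLocalRing

/-! ## Nodes -/

section

variable {k : Type u} [Field k]

theorem mem_maximalIdeal_mvPowerSeries {σ : Type*} {F : MvPowerSeries σ k} :
    F ∈ maximalIdeal (MvPowerSeries σ k) ↔ MvPowerSeries.coeff 0 F = 0 := by
  rw [mem_maximalIdeal, mem_nonunits_iff, MvPowerSeries.isUnit_iff_constantCoeff, isUnit_iff_ne_zero,
    not_not]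
  rfl

/-- The restriction of power series to a coordinate axis. -/
noncomputable def axisHom {σ : Type*} (i : σ) : MvPowerSeries σ k →+* PowerSeries k where
  toFun F := PowerSeries.mk fun n => MvPowerSeries.coeff (Finsupp.single i n) F
  map_one' := by
    classical
    ext n
    rw [PowerSeries.coeff_mk, MvPowerSeries.coeff_one, PowerSeries.coeff_one]
    simp
  map_mul' F G := by
    classical
    ext n
    rw [PowerSeries.coeff_mk, MvPowerSeries.coeff_mul, Finsupp.antidiagonal_single,
      Finset.sum_map, PowerSeries.coeff_mul]
    simp
  map_zero' := by ext; simp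
  map_add' F G := by ext; simp

theorem coeff_axisHom {σ : Type*} (i : σ) (F : MvPowerSeries σ k) (n : ℕ) :
    PowerSeries.coeff n (axisHom i F) = MvPowerSeries.coeff (Finsupp.single i n) F :=
  PowerSeries.coeff_mk n fun n => MvPowerSeries.coeff (Finsupp.single i n) F

/-- On either coordinate axis `x y` vanishes, and the hypothesis says that the square of the
restriction of `F` is divisible by `X ^ 3`. Then the restriction is divisible by `X ^ 2`. -/
theorem coeff_single_one_eq_zero_of_sq_mem {F : MvPowerSeries (Fin 2) k}
    (hF : F ∈ maximalIdeal (MvPowerSeries (Fin 2) k))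
    (h : F ^ 2 ∈ maximalIdeal (MvPowerSeries (Fin 2) k) ^ 3 ⊔
      Ideal.span {MvPowerSeries.X 0 * MvPowerSeries.X 1}) (i : Fin 2) :
    MvPowerSeries.coeff (Finsupp.single i 1) F = 0 := by
  classical
  have hmap : ∀ G ∈ maximalIdeal (MvPowerSeries (Fin 2) k),
      axisHom i G ∈ Ideal.span {(PowerSeries.X : PowerSeries k)} := by
    intro G hG
    rw [Ideal.mem_span_singleton, PowerSeries.X_dvd_iff, ← PowerSeries.coeff_zero_eq_constantCoeff,
      coeff_axisHom, Finsupp.single_zero]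
    exact mem_maximalIdeal_mvPowerSeries.mp hG
  have hXY : axisHom i (MvPowerSeries.X 0 * MvPowerSeries.X 1 : MvPowerSeries (Fin 2) k) = 0 := by
    have : ∀ j : Fin 2, j ≠ i → axisHom i (MvPowerSeries.X j : MvPowerSeries (Fin 2) k) = 0 := by
      intro j hj
      ext n
      rw [coeff_axisHom, MvPowerSeries.coeff_X, if_neg, map_zero]
      intro h
      rcases (Finsupp.single_eq_single_iff _ _ _ _).mp h with h | h
      · exact hj h.1.symm
      · exact one_ne_zero h.2
    rw [map_mul]
    fin_cases i
    · rw [this 1 (by decide), mul_zero]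
    · rw [this 0 (by decide), zero_mul]
  have hle : maximalIdeal (MvPowerSeries (Fin 2) k) ^ 3 ⊔
      Ideal.span {MvPowerSeries.X 0 * MvPowerSeries.X 1} ≤
      (Ideal.span {(PowerSeries.X : PowerSeries k)} ^ 3).comap (axisHom i) := by
    refine sup_le ?_ ?_
    · rw [← Ideal.map_le_iff_le_comap, Ideal.map_pow]
      exact Ideal.pow_right_mono (Ideal.map_le_iff_le_comap.mpr hmap) 3
    · rw [Ideal.span_singleton_le_iff_mem, Ideal.mem_comap, hXY]
      exact zero_mem _
  have h₁ := hle h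
  rw [Ideal.mem_comap, map_pow, Ideal.span_singleton_pow, Ideal.mem_span_singleton] at h₁
  obtain ⟨g, hg⟩ := Ideal.mem_span_singleton.mp (hmap F hF)
  have hX := PowerSeries.X_prime (R := k)
  have h₂ : (PowerSeries.X : PowerSeries k) ∣ g := by
    rw [hg, mul_pow, pow_succ _ 2] at h₁
    exact hX.dvd_of_dvd_pow ((mul_dvd_mul_iff_left (pow_ne_zero 2 hX.ne_zero)).mp h₁)
  have h₃ : (PowerSeries.X : PowerSeries k) ^ 2 ∣ axisHom i F := by
    rw [hg, pow_two]
    exact mul_dvd_mul_left _ h₂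
  rw [← coeff_axisHom]
  exact PowerSeries.X_pow_dvd_iff.mp h₃ 1 one_lt_two

theorem mem_maximalIdeal_sq_mvPowerSeries {F : MvPowerSeries (Fin 2) k}
    (h₀ : MvPowerSeries.coeff 0 F = 0)
    (h₁ : ∀ i, MvPowerSeries.coeff (Finsupp.single i 1) F = 0) :
    F ∈ maximalIdeal (MvPowerSeries (Fin 2) k) ^ 2 := by
  classical
  have hX : ∀ i : Fin 2, (MvPowerSeries.X i : MvPowerSeries (Fin 2) k) ∈
      maximalIdeal (MvPowerSeries (Fin 2) k) := fun i =>
    mem_maximalIdeal_mvPowerSeries.mpr (MvPowerSeries.coeff_zero_X i)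
  -- `F₀` is the part of `F` free of the first variable, hence divisible by the square of the
  -- second; the rest is the first variable times a series without constant term.
  let F₀ : MvPowerSeries (Fin 2) k := fun e => if e 0 = 0 then MvPowerSeries.coeff e F else 0
  have hF₀ : ∀ e, MvPowerSeries.coeff e F₀ = if e 0 = 0 then MvPowerSeries.coeff e F else 0 :=
    fun e => rfl
  have hd₁ : (MvPowerSeries.X 1 : MvPowerSeries (Fin 2) k) ^ 2 ∣ F₀ := by
    refine MvPowerSeries.X_pow_dvd_iff.mpr fun e he => ?_
    rw [hF₀]
    split_ifs with h
    · obtain he | he : e 1 = 0 ∨ e 1 = 1 := by omega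
      · rw [show e = 0 by ext i; fin_cases i <;> simp [h, he], h₀]
      · rw [show e = Finsupp.single 1 1 by ext i; fin_cases i <;> simp [h, he], h₁]
    · rfl
  obtain ⟨G, hG⟩ : (MvPowerSeries.X 0 : MvPowerSeries (Fin 2) k) ∣ F - F₀ := by
    refine MvPowerSeries.X_dvd_iff.mpr fun e he => ?_
    rw [map_sub, hF₀, if_pos he, sub_self]
  obtain ⟨H, hH⟩ := hd₁
  have hG₀ : G ∈ maximalIdeal (MvPowerSeries (Fin 2) k) := by
    rw [mem_maximalIdeal_mvPowerSeries]
    have h := congrArg (MvPowerSeries.coeff (Finsupp.single 0 1)) hG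
    rw [map_sub, hF₀, if_neg (by simp), h₁, sub_zero, MvPowerSeries.X_def] at h
    have h' := MvPowerSeries.coeff_add_monomial_mul (Finsupp.single (0 : Fin 2) 1) 0 G (1 : k)
    rw [add_zero, one_mul] at h'
    rw [← h', ← h]
  rw [← sub_add_cancel F F₀, hG, hH, pow_two]
  refine add_mem (Ideal.mul_mem_mul (hX 0) hG₀) (Ideal.mul_mem_right _ _ ?_)
  rw [pow_two]
  exact Ideal.mul_mem_mul (hX 1) (hX 1)

/-- The tangent cone of a node has no nilpotents in degree one. This is checked on a lift of `f` to
power series, and the conclusion descends because `A / m ^ 2` is a quotient of the power series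
ring. -/
theorem mem_maximalIdeal_sq_of_node {A : Type u} [CommRing A] [IsLocalRing A]
    (e : AdicCompletion (maximalIdeal A) A ≃+* MvPowerSeries (Fin 2) k ⧸
      Ideal.span {(MvPowerSeries.X 0 * MvPowerSeries.X 1 : MvPowerSeries (Fin 2) k)})
    {f : A} (hf : f ∈ maximalIdeal A) (hf2 : f ^ 2 ∈ maximalIdeal A ^ 3) :
    f ∈ maximalIdeal A ^ 2 := by
  let P := MvPowerSeries (Fin 2) k
  let σ : P →+* AdicCompletion (maximalIdeal A) A :=
    e.symm.toRingHom.comp (Ideal.Quotient.mk _)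
  have hσ : Function.Surjective σ := e.symm.surjective.comp Ideal.Quotient.mk_surjective
  have hker : RingHom.ker σ = Ideal.span {(MvPowerSeries.X 0 * MvPowerSeries.X 1 : P)} := by
    ext G
    rw [RingHom.mem_ker, ← Ideal.Quotient.eq_zero_iff_mem]
    exact map_eq_zero_iff e.symm e.symm.injective
  let ρ : P →+* A ⧸ maximalIdeal A ^ 2 :=
    (AdicCompletion.evalₐ (maximalIdeal A) 2).toRingHom.comp σ
  have hρ : Function.Surjective ρ := (AdicCompletion.surjective_evalₐ _ 2).comp hσ
  have hne : maximalIdeal A ^ 2 ≠ ⊤ :=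
    (lt_of_le_of_lt (Ideal.pow_le_self two_ne_zero) (maximalIdeal.isMaximal A).ne_top.lt_top).ne
  have : Nontrivial (A ⧸ maximalIdeal A ^ 2) := Ideal.Quotient.nontrivial_iff.mpr hne
  have hloc : IsLocalHom ρ := .of_surjective ρ hρ
  have hlocA : IsLocalHom (Ideal.Quotient.mk (maximalIdeal A ^ 2)) :=
    .of_surjective _ Ideal.Quotient.mk_surjective
  have hmem : ∀ (G : P) (a : A), σ G = AdicCompletion.of (maximalIdeal A) A a →
      ρ G = Ideal.Quotient.mk _ a := by
    intro G a h
    change AdicCompletion.evalₐ (maximalIdeal A) 2 (σ G) = _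
    rw [h, AdicCompletion.evalₐ_of]
  have hlift : ∀ (G : P) (a : A), ρ G = Ideal.Quotient.mk _ a →
      (G ∈ maximalIdeal P ↔ a ∈ maximalIdeal A) := by
    intro G a h
    rw [mem_maximalIdeal, mem_maximalIdeal, mem_nonunits_iff, mem_nonunits_iff,
      ← isUnit_map_iff ρ, h, isUnit_map_iff]
  obtain ⟨F, hF⟩ := hσ (AdicCompletion.of (maximalIdeal A) A f)
  have hFm : F ∈ maximalIdeal P := (hlift _ _ (hmem _ _ hF)).mpr hf
  let ι := algebraMap A (AdicCompletion (maximalIdeal A) A)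
  have hι : ∀ a, ι a = AdicCompletion.of (maximalIdeal A) A a := fun _ => rfl
  have hmap : (maximalIdeal A).map ι ≤ (maximalIdeal P).map σ := by
    refine Ideal.map_le_iff_le_comap.mpr fun a ha => ?_
    obtain ⟨G, hG⟩ := hσ (ι a)
    rw [Ideal.mem_comap, ← hG]
    exact Ideal.mem_map_of_mem _ ((hlift _ _ (hmem _ _ hG)).mpr ha)
  have h₁ : ι (f ^ 2) ∈ (maximalIdeal P ^ 3).map σ := by
    rw [Ideal.map_pow]
    refine Ideal.pow_right_mono hmap 3 ?_
    rw [← Ideal.map_pow]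
    exact Ideal.mem_map_of_mem _ hf2
  obtain ⟨H, hH, hHf⟩ := (Ideal.mem_map_iff_of_surjective σ hσ).mp h₁
  have h₂ : F ^ 2 ∈ maximalIdeal P ^ 3 ⊔ Ideal.span {MvPowerSeries.X 0 * MvPowerSeries.X 1} := by
    rw [← sub_add_cancel (F ^ 2) H, add_comm]
    refine Submodule.add_mem_sup hH ?_
    rw [← hker, RingHom.mem_ker, map_sub, map_pow, hF, hHf, map_pow, hι, sub_self]
  have h₃ := mem_maximalIdeal_sq_mvPowerSeries (mem_maximalIdeal_mvPowerSeries.mp hFm)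
    (coeff_single_one_eq_zero_of_sq_mem hFm h₂)
  have h₄ : (maximalIdeal P).map ρ ≤ (maximalIdeal A).map (Ideal.Quotient.mk _) := by
    refine Ideal.map_le_iff_le_comap.mpr fun G hG => ?_
    obtain ⟨a, ha⟩ := Ideal.Quotient.mk_surjective (ρ G)
    rw [Ideal.mem_comap, ← ha]
    exact Ideal.mem_map_of_mem _ ((hlift _ _ ha.symm).mp hG)
  have h₅ : ρ F ∈ ((maximalIdeal A) ^ 2).map (Ideal.Quotient.mk (maximalIdeal A ^ 2)) := by
    rw [Ideal.map_pow]
    refine Ideal.pow_right_mono h₄ 2 ?_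
    rw [← Ideal.map_pow]
    exact Ideal.mem_map_of_mem _ h₃
  rw [Ideal.map_quotient_self, Submodule.mem_bot, hmem _ _ hF] at h₅
  exact Ideal.Quotient.eq_zero_iff_mem.mp h₅

end

end NodalResolution

namespace NodalResolution

open IsLocalRing

/-! ## Parameters of two-dimensional regular local rings -/

section

variable {O : Type u} [CommRing O]

theorem eq_span_of_isRadical {t : O} (hrad : (Ideal.span {t}).IsRadical) {P : Ideal O}
    (ht : t ∈ P) (h : ∀ Q : Ideal O, Q.IsPrime → t ∈ Q → P ≤ Q) : P = Ideal.span {t} := by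
  refine le_antisymm (fun f hf => hrad ?_) (by simpa using! ht)
  rw [Ideal.radical_eq_sInf, Ideal.mem_sInf]
  rintro Q ⟨htQ, hQ⟩
  exact h Q hQ (by simpa using! htQ) hf

variable [IsRegularLocalRing O]

/-- If `P` were inside `m ^ 2`, Nakayama would make `m` principal. So `P` contains a parameter `x`,
which is prime, and `0 < (x) < P < m` would be too long a chain. -/
theorem exists_eq_span_of_isPrime (hd : ringKrullDim O = 2) {P : Ideal O} [P.IsPrime]
    (hP : P ≠ maximalIdeal O) {z : O} (hz : maximalIdeal O = P ⊔ Ideal.span {z}) :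
    ∃ x, P = Ideal.span {x} ∧ x ∈ maximalIdeal O ∧ x ∉ maximalIdeal O ^ 2 := by
  classical
  have hle : P ≤ maximalIdeal O := le_maximalIdeal (Ideal.IsPrime.ne_top ‹_›)
  obtain ⟨x, hxP, hx2⟩ : ∃ x ∈ P, x ∉ maximalIdeal O ^ 2 := by
    by_contra! h
    have h₁ : maximalIdeal O = Ideal.span (({z} : Finset O) : Set O) := by
      rw [Finset.coe_singleton]
      refine le_antisymm ?_ (le_sup_right.trans hz.ge)
      refine Submodule.le_of_le_smul_of_le_jacobson_bot (I := maximalIdeal O)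
        (IsNoetherian.noetherian _) (maximalIdeal_le_jacobson _) ?_
      rw [smul_eq_mul, ← pow_two, sup_comm]
      exact hz.le.trans (sup_le_sup_right h _)
    have h₂ := ringKrullDim_le_card h₁
    rw [hd, Finset.card_singleton] at h₂
    exact absurd h₂ (by norm_num)
  obtain ⟨s, hs, hsd⟩ := exists_finset_of_isRegularLocalRing O
  obtain ⟨s', hs', hxs', hspan⟩ := exists_mem_span_insert_erase hs (hle hxP) hx2
  have hcard : s'.card ≤ 2 := by
    rw [hd] at hsd
    exact hs'.trans (by exact_mod_cast hsd)
  have hx := prime_of_mem_of_card_le hspan (le_trans (by exact_mod_cast hs') hsd) hxs'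
  refine ⟨x, ?_, hle hxP, hx2⟩
  have := (Ideal.span_singleton_prime hx.ne_zero).mpr hx
  have := isDomain_of_isRegularLocalRing O
  by_contra hne
  have h₁ : Ideal.span {x} < P := lt_of_le_of_ne (by simpa using! hxP) (Ne.symm hne)
  have h₂ := Ideal.height_add_one_le_of_lt_of_isPrime h₁
  have h₃ := Ideal.height_add_one_le_of_lt_of_isPrime (lt_of_le_of_ne hle hP)
  have h₄ : (⊥ : Ideal O) < Ideal.span {x} := bot_lt_iff_ne_bot.mpr (by simpa using! hx.ne_zero)
  have h₅ := Ideal.height_add_one_le_of_lt_of_isPrime h₄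
  have h₆ : (3 : ℕ∞) ≤ (maximalIdeal O).height := by
    refine le_trans ?_ ((add_le_add_left ((add_le_add_left h₅ 1).trans h₂) 1).trans h₃)
    rw [add_assoc, add_assoc]
    exact le_trans (by norm_num) le_add_self
  have h₇ := maximalIdeal_height_eq_ringKrullDim (R := O)
  rw [hd] at h₇
  have h₈ : ((3 : ℕ∞) : WithBot ℕ∞) ≤ (2 : ℕ∞) :=
    (WithBot.coe_le_coe.mpr h₆).trans h₇.le
  exact absurd (WithBot.coe_le_coe.mp h₈) (by norm_num)

/-- Write `y = a x + b w` with `m = (x, w)`. If `b` were a nonunit, the branches would be tangent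
and `y ^ 2 = b w y + a x y` would lie in `m ^ 3 + (x y)`; the hypothesis then puts `y` in `m ^ 2`.
-/
theorem maximalIdeal_eq_span_pair (hd : ringKrullDim O = 2) {x y : O}
    (hx : x ∈ maximalIdeal O) (hx2 : x ∉ maximalIdeal O ^ 2)
    (hy : y ∈ maximalIdeal O) (hy2 : y ∉ maximalIdeal O ^ 2)
    (hN : ∀ f ∈ maximalIdeal O, f ^ 2 ∈ maximalIdeal O ^ 3 ⊔ Ideal.span {x * y} →
      f ∈ maximalIdeal O ^ 2 ⊔ Ideal.span {x * y}) : maximalIdeal O = Ideal.span {x, y} := by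
  classical
  obtain ⟨s, hs, hsd⟩ := exists_finset_of_isRegularLocalRing O
  obtain ⟨s', hs', hxs', hspan⟩ := exists_mem_span_insert_erase hs hx hx2
  have hcard : s'.card ≤ 2 := by
    rw [hd] at hsd
    exact hs'.trans (by exact_mod_cast hsd)
  obtain ⟨w, hw⟩ : ∃ w, maximalIdeal O = Ideal.span {x, w} := by
    rw [hspan]
    have h₁ : (s'.erase x).card ≤ 1 := by
      rw [Finset.card_erase_of_mem hxs']
      omega
    rw [← Finset.insert_erase hxs', Finset.coe_insert]
    rcases Finset.card_le_one_iff_subset_singleton.mp h₁ with ⟨w, hw⟩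
    rcases Finset.subset_singleton_iff.mp hw with h | h
    · exact ⟨x, by simp [h]⟩
    · exact ⟨w, by simp [h]⟩
  have hwm : w ∈ maximalIdeal O := hw ▸ Ideal.subset_span (by simp)
  obtain ⟨a, b, hab⟩ := Ideal.mem_span_pair.mp (hw ▸ hy)
  by_cases hb : IsUnit b
  · refine le_antisymm ?_ (Ideal.span_le.mpr (by rintro _ (rfl | rfl) <;> assumption))
    obtain ⟨b, rfl⟩ := hb
    rw [hw, Ideal.span_le]
    rintro v (rfl | hv)
    · exact Ideal.subset_span (by simp)
    · obtain rfl : v = w := hv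
      refine Ideal.mem_span_pair.mpr ⟨-(↑b⁻¹ * a), (b⁻¹ : Oˣ), ?_⟩
      rw [← hab]
      linear_combination v * b.inv_mul
  · have hbm : b * w ∈ maximalIdeal O ^ 2 := by
      rw [pow_two]
      exact Ideal.mul_mem_mul ((mem_maximalIdeal _).mpr hb) hwm
    have h₁ : y ^ 2 ∈ maximalIdeal O ^ 3 ⊔ Ideal.span {x * y} := by
      have : y ^ 2 = (b * w) * y + a * (x * y) := by linear_combination (-y) * hab
      rw [this, pow_succ _ 2]
      exact Submodule.add_mem_sup (Ideal.mul_mem_mul hbm hy)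
        (Ideal.mul_mem_left _ _ (Ideal.mem_span_singleton_self _))
    refine absurd ((sup_le le_rfl ?_ : _ ≤ maximalIdeal O ^ 2) (hN y hy h₁)) hy2
    rw [Ideal.span_singleton_le_iff_mem, pow_two]
    exact Ideal.mul_mem_mul hx hy

/-- Both components are principal, with generators dividing `t`, so `t = x y b`. Since `(t)` is
radical `b` is a unit, to be absorbed in `y`, and the hypothesis on squares makes the components
transversal. -/
theorem exists_node_parameters (hd : ringKrullDim O = 2) {P₀ P₁ : Ideal O} [P₀.IsPrime]
    [P₁.IsPrime] (h₀ : P₀ ≠ maximalIdeal O) (h₁ : P₁ ≠ maximalIdeal O) (hne : P₀ ≠ P₁) {z₀ z₁ : O}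
    (hz₀ : maximalIdeal O = P₀ ⊔ Ideal.span {z₀}) (hz₁ : maximalIdeal O = P₁ ⊔ Ideal.span {z₁})
    {t : O} (ht0 : t ≠ 0) (hrad : (Ideal.span {t}).IsRadical) (ht₀ : t ∈ P₀) (ht₁ : t ∈ P₁)
    (ht : ∀ Q : Ideal O, Q.IsPrime → t ∈ Q → P₀ ≤ Q ∨ P₁ ≤ Q)
    (hN : ∀ f ∈ maximalIdeal O, f ^ 2 ∈ maximalIdeal O ^ 3 ⊔ Ideal.span {t} →
      f ∈ maximalIdeal O ^ 2 ⊔ Ideal.span {t}) :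
    ∃ x y, P₀ = Ideal.span {x} ∧ P₁ = Ideal.span {y} ∧ x * y = t ∧
      maximalIdeal O = Ideal.span {x, y} := by
  have := isDomain_of_isRegularLocalRing O
  obtain ⟨x, rfl, hx, hx2⟩ := exists_eq_span_of_isPrime hd h₀ hz₀
  obtain ⟨y, rfl, hy, hy2⟩ := exists_eq_span_of_isPrime hd h₁ hz₁
  have hxy : x ∉ Ideal.span {y} := by
    intro h
    obtain ⟨c, rfl⟩ := Ideal.mem_span_singleton.mp h
    by_cases hc : IsUnit c
    · exact hne (Ideal.span_singleton_eq_span_singleton.mpr (associated_mul_unit_left _ _ hc))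
    · refine hx2 ?_
      rw [pow_two]
      exact Ideal.mul_mem_mul hy ((mem_maximalIdeal _).mpr hc)
  obtain ⟨a, rfl⟩ := Ideal.mem_span_singleton.mp ht₀
  obtain ⟨b, rfl⟩ := Ideal.mem_span_singleton.mp
    ((Ideal.IsPrime.mem_or_mem ‹(Ideal.span {y}).IsPrime› ht₁).resolve_left hxy)
  -- Every prime over `t` contains `x` or `y`, hence `x y`.
  have h : x * y ∈ Ideal.span {x * (y * b)} := by
    refine hrad ?_
    rw [Ideal.radical_eq_sInf, Ideal.mem_sInf]
    rintro Q ⟨htQ, hQ⟩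
    rcases ht Q hQ (by simpa using! htQ) with h | h
    · exact Ideal.mul_mem_right _ _ (by simpa using! h)
    · exact Ideal.mul_mem_left _ _ (by simpa using! h)
  obtain ⟨c, hc⟩ := Ideal.mem_span_singleton.mp h
  have hb : IsUnit b := by
    have hxy0 : x * y ≠ 0 := fun h => ht0 (by rw [← mul_assoc, h, zero_mul])
    refine IsUnit.of_mul_eq_one c (mul_left_cancel₀ hxy0 ?_)
    linear_combination -hc
  have hspan : Ideal.span {y * b} = Ideal.span {y} :=
    Ideal.span_singleton_eq_span_singleton.mpr (associated_mul_unit_left _ _ hb)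
  refine ⟨x, y * b, rfl, hspan.symm, rfl, maximalIdeal_eq_span_pair hd hx hx2
    (Ideal.mul_mem_right _ _ hy) ?_ hN⟩
  rwa [mul_comm, Ideal.unit_mul_mem_iff_mem _ hb]

end

end NodalResolution

namespace NodalResolution

open IsLocalRing

/-! ## Smooth curves -/

/-- Parameters of the local ring below generate the maximal ideal, and flatness prevents the
dimension from dropping. -/
theorem EssEtale.isRegularLocalRing {D A : Type u} [CommRing D] [CommRing A]
    [IsRegularRing D] [IsLocalRing A] [IsNoetherianRing A] {φ : D →+* A} (hφ : EssEtale φ) :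
    IsRegularLocalRing A := by
  classical
  have hmax := hφ.map_comap_maximalIdeal
  algebraize [φ]
  set p := (maximalIdeal A).comap φ
  have hp : ∀ m : p.primeCompl, IsUnit (φ m) := fun m => by
    have := m.2
    simpa [p, Ideal.primeCompl] using! this
  let ψ : Localization.AtPrime p →+* A := IsLocalization.lift hp
  have hψ : ψ.comp (algebraMap D (Localization.AtPrime p)) = φ := IsLocalization.lift_comp hp
  have hm : (maximalIdeal (Localization.AtPrime p)).map ψ = maximalIdeal A := by
    rw [← Localization.AtPrime.map_eq_maximalIdeal, Ideal.map_map, hψ, hmax]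
  have : IsLocalHom ψ := ((local_hom_TFAE ψ).out 0 2).mpr hm.le
  have hflat : ψ.Flat := by
    algebraize [ψ]
    have : IsScalarTower D (Localization.AtPrime p) A := .of_algebraMap_eq' hψ.symm
    exact (EssEtale.of_comp_isLocalization (B := Localization.AtPrime p) p.primeCompl
      (show EssEtale (algebraMap D A) from hφ)).flat
  obtain ⟨s, hs, hsd⟩ := exists_finset_of_isRegularLocalRing (Localization.AtPrime p)
  rw [hs, Ideal.map_span, ← Finset.coe_image] at hm
  refine isRegularLocalRing_of_card_le hm.symm ?_
  exact le_trans (by exact_mod_cast Finset.card_image_le) (hsd.trans (ringKrullDim_le_of_flat hflat))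

theorem exists_maximalIdeal_eq_span_of_isRegularLocalRing {A : Type u} [CommRing A]
    [IsRegularLocalRing A] (hd : ringKrullDim A ≤ 1) :
    ∃ w, maximalIdeal A = Ideal.span {w} := by
  obtain ⟨s, hs, hsd⟩ := exists_finset_of_isRegularLocalRing A
  have hcard : s.card ≤ 1 := by exact_mod_cast hsd.trans hd
  rw [hs]
  rcases Finset.card_le_one_iff_subset_singleton.mp hcard with ⟨w, hw⟩
  rcases Finset.subset_singleton_iff.mp hw with rfl | rfl
  · exact ⟨0, by simp⟩
  · exact ⟨w, by simp⟩

theorem isRegularLocalRing_stalk_of_smooth {K : Type u} [Field K] {Z : Scheme.{u}}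
    (f : Z ⟶ Spec (.of K)) [Smooth f] (z : Z) : IsRegularLocalRing (Z.presheaf.stalk z) := by
  have : IsLocallyNoetherian Z := LocallyOfFiniteType.isLocallyNoetherian f
  obtain ⟨U, hU, V, hV, hzV, e, h⟩ := Smooth.exists_isStandardSmooth f z
  obtain rfl : U = ⊤ := by
    ext a
    have : a = f z := Subsingleton.elim (α := PrimeSpectrum K) _ _
    simpa [this] using! e hzV
  obtain ⟨n, g, -, hg⟩ := h.exists_etale_mvPolynomial
  have : IsRegularRing K := inferInstance
  have : IsRegularRing Γ(Spec (.of K), ⊤) :=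
    .of_ringEquiv (Scheme.ΓSpecIso (.of K)).symm.commRingCatIsoToRingEquiv
  have h₁ : EssEtale g := by
    algebraize [g]
    exact essEtale_algebraMap.mpr ⟨inferInstance, inferInstance, inferInstance⟩
  have h₂ : EssEtale (Z.presheaf.germ V z hzV).hom := by
    let : Algebra Γ(Z, V) (Z.presheaf.stalk z) := (Z.presheaf.germ V z hzV).hom.toAlgebra
    have := hV.isLocalization_stalk ⟨z, hzV⟩
    exact EssEtale.of_isLocalization (hV.primeIdealOf ⟨z, hzV⟩).asIdeal.primeCompl
  exact (h₁.comp h₂).isRegularLocalRing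

end NodalResolution

namespace NodalResolution

open IsLocalRing

/-! ## Local rings of the special fibre -/

section

theorem essFiniteType_baseHom {R₀ : Type u} [CommRing R₀] {X : Scheme.{u}}
    (π : X ⟶ Spec (.of R₀)) [LocallyOfFiniteType π] (p : X) : (baseHom π p).EssFiniteType := by
  let τ : CommRingCat.of R₀ ⟶ (Spec (.of R₀)).presheaf.stalk (π p) :=
    StructureSheaf.toStalk (CommRingCat.of R₀) (π p)
  have h : baseHom π p = (π.stalkMap p).hom.comp τ.hom := by
    have : CommRingCat.ofHom (baseHom π p) = τ ≫ π.stalkMap p := by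
      apply Spec.map_injective
      rw [specMap_baseHom, Spec.map_comp, ← Scheme.SpecMap_stalkMap_fromSpecStalk]
      congr 1
      exact Spec.fromSpecStalk_eq' _ _
    exact congrArg CommRingCat.Hom.hom this
  rw [h]
  have h₁ : τ.hom.EssFiniteType := by
    obtain ⟨M, hM⟩ := isLocalization_toStalk (B := CommRingCat.of R₀) (π p)
    let := τ.hom.toAlgebra
    have : IsLocalization M ((Spec (CommRingCat.of R₀)).presheaf.stalk (π p)) := hM
    exact Algebra.EssFiniteType.of_isLocalization _ M
  exact RingHom.EssFiniteType.comp h₁ (LocallyOfFiniteType.stalkMap π p)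

theorem exists_stalk_hom_of_apply_closedPoint {W : Scheme.{u}} {B : CommRingCat.{u}}
    [IsLocalRing B] (h : Spec B ⟶ W) {w : W} (hw : h (closedPoint B) = w) :
    ∃ ψ : W.presheaf.stalk w ⟶ B, Spec.map ψ ≫ W.fromSpecStalk w = h := by
  subst hw
  exact ⟨_, Scheme.Spec_stalkClosedPointTo_fromSpecStalk h⟩

theorem surjective_residue_comp_baseHom {K : Type u} [Field K] [IsAlgClosed K] {Z : Scheme.{u}}
    (f : Z ⟶ Spec (.of K)) [LocallyOfFiniteType f] {z : Z} (hz : IsClosed {z}) :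
    Function.Surjective ((residue (Z.presheaf.stalk z)).comp (baseHom f z)) := by
  have h : CommRingCat.ofHom (baseHom f z) ≫ Z.residue z = (residueFieldIsoBase f z hz).inv := by
    apply Spec.map_injective
    rw [SpecMap_residueFieldIsoBase_inv, Spec.map_comp, specMap_baseHom, ← Category.assoc]
    rfl
  have h' : Function.Surjective (CommRingCat.ofHom (baseHom f z) ≫ Z.residue z).hom := by
    rw [h]
    exact (ConcreteCategory.bijective_of_isIso (residueFieldIsoBase f z hz).inv).2
  exact h'

theorem isClosedImmersion_pullback_fst_of_surjective {R S : Type u} [CommRing R] [CommRing S]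
    {X : Scheme.{u}} (f : X ⟶ Spec (.of R)) {φ : R →+* S} (hφ : Function.Surjective φ) :
    IsClosedImmersion (pullback.fst f (Spec.map (CommRingCat.ofHom φ))) := by
  have : IsClosedImmersion (Spec.map (CommRingCat.ofHom φ)) :=
    IsClosedImmersion.spec_of_surjective _ hφ
  infer_instance

variable {K : Type u} [Field K] {X : Scheme.{u}} (π : X ⟶ Spec (.of (PowerSeries K)))

instance : IsClosedImmersion (specialFiberι π) :=
  isClosedImmersion_pullback_fst_of_surjective π fun a => ⟨PowerSeries.C a, by simp⟩

theorem stalkMap_specialFiberι_baseHom (x : specialFiber π) (a : PowerSeries K) :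
    ((specialFiberι π).stalkMap x).hom (baseHom π (specialFiberι π x) a) =
      baseHom (specialFiberToSpec π) x (PowerSeries.constantCoeff a) := by
  rw [stalkMap_baseHom]
  have h : CommRingCat.ofHom (baseHom (specialFiberι π ≫ π) x) =
      CommRingCat.ofHom (PowerSeries.constantCoeff (R := K)) ≫
        CommRingCat.ofHom (baseHom (specialFiberToSpec π) x) := by
    apply Spec.map_injective
    rw [Spec.map_comp, specMap_baseHom, specMap_baseHom, Category.assoc]
    exact congrArg (_ ≫ ·) pullback.condition
  exact congr($(h).hom a)

/-- The quotient of the local ring by `t` is an algebra over `K`, so its spectrum maps to the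
special fibre. Hence the quotient map factors through the stalk of the special fibre. -/
theorem ker_stalkMap_specialFiberι (x : specialFiber π) :
    RingHom.ker ((specialFiberι π).stalkMap x).hom =
      Ideal.span {baseHom π (specialFiberι π x) PowerSeries.X} := by
  set p := specialFiberι π x
  set t := baseHom π p PowerSeries.X
  have ht : ((specialFiberι π).stalkMap x).hom t = 0 := by
    rw [stalkMap_specialFiberι_baseHom, PowerSeries.constantCoeff_X, map_zero]
  refine le_antisymm ?_ (by simpa using! ht)
  have htm : t ∈ maximalIdeal (X.presheaf.stalk p) := by
    rw [mem_maximalIdeal, mem_nonunits_iff]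
    intro h
    have := h.map ((specialFiberι π).stalkMap x).hom
    rw [ht] at this
    exact not_isUnit_zero this
  have hloc := isLocalRing_quotient_span_singleton htm
  let B : CommRingCat.{u} := .of (X.presheaf.stalk p ⧸ Ideal.span {t})
  have : IsLocalRing B := hloc
  let q₀ : X.presheaf.stalk p →+* (X.presheaf.stalk p ⧸ Ideal.span {t}) := Ideal.Quotient.mk _
  let q : X.presheaf.stalk p ⟶ B := CommRingCat.ofHom q₀
  have : IsLocalHom q.hom := .of_surjective q₀ Ideal.Quotient.mk_surjective
  let κ : CommRingCat.of K ⟶ B :=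
    CommRingCat.ofHom ((q.hom.comp (baseHom π p)).comp (PowerSeries.C (R := K)))
  have hκ : CommRingCat.ofHom (baseHom π p) ≫ q =
      CommRingCat.ofHom (PowerSeries.constantCoeff (R := K)) ≫ κ := by
    ext a
    change q.hom (baseHom π p a) = q.hom (baseHom π p (PowerSeries.C (PowerSeries.constantCoeff a)))
    rw [← sub_eq_zero, ← map_sub, ← map_sub]
    obtain ⟨b, hb⟩ := PowerSeries.X_dvd_iff.mpr
      (show PowerSeries.constantCoeff (a - PowerSeries.C (PowerSeries.constantCoeff a)) = 0 by simp)
    rw [hb, map_mul]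
    change q₀ _ = 0
    exact Ideal.Quotient.eq_zero_iff_mem.mpr
      (Ideal.mul_mem_right _ _ (Ideal.mem_span_singleton_self _))
  let h : Spec B ⟶ specialFiber π := pullback.lift (Spec.map q ≫ X.fromSpecStalk p) (Spec.map κ) (by
    rw [Category.assoc, ← specMap_baseHom, ← Spec.map_comp, ← Spec.map_comp, hκ])
  have hh : h ≫ specialFiberι π = Spec.map q ≫ X.fromSpecStalk p := pullback.lift_fst _ _ _
  have hx : h (closedPoint B) = x := by
    apply (specialFiberι π).isEmbedding.injective
    have h₁ : specialFiberι π (h (closedPoint B)) = X.fromSpecStalk p (Spec.map q (closedPoint B)) :=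
      congr($hh (closedPoint B))
    have h₂ : Spec.map q (closedPoint B) = closedPoint (X.presheaf.stalk p) := comap_closedPoint q.hom
    exact (h₁.trans (congrArg _ h₂)).trans Scheme.fromSpecStalk_closedPoint
  obtain ⟨ψ, hψ⟩ := exists_stalk_hom_of_apply_closedPoint h hx
  have hq : (specialFiberι π).stalkMap x ≫ ψ = q := by
    apply Spec.map_injective
    rw [← cancel_mono (X.fromSpecStalk p), ← hh, ← hψ, Spec.map_comp, Category.assoc, Category.assoc,
      Scheme.SpecMap_stalkMap_fromSpecStalk]
  intro a ha
  refine Ideal.Quotient.eq_zero_iff_mem.mp (?_ : q.hom a = 0)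
  rw [← hq]
  change ψ.hom (((specialFiberι π).stalkMap x).hom a) = 0
  rw [(RingHom.mem_ker).mp ha, map_zero]

end

end NodalResolution

namespace NodalResolution

open IsLocalRing

/-! ## Components of the special fibre -/

theorem ringKrullDim_stalk_le {W V : Scheme.{u}} (g : W ⟶ V) [IsPreimmersion g] (w : W) :
    ringKrullDim (W.presheaf.stalk w) ≤ topologicalKrullDim V := by
  rw [← PrimeSpectrum.topologicalKrullDim_eq_ringKrullDim]
  exact (g.isEmbedding.comp (W.fromSpecStalk w).isEmbedding).isInducing.topologicalKrullDim_le

/-- The ideal of a smooth curve in the local ring of an ambient scheme. -/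
theorem exists_ideal_of_mem_range {Z X : Scheme.{u}} (j : Z ⟶ X) [IsPreimmersion j]
    (hZ : ∀ z : Z, IsRegularLocalRing (Z.presheaf.stalk z))
    (hd : ∀ z : Z, ringKrullDim (Z.presheaf.stalk z) ≤ 1) {p : X} (hp : p ∈ Set.range j) :
    ∃ P : Ideal (X.presheaf.stalk p), P.IsPrime ∧
      (∀ Q : PrimeSpectrum (X.presheaf.stalk p),
        X.fromSpecStalk p Q ∈ Set.range j ↔ P ≤ Q.asIdeal) ∧
      ∃ w, maximalIdeal (X.presheaf.stalk p) = P ⊔ Ideal.span {w} := by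
  obtain ⟨z, rfl⟩ := hp
  have := hZ z
  have := isDomain_of_isRegularLocalRing (Z.presheaf.stalk z)
  have hle : RingHom.ker (j.stalkMap z).hom ≤ maximalIdeal _ :=
    le_maximalIdeal (RingHom.ker_ne_top _)
  refine ⟨RingHom.ker (j.stalkMap z).hom, RingHom.ker_isPrime _,
    fromSpecStalk_mem_range_iff j z, ?_⟩
  obtain ⟨w, hw⟩ := exists_maximalIdeal_eq_span_of_isRegularLocalRing (hd z)
  obtain ⟨w, rfl⟩ := j.stalkMap_surjective z w
  have hwm : w ∈ maximalIdeal (X.presheaf.stalk (j z)) := by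
    have : (j.stalkMap z).hom w ∈ maximalIdeal (Z.presheaf.stalk z) :=
      hw ▸ Ideal.mem_span_singleton_self _
    exact (mem_maximalIdeal _).mpr fun h => (mem_maximalIdeal _).mp this (h.map _)
  refine ⟨w, le_antisymm (fun a ha => ?_) (sup_le hle (by simpa using! hwm))⟩
  have h : (j.stalkMap z).hom a ∈ maximalIdeal (Z.presheaf.stalk z) :=
    (mem_maximalIdeal _).mpr fun h => (mem_maximalIdeal _).mp ha (isUnit_of_map_unit _ _ h)
  rw [hw, Ideal.mem_span_singleton] at h
  obtain ⟨b, hb⟩ := h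
  obtain ⟨b, rfl⟩ := j.stalkMap_surjective z b
  rw [← sub_add_cancel a (w * b)]
  refine Submodule.add_mem_sup ?_ (Ideal.mem_span_singleton.mpr ⟨b, rfl⟩)
  rw [RingHom.mem_ker, map_sub, map_mul]
  exact sub_eq_zero.mpr hb

section

variable {K : Type u} [Field K] {C : Scheme.{u}} {f : C ⟶ Spec (.of K)} {Z : Fin 2 → Closeds C}

theorem mem_irreducibleComponents (hZ : HasTwoSmoothComponents f Z) (k : Fin 2) :
    (Z k : Set C) ∈ irreducibleComponents C := by
  rw [hZ.irreducibleComponents_eq]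
  fin_cases k
  · exact .inl rfl
  · exact .inr rfl

theorem exists_mem_component (hZ : HasTwoSmoothComponents f Z) (x : C) : ∃ k, x ∈ Z k := by
  have h : x ∈ ⋃₀ irreducibleComponents C := by
    rw [sUnion_irreducibleComponents]
    trivial
  rw [hZ.irreducibleComponents_eq] at h
  obtain ⟨_, rfl | rfl, h⟩ := h
  · exact ⟨0, h⟩
  · exact ⟨1, h⟩

theorem component_not_le (hZ : HasTwoSmoothComponents f Z) {k j : Fin 2} (hkj : k ≠ j) :
    ¬ (Z k : Set C) ⊆ Z j := by
  intro h
  have h₁ := (mem_irreducibleComponents hZ k).2 (mem_irreducibleComponents hZ j).1 h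
  have h₂ : Z k = Z j := SetLike.coe_injective (h.antisymm h₁)
  have hne := hZ.ne
  fin_cases k <;> fin_cases j <;> first | exact hkj rfl | exact hne h₂ | exact hne h₂.symm

/-- The generic point of the component is used. Were it closed, the component would be a single
point with complement the other component, hence open and closed, against connectedness. -/
theorem exists_generization_of_mem_component (hZ : HasTwoSmoothComponents f Z)
    [ConnectedSpace C] {k : Fin 2} {x : C} (hx : x ∈ Z k) :
    ∃ η ∈ Z k, η ⤳ x ∧ (∀ j ≠ k, η ∉ Z j) ∧ ¬ IsClosed {η} := by
  have hirr := (mem_irreducibleComponents hZ k).1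
  have hclos : closure ({hirr.genericPoint} : Set C) = Z k := by
    rw [hirr.genericPoint_closure_eq, (Z k).isClosed.closure_eq]
  have hmem : hirr.genericPoint ∈ Z k := hclos.subset (subset_closure rfl)
  have hnot : ∀ j ≠ k, hirr.genericPoint ∉ Z j := by
    intro j hj h
    refine component_not_le hZ hj.symm (hclos.symm.subset.trans ?_)
    exact closure_minimal (by simpa using! h) (Z j).isClosed
  refine ⟨_, hmem, ?_, hnot, fun h => ?_⟩
  · rw [specializes_iff_mem_closure]
    exact hclos.symm.subset hx
  · rw [h.closure_eq] at hclos
    obtain ⟨j, hj⟩ : ∃ j : Fin 2, j ≠ k := exists_ne k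
    have hcompl : (Z k : Set C)ᶜ = Z j := by
      ext y
      refine ⟨fun hy => ?_, fun hy hy' => ?_⟩
      · obtain ⟨i, hi⟩ := exists_mem_component hZ y
        have hik : i ≠ k := by
          rintro rfl
          exact hy hi
        have hij : i = j := by omega
        exact hij ▸ hi
      · have hy'' : y = hirr.genericPoint := hclos.symm.subset hy'
        exact hnot j hj (hy'' ▸ hy)
    have hclopen : IsClopen (Z k : Set C) :=
      ⟨(Z k).isClosed, isClosed_compl_iff.mp (hcompl ▸ (Z j).isClosed)⟩
    rcases isClopen_iff.mp hclopen with h | h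
    · exact hirr.1.ne_empty h
    · obtain ⟨y, hy⟩ := (mem_irreducibleComponents hZ j).1.1
      exact (hcompl ▸ hy : y ∈ (Z k : Set C)ᶜ) (h ▸ Set.mem_univ y)

theorem exists_ideal_of_mem_component (hZ : HasTwoSmoothComponents f Z)
    (hd : topologicalKrullDim C = 1) {X : Scheme.{u}} (ι : C ⟶ X) [IsPreimmersion ι] {k : Fin 2}
    {x : C} (hx : x ∈ Z k) :
    ∃ P : Ideal (X.presheaf.stalk (ι x)), P.IsPrime ∧
      (∀ Q : PrimeSpectrum (X.presheaf.stalk (ι x)),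
        X.fromSpecStalk (ι x) Q ∈ ι '' (Z k : Set C) ↔ P ≤ Q.asIdeal) ∧
      ∃ w, maximalIdeal (X.presheaf.stalk (ι x)) = P ⊔ Ideal.span {w} := by
  let I := Scheme.IdealSheafData.vanishingIdeal (Z k)
  have hI : Set.range I.subschemeι = (Z k : Set C) := I.range_subschemeι
  have hr : Set.range (I.subschemeι ≫ ι) = ι '' (Z k : Set C) := by
    rw [← hI, ← Set.range_comp]
    rfl
  have := hZ.smooth k
  have := IsPreimmersion.comp I.subschemeι ι
  obtain ⟨P, h₁, h₂, h₃⟩ := exists_ideal_of_mem_range (I.subschemeι ≫ ι)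
    (fun z => isRegularLocalRing_stalk_of_smooth (I.subschemeι ≫ f) z)
    (fun z => (ringKrullDim_stalk_le I.subschemeι z).trans hd.le) (p := ι x)
    (hr ▸ ⟨x, hx, rfl⟩)
  exact ⟨P, h₁, fun Q => by rw [← h₂, hr], h₃⟩

end

end NodalResolution

namespace NodalResolution

open IsLocalRing

/-! ## Charts at the closed points of a smoothing -/

section

variable {K : Type u} [Field K] {X : Scheme.{u}} {π : X ⟶ Spec (.of (PowerSeries K))}

theorem baseHom_X_mem_maximalIdeal (x : specialFiber π) :
    baseHom π (specialFiberι π x) PowerSeries.X ∈ maximalIdeal _ := by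
  have h : baseHom π (specialFiberι π x) PowerSeries.X ∈
      RingHom.ker ((specialFiberι π).stalkMap x).hom := by
    rw [ker_stalkMap_specialFiberι]
    exact Ideal.mem_span_singleton_self _
  exact le_maximalIdeal (RingHom.ker_ne_top _) h

theorem isLocalHom_baseHom_specialFiberι (x : specialFiber π) :
    IsLocalHom (baseHom π (specialFiberι π x)) := by
  refine ((local_hom_TFAE _).out 0 2).mpr ?_
  rw [PowerSeries.maximalIdeal_eq_span_X, Ideal.map_span, Set.image_singleton,
    Ideal.span_singleton_le_iff_mem]
  exact baseHom_X_mem_maximalIdeal x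

theorem surjective_residue_comp_baseHom_specialFiberι [IsAlgClosed K]
    [LocallyOfFiniteType (specialFiberToSpec π)] {x : specialFiber π} (hx : IsClosed {x}) :
    Function.Surjective ((residue _).comp (baseHom π (specialFiberι π x))) := by
  intro r
  obtain ⟨a, rfl⟩ := residue_surjective r
  obtain ⟨c, hc⟩ := surjective_residue_comp_baseHom (specialFiberToSpec π) hx
    (residue _ (((specialFiberι π).stalkMap x).hom a))
  refine ⟨PowerSeries.C c, ?_⟩
  have hc' : residue _ (baseHom (specialFiberToSpec π) x c) =
    residue _ (((specialFiberι π).stalkMap x).hom a) := hc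
  rw [← sub_eq_zero, ← map_sub, residue_eq_zero_iff] at hc'
  change residue _ (baseHom π (specialFiberι π x) (PowerSeries.C c)) = _
  rw [← sub_eq_zero, ← map_sub, residue_eq_zero_iff]
  refine (mem_maximalIdeal _).mpr fun h => (mem_maximalIdeal _).mp hc' ?_
  have := h.map ((specialFiberι π).stalkMap x).hom
  rwa [map_sub, stalkMap_specialFiberι_baseHom, PowerSeries.constantCoeff_C] at this

theorem flat_baseHom {R₀ : Type u} [CommRing R₀] {X : Scheme.{u}} (π : X ⟶ Spec (.of R₀))
    [Flat π] (p : X) : (baseHom π p).Flat := by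
  have : Flat (Spec.map (CommRingCat.ofHom (baseHom π p))) := by
    rw [specMap_baseHom]
    infer_instance
  exact Flat.SpecMap_iff.mp this

theorem baseHom_X_ne_zero (hπ : Flat π) (x : specialFiber π) :
    baseHom π (specialFiberι π x) PowerSeries.X ≠ 0 := by
  have hloc := isLocalHom_baseHom_specialFiberι x
  have hflat := flat_baseHom π (specialFiberι π x)
  intro h
  algebraize [baseHom π (specialFiberι π x)]
  have := Module.FaithfullyFlat.of_flat_of_isLocalHom (A := PowerSeries K)
    (B := X.presheaf.stalk (specialFiberι π x))
  have hinj := FaithfulSMul.algebraMap_injective (PowerSeries K)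
    (X.presheaf.stalk (specialFiberι π x))
  exact PowerSeries.X_ne_zero (hinj (h.trans (map_zero _).symm))

theorem isRadical_span_baseHom_X (hπ : IsSmoothing π) (x : specialFiber π) :
    (Ideal.span {baseHom π (specialFiberι π x) PowerSeries.X}).IsRadical := by
  have := hπ.isNodalCurve.isReduced
  rw [← ker_stalkMap_specialFiberι,
    RingHom.ker_isRadical_iff_reduced_of_surjective ((specialFiberι π).stalkMap_surjective x)]
  infer_instance

theorem baseHom_X_mem_iff (x : specialFiber π)
    (Q : PrimeSpectrum (X.presheaf.stalk (specialFiberι π x))) :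
    baseHom π (specialFiberι π x) PowerSeries.X ∈ Q.asIdeal ↔
      X.fromSpecStalk _ Q ∈ Set.range (specialFiberι π) := by
  rw [fromSpecStalk_mem_range_iff, ker_stalkMap_specialFiberι, Ideal.span_singleton_le_iff_mem]

/-- From above, the quotient by `t` is a local ring of a curve. From below, `t ≠ 0` lies in `P`, and
`0 < P < m` is a chain. -/
theorem ringKrullDim_stalk_eq_two (hπ : IsSmoothing π) {x : specialFiber π}
    {P : Ideal (X.presheaf.stalk (specialFiberι π x))} [P.IsPrime]
    (hP : baseHom π (specialFiberι π x) PowerSeries.X ∈ P) (hP' : P ≠ maximalIdeal _) :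
    ringKrullDim (X.presheaf.stalk (specialFiberι π x)) = 2 := by
  have := hπ.isRegular.isRegularLocalRing_stalk (specialFiberι π x)
  have := isDomain_of_isRegularLocalRing (X.presheaf.stalk (specialFiberι π x))
  set t := baseHom π (specialFiberι π x) PowerSeries.X
  refine le_antisymm ?_ ?_
  · have h₁ : ringKrullDim (X.presheaf.stalk (specialFiberι π x) ⧸ Ideal.span {t}) ≤ 1 := by
      rw [← ker_stalkMap_specialFiberι, ringKrullDim_eq_of_ringEquiv
        (RingHom.quotientKerEquivOfSurjective ((specialFiberι π).stalkMap_surjective x)),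
        ← hπ.isNodalCurve.dim_eq_one]
      exact ringKrullDim_stalk_le (𝟙 _) x
    have h₂ := Ideal.height_le_ringKrullDim_quotient_add_one (baseHom_X_mem_maximalIdeal x)
    rw [maximalIdeal_height_eq_ringKrullDim] at h₂
    refine (h₂.trans (add_le_add_left h₁ 1)).trans (by norm_num)
  · have h₁ := Ideal.height_add_one_le_of_lt_of_isPrime
      (lt_of_le_of_ne (le_maximalIdeal (Ideal.IsPrime.ne_top ‹P.IsPrime›)) hP')
    have h₂ : (⊥ : Ideal (X.presheaf.stalk (specialFiberι π x))) < P := by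
      refine bot_lt_iff_ne_bot.mpr fun h => baseHom_X_ne_zero hπ.flat x ?_
      simpa [h] using! hP
    have h₃ := Ideal.height_add_one_le_of_lt_of_isPrime h₂
    have h₄ : (2 : ℕ∞) ≤ (maximalIdeal (X.presheaf.stalk (specialFiberι π x))).height := by
      refine le_trans ?_ ((add_le_add_left h₃ 1).trans h₁)
      rw [add_assoc]
      exact le_trans (by norm_num) le_add_self
    rw [← maximalIdeal_height_eq_ringKrullDim]
    exact WithBot.coe_le_coe.mpr h₄

end

end NodalResolution

namespace NodalResolution

open IsLocalRing

section

variable {K : Type u} [Field K] {X : Scheme.{u}} {π : X ⟶ Spec (.of (PowerSeries K))}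
  {Z : Fin 2 → Closeds (specialFiber π)}

theorem mem_image_specialFiberι_iff (Z : Closeds (specialFiber π)) (y : specialFiber π) :
    specialFiberι π y ∈ specialFiberι π '' (Z : Set (specialFiber π)) ↔ y ∈ Z :=
  (specialFiberι π).isEmbedding.injective.mem_set_image

/-- There is a point of the component through `x` that lies on no other component, viewed as a
prime ideal of the local ring of `X` at `x`. -/
theorem exists_prime_of_mem_component (hπ : IsSmoothing π)
    (hZ : HasTwoSmoothComponents (specialFiberToSpec π) Z) {x : specialFiber π} (hx : IsClosed {x})
    {k : Fin 2} (hxk : x ∈ Z k) :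
    ∃ Q : PrimeSpectrum (X.presheaf.stalk (specialFiberι π x)),
      X.fromSpecStalk _ Q ∈ specialFiberι π '' (Z k : Set (specialFiber π)) ∧
      (∀ j ≠ k, X.fromSpecStalk _ Q ∉ specialFiberι π '' (Z j : Set (specialFiber π))) ∧
      Q.asIdeal ≠ maximalIdeal _ := by
  have := hπ.isNodalCurve.connectedSpace
  obtain ⟨η, hη, hηx, hηj, hηc⟩ := exists_generization_of_mem_component hZ hxk
  obtain ⟨Q, hQ⟩ := exists_fromSpecStalk_eq (hηx.map (specialFiberι π).continuous)
  refine ⟨Q, ?_, ?_, fun h => hηc ?_⟩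
  · rw [hQ]
    exact ⟨η, hη, rfl⟩
  · intro j hj
    rw [hQ, mem_image_specialFiberι_iff]
    exact hηj j hj
  · have h' : Q = closedPoint _ := PrimeSpectrum.ext h
    rw [h'] at hQ
    have h'' : specialFiberι π η = specialFiberι π x :=
      hQ.symm.trans Scheme.fromSpecStalk_closedPoint
    rw [(specialFiberι π).isEmbedding.injective h'']
    exact hx

theorem mem_sup_ker_of_isNode {O A : Type u} [CommRing O] [CommRing A] [IsLocalRing O] [IsLocalRing A]
    {σ : O →+* A} (hσ : Function.Surjective σ) (hN : ∀ f ∈ maximalIdeal A,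
      f ^ 2 ∈ maximalIdeal A ^ 3 → f ∈ maximalIdeal A ^ 2) {f : O} (hf : f ∈ maximalIdeal O)
    (hf2 : f ^ 2 ∈ maximalIdeal O ^ 3 ⊔ RingHom.ker σ) : f ∈ maximalIdeal O ^ 2 ⊔ RingHom.ker σ := by
  have hm : (maximalIdeal O).map σ = maximalIdeal A := map_maximalIdeal_of_surjective σ hσ
  rw [← Ideal.comap_map_of_surjective' σ hσ, Ideal.mem_comap, Ideal.map_pow, hm] at hf2 ⊢
  refine hN _ (hm ▸ Ideal.mem_map_of_mem σ hf) ?_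
  rwa [map_pow] at hf2

/-- A domain would have one generic point, lying on a component `k`. The other component, locally a
specialization of it, would then be contained in component `k`. -/
theorem not_isDomain_of_mem_components (hπ : IsSmoothing π)
    (hZ : HasTwoSmoothComponents (specialFiberToSpec π) Z) {x : specialFiber π} (hx : IsClosed {x})
    (hxZ : ∀ k, x ∈ Z k) : ¬ IsDomain ((specialFiber π).presheaf.stalk x) := by
  intro h
  let σ := ((specialFiberι π).stalkMap x).hom
  let Q : PrimeSpectrum (X.presheaf.stalk (specialFiberι π x)) :=
    ⟨RingHom.ker σ, RingHom.ker_isPrime σ⟩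
  obtain ⟨y, hy⟩ := (fromSpecStalk_mem_range_iff (specialFiberι π) x Q).mpr le_rfl
  obtain ⟨k, hk⟩ := exists_mem_component hZ y
  obtain ⟨j, hj⟩ : ∃ j : Fin 2, j ≠ k := exists_ne k
  obtain ⟨P, -, hP, -⟩ := exists_ideal_of_mem_component hZ hπ.isNodalCurve.dim_eq_one
    (specialFiberι π) (hxZ k)
  obtain ⟨Q', hQ', hQ'', -⟩ := exists_prime_of_mem_component hπ hZ hx (hxZ j)
  refine hQ'' k hj.symm ((hP Q').mpr (((hP Q).mp (hy ▸ ⟨y, hk, rfl⟩)).trans ?_))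
  refine (fromSpecStalk_mem_range_iff (specialFiberι π) x Q').mp ?_
  obtain ⟨y', -, hy'⟩ := hQ'
  exact ⟨y', hy'⟩

theorem mem_sq_of_sq_mem_of_mem_components (hπ : IsSmoothing π)
    (hZ : HasTwoSmoothComponents (specialFiberToSpec π) Z) {x : specialFiber π} (hx : IsClosed {x})
    (hxZ : ∀ k, x ∈ Z k) {f : (specialFiber π).presheaf.stalk x} (hf : f ∈ maximalIdeal _)
    (hf2 : f ^ 2 ∈ maximalIdeal ((specialFiber π).presheaf.stalk x) ^ 3) :
    f ∈ maximalIdeal ((specialFiber π).presheaf.stalk x) ^ 2 := by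
  rcases hπ.isNodalCurve.smooth_or_node x hx with ⟨U, hxU, hU⟩ | ⟨⟨e⟩⟩
  · have h₁ := isRegularLocalRing_stalk_of_smooth (U.ι ≫ specialFiberToSpec π) ⟨x, hxU⟩
    have h₂ := isDomain_of_isRegularLocalRing (U.toScheme.presheaf.stalk ⟨x, hxU⟩)
    exact absurd ((U.stalkIso ⟨x, hxU⟩).commRingCatIsoToRingEquiv.symm.toMulEquiv.isDomain _)
      (not_isDomain_of_mem_components hπ hZ hx hxZ)
  · exact mem_maximalIdeal_sq_of_node e hf hf2

/-- A point on both components has a stalk on the fibre that is not a domain, so it is not smooth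
and must be a node; its two branches give the coordinates. A point on one component only is smooth
on the fibre. -/
theorem exists_isNodeChart_of_isClosed [IsAlgClosed K] (hπ : IsSmoothing π)
    (hZ : HasTwoSmoothComponents (specialFiberToSpec π) Z) {x : specialFiber π}
    (hx : IsClosed {x}) :
    ∃ c : Fin 2 → X.presheaf.stalk (specialFiberι π x), IsNodeChart π PowerSeries.X _ c ∧
      ∀ (Q : PrimeSpectrum (X.presheaf.stalk (specialFiberι π x))) (k : Fin 2),
        X.fromSpecStalk _ Q ∈ specialFiberι π '' (Z k : Set (specialFiber π)) ↔
          c k ∈ Q.asIdeal := by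
  have := hπ.isProper
  have := hπ.isNodalCurve.isProper
  have := hπ.isRegular.isRegularLocalRing_stalk (specialFiberι π x)
  have := isDomain_of_isRegularLocalRing (X.presheaf.stalk (specialFiberι π x))
  have hloc := isLocalHom_baseHom_specialFiberι x
  have hess := essFiniteType_baseHom π (specialFiberι π x)
  have hres := surjective_residue_comp_baseHom_specialFiberι hx
  have hmax := PowerSeries.maximalIdeal_eq_span_X (k := K)
  set t := baseHom π (specialFiberι π x) PowerSeries.X with ht
  have hcomp : ∀ Q : PrimeSpectrum (X.presheaf.stalk (specialFiberι π x)), t ∈ Q.asIdeal ↔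
      ∃ k, X.fromSpecStalk _ Q ∈ specialFiberι π '' (Z k : Set (specialFiber π)) := by
    intro Q
    rw [baseHom_X_mem_iff]
    constructor
    · rintro ⟨y, hy⟩
      obtain ⟨k, hk⟩ := exists_mem_component hZ y
      exact ⟨k, hy ▸ ⟨y, hk, rfl⟩⟩
    · rintro ⟨k, y, -, hy⟩
      exact ⟨y, hy⟩
  have hideal : ∀ k, x ∈ Z k → ∃ P : Ideal (X.presheaf.stalk (specialFiberι π x)), P.IsPrime ∧
      (∀ Q : PrimeSpectrum (X.presheaf.stalk (specialFiberι π x)),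
        X.fromSpecStalk _ Q ∈ specialFiberι π '' (Z k : Set (specialFiber π)) ↔ P ≤ Q.asIdeal) ∧
      (∃ w, maximalIdeal _ = P ⊔ Ideal.span {w}) ∧ P ≠ maximalIdeal _ ∧ t ∈ P := by
    intro k hk
    obtain ⟨P, hP, hPQ, hw⟩ := exists_ideal_of_mem_component hZ hπ.isNodalCurve.dim_eq_one
      (specialFiberι π) hk
    refine ⟨P, hP, hPQ, hw, ?_, (hcomp ⟨P, hP⟩).mpr ⟨k, (hPQ ⟨P, hP⟩).mpr le_rfl⟩⟩
    rintro rfl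
    obtain ⟨Q, hQ, -, hQ'⟩ := exists_prime_of_mem_component hπ hZ hx hk
    exact hQ' (le_antisymm (le_maximalIdeal Q.2.ne_top) ((hPQ Q).mp hQ))
  by_cases hxZ : ∀ k, x ∈ Z k
  · obtain ⟨P₀, hP₀, hPQ₀, ⟨w₀, hw₀⟩, hm₀, ht₀⟩ := hideal 0 (hxZ 0)
    obtain ⟨P₁, hP₁, hPQ₁, ⟨w₁, hw₁⟩, hm₁, ht₁⟩ := hideal 1 (hxZ 1)
    have hd := ringKrullDim_stalk_eq_two hπ ht₀ hm₀
    have hne : P₀ ≠ P₁ := by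
      rintro rfl
      obtain ⟨Q, hQ, hQ', -⟩ := exists_prime_of_mem_component hπ hZ hx (hxZ 0)
      exact hQ' 1 (by decide) ((hPQ₁ Q).mpr ((hPQ₀ Q).mp hQ))
    obtain ⟨a, b, rfl, rfl, hab, hmab⟩ := exists_node_parameters hd hm₀ hm₁ hne hw₀ hw₁
      (baseHom_X_ne_zero hπ.flat x) (isRadical_span_baseHom_X hπ x) ht₀ ht₁
      (fun Q hQ htQ => by
        obtain ⟨k, hk⟩ := (hcomp ⟨Q, hQ⟩).mp htQ
        fin_cases k
        · exact .inl ((hPQ₀ _).mp hk)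
        · exact .inr ((hPQ₁ _).mp hk))
      (fun f hf hf2 => by
        rw [← ker_stalkMap_specialFiberι] at hf2 ⊢
        exact mem_sup_ker_of_isNode ((specialFiberι π).stalkMap_surjective x)
          (fun f => mem_sq_of_sq_mem_of_mem_components hπ hZ hx hxZ) hf hf2)
    refine ⟨![a, b], isNodeChart_of_node hmax hloc hess hres hd.ge hab hmab, fun Q k => ?_⟩
    fin_cases k
    · exact (hPQ₀ Q).trans (Ideal.span_singleton_le_iff_mem _)
    · exact (hPQ₁ Q).trans (Ideal.span_singleton_le_iff_mem _)
  · obtain ⟨k, hk⟩ := exists_mem_component hZ x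
    have hj : ∀ j ≠ k, ∀ Q : PrimeSpectrum (X.presheaf.stalk (specialFiberι π x)),
        X.fromSpecStalk _ Q ∉ specialFiberι π '' (Z j : Set (specialFiber π)) := by
      rintro j hjk Q ⟨y, hy, hyQ⟩
      have h₁ : X.fromSpecStalk _ Q ⤳ specialFiberι π x := by
        have : X.fromSpecStalk (specialFiberι π x) Q ∈ Set.range (X.fromSpecStalk _) := ⟨Q, rfl⟩
        rwa [Scheme.range_fromSpecStalk] at this
      rw [← hyQ, (specialFiberι π).isEmbedding.isInducing.specializes_iff] at h₁
      refine hxZ fun i => ?_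
      by_cases hik : i = k
      · exact hik ▸ hk
      · obtain rfl : i = j := by omega
        exact h₁.mem_closed (Z i).isClosed hy
    obtain ⟨P, hP, hPQ, ⟨w, hw⟩, hm, htP⟩ := hideal k hk
    have hd := ringKrullDim_stalk_eq_two hπ htP hm
    -- Near `x` the special fibre is this single component, and it is reduced, so the ideal of the
    -- component is `(t)`.
    obtain rfl := eq_span_of_isRadical (isRadical_span_baseHom_X hπ x) htP fun Q hQ htQ => by
      obtain ⟨i, hi⟩ := (hcomp ⟨Q, hQ⟩).mp htQ
      by_cases hik : i = k
      · exact (hPQ ⟨Q, hQ⟩).mp (hik ▸ hi)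
      · exact absurd hi (hj i hik _)
    obtain ⟨c, hc, hck, hcj⟩ := exists_isNodeChart_of_smooth (z := w) hmax hloc hess hres hd.ge
      (by rw [hw, ← Ideal.span_insert]) k
    refine ⟨c, hc, fun Q i => ?_⟩
    by_cases hik : i = k
    · rw [hik, hPQ, ← Ideal.span_singleton_eq_span_singleton.mpr hck,
        Ideal.span_singleton_le_iff_mem]
    · exact iff_of_false (hj i hik Q) fun h => Q.2.ne_top (Ideal.eq_top_of_isUnit_mem _ h (hcj i hik))

end

end NodalResolution

namespace NodalResolution

open IsLocalRing

/-! ## Charts at all points of a smoothing -/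

/-- The local ring at a generization is a localization, through which the chart and the equations
pass. So only closed points need to be treated. -/
theorem exists_isNodeChart_of_specializes {R₀ : Type u} [CommRing R₀] {X : Scheme.{u}}
    {π : X ⟶ Spec (.of R₀)} {t : R₀} {C : Fin 2 → Set X} {p p₀ : X} (hp : p ⤳ p₀)
    (h : ∃ c : Fin 2 → X.presheaf.stalk p₀, IsNodeChart π t p₀ c ∧
      ∀ (Q : PrimeSpectrum (X.presheaf.stalk p₀)) (k : Fin 2),
        X.fromSpecStalk p₀ Q ∈ C k ↔ c k ∈ Q.asIdeal) :
    ∃ c : Fin 2 → X.presheaf.stalk p, IsNodeChart π t p c ∧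
      ∀ (Q : PrimeSpectrum (X.presheaf.stalk p)) (k : Fin 2),
        X.fromSpecStalk p Q ∈ C k ↔ c k ∈ Q.asIdeal := by
  obtain ⟨c, ⟨m, s, n, x, y, hxy, hms, hE, h₀, h₁⟩, hc⟩ := h
  obtain ⟨P, hP⟩ := exists_fromSpecStalk_eq hp
  have := isIso_stalkMap_of_isPreimmersion (X.fromSpecStalk p₀) P
  obtain ⟨ψ, ⟨M, hM⟩, hψ⟩ := exists_stalk_of_isIso_stalkMap (X.fromSpecStalk p₀) hP
  have hψE : EssEtale ψ.hom := by
    let := ψ.hom.toAlgebra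
    exact EssEtale.of_isLocalization M
  have hbase : ∀ a, ψ.hom (baseHom π p₀ a) = baseHom π p a := by
    have : CommRingCat.ofHom (baseHom π p₀) ≫ ψ = CommRingCat.ofHom (baseHom π p) := by
      apply Spec.map_injective
      rw [Spec.map_comp, specMap_baseHom, specMap_baseHom, ← Category.assoc, hψ]
    exact fun a => congr($(this).hom a)
  have hxy' : ψ.hom x * ψ.hom y = baseHom π p s := by rw [← map_mul, hxy, hbase]
  refine ⟨fun k => ψ.hom (c k), ⟨m, s, n, ψ.hom x, ψ.hom y, hxy', hms, ?_, ?_, ?_⟩, fun Q k => ?_⟩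
  · convert hE.comp hψE using 1
    refine Node.ringHom_ext ?_ ?_ ?_
    · rw [RingHom.comp_assoc, Node.lift_comp_algebraMap, Node.lift_comp_algebraMap]
      exact RingHom.ext fun a => (hbase a).symm
    · rw [RingHom.comp_apply, Node.lift_x, Node.lift_x]
    · rw [RingHom.comp_apply, Node.lift_y, Node.lift_y]
  · exact (congrArg ψ.hom h₀).trans (by rw [map_mul, hbase])
  · exact (congrArg ψ.hom h₁).trans (by rw [map_mul, hbase])
  · have : X.fromSpecStalk p Q = X.fromSpecStalk p₀ (PrimeSpectrum.comap ψ.hom Q) :=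
      congr($hψ Q).symm
    rw [this]
    exact hc _ k

section

variable {K : Type u} [Field K] {X : Scheme.{u}} {π : X ⟶ Spec (.of (PowerSeries K))}
  {Z : Fin 2 → Closeds (specialFiber π)}

/-- A closed point in the closure of `p` maps to a closed point because `f` is proper, hence to the
only closed point of the base. -/
theorem exists_closed_specialization_pullback {R S : Type u} [CommRing R] [CommRing S]
    [IsLocalRing R] [IsLocalRing S] {X : Scheme.{u}} (f : X ⟶ Spec (.of R)) [IsProper f]
    (φ : R →+* S) [IsLocalHom φ] (p : X) :
    ∃ x : ↥(pullback f (Spec.map (CommRingCat.ofHom φ))),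
      p ⤳ pullback.fst f (Spec.map (CommRingCat.ofHom φ)) x ∧
      IsClosed {pullback.fst f (Spec.map (CommRingCat.ofHom φ)) x} := by
  have : CompactSpace X := (quasiCompact_iff_compactSpace f).mp inferInstance
  obtain ⟨p₀, hp₀, hcl⟩ := isClosed_closure.exists_closed_singleton
    (⟨p, subset_closure rfl⟩ : (closure {p} : Set X).Nonempty)
  have h₁ : f p₀ = closedPoint R := by
    have h := f.isClosedMap _ hcl
    rw [Set.image_singleton] at h
    exact PrimeSpectrum.ext
      (eq_maximalIdeal ((PrimeSpectrum.isClosed_singleton_iff_isMaximal (R := R) (f p₀)).mp h))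
  obtain ⟨x, rfl⟩ : p₀ ∈ Set.range (pullback.fst f (Spec.map (CommRingCat.ofHom φ))) := by
    rw [Scheme.Pullback.range_fst]
    exact ⟨closedPoint S, (comap_closedPoint φ).trans h₁.symm⟩
  exact ⟨x, specializes_iff_mem_closure.mpr hp₀, hcl⟩

theorem exists_isNodeChart [IsAlgClosed K] (hπ : IsSmoothing π)
    (hZ : HasTwoSmoothComponents (specialFiberToSpec π) Z) (p : X) :
    ∃ c : Fin 2 → X.presheaf.stalk p, IsNodeChart π PowerSeries.X p c ∧
      ∀ (Q : PrimeSpectrum (X.presheaf.stalk p)) (k : Fin 2),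
        X.fromSpecStalk p Q ∈ specialFiberι π '' (Z k : Set (specialFiber π)) ↔
          c k ∈ Q.asIdeal := by
  have := hπ.isProper
  have : IsLocalHom (PowerSeries.constantCoeff (R := K)) :=
    .of_surjective _ fun a => ⟨PowerSeries.C a, by simp⟩
  obtain ⟨x, hpx, hx⟩ := exists_closed_specialization_pullback π (PowerSeries.constantCoeff (R := K)) p
  refine exists_isNodeChart_of_specializes hpx (exists_isNodeChart_of_isClosed hπ hZ (x := x) ?_)
  have h := hx.preimage (specialFiberι π).continuous
  convert h using 1
  ext y
  exact (specialFiberι π).isEmbedding.injective.eq_iff.symm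

/-- The generic point of the component serves; it stays in the same fibre over the base because
`Spec K` has one point. -/
theorem exists_generization_of_mem_image (hπ : IsSmoothing π)
    (hZ : HasTwoSmoothComponents (specialFiberToSpec π) Z) (k : Fin 2) (p : X)
    (hp : p ∈ specialFiberι π '' (Z k : Set (specialFiber π))) :
    ∃ p', p' ⤳ p ∧ p' ∈ specialFiberι π '' (Z k : Set (specialFiber π)) ∧ π p' = π p ∧
      ∃ k', p' ∉ specialFiberι π '' (Z k' : Set (specialFiber π)) := by
  have := hπ.isNodalCurve.connectedSpace
  obtain ⟨x, hx, rfl⟩ := hp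
  obtain ⟨η, hη, hηx, hηj, -⟩ := exists_generization_of_mem_component hZ hx
  obtain ⟨j, hj⟩ : ∃ j : Fin 2, j ≠ k := exists_ne k
  refine ⟨_, hηx.map (specialFiberι π).continuous, ⟨η, hη, rfl⟩, ?_, j, ?_⟩
  · have h : ∀ y, π (specialFiberι π y) =
        Spec.map (CommRingCat.ofHom (PowerSeries.constantCoeff (R := K))) (specialFiberToSpec π y) :=
      fun y => by
        have h : specialFiberι π ≫ π = specialFiberToSpec π ≫
          Spec.map (CommRingCat.ofHom (PowerSeries.constantCoeff (R := K))) := pullback.condition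
        exact congr($h y)
    rw [h, h]
    exact congrArg _ (Subsingleton.elim (α := PrimeSpectrum K) _ _)
  · rw [mem_image_specialFiberι_iff]
    exact hηj j hj

end

end NodalResolution

/-- Let `K` be an algebraically closed field and `π : X ⟶ Spec K[[t]]` a smoothing of a nodal curve
with two smooth components `C 0` and `C 1`. Then the iterated blowup `X̃ ^ d` of the fiber power
`X ^ d` is a smooth (i.e. regular) scheme for every `d ≥ 1`. -/
theorem mainTheorem7 {K : Type u} [Field K] [IsAlgClosed K] {X : Scheme.{u}}
    (π : X ⟶ Spec (.of (PowerSeries K))) (hπ : IsSmoothing π)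
    (C : Fin 2 → Closeds (specialFiber π))
    (hC : HasTwoSmoothComponents (specialFiberToSpec π) C) (d : ℕ) (hd : 1 ≤ d) :
    IsRegularScheme
      (desingularization π (fun i => specialFiberι π '' (C i : Set (specialFiber π))) d).left := by
  have := hπ.isProper
  have hclosed : ∀ k, IsClosed (specialFiberι π '' (C k : Set (specialFiber π))) := fun k =>
    (specialFiberι π).isClosedEmbedding.isClosedMap _ (C k).isClosed
  -- The coordinates are chosen independently at each point; no compatibility between different
  -- points is needed.
  choose c hc hC' using NodalResolution.exists_isNodeChart hπ hC
  obtain ⟨d, rfl⟩ : ∃ d', d = d' + 1 := ⟨d - 1, by omega⟩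
  exact (NodalResolution.isResolved_desingularization hclosed PowerSeries.X_prime.irreducible
    (fun p Q k => hC' p Q k) hc (NodalResolution.exists_generization_of_mem_image hπ hC) d).isRegularScheme
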